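/- Let $G=G_1\times\cdots\times G_n$ be a finite product of $\sigma$-compact locally compact (Hausdorff) groups, and let $\Gamma<G$ be a subgroup whose projection to each $G_i$ is dense (irreducibility). Assume that (a) $\Gamma$ is a uniform lattice, i.e. discrete and cocompact in $G$; or, more generally, (b) $\Gamma$ is a lattice (discrete, with a $G$-invariant regular Borel probability measure on $G/\Gamma$) which is weakly cocompact, i.e. the $G$-representation on $L^2_0(G/\Gamma)$ (square integrable functions of integral zero) does not almost have invariant vectors, and which is $p$-integrable for some $p>1$, i.e. either $\Gamma$ is uniform, or $\Gamma$ is generated by a finite set $S$ and there is a Borel fundamental domain $\mathcal D\subseteq G$ with null boundary such that $\int_{\mathcal D}\|\chi(g^{-1}h)\|_S^p\,dh<\infty$ for all $g\in G$, where $dh$ is a Haar measure, $\|\cdot\|_S$ is the word length with respect to $S$, and $\chi:G\to\Gamma$ is given by $\chi^{-1}(e)=\mathcal D$, $\chi(g\gamma^{-1})=\gamma\chi(g)$. Let $B$ be a superreflexive space, i.e. a real topological vector space isomorphic to a uniformly convex Banach space, with a uniformly equicontinuous affine $\Gamma$-action, and let $\varrho$ be the linear part of the action. Assume that $\varrho$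 does not almost have invariant vectors. (A linear representation $\pi$ of a topological group $H$ on $V$ almost has invariant vectors if $\inf_{\|v\|=1}\operatorname{diam}(\pi(K)v)=0$ for every compact $K\subseteq H$, where $\|\cdot\|$ is a norm defining the topology of $V$.) Then there is a non-empty closed $\Gamma$-invariant affine subspace $\underline B\subseteq B$, whose direction is a complemented subspace of $B$, on which the $\Gamma$-action is a sum of actions that extend continuously to $G$ and factor through the projections $G\to G_i$. That is, there are a point $v\in\underline B$, closed linear subspaces $B_1,\dots,B_n\subseteq B$ (hence superreflexive) with $v+(B_1+\cdots+B_n)=\underline B$, and for each $i$ a continuous uniformly equicontinuous affine action of $G_i$ on $B_i$, such that $$\gamma\cdot(v+x_1+\cdots+x_n)=v+\gamma_1\cdot x_1+\cdots+\gamma_n\cdot x_n$$ for all $\gamma=(\gamma_1,\dots,\gamma_n)\in\Gamma$ and $x_i\in B_i$. -/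

import Mathlib

open MeasureTheory Topology
open scoped ENNReal

/-! ### Superreflexive spaces, almost invariant vectors, equicontinuous actions -/

section Spaces

/-- A real topological vector space is superreflexive if it is isomorphic, as a topological
vector space, to a uniformly convex Banach space. -/
def IsSuperreflexive.{u} (V : Type u) [AddCommGroup V] [Module ℝ V] [TopologicalSpace V] : Prop :=
  ∃ (E : Type u) (_ : NormedAddCommGroup E) (_ : NormedSpace ℝ E),
    CompleteSpace E ∧ UniformConvexSpace E ∧ Nonempty (V ≃L[ℝ] E)

/-- A compatible norm on a topological vector space: a norm defining the given topology. -/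
def IsCompatibleNorm {V : Type*} [AddCommGroup V] [Module ℝ V] [TopologicalSpace V]
    (p : Seminorm ℝ V) : Prop :=
  (∀ v, p v = 0 → v = 0) ∧ WithSeminorms (fun _ : Unit => p)

/-- The linear representation `ρ` of the topological group `H` almost has invariant vectors:
for every compact `K ⊆ H`, the infimum over unit vectors `v` of `diam (ρ(K) v)` is zero. All
compatible norms are equivalent, so that the choice of the norm does not matter. -/
def AlmostHasInvariantVectors {H V : Type*} [Group H] [TopologicalSpace H]
    [AddCommGroup V] [Module ℝ V] [TopologicalSpace V] (ρ : H →* (V ≃ₗ[ℝ] V)) : Prop :=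
  ∃ p : Seminorm ℝ V, IsCompatibleNorm p ∧
    ∀ K : Set H, IsCompact K → ∀ ε : ℝ, 0 < ε →
      ∃ v : V, p v = 1 ∧ ∀ g ∈ K, ∀ h ∈ K, p (ρ g v - ρ h v) ≤ ε

/-- The affine action `α` is uniformly equicontinuous, for the uniform structure of the
topological vector space `V`. -/
def IsUniformlyEquicontinuousAction {H V : Type*} [Group H]
    [AddCommGroup V] [Module ℝ V] [TopologicalSpace V] (α : H →* (V ≃ᵃ[ℝ] V)) : Prop :=
  ∀ U ∈ 𝓝 (0 : V), ∃ W ∈ 𝓝 (0 : V), ∀ x y : V, x - y ∈ W → ∀ g : H, α g x - α g y ∈ U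

end Spaces

/-! ### Lattices -/

section Lattices

variable {G : Type*} [Group G] [TopologicalSpace G]

/-- A `G`-invariant regular Borel probability measure on `G ⧸ Γ`. -/
def IsInvariantProbability (Γ : Subgroup G) (μ : @Measure (G ⧸ Γ) (borel (G ⧸ Γ))) : Prop :=
  letI : MeasurableSpace (G ⧸ Γ) := borel (G ⧸ Γ)
  IsProbabilityMeasure μ ∧ μ.Regular ∧ SMulInvariantMeasure G (G ⧸ Γ) μ

/-- A lattice: a discrete subgroup of finite invariant covolume. -/
def IsLatticeSubgroup (Γ : Subgroup G) : Prop :=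
  DiscreteTopology Γ ∧ ∃ μ, IsInvariantProbability Γ μ

/-- A uniform lattice: a discrete cocompact subgroup. -/
def IsUniformLattice (Γ : Subgroup G) : Prop :=
  DiscreteTopology Γ ∧ CompactSpace (G ⧸ Γ)

/-- The representation of `G` on `L²₀(G ⧸ Γ)`, `(g f)(x) = f (g⁻¹ x)`, on the space of square
integrable functions of integral zero, does not almost have invariant vectors. -/
def IsWeaklyCocompact (Γ : Subgroup G) : Prop :=
  letI : MeasurableSpace (G ⧸ Γ) := borel (G ⧸ Γ)
  ∃ μ : Measure (G ⧸ Γ), IsInvariantProbability Γ μ ∧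
    ∃ K : Set G, IsCompact K ∧ ∃ ε : ℝ, 0 < ε ∧
      ∀ f : G ⧸ Γ → ℝ, MemLp f 2 μ → ∫ x, f x ∂μ = 0 → eLpNorm f 2 μ = 1 →
        ∃ g ∈ K, ∃ h ∈ K,
          ENNReal.ofReal ε ≤ eLpNorm (fun x => f (g⁻¹ • x) - f (h⁻¹ • x)) 2 μ

/-- The word length on a group with respect to a set `S` (meant to be a generating set). -/
noncomputable def wordLength {H : Type*} [Group H] (S : Set H) (γ : H) : ℕ :=
  sInf {n | ∃ l : List H, l.length = n ∧ (∀ x ∈ l, x ∈ S ∨ x⁻¹ ∈ S) ∧ l.prod = γ}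

/-- The lattice `Γ` is `p`-integrable: it is uniform, or it is finitely generated and there is a
Borel fundamental domain `D ⊆ G` with null boundary such that
`∫_D ‖χ(g⁻¹ h)‖ ^ p dh < ∞` for all `g`, for the word length with respect to some finite
generating set. The map `χ : G → Γ` is determined by `χ⁻¹(1) = D` and
`χ(g γ⁻¹) = γ χ(g)`; equivalently `χ g` is the unique `γ` with `g γ ∈ D`. -/
def IsPIntegrable [IsTopologicalGroup G] [LocallyCompactSpace G]
    (Γ : Subgroup G) (p : ℝ) : Prop :=
  letI : MeasurableSpace G := borel G
  haveI : BorelSpace G := ⟨rfl⟩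
  IsUniformLattice Γ ∨
    ∃ S : Finset Γ, Subgroup.closure (S : Set Γ) = ⊤ ∧
      ∃ (D : Set G) (χ : G → Γ), MeasurableSet D ∧ Measure.haar (frontier D) = 0 ∧
        χ ⁻¹' {1} = D ∧ (∀ (g : G) (γ : Γ), χ (g * (γ : G)⁻¹) = γ * χ g) ∧
        ∀ g : G, ∫⁻ h in D, (wordLength (S : Set Γ) (χ (g⁻¹ * h)) : ℝ≥0∞) ^ p ∂Measure.haar < ⊤

end Lattices

/-! ### Products -/

section Products

variable {ι : Type*} {G : ι → Type*} [∀ i, Group (G i)] [∀ i, TopologicalSpace (G i)]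

/-- A subgroup of a product is irreducible if its projection to each factor is dense. -/
def IsIrreducibleSubgroup (Γ : Subgroup (∀ i, G i)) : Prop :=
  ∀ i, Dense ((fun g : ∀ i, G i => g i) '' (Γ : Set (∀ i, G i)))

/-- On the affine subspace `S` of `B`, the action `α` of `Γ` is a sum of actions which extend
continuously to `∏ i, G i` and factor through the projections to the factors `G i`.

There are an origin `v ∈ S`, closed (superreflexive) linear subspaces `E i` of `B` whose sum is
the direction of `S`, and continuous uniformly equicontinuous affine actions `β i` of `G i` on
`E i`, such that the affine map `(x i)_i ↦ v + ∑ i, x i` from `⨁ i, E i` onto `S` is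
`Γ`-equivariant. The linear part of `β i` then extends the linear part of `α` restricted to
`E i`, and the cocycle `γ ↦ α γ 0` is cohomologous to the sum of the cocycles
`γ ↦ β i (γ i) 0`. -/
def IsSumOfFactorActions [Fintype ι] (Γ : Subgroup (∀ i, G i))
    {B : Type*} [AddCommGroup B] [Module ℝ B] [TopologicalSpace B]
    (α : Γ →* (B ≃ᵃ[ℝ] B)) (S : AffineSubspace ℝ B) : Prop :=
  ∃ v ∈ S, ∃ E : ι → Submodule ℝ B,
    (∀ i, IsClosed (E i : Set B)) ∧ (∀ i, IsSuperreflexive (E i)) ∧ ⨆ i, E i = S.direction ∧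
    ∃ β : ∀ i, G i →* (E i ≃ᵃ[ℝ] E i),
      (∀ i, IsUniformlyEquicontinuousAction (β i)) ∧
      (∀ i, Continuous fun q : G i × E i => β i q.1 q.2) ∧
      ∀ (γ : Γ) (x : ∀ i, E i),
        α γ (v + ∑ i, (x i : B)) = v + ∑ i, (β i ((γ : ∀ i, G i) i) (x i) : B)

end Products

set_option linter.unusedSectionVars false

/-! ### Uniform convexity and weak limits along ultrafilters. -/

section UniformConvexity

/-! Taking the supremum of a norm over the group makes the action isometric for a uniformly convex
norm (`exists_invariant_uniformConvex_norm`). The absence of almost invariant vectors then reads: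
there are a finite set `F ⊆ Γ` and `ε > 0` such that every vector `v` is moved by at least `ε ‖v‖`
by some element of `F`.

The induced action of `G` is realized on continuous functions `f : G → E` with `f (g γ⁻¹) = γ · f
g`. These form an affine space on which `G` acts by left translations, and the averages over the
different factors, against probability measures `m i`, commute. On the direction space, made of the
functions `u` that are equivariant for the linear part, the product of all averages is a strict
contraction. If it nearly preserved the norm of `u`, uniform convexity would make `u` nearly
constant, in the mean, on a piece of `G` large enough to surround both some `g` and `g γ⁻¹ = (g γ
g⁻¹)⁻¹ g` for `γ ∈ F`; the averaged value of `u` at `g` would then be moved too little by all of `F`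
(`exists_no_almost_constant`). For a uniform lattice the norm is the sup norm
(`exists_norm_repAverageList_le`). In general it is the `L ^ p` norm over `G ⧸ Γ` with `1 < p ≤ 2`,
and the spectral gap on `L²₀` first shows that `‖u‖` is nearly constant (`exists_contraction`).

Consequently the product of averages has a fixed point `f`, and every single average fixes `f`,
because it commutes with the product. The increment of `f` along the factor `i` is fixed by the
averages over the other factors, and strict convexity makes it invariant under these factors. Hence
`f g - f 1` is a sum of functions `c i (g i)` of one coordinate each. Equivariance and continuity
place `c i` in the space `V i` of vectors whose `Γ`-orbit map is continuous for the topology of `G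
i`. By density the representation extends to `G i` on `V i`, and `c i` supplies the cocycle
(`splitting_of_equivariant`). Each `V i` is the range of a projection preserving every closed
invariant subspace (`exists_projection_continuousVectors`), so the sum of the `V i` is closed and
complemented.

An initial equivariant function comes from a partition of unity when `G ⧸ Γ` is compact. Otherwise
it is the orbit map attached to a fundamental domain, smoothed by a bump; `p`-integrability together
with Baire category bounds its displacement
(`IsFundamentalSection.exists_equivariant_of_displacement`). -/

lemma eq_of_forall_dual_eq {E : Type*} [NormedAddCommGroup E] [NormedSpace ℝ E] {x y : E} (h : ∀ l : E →L[ℝ] ℝ, l x = l y) : x = y := by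
  by_contra hxy
  obtain ⟨l, -, hl⟩ := exists_dual_vector ℝ (x - y) (norm_ne_zero_iff.2 (sub_ne_zero.2 hxy))
  have : l (x - y) = 0 := by rw [map_sub, h l, sub_self]
  rw [this] at hl
  exact hxy (sub_eq_zero.1 (norm_eq_zero.1 (by simpa using hl.symm)))

variable {E : Type*} [NormedAddCommGroup E] [NormedSpace ℝ E] [UniformConvexSpace E]

/-- A functional that nearly norms both points makes their midpoint long, so uniform convexity
brings the points together. This is the form suited to averages, since `l` commutes with
integration. -/
lemma exists_norm_sub_lt_of_almost_norming {ε : ℝ} (hε : 0 < ε) :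
    ∃ η : ℝ, 0 < η ∧ ∀ (x y : E) (l : E →L[ℝ] ℝ), ‖l‖ ≤ 1 → ‖x‖ ≤ 1 + η → ‖y‖ ≤ 1 + η →
      1 - η ≤ l x → 1 - η ≤ l y → ‖x - y‖ < ε := by
  obtain ⟨δ, hδ, h⟩ := exists_forall_closed_ball_dist_add_le_two_sub E (half_pos hε)
  -- After rescaling by `1 + η`, distant points would give `2 - 2η ≤ (2 - δ)(1 + η)`, hence `δ ≤
  -- 4η`. The bound `η ≤ 1` keeps the rescaled distance at least `ε / 2`.
  obtain ⟨η, hη0, hη⟩ : ∃ η : ℝ, 0 < η ∧ η ≤ 1 ∧ 4 * η < δ :=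
    ⟨min 1 (δ / 5), by positivity, min_le_left _ _, by
      have := min_le_right 1 (δ / 5); linarith⟩
  refine ⟨η, hη0, fun x y l hl hx hy hlx hly => ?_⟩
  by_contra! hxy
  have hr : 0 < 1 + η := by linarith
  have hs : ∀ z : E, ‖z‖ ≤ 1 + η → ‖(1 + η)⁻¹ • z‖ ≤ 1 := fun z hz => by
    rw [norm_smul, norm_inv, Real.norm_of_nonneg hr.le, inv_mul_le_iff₀ hr]; linarith
  have h1 := h (hs x hx) (hs y hy) (by
    rw [← smul_sub, norm_smul, norm_inv, Real.norm_of_nonneg hr.le, ← div_eq_inv_mul,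
      div_le_div_iff₀ (by norm_num) hr]
    nlinarith [norm_nonneg (x - y)])
  have h2 : l ((1 + η)⁻¹ • x + (1 + η)⁻¹ • y) ≤ 2 - δ :=
    (le_abs_self _).trans ((l.le_of_opNorm_le hl _).trans (by rw [one_mul]; exact h1))
  rw [← smul_add, map_smul, map_add, smul_eq_mul, ← div_eq_inv_mul, div_le_iff₀ hr] at h2
  nlinarith

/-- In a uniformly convex space, points of a convex set of almost minimal norm are close. -/
lemma exists_norm_sub_lt_of_midpoint {R ε : ℝ} (hε : 0 < ε) :
    ∃ η : ℝ, 0 < η ∧ ∀ (d : ℝ) (x y : E), d ≤ R → ‖x‖ ≤ d + η → ‖y‖ ≤ d + η →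
      2 * (d - η) ≤ ‖x + y‖ → ‖x - y‖ < ε := by
  by_cases hR : R < 0
  · refine ⟨-R, by linarith, fun d x y hd hx hy _ => ?_⟩
    have hx0 := norm_nonneg x
    have hy0 := norm_nonneg y
    calc ‖x - y‖ ≤ ‖x‖ + ‖y‖ := norm_sub_le _ _
      _ < ε := by linarith
  push Not at hR
  obtain ⟨δ, hδ, h⟩ := exists_forall_closed_ball_dist_add_le_two_sub E
    (show 0 < ε / (R + 1) by positivity)
  -- the ball of radius `d + η`
  obtain ⟨η, hη0, hη1, hηε, hηδ⟩ : ∃ η : ℝ, 0 < η ∧ η ≤ 1 ∧ 4 * η < ε ∧ 16 * η < δ * ε := by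
    refine ⟨min 1 (min (ε / 5) (δ * ε / 17)), by positivity, min_le_left _ _, ?_, ?_⟩
    · have := (min_le_right 1 (min (ε / 5) (δ * ε / 17))).trans (min_le_left _ _); linarith
    · have := (min_le_right 1 (min (ε / 5) (δ * ε / 17))).trans (min_le_right _ _)
      have : 0 < δ * ε := by positivity
      linarith
  refine ⟨η, hη0, fun d x y hd hx hy hm => ?_⟩
  by_contra! hxy
  -- Points at distance `ε` force the radius `d + η` to be at least `ε / 2`, so the gain `δ (d + η)`
  -- is at least `δ ε / 2`. This beats the slack `4η` between the two bounds on `‖x + y‖`.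
  have hsmall : ε ≤ 2 * (d + η) := hxy.trans ((norm_sub_le _ _).trans (by linarith))
  have hr : 0 < d + η := by linarith
  have hs : ∀ z : E, ‖z‖ ≤ d + η → ‖(d + η)⁻¹ • z‖ ≤ 1 := fun z hz => by
    rw [norm_smul, norm_inv, Real.norm_of_nonneg hr.le, inv_mul_le_iff₀ hr]; linarith
  have h1 := h (hs x hx) (hs y hy) (by
    rw [← smul_sub, norm_smul, norm_inv, Real.norm_of_nonneg hr.le, ← div_eq_inv_mul,
      div_le_div_iff₀ (by positivity) hr]
    exact mul_le_mul hxy (by linarith) hr.le (norm_nonneg _))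
  rw [← smul_add, norm_smul, norm_inv, Real.norm_of_nonneg hr.le, ← div_eq_inv_mul,
    div_le_iff₀ hr] at h1
  nlinarith [mul_le_mul_of_nonneg_left hsmall hδ.le]

variable [CompleteSpace E]

open Filter in
-- A substitute for weak compactness. The distances from the origin to the closed hulls of the sets
-- of `U` are bounded, with supremum `D`. By uniform convexity the points of these hulls of norm
-- nearly at most `D` form a Cauchy filter, and its limit lies in every hull.
lemma exists_forall_mem_closure_convexHull {I : Type*} (U : Ultrafilter I) (x : I → E) {R : ℝ}
    (hx : ∀ i, ‖x i‖ ≤ R) :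
    ∃ y, ∀ A ∈ U, y ∈ closure (convexHull ℝ (x '' A)) := by
  set C : Set I → Set E := fun A => closure (convexHull ℝ (x '' A)) with hC
  have hCconv : ∀ A, Convex ℝ (C A) := fun A => (convex_convexHull ℝ _).closure
  have hCmono : ∀ A A', A ⊆ A' → C A ⊆ C A' := fun A A' h =>
    closure_mono (convexHull_mono (Set.image_mono h))
  have hCne : ∀ A ∈ U, (C A).Nonempty := fun A hA =>
    ((U.nonempty_of_mem hA).image x).convexHull.closure
  set d : Set I → ℝ := fun A => Metric.infDist 0 (C A) with hd
  have hdle : ∀ A, ∀ z ∈ C A, d A ≤ ‖z‖ := fun A z hz => by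
    simpa using Metric.infDist_le_dist_of_mem (x := (0 : E)) hz
  have hdR : ∀ A ∈ U, d A ≤ R := fun A hA => by
    obtain ⟨i, hi⟩ := U.nonempty_of_mem hA
    exact (hdle A (x i) (subset_closure (subset_convexHull _ _ ⟨i, hi, rfl⟩))).trans (hx i)
  set S : Set ℝ := d '' {A | A ∈ U} with hS
  have hSne : S.Nonempty := ⟨_, Set.univ, univ_mem, rfl⟩
  have hSbdd : BddAbove S := ⟨R, by rintro _ ⟨A, hA, rfl⟩; exact hdR A hA⟩
  set D := sSup S with hD
  have hDR : D ≤ R := csSup_le hSne (by rintro _ ⟨A, hA, rfl⟩; exact hdR A hA)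
  have hdD : ∀ A ∈ U, d A ≤ D := fun A hA => le_csSup hSbdd ⟨A, hA, rfl⟩
  have hAη : ∀ η : ℝ, 0 < η → ∃ A ∈ U, D - η < d A := fun η hη => by
    obtain ⟨_, ⟨A, hA, rfl⟩, h⟩ := exists_lt_of_lt_csSup hSne (show D - η < sSup S by linarith)
    exact ⟨A, hA, h⟩
  have hzη : ∀ A ∈ U, ∀ η : ℝ, 0 < η → ∃ z ∈ C A, ‖z‖ ≤ D + η := fun A hA η hη => by
    obtain ⟨z, hz, h⟩ := (Metric.infDist_lt_iff (hCne A hA)).1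
      (show Metric.infDist 0 (C A) < D + η by have := hdD A hA; simp only [hd] at this; linarith)
    exact ⟨z, hz, by simpa using h.le⟩
  have hclose : ∀ ε : ℝ, 0 < ε → ∃ A ∈ U, ∃ η : ℝ, 0 < η ∧ ∀ z ∈ C A, ∀ w ∈ C A,
      ‖z‖ ≤ D + η → ‖w‖ ≤ D + η → ‖z - w‖ < ε := fun ε hε => by
    obtain ⟨η, hη, h⟩ := exists_norm_sub_lt_of_midpoint (E := E) (R := R) hε
    obtain ⟨A, hA, hdA⟩ := hAη η hη
    refine ⟨A, hA, η, hη, fun z hz w hw hzn hwn => h D z w hDR hzn hwn ?_⟩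
    have hm : (1 / 2 : ℝ) • z + (1 / 2 : ℝ) • w ∈ C A :=
      hCconv A hz hw (by norm_num) (by norm_num) (by norm_num)
    have := hdle A _ hm
    rw [← smul_add, norm_smul, Real.norm_of_nonneg (by norm_num)] at this
    linarith
  -- the Cauchy filter of points of almost minimal norm
  set F : Filter E := ⨅ A : {A // A ∈ U}, ⨅ η : {η : ℝ // 0 < η},
    𝓟 {z | z ∈ C A ∧ ‖z‖ ≤ D + η} with hF
  have hbasis : F = ⨅ q : {A // A ∈ U} × {η : ℝ // 0 < η},
      𝓟 {z | z ∈ C q.1 ∧ ‖z‖ ≤ D + q.2} := by rw [hF, iInf_prod]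
  have hdir : Directed (· ≥ ·) fun q : {A // A ∈ U} × {η : ℝ // 0 < η} =>
      𝓟 {z | z ∈ C q.1 ∧ ‖z‖ ≤ D + q.2} := by
    rintro ⟨⟨A, hA⟩, η, hη⟩ ⟨⟨A', hA'⟩, η', hη'⟩
    refine ⟨⟨⟨A ∩ A', inter_mem hA hA'⟩, min η η', lt_min hη hη'⟩, ?_, ?_⟩
    · refine principal_mono.2 fun z hz => ⟨hCmono _ _ Set.inter_subset_left hz.1, hz.2.trans ?_⟩
      simp
    · refine principal_mono.2 fun z hz => ⟨hCmono _ _ Set.inter_subset_right hz.1, hz.2.trans ?_⟩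
      simp
  have : Nonempty ({A // A ∈ U} × {η : ℝ // 0 < η}) := ⟨⟨⟨Set.univ, univ_mem⟩, 1, one_pos⟩⟩
  have hne : F.NeBot := by
    rw [hbasis]
    refine iInf_neBot_of_directed' hdir fun q => ?_
    obtain ⟨z, hz, h⟩ := hzη q.1 q.1.2 q.2 q.2.2
    exact principal_neBot_iff.2 ⟨z, hz, h⟩
  have hmem : ∀ A (hA : A ∈ U) (η : ℝ) (hη : 0 < η), {z | z ∈ C A ∧ ‖z‖ ≤ D + η} ∈ F :=
    fun A hA η hη => by
      rw [hbasis]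
      exact mem_iInf_of_mem (⟨⟨A, hA⟩, η, hη⟩ : {A // A ∈ U} × {η : ℝ // 0 < η}) (mem_principal_self _)
  have hcauchy : Cauchy F := by
    refine Metric.cauchy_iff.2 ⟨hne, fun ε hε => ?_⟩
    obtain ⟨A, hA, η, hη, h⟩ := hclose ε hε
    exact ⟨_, hmem A hA η hη, fun z hz w hw => by
      rw [dist_eq_norm]; exact h z hz.1 w hw.1 hz.2 hw.2⟩
  obtain ⟨y, hy⟩ := CompleteSpace.complete hcauchy
  refine ⟨y, fun A hA => ?_⟩
  have : y ∈ closure (C A) := mem_closure_iff_clusterPt.2 (by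
    refine ClusterPt.mono (ClusterPt.of_le_nhds hy) (le_principal_iff.2 ?_)
    filter_upwards [hmem A hA 1 one_pos] with z hz using hz.1)
  rwa [hC, isClosed_closure.closure_eq] at this

open Filter in
-- Each scalar family `l (x i)` converges along `U` by compactness. The common point of the hulls
-- must take the limit value, since the hull over the indices with `l (x i)` close to the limit
-- stays in a closed slab.
lemma exists_weak_ultralimit {I : Type*} (U : Ultrafilter I) (x : I → E) {R : ℝ}
    (hx : ∀ i, ‖x i‖ ≤ R) :
    ∃ y, ∀ l : E →L[ℝ] ℝ, Tendsto (fun i => l (x i)) U (𝓝 (l y)) := by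
  obtain ⟨y, hy⟩ := exists_forall_mem_closure_convexHull U x hx
  refine ⟨y, fun l => ?_⟩
  have hb : ∀ i, l (x i) ∈ Metric.closedBall (0 : ℝ) (‖l‖ * R) := fun i => by
    rw [mem_closedBall_zero_iff]
    exact (l.le_opNorm _).trans (mul_le_mul_of_nonneg_left (hx i) (norm_nonneg _))
  obtain ⟨t, -, ht⟩ := (isCompact_closedBall (0 : ℝ) (‖l‖ * R)).ultrafilter_le_nhds
    (U.map fun i => l (x i)) (by
      rw [le_principal_iff]; exact Filter.mem_map.2 (univ_mem' hb))
  have ht' : Tendsto (fun i => l (x i)) U (𝓝 t) := ht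
  suffices h : l y = t by rwa [h]
  refine eq_of_forall_dist_le fun ε hε => ?_
  have hA : {i | l (x i) ∈ Metric.closedBall t ε} ∈ U := ht' (Metric.closedBall_mem_nhds t hε)
  have hsub : closure (convexHull ℝ (x '' {i | l (x i) ∈ Metric.closedBall t ε})) ⊆
      l ⁻¹' Metric.closedBall t ε := by
    refine closure_minimal (convexHull_min ?_ ?_) (Metric.isClosed_closedBall.preimage l.continuous)
    · rintro _ ⟨i, hi, rfl⟩; exact hi
    · exact (convex_closedBall t ε).linear_preimage l.toLinearMap
  exact hsub (hy _ hA)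

/-- The weak limit along an ultrafilter of a bounded family in a uniformly convex space. -/
noncomputable def wlim {I : Type*} (U : Ultrafilter I) (x : I → E) : E :=
  open Classical in
  if h : ∃ y, ∀ l : E →L[ℝ] ℝ, Filter.Tendsto (fun i => l (x i)) U (𝓝 (l y)) then h.choose else 0

lemma tendsto_wlim {I : Type*} (U : Ultrafilter I) {x : I → E} {R : ℝ}
    (hx : ∀ i, ‖x i‖ ≤ R) (l : E →L[ℝ] ℝ) :
    Filter.Tendsto (fun i => l (x i)) U (𝓝 (l (wlim U x))) := by
  have h := exists_weak_ultralimit U x hx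
  rw [wlim, dif_pos h]
  exact h.choose_spec l

lemma wlim_eq {I : Type*} {U : Ultrafilter I} {x : I → E} {y : E}
    (hy : ∀ l : E →L[ℝ] ℝ, Filter.Tendsto (fun i => l (x i)) U (𝓝 (l y))) : wlim U x = y := by
  have h : ∃ y, ∀ l : E →L[ℝ] ℝ, Filter.Tendsto (fun i => l (x i)) U (𝓝 (l y)) := ⟨y, hy⟩
  rw [wlim, dif_pos h]
  exact eq_of_forall_dual_eq fun l => tendsto_nhds_unique (h.choose_spec l) (hy l)

lemma wlim_add {I : Type*} (U : Ultrafilter I) {x y : I → E} {R S : ℝ}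
    (hx : ∀ i, ‖x i‖ ≤ R) (hy : ∀ i, ‖y i‖ ≤ S) :
    wlim U (fun i => x i + y i) = wlim U x + wlim U y :=
  wlim_eq fun l => by
    simpa using (tendsto_wlim U hx l).add (tendsto_wlim U hy l)

lemma wlim_clm {I : Type*} (U : Ultrafilter I) {x : I → E} {R : ℝ}
    (hx : ∀ i, ‖x i‖ ≤ R) (T : E →L[ℝ] E) : wlim U (fun i => T (x i)) = T (wlim U x) :=
  wlim_eq fun l => tendsto_wlim U hx (l.comp T)

lemma wlim_mem {I : Type*} (U : Ultrafilter I) {x : I → E} {R : ℝ}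
    (hx : ∀ i, ‖x i‖ ≤ R) {C : Set E} (hC : Convex ℝ C) (hCc : IsClosed C)
    (h : ∀ᶠ i in (U : Filter I), x i ∈ C) : wlim U x ∈ C := by
  by_contra hn
  obtain ⟨l, t, h1, h2⟩ := geometric_hahn_banach_point_closed hC hCc hn
  have := ge_of_tendsto (tendsto_wlim U hx l) (h.mono fun i hi => (h2 _ hi).le)
  linarith

lemma norm_wlim_le {I : Type*} (U : Ultrafilter I) {x : I → E} {R S : ℝ}
    (hx : ∀ i, ‖x i‖ ≤ R) (h : ∀ᶠ i in (U : Filter I), ‖x i‖ ≤ S) : ‖wlim U x‖ ≤ S := by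
  have := wlim_mem U hx (convex_closedBall (0 : E) S) Metric.isClosed_closedBall
    (h.mono fun i hi => mem_closedBall_zero_iff.2 hi)
  exact mem_closedBall_zero_iff.1 this

end UniformConvexity

/-! ### Invariant uniformly convex norms. -/

section Renorming

/-- A real vector space with a seminorm that separates points, as a normed space. -/
def Renormed {B : Type*} [AddCommGroup B] [Module ℝ B] (p : Seminorm ℝ B)
    (_ : ∀ v, p v = 0 → v = 0) : Type _ := B

variable {B : Type*} [AddCommGroup B] [Module ℝ B] (p : Seminorm ℝ B) (hp : ∀ v, p v = 0 → v = 0)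

instance : AddCommGroup (Renormed p hp) := inferInstanceAs (AddCommGroup B)
instance : Module ℝ (Renormed p hp) := inferInstanceAs (Module ℝ B)

/-- The tautological identification. -/
def Renormed.equiv : B ≃ₗ[ℝ] Renormed p hp := LinearEquiv.refl ℝ B

noncomputable instance : NormedAddCommGroup (Renormed p hp) :=
  AddGroupNorm.toNormedAddCommGroup
    { toFun := fun v => p ((Renormed.equiv p hp).symm v)
      map_zero' := by simp
      add_le' := fun x y => by simpa using map_add_le_add p _ _
      neg' := fun x => by simp
      eq_zero_of_map_eq_zero' := fun x hx => by simpa using hp _ hx }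

lemma Renormed.norm_equiv (v : B) : ‖Renormed.equiv p hp v‖ = p v := rfl

noncomputable instance : NormedSpace ℝ (Renormed p hp) where
  norm_smul_le c x := by
    change p (c • (Renormed.equiv p hp).symm x) ≤ _
    rw [map_smul_eq_mul]; exact le_rfl

lemma AffineEquiv.sub_eq_linear {V : Type*} [AddCommGroup V] [Module ℝ V] (a : V ≃ᵃ[ℝ] V)
    (x y : V) : a x - a y = a.linear (x - y) := by
  have := a.toAffineMap.linearMap_vsub x y
  simpa using this.symm

lemma linear_mul_apply {H V : Type*} [Group H] [AddCommGroup V] [Module ℝ V]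
    (α : H →* (V ≃ᵃ[ℝ] V)) (g h : H) (v : V) :
    (α (g * h)).linear v = (α g).linear ((α h).linear v) := by
  rw [map_mul]; rfl

lemma linear_one_apply {H V : Type*} [Group H] [AddCommGroup V] [Module ℝ V]
    (α : H →* (V ≃ᵃ[ℝ] V)) (v : V) : (α 1).linear v = v := by
  rw [map_one]; rfl

/-- A uniformly equicontinuous affine action on a superreflexive space is isometric for some
uniformly convex norm defining the topology. -/
theorem exists_invariant_uniformConvex_norm {H : Type*} [Group H] {B : Type*} [AddCommGroup B]
    [Module ℝ B] [TopologicalSpace B] (hB : IsSuperreflexive B) (α : H →* (B ≃ᵃ[ℝ] B))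
    (hα : IsUniformlyEquicontinuousAction α) :
    ∃ (p : Seminorm ℝ B) (hp : ∀ v, p v = 0 → v = 0), CompleteSpace (Renormed p hp) ∧
      UniformConvexSpace (Renormed p hp) ∧ (∀ g v, p ((α g).linear v) = p v) ∧
      ∃ e : B ≃L[ℝ] Renormed p hp, ∀ v, e v = Renormed.equiv p hp v := by
  obtain ⟨E, iN, iS, hcomp, huc, ⟨e⟩⟩ := hB
  -- Equicontinuity at the origin says that a ball of radius `r` is carried into the unit ball by
  -- all linear parts; rescaling vectors to norm `r / 2` gives `C = 2 / r`.
  obtain ⟨C, hC0, hC⟩ : ∃ C : ℝ, 0 < C ∧ ∀ g v, ‖e ((α g).linear v)‖ ≤ C * ‖e v‖ := by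
    have hU : e ⁻¹' Metric.ball 0 1 ∈ 𝓝 (0 : B) :=
      e.continuous.continuousAt.preimage_mem_nhds (by
        rw [map_zero]; exact Metric.ball_mem_nhds _ one_pos)
    obtain ⟨W, hW, h⟩ := hα _ hU
    have hW' : e.symm ⁻¹' W ∈ 𝓝 (0 : E) :=
      e.symm.continuous.continuousAt.preimage_mem_nhds (by rwa [map_zero])
    obtain ⟨r, hr, hrW⟩ := Metric.mem_nhds_iff.1 hW'
    have key : ∀ g v, ‖e v‖ < r → ‖e ((α g).linear v)‖ < 1 := fun g v hv => by
      have h1 : v - 0 ∈ W := by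
        have : e v ∈ e.symm ⁻¹' W := hrW (by simpa using hv)
        simpa using this
      have := h v 0 h1 g
      rw [AffineEquiv.sub_eq_linear, sub_zero] at this
      simpa using this
    refine ⟨2 / r, by positivity, fun g v => ?_⟩
    rcases eq_or_ne v 0 with rfl | hv
    · simp
    have hn : 0 < ‖e v‖ := norm_pos_iff.2 (by simpa using hv)
    have := key g ((r / 2 / ‖e v‖) • v) (by
      rw [map_smul, norm_smul, Real.norm_of_nonneg (by positivity), div_mul_cancel₀ _ hn.ne']
      linarith)
    rw [map_smul, map_smul, norm_smul, Real.norm_of_nonneg (by positivity), div_mul_eq_mul_div,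
      div_lt_one hn] at this
    rw [div_mul_eq_mul_div, le_div_iff₀ hr]; linarith
  have hbdd : ∀ v, BddAbove (Set.range fun g => ‖e ((α g).linear v)‖) := fun v =>
    ⟨C * ‖e v‖, by rintro _ ⟨g, rfl⟩; exact hC g v⟩
  set p : Seminorm ℝ B :=
    { toFun := fun v => ⨆ g, ‖e ((α g).linear v)‖
      map_zero' := by simp
      add_le' := fun x y => ciSup_le fun g => by
        rw [map_add, map_add]
        exact (norm_add_le _ _).trans (add_le_add (le_ciSup (hbdd x) g) (le_ciSup (hbdd y) g))
      neg' := fun x => by simp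
      smul' := fun c x => by
        simp only [map_smul, norm_smul]
        exact (Real.mul_iSup_of_nonneg (norm_nonneg c) _).symm } with hpdef
  have hp_apply : ∀ v, p v = ⨆ g, ‖e ((α g).linear v)‖ := fun v => rfl
  have hle : ∀ g v, ‖e ((α g).linear v)‖ ≤ p v := fun g v => le_ciSup (hbdd v) g
  have hlow : ∀ v, ‖e v‖ ≤ p v := fun v => by
    have := hle 1 v
    rwa [linear_one_apply] at this
  have hup : ∀ v, p v ≤ C * ‖e v‖ := fun v => ciSup_le fun g => hC g v
  have hinv : ∀ g v, p ((α g).linear v) = p v := by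
    have h1 : ∀ g v, p ((α g).linear v) ≤ p v := fun g v => ciSup_le fun h => by
      rw [← linear_mul_apply]; exact hle _ _
    refine fun g v => le_antisymm (h1 g v) ?_
    have := h1 g⁻¹ ((α g).linear v)
    rwa [← linear_mul_apply, inv_mul_cancel, linear_one_apply] at this
  have hp : ∀ v, p v = 0 → v = 0 := fun v hv => by
    have := hlow v
    rw [hv] at this
    simpa using norm_le_zero_iff.1 this
  set q := Renormed.equiv p hp with hq
  let eL : B ≃L[ℝ] Renormed p hp :=
    { q with
      continuous_toFun := by
        have : Continuous (q.toLinearMap.comp e.symm.toLinearEquiv.toLinearMap) :=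
          (LinearMap.mkContinuous _ C fun x => by
            have := hup (e.symm x)
            rw [e.apply_symm_apply] at this
            exact this).continuous
        have h2 := this.comp e.continuous
        convert h2 using 1
        ext v; simp
      continuous_invFun := by
        have : Continuous (e.toLinearEquiv.toLinearMap.comp q.symm.toLinearMap) :=
          (LinearMap.mkContinuous _ 1 fun x => by
            rw [one_mul]; exact hlow (q.symm x)).continuous
        have h2 := e.symm.continuous.comp this
        convert h2 using 1
        ext v; simp }
  refine ⟨p, hp, ?_, ?_, hinv, eL, fun v => rfl⟩
  · have huu : IsUniformEmbedding (e.symm.trans eL) := (e.symm.trans eL).isUniformEmbedding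
    exact (completeSpace_congr (e := (e.symm.trans eL).toEquiv) huu).1 hcomp
  · refine ⟨fun ε hε => ?_⟩
    obtain ⟨δ, hδ, h⟩ := exists_forall_closed_ball_dist_add_le_two_sub E
      (show 0 < ε / C by positivity)
    refine ⟨δ, hδ, fun x hx y hy hxy => ?_⟩
    obtain ⟨x, rfl⟩ := q.surjective x
    obtain ⟨y, rfl⟩ := q.surjective y
    rw [← map_sub, Renormed.norm_equiv] at hxy
    rw [Renormed.norm_equiv] at hx hy
    rw [← map_add, Renormed.norm_equiv]
    -- Uniform convexity survives the supremum because the distance is invariant: for every `g` the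
    -- translates of `x` and `y` are still `ε` apart for `p`, hence `ε / C` apart in `E`, and one
    -- `δ` serves all `g`.
    refine ciSup_le fun g => ?_
    rw [map_add, map_add]
    refine h ((hle g x).trans hx.le) ((hle g y).trans hy.le) ?_
    rw [← map_sub, ← map_sub, div_le_iff₀ hC0, mul_comm]
    calc ε ≤ p (x - y) := hxy
      _ = p ((α g).linear (x - y)) := (hinv _ _).symm
      _ ≤ _ := hup _

end Renorming

/-! ### Quantitative absence of almost invariant vectors, and transport of the conclusion. -/

section Transfer

variable {H : Type*} [Group H] [TopologicalSpace H] [IsTopologicalGroup H] [DiscreteTopology H]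

/-- Without almost invariant vectors, a finite set moves all vectors by a definite amount. -/
lemma exists_finset_of_not_almostHasInvariantVectors {B : Type*} [AddCommGroup B]
    [Module ℝ B] [TopologicalSpace B] (α : H →* (B ≃ᵃ[ℝ] B))
    (hinv : ¬ AlmostHasInvariantVectors ((AffineEquiv.linearHom (k := ℝ) (P₁ := B)).comp α))
    {p : Seminorm ℝ B} (hp : IsCompatibleNorm p) (hpi : ∀ g v, p ((α g).linear v) = p v) :
    ∃ (F : Finset H) (ε : ℝ), 0 < ε ∧ ∀ v, ∃ g ∈ F, ε * p v ≤ p ((α g).linear v - v) := by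
  classical
  have h1 : ¬ ∀ K : Set H, IsCompact K → ∀ ε : ℝ, 0 < ε →
      ∃ v : B, p v = 1 ∧ ∀ g ∈ K, ∀ h ∈ K, p ((α g).linear v - (α h).linear v) ≤ ε :=
    fun h => hinv ⟨p, hp, h⟩
  push Not at h1
  obtain ⟨K, hK, ε, hε, h⟩ := h1
  have hKf := hK.finite_of_discrete
  let F := hKf.toFinset
  -- The quotients `k⁻¹ g` turn the diameter of an orbit into a displacement. The identity is added
  -- to have a witness when `p v = 0`, even if `K` is empty.
  refine ⟨insert 1 ((F ×ˢ F).image fun q => q.2⁻¹ * q.1), ε, hε, fun v => ?_⟩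
  by_cases hv : p v = 0
  · exact ⟨1, by simp, by simp [hv]⟩
  have hv' : 0 < p v := lt_of_le_of_ne (apply_nonneg _ _) (Ne.symm hv)
  obtain ⟨g, hg, k, hk, hgk⟩ := h ((p v)⁻¹ • v) (by
    rw [map_smul_eq_mul, norm_inv, Real.norm_of_nonneg hv'.le, inv_mul_cancel₀ hv])
  refine ⟨k⁻¹ * g, Finset.mem_insert_of_mem (Finset.mem_image.2 ⟨(g, k), by
    simp [F, hg, hk], rfl⟩), ?_⟩
  rw [map_smul, map_smul, ← smul_sub, map_smul_eq_mul, norm_inv, Real.norm_of_nonneg hv'.le,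
    ← div_eq_inv_mul, lt_div_iff₀ hv'] at hgk
  refine hgk.le.trans (le_of_eq ?_)
  rw [← hpi k⁻¹, map_sub, ← linear_mul_apply, ← linear_mul_apply, inv_mul_cancel,
    linear_one_apply]

lemma isCompatibleNorm_of_equiv {B : Type*} [AddCommGroup B] [Module ℝ B] [TopologicalSpace B]
    [IsTopologicalAddGroup B] (p : Seminorm ℝ B) (hp : ∀ v, p v = 0 → v = 0)
    (e : B ≃L[ℝ] Renormed p hp) (he : ∀ v, e v = Renormed.equiv p hp v) : IsCompatibleNorm p := by
  refine ⟨hp, (SeminormFamily.withSeminorms_iff_nhds_eq_iInf _).2 ?_⟩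
  rw [iInf_const]
  have h1 : 𝓝 (0 : B) = Filter.comap e (𝓝 0) := by
    have := e.toHomeomorph.isInducing.nhds_eq_comap 0
    simpa using this
  rw [h1, ← comap_norm_nhds_zero, Filter.comap_comap]
  congr 1
  ext v
  simp only [Function.comp_apply, he]
  rfl

/-- An affine action transported along a linear equivalence. -/
def conjAction {H B E : Type*} [Group H] [AddCommGroup B] [Module ℝ B] [AddCommGroup E] [Module ℝ E]
    (e : B ≃ₗ[ℝ] E) (α : H →* (B ≃ᵃ[ℝ] B)) : H →* (E ≃ᵃ[ℝ] E) :=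
  MonoidHom.mk' (fun g => e.symm.toAffineEquiv.trans ((α g).trans e.toAffineEquiv)) fun g h => by
    ext x
    simp [map_mul]

lemma conjAction_apply {H B E : Type*} [Group H] [AddCommGroup B] [Module ℝ B] [AddCommGroup E]
    [Module ℝ E] (e : B ≃ₗ[ℝ] E) (α : H →* (B ≃ᵃ[ℝ] B)) (g : H) (x : E) :
    conjAction e α g x = e (α g (e.symm x)) := rfl

lemma IsSuperreflexive.congr.{u} {V W : Type u} [AddCommGroup V] [Module ℝ V] [TopologicalSpace V]
    [AddCommGroup W] [Module ℝ W] [TopologicalSpace W] (e : V ≃L[ℝ] W) (h : IsSuperreflexive V) :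
    IsSuperreflexive W := by
  obtain ⟨E, i1, i2, h1, h2, ⟨f⟩⟩ := h
  exact ⟨E, i1, i2, h1, h2, ⟨e.symm.trans f⟩⟩

/-- The conclusion of the splitting theorem is invariant under linear homeomorphisms. -/
theorem splitting_of_equiv.{u} {ι : Type*} [Fintype ι] {G : ι → Type*} [∀ i, Group (G i)]
    [∀ i, TopologicalSpace (G i)] (Γ : Subgroup (∀ i, G i))
    {B E : Type u} [AddCommGroup B] [Module ℝ B] [TopologicalSpace B]
    [AddCommGroup E] [Module ℝ E] [TopologicalSpace E] (e : B ≃L[ℝ] E)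
    (α : Γ →* (B ≃ᵃ[ℝ] B))
    (h : ∃ S : AffineSubspace ℝ E, (S : Set E).Nonempty ∧ IsClosed (S : Set E) ∧
      S.direction.ClosedComplemented ∧
      (∀ γ : Γ, ∀ x ∈ S, conjAction e.toLinearEquiv α γ x ∈ S) ∧
      IsSumOfFactorActions Γ (conjAction e.toLinearEquiv α) S) :
    ∃ S : AffineSubspace ℝ B, (S : Set B).Nonempty ∧ IsClosed (S : Set B) ∧
      S.direction.ClosedComplemented ∧ (∀ γ : Γ, ∀ x ∈ S, α γ x ∈ S) ∧
      IsSumOfFactorActions Γ α S := by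
  obtain ⟨S, ⟨s, hs⟩, hcl, ⟨Q, hQ⟩, hinv, v, hv, F, hFc, hFs, hFd, β, hβu, hβc, hβ⟩ := h
  set es : E →ᵃ[ℝ] B := e.symm.toLinearEquiv.toAffineEquiv.toAffineMap with hes
  have hmem : ∀ x : B, x ∈ S.map es ↔ e x ∈ S := fun x => by
    rw [AffineSubspace.mem_map]
    constructor
    · rintro ⟨y, hy, rfl⟩
      have : e (es y) = y := e.apply_symm_apply y
      rwa [this]
    · exact fun hx => ⟨e x, hx, e.symm_apply_apply x⟩
  have hdir : (S.map es).direction = S.direction.map e.symm.toLinearEquiv.toLinearMap :=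
    AffineSubspace.map_direction _ _
  have hdmem : ∀ x : B, x ∈ (S.map es).direction ↔ e x ∈ S.direction := fun x => by
    rw [hdir, Submodule.mem_map]
    constructor
    · rintro ⟨y, hy, rfl⟩
      have : e (e.symm y) = y := e.apply_symm_apply y
      change e (e.symm y) ∈ _
      rwa [this]
    · exact fun hx => ⟨e x, hx, e.symm_apply_apply x⟩
  refine ⟨S.map es, ⟨es s, (hmem _).2 ?_⟩, ?_, ?_, ?_, es v, (hmem _).2 ?_, ?_⟩
  · change e (e.symm s) ∈ S
    rwa [e.apply_symm_apply]
  · have : ((S.map es : AffineSubspace ℝ B) : Set B) = e ⁻¹' S := Set.ext fun x => hmem x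
    rw [this]; exact hcl.preimage e.continuous
  · refine ⟨((e.symm : E →L[ℝ] B).comp ((Submodule.subtypeL _).comp (Q.comp (e : B →L[ℝ] E)))).codRestrict
      _ fun x => (hdmem _).2 ?_, fun x => ?_⟩
    · simp
    · have := hQ ⟨e x, (hdmem _).1 x.2⟩
      apply Subtype.ext
      simp [this]
  · intro γ x hx
    have := hinv γ _ ((hmem x).1 hx)
    rw [conjAction_apply] at this
    refine (hmem _).2 ?_
    simpa using this
  · change e (e.symm v) ∈ S
    rwa [e.apply_symm_apply]
  · let f : ∀ i, F i ≃L[ℝ] (F i).map e.symm.toLinearEquiv.toLinearMap :=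
      fun i => e.symm.submoduleMap (F i)
    have hf : ∀ i x, ((f i x : (F i).map e.symm.toLinearEquiv.toLinearMap) : B) = e.symm x :=
      fun i x => rfl
    refine ⟨fun i => (F i).map e.symm.toLinearEquiv.toLinearMap, fun i => ?_,
      fun i => (hFs i).congr (f i), ?_, fun i => conjAction (f i).toLinearEquiv (β i),
      fun i => ?_, fun i => ?_, fun γ x => ?_⟩
    · exact e.symm.toHomeomorph.isClosedMap _ (hFc i)
    · rw [hdir, ← hFd, Submodule.map_iSup]
    · intro U hU
      obtain ⟨W, hW, h⟩ := hβu i (f i ⁻¹' U)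
        ((f i).continuous.continuousAt.preimage_mem_nhds (by rwa [map_zero]))
      refine ⟨(f i).symm ⁻¹' W, (f i).symm.continuous.continuousAt.preimage_mem_nhds
        (by rwa [map_zero]), fun x y hxy g => ?_⟩
      have := h ((f i).symm x) ((f i).symm y) (by rw [← map_sub]; exact hxy) g
      rw [Set.mem_preimage, map_sub] at this
      exact this
    · exact (f i).continuous.comp ((hβc i).comp
        (continuous_fst.prodMk ((f i).symm.continuous.comp continuous_snd)))
    · have := hβ γ fun i => (f i).symm (x i)
      rw [conjAction_apply] at this
      have h2 : α γ (e.symm (v + ∑ i, ((f i).symm (x i) : E))) =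
          e.symm (v + ∑ i, (β i ((γ : ∀ i, G i) i) ((f i).symm (x i)) : E)) :=
        (e.symm_apply_apply _).symm.trans (congrArg e.symm this)
      have h3 : ∀ i, e.symm ((f i).symm (x i) : E) = (x i : B) := fun i => by
        rw [← hf, (f i).apply_symm_apply]
      rw [map_add e.symm, map_sum e.symm, map_add e.symm, map_sum e.symm] at h2
      simp only [h3] at h2
      exact h2

end Transfer

/-! ### Integration of continuous functions over sigma-compact spaces. -/

section SigmaCompactIntegrals

variable {Y : Type*} [TopologicalSpace Y] [SigmaCompactSpace Y] [MeasurableSpace Y] [BorelSpace Y]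
  {V : Type*} [NormedAddCommGroup V]

/-- The target need not be separable, but the range is a countable union of compact sets and hence
separable. -/
lemma Continuous.stronglyMeasurable_of_sigmaCompact {f : Y → V} (hf : Continuous f) :
    StronglyMeasurable f := by
  borelize V
  refine stronglyMeasurable_iff_measurable_separable.2 ⟨hf.measurable, ?_⟩
  have : Set.range f = ⋃ n, f '' compactCovering Y n := by
    rw [← Set.image_iUnion, iUnion_compactCovering, Set.image_univ]
  rw [this]
  exact .iUnion fun n => ((isCompact_compactCovering Y n).image hf).isSeparable

lemma exists_isCompact_measure_compl_lt [T2Space Y] (m : Measure Y) [IsFiniteMeasure m] {ε : ℝ≥0∞}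
    (hε : 0 < ε) : ∃ K, IsCompact K ∧ m Kᶜ < ε := by
  have h := tendsto_measure_iInter_atTop (μ := m) (s := fun n => (compactCovering Y n)ᶜ)
    (fun n => (isCompact_compactCovering Y n).measurableSet.compl.nullMeasurableSet)
    (fun a b hab => Set.compl_subset_compl.2 (compactCovering_subset Y hab))
    ⟨0, measure_ne_top _ _⟩
  rw [← Set.compl_iUnion, iUnion_compactCovering, Set.compl_univ, measure_empty] at h
  obtain ⟨n, hn⟩ := (h.eventually (gt_mem_nhds hε)).exists
  exact ⟨_, isCompact_compactCovering Y n, hn⟩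

/-- A function is controlled by the measure if it is bounded or the measure is carried by a
compact set. -/
def Controlled (m : Measure Y) (f : Y → V) : Prop :=
  (∃ C, ∀ y, ‖f y‖ ≤ C) ∨ ∃ K, IsCompact K ∧ m Kᶜ = 0

lemma Controlled.integrable [T2Space Y] {m : Measure Y} [IsFiniteMeasure m] {f : Y → V}
    (h : Controlled m f) (hf : Continuous f) : Integrable f m := by
  rcases h with ⟨C, hC⟩ | ⟨K, hK, hK0⟩
  · exact Integrable.of_bound hf.stronglyMeasurable_of_sigmaCompact.aestronglyMeasurable C
      (ae_of_all _ hC)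
  · have h1 := hf.continuousOn.integrableOn_compact (μ := m) hK
    rwa [IntegrableOn, Measure.restrict_eq_self_of_ae_mem (mem_ae_iff.2 hK0)] at h1

/-- Continuity of parametric integrals over a sigma-compact space. -/
lemma continuous_integral_of_controlled [T2Space Y] [NormedSpace ℝ V] {Z : Type*}
    [TopologicalSpace Z]
    (m : Measure Y) [IsFiniteMeasure m] {f : Z → Y → V} (hf : Continuous f.uncurry)
    (h : (∃ C, ∀ z y, ‖f z y‖ ≤ C) ∨ ∃ K, IsCompact K ∧ m Kᶜ = 0) :
    Continuous fun z => ∫ y, f z y ∂m := by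
  have hfz : ∀ z, Continuous (f z) := fun z => hf.comp (by fun_prop : Continuous fun y => (z, y))
  have hint : ∀ z, Integrable (f z) m := fun z => by
    refine Controlled.integrable ?_ (hfz z)
    rcases h with ⟨C, hC⟩ | h
    · exact Or.inl ⟨C, hC z⟩
    · exact Or.inr h
  -- The integral outside some compact set is small uniformly in `z`, by boundedness or because the
  -- measure does not charge the complement; on the compact set continuity in `z` is uniform.
  have htail : ∀ ε : ℝ, 0 < ε → ∃ K, IsCompact K ∧ ∀ z, ‖∫ y in Kᶜ, f z y ∂m‖ ≤ ε := by
    intro ε hε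
    rcases h with ⟨C, hC⟩ | ⟨K, hK, hK0⟩
    · obtain ⟨K, hK, hKm⟩ := exists_isCompact_measure_compl_lt m
        (show 0 < ENNReal.ofReal (ε / (|C| + 1)) by simp; positivity)
      refine ⟨K, hK, fun z => ?_⟩
      refine (norm_setIntegral_le_of_norm_le_const (measure_lt_top _ _) (C := |C| + 1)
        fun y _ => (hC z y).trans ((le_abs_self C).trans (by linarith))).trans ?_
      have : m.real Kᶜ ≤ ε / (|C| + 1) := ENNReal.toReal_le_of_le_ofReal (by positivity) hKm.le
      calc (|C| + 1) * m.real Kᶜ ≤ (|C| + 1) * (ε / (|C| + 1)) := by gcongr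
        _ = ε := by field_simp
    · refine ⟨K, hK, fun z => ?_⟩
      rw [Measure.restrict_eq_zero.2 hK0, integral_zero_measure, norm_zero]; exact hε.le
  rw [continuous_iff_continuousAt]
  intro z₀
  rw [ContinuousAt, Metric.tendsto_nhds]
  intro ε hε
  obtain ⟨K, hK, hKt⟩ := htail (ε / 8) (by positivity)
  have hM : 0 < m.real Set.univ + 1 := by positivity
  obtain ⟨v, hv, hvK⟩ := hK.mem_uniformity_of_prod (f := f) (s := Set.univ) (q := z₀)
    hf.continuousOn (Set.mem_univ _) (Metric.dist_mem_uniformity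
      (show 0 < ε / 4 / (m.real Set.univ + 1) by positivity))
  rw [nhdsWithin_univ] at hv
  filter_upwards [hv] with z hz
  rw [dist_eq_norm, ← integral_add_compl hK.measurableSet (hint z),
    ← integral_add_compl hK.measurableSet (hint z₀)]
  have h1 : ‖∫ y in K, f z y ∂m - ∫ y in K, f z₀ y ∂m‖ ≤ ε / 4 := by
    rw [← integral_sub (hint z).integrableOn (hint z₀).integrableOn]
    refine (norm_setIntegral_le_of_norm_le_const (measure_lt_top _ _)
      (C := ε / 4 / (m.real Set.univ + 1)) fun y hy => ?_).trans ?_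
    · have : dist (f z y) (f z₀ y) < ε / 4 / (m.real Set.univ + 1) := hvK z hz y hy
      rw [← dist_eq_norm]; exact this.le
    · rw [div_mul_eq_mul_div, div_le_iff₀ hM]
      have : m.real K ≤ m.real Set.univ := measureReal_mono (Set.subset_univ K)
      nlinarith
  calc ‖∫ y in K, f z y ∂m + ∫ y in Kᶜ, f z y ∂m -
        (∫ y in K, f z₀ y ∂m + ∫ y in Kᶜ, f z₀ y ∂m)‖
      = ‖(∫ y in K, f z y ∂m - ∫ y in K, f z₀ y ∂m) + ∫ y in Kᶜ, f z y ∂m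
          - ∫ y in Kᶜ, f z₀ y ∂m‖ := by congr 1; abel
    _ ≤ ‖∫ y in K, f z y ∂m - ∫ y in K, f z₀ y ∂m‖ + ‖∫ y in Kᶜ, f z y ∂m‖
          + ‖∫ y in Kᶜ, f z₀ y ∂m‖ := (norm_sub_le _ _).trans (by gcongr; exact norm_add_le _ _)
    _ < ε := by have := hKt z; have := hKt z₀; linarith

lemma eq_zero_of_integral_eq_zero_of_mem_support {f : Y → ℝ} {m : Measure Y} (hf : Continuous f)
    (h0 : ∀ y, 0 ≤ f y) (hi : Integrable f m) (h : ∫ y, f y ∂m = 0) {y : Y}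
    (hy : y ∈ m.support) : f y = 0 := by
  have h1 := (integral_eq_zero_iff_of_nonneg (fun y => h0 y) hi).1 h
  by_contra hne
  have hU : {z | f z ≠ 0} ∈ 𝓝 y := hf.continuousAt.eventually_ne hne
  have h2 := (Measure.mem_support_iff_forall y).1 hy _ hU
  exact h2.ne' h1

end SigmaCompactIntegrals

/-! ### Iterated averages over the factors. -/

section Averages

variable {ι : Type*} [Fintype ι] [DecidableEq ι] {G : ι → Type*} [∀ i, Group (G i)]
  [∀ i, TopologicalSpace (G i)] [∀ i, IsTopologicalGroup (G i)] [∀ i, T2Space (G i)]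
  [∀ i, LocallyCompactSpace (G i)] [∀ i, SigmaCompactSpace (G i)]
  [∀ i, MeasurableSpace (G i)] [∀ i, BorelSpace (G i)]
  {V : Type*} [NormedAddCommGroup V] [NormedSpace ℝ V]
  {W : Type*} [NormedAddCommGroup W] [NormedSpace ℝ W]
  (m q : ∀ i, Measure (G i))

/-- Iterated convolution on the left by measures on the factors of a product group. -/
noncomputable def avg : List ι → ((∀ i, G i) → V) → (∀ i, G i) → V
  | [], f => f
  | i :: l, f => fun g => ∫ h, avg l f ((Pi.mulSingle i h)⁻¹ * g) ∂(m i)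

/-- Continuous functions which may be averaged: they are bounded, or all the measures are
compactly supported. -/
def Admissible (f : (∀ i, G i) → V) : Prop :=
  Continuous f ∧ ((∃ C, ∀ g, ‖f g‖ ≤ C) ∨ ∀ i, ∃ K, IsCompact K ∧ m i Kᶜ = 0)

variable {m q}

lemma continuous_mulSingle_inv_mul (i : ι) :
    Continuous fun p : (∀ i, G i) × G i => (Pi.mulSingle i p.2)⁻¹ * p.1 := by
  have : Continuous fun h : G i => (Pi.mulSingle i h : ∀ i, G i) := continuous_mulSingle i
  fun_prop

lemma Admissible.comp {f : (∀ i, G i) → V} (hf : Admissible m f) {φ : V → W} (hφ : Continuous φ)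
    (hb : ∀ C, ∃ C', ∀ v, ‖v‖ ≤ C → ‖φ v‖ ≤ C') : Admissible m fun g => φ (f g) := by
  refine ⟨hφ.comp hf.1, hf.2.imp_left ?_⟩
  rintro ⟨C, hC⟩
  obtain ⟨C', hC'⟩ := hb C
  exact ⟨C', fun g => hC' _ (hC g)⟩

lemma Admissible.norm {f : (∀ i, G i) → V} (hf : Admissible m f) :
    Admissible m fun g => ‖f g‖ :=
  hf.comp continuous_norm fun C => ⟨C, fun v hv => by simpa using hv⟩

lemma Admissible.clm {f : (∀ i, G i) → V} (hf : Admissible m f) (T : V →L[ℝ] W) :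
    Admissible m fun g => T (f g) :=
  hf.comp T.continuous fun C => ⟨‖T‖ * C, fun v hv =>
    (T.le_opNorm v).trans (mul_le_mul_of_nonneg_left hv (norm_nonneg _))⟩

lemma Admissible.const (v : V) : Admissible m fun _ : ∀ i, G i => v :=
  ⟨continuous_const, Or.inl ⟨‖v‖, fun _ => le_rfl⟩⟩

lemma Admissible.add {f f' : (∀ i, G i) → V} (hf : Admissible m f) (hf' : Admissible m f') :
    Admissible m fun g => f g + f' g := by
  refine ⟨hf.1.add hf'.1, ?_⟩
  rcases hf.2 with ⟨C, hC⟩ | h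
  · rcases hf'.2 with ⟨C', hC'⟩ | h
    · exact Or.inl ⟨C + C', fun g => (norm_add_le _ _).trans (add_le_add (hC g) (hC' g))⟩
    · exact Or.inr h
  · exact Or.inr h

lemma Admissible.neg {f : (∀ i, G i) → V} (hf : Admissible m f) :
    Admissible m fun g => - f g :=
  hf.comp continuous_neg fun C => ⟨C, fun v hv => by simpa using hv⟩

lemma Admissible.sub {f f' : (∀ i, G i) → V} (hf : Admissible m f) (hf' : Admissible m f') :
    Admissible m fun g => f g - f' g := by
  simpa [sub_eq_add_neg] using hf.add hf'.neg

lemma Admissible.smul {f : (∀ i, G i) → V} (hf : Admissible m f) (c : ℝ) :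
    Admissible m fun g => c • f g :=
  hf.clm (c • ContinuousLinearMap.id ℝ V)

variable [∀ i, IsProbabilityMeasure (m i)] [∀ i, IsProbabilityMeasure (q i)]

lemma Admissible.integrable {f : (∀ i, G i) → V} (hf : Admissible m f) (i : ι) (g : ∀ i, G i) :
    Integrable (fun h => f ((Pi.mulSingle i h)⁻¹ * g)) (m i) := by
  refine Controlled.integrable ?_ (hf.1.comp
    ((continuous_mulSingle_inv_mul i).comp (by fun_prop : Continuous fun h => (g, h))))
  rcases hf.2 with ⟨C, hC⟩ | h
  · exact Or.inl ⟨C, fun y => hC _⟩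
  · exact Or.inr (h i)

lemma norm_integral_le_of_bound {Y : Type*} [MeasurableSpace Y] {μ : Measure Y}
    [IsProbabilityMeasure μ] {f : Y → V} {C : ℝ} (h : ∀ y, ‖f y‖ ≤ C) : ‖∫ y, f y ∂μ‖ ≤ C := by
  simpa using norm_integral_le_of_norm_le_const (μ := μ) (ae_of_all _ h)

lemma Admissible.avg {f : (∀ i, G i) → V} (hf : Admissible m f) (l : List ι) :
    Admissible m (avg m l f) := by
  induction l with
  | nil => exact hf
  | cons i l ih =>
    refine ⟨continuous_integral_of_controlled (m i)
      (f := fun g h => _root_.avg m l f ((Pi.mulSingle i h)⁻¹ * g))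
      (ih.1.comp (continuous_mulSingle_inv_mul i)) ?_, ih.2.imp_left ?_⟩
    · rcases ih.2 with ⟨C, hC⟩ | h
      · exact Or.inl ⟨C, fun z y => hC _⟩
      · exact Or.inr (h i)
    · rintro ⟨C, hC⟩
      exact ⟨C, fun g => norm_integral_le_of_bound fun h => hC _⟩

lemma avg_const [CompleteSpace V] (l : List ι) (v : V) : avg m l (fun _ => v) = fun _ => v := by
  induction l with
  | nil => rfl
  | cons i l ih => funext g; simp [avg, ih]

lemma avg_add {f f' : (∀ i, G i) → V} (hf : Admissible m f) (hf' : Admissible m f')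
    (l : List ι) (g : ∀ i, G i) : avg m l (fun g => f g + f' g) g = avg m l f g + avg m l f' g := by
  induction l generalizing g with
  | nil => rfl
  | cons i l ih =>
    simp only [avg, ih]
    exact integral_add ((hf.avg l).integrable i g) ((hf'.avg l).integrable i g)

lemma avg_clm [CompleteSpace V] [CompleteSpace W] {f : (∀ i, G i) → V} (hf : Admissible m f)
    (T : V →L[ℝ] W) (l : List ι) (g : ∀ i, G i) :
    avg m l (fun g => T (f g)) g = T (avg m l f g) := by
  induction l generalizing g with
  | nil => rfl
  | cons i l ih =>
    simp only [avg, ih]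
    exact T.integral_comp_comm ((hf.avg l).integrable i g)

lemma avg_smul [CompleteSpace V] {f : (∀ i, G i) → V} (hf : Admissible m f) (c : ℝ) (l : List ι)
    (g : ∀ i, G i) : avg m l (fun g => c • f g) g = c • avg m l f g :=
  avg_clm hf (c • ContinuousLinearMap.id ℝ V) l g

lemma avg_sub [CompleteSpace V] {f f' : (∀ i, G i) → V} (hf : Admissible m f)
    (hf' : Admissible m f') (l : List ι) (g : ∀ i, G i) :
    avg m l (fun g => f g - f' g) g = avg m l f g - avg m l f' g := by
  have h1 := avg_add hf (hf'.smul (-1)) l g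
  rw [avg_smul hf'] at h1
  simpa [sub_eq_add_neg] using h1

lemma avg_mono {f f' : (∀ i, G i) → ℝ} (hf : Admissible m f) (hf' : Admissible m f')
    (h : ∀ g, f g ≤ f' g) (l : List ι) (g : ∀ i, G i) : avg m l f g ≤ avg m l f' g := by
  induction l generalizing g with
  | nil => exact h g
  | cons i l ih =>
    exact integral_mono ((hf.avg l).integrable i g) ((hf'.avg l).integrable i g) fun h => ih _

lemma avg_nonneg {f : (∀ i, G i) → ℝ} (h : ∀ g, 0 ≤ f g) (l : List ι) (g : ∀ i, G i) :
    0 ≤ avg m l f g := by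
  induction l generalizing g with
  | nil => exact h g
  | cons i l ih => exact integral_nonneg fun h => ih _

lemma norm_avg_le {f : (∀ i, G i) → V} (hf : Admissible m f) (l : List ι) (g : ∀ i, G i) :
    ‖avg m l f g‖ ≤ avg m l (fun g => ‖f g‖) g := by
  induction l generalizing g with
  | nil => exact le_rfl
  | cons i l ih =>
    exact (norm_integral_le_integral_norm _).trans
      (integral_mono ((hf.avg l).integrable i g).norm ((hf.norm.avg l).integrable i g)
        fun h => ih _)

lemma avg_comp_mul_right (f : (∀ i, G i) → V) (k : ∀ i, G i) (l : List ι) (g : ∀ i, G i) :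
    avg m l (fun g => f (g * k)) g = avg m l f (g * k) := by
  induction l generalizing g with
  | nil => rfl
  | cons i l ih => simp only [avg, ih, mul_assoc]

lemma mulSingle_mul_comm {i : ι} {k : ∀ i, G i} (hk : k i = 1) (h : G i) :
    Pi.mulSingle i h * k = k * Pi.mulSingle i h := by
  ext j
  rcases eq_or_ne j i with rfl | hj
  · simp [hk]
  · simp [hj]

lemma mulSingle_inv_mul_comm {i : ι} {k : ∀ i, G i} (hk : k i = 1) (h : G i) :
    (Pi.mulSingle i h)⁻¹ * k = k * (Pi.mulSingle i h)⁻¹ := by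
  rw [← Pi.mulSingle_inv, mulSingle_mul_comm hk]

/-- Translations along one factor commute with averages over the others; this lets increments along
a factor inherit invariance under the remaining averages. -/
lemma avg_comp_mul_left (f : (∀ i, G i) → V) (k : ∀ i, G i) (l : List ι) (hk : ∀ i ∈ l, k i = 1)
    (g : ∀ i, G i) : avg m l (fun g => f (k * g)) g = avg m l f (k * g) := by
  induction l generalizing g with
  | nil => rfl
  | cons i l ih =>
    have ih' := ih fun j hj => hk j (List.mem_cons_of_mem _ hj)
    simp only [avg, ih', ← mul_assoc]
    rw [← funext fun h => congrArg (fun x => avg m l f (x * g))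
      (mulSingle_inv_mul_comm (hk i List.mem_cons_self) h)]

/-- Domination of averages by averages with respect to larger measures. -/
lemma avg_le_of_map_le {C : NNReal} {F : (∀ i, G i) → ℝ} (hFm : Admissible m F)
    (hFq : Admissible q F) (hF : ∀ g, 0 ≤ F g) {k : ∀ i, G i} {l : List ι} (hl : l.Nodup)
    (hk : ∀ i ∈ l, (q i).map (fun h => k i * h) ≤ C • m i) (hk1 : ∀ i ∉ l, k i = 1)
    (g : ∀ i, G i) : avg q l F (k⁻¹ * g) ≤ (C : ℝ) ^ l.length * avg m l F g := by
  induction l generalizing k g with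
  | nil =>
    have : k = 1 := funext fun i => hk1 i (by simp)
    simp [avg, this]
  | cons i l ih =>
    obtain ⟨hil, hl⟩ := List.nodup_cons.1 hl
    -- Peeling off the coordinate `i`: `k'` is left to the remaining averages, while `k i` shifts
    -- the integration variable, where the bound on the push-forward of `q i` applies. Each factor
    -- costs one constant `C`.
    set k' : ∀ i, G i := Function.update k i 1 with hk'
    have hk'i : k' i = 1 := by simp [hk']
    have hkk : k = k' * Pi.mulSingle i (k i) := by
      ext j
      rcases eq_or_ne j i with rfl | hj
      · simp [hk']
      · simp [hk', hj]
    have ih' := fun g => ih (k := k') hl (fun j hj => by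
      have hji : j ≠ i := fun h => hil (h ▸ hj)
      simpa [hk', hji] using hk j (List.mem_cons_of_mem _ hj)) (fun j hj => by
      rcases eq_or_ne j i with rfl | hji
      · simp [hk']
      · simpa [hk', hji] using hk1 j (by simp [hji, hj])) g
    set Φ : G i → ℝ := fun h => avg m l F ((Pi.mulSingle i h)⁻¹ * g) with hΦ
    have hΦi : Integrable Φ (m i) := (hFm.avg l).integrable i g
    have hΦc : Continuous Φ := (hFm.avg l).1.comp
      ((continuous_mulSingle_inv_mul i).comp (by fun_prop : Continuous fun h => (g, h)))
    have hΦC : Integrable Φ (C • m i) := hΦi.smul_measure_nnreal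
    have hmap : Integrable Φ ((q i).map fun h => k i * h) :=
      hΦC.mono_measure (hk i List.mem_cons_self)
    have hmeas : Measurable fun h : G i => k i * h := (continuous_const_mul (k i)).measurable
    have hstep : ∀ h, avg q l F ((Pi.mulSingle i h)⁻¹ * (k⁻¹ * g)) ≤
        (C : ℝ) ^ l.length * Φ (k i * h) := fun h => by
      have : (Pi.mulSingle i h)⁻¹ * (k⁻¹ * g) = k'⁻¹ * ((Pi.mulSingle i (k i * h))⁻¹ * g) := by
        rw [← mul_assoc, ← mul_assoc, ← mul_inv_rev, ← mul_inv_rev, hkk]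
        congr 2
        have h1 : (k' * Pi.mulSingle i (k i)) i = k i := by simp [hk']
        rw [h1, mul_assoc, ← Pi.mulSingle_mul, mulSingle_mul_comm hk'i]
      rw [this]
      exact ih' _
    calc avg q (i :: l) F (k⁻¹ * g)
        = ∫ h, avg q l F ((Pi.mulSingle i h)⁻¹ * (k⁻¹ * g)) ∂(q i) := rfl
      _ ≤ ∫ h, (C : ℝ) ^ l.length * Φ (k i * h) ∂(q i) :=
          integral_mono ((hFq.avg l).integrable i _)
            ((hmap.comp_measurable hmeas).const_mul _) hstep
      _ = (C : ℝ) ^ l.length * ∫ h, Φ h ∂((q i).map fun h => k i * h) := by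
          rw [integral_const_mul, integral_map hmeas.aemeasurable
            hΦc.stronglyMeasurable_of_sigmaCompact.aestronglyMeasurable]
      _ ≤ (C : ℝ) ^ l.length * ∫ h, Φ h ∂(C • m i) := by
          exact mul_le_mul_of_nonneg_left (integral_mono_measure (hk i List.mem_cons_self)
            (ae_of_all _ fun h => avg_nonneg hF _ _) hΦC) (by positivity)
      _ = (C : ℝ) ^ (i :: l).length * avg m (i :: l) F g := by
          rw [integral_smul_nnreal_measure, NNReal.smul_def, smul_eq_mul, List.length_cons, pow_succ,
            mul_assoc]
          rfl

/-- A nonnegative continuous function of zero integral vanishes on the support of the measure; this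
is applied to one factor at a time. -/
lemma eq_zero_of_avg_eq_zero {F : (∀ i, G i) → ℝ} (hFm : Admissible m F)
    (hF : ∀ g, 0 ≤ F g) {l : List ι} (hl : l.Nodup) {g : ∀ i, G i} (h0 : avg m l F g = 0)
    {k : ∀ i, G i} (hk : ∀ i ∈ l, k i ∈ (m i).support) (hk1 : ∀ i ∉ l, k i = 1) :
    F (k⁻¹ * g) = 0 := by
  induction l generalizing k g with
  | nil =>
    have : k = 1 := funext fun i => hk1 i (by simp)
    simpa [avg, this] using h0
  | cons i l ih =>
    obtain ⟨hil, hl⟩ := List.nodup_cons.1 hl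
    have h1 := eq_zero_of_integral_eq_zero_of_mem_support ((hFm.avg l).1.comp
      ((continuous_mulSingle_inv_mul i).comp (by fun_prop : Continuous fun h => (g, h))))
      (fun y => avg_nonneg hF _ _) ((hFm.avg l).integrable i g) h0 (hk i List.mem_cons_self)
    set k' : ∀ i, G i := Function.update k i 1 with hk'
    have hkk : k = Pi.mulSingle i (k i) * k' := by
      ext j
      rcases eq_or_ne j i with rfl | hj
      · simp [hk']
      · simp [hk', hj]
    have := ih (k := k') hl h1 (fun j hj => by
      have hji : j ≠ i := fun h => hil (h ▸ hj)
      simpa [hk', hji] using hk j (List.mem_cons_of_mem _ hj)) (fun j hj => by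
      rcases eq_or_ne j i with rfl | hji
      · simp [hk']
      · simpa [hk', hji] using hk1 j (by simp [hji, hj]))
    rw [hkk, mul_inv_rev, mul_assoc]
    exact this

end Averages

/-! ### Measures with compactly supported densities, and domination of their translates. -/

section Bumps

open scoped NNReal Pointwise

variable {H : Type*} [Group H] [TopologicalSpace H] [IsTopologicalGroup H] [T2Space H]
  [LocallyCompactSpace H] [MeasurableSpace H] [BorelSpace H]

/-- A probability measure with a continuous compactly supported density. -/
def IsBump (m : Measure H) : Prop :=
  ∃ φ : H → ℝ≥0, Continuous φ ∧ HasCompactSupport φ ∧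
    m = Measure.haar.withDensity (fun x => (φ x : ℝ≥0∞)) ∧ IsProbabilityMeasure m

lemma IsBump.isProbabilityMeasure {m : Measure H} (hm : IsBump m) : IsProbabilityMeasure m :=
  hm.choose_spec.2.2.2

lemma IsBump.exists_isCompact {m : Measure H} (hm : IsBump m) : ∃ K, IsCompact K ∧ m Kᶜ = 0 := by
  obtain ⟨φ, hφ, hc, rfl, -⟩ := hm
  refine ⟨tsupport φ, hc, ?_⟩
  rw [withDensity_apply _ (isClosed_tsupport φ).measurableSet.compl]
  refine (setLIntegral_congr_fun (isClosed_tsupport φ).measurableSet.compl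
    (g := fun _ => 0) fun x hx => ?_).trans (by simp)
  simp [image_eq_zero_of_notMem_tsupport hx]

lemma exists_bound_of_hasCompactSupport_nnreal {φ : H → ℝ≥0} (hφ : Continuous φ)
    (hc : HasCompactSupport φ) : ∃ M : ℝ≥0, ∀ x, φ x ≤ M := by
  obtain ⟨M, hM⟩ := (hc.isCompact_range hφ).bddAbove
  exact ⟨M, fun x => hM ⟨x, rfl⟩⟩

lemma lintegral_lt_top_of_hasCompactSupport {φ : H → ℝ≥0} (hφ : Continuous φ)
    (hc : HasCompactSupport φ) : ∫⁻ x, φ x ∂(Measure.haar : Measure H) < ⊤ := by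
  obtain ⟨M, hM⟩ := exists_bound_of_hasCompactSupport_nnreal hφ hc
  calc ∫⁻ x, φ x ∂(Measure.haar : Measure H)
      ≤ ∫⁻ x, (tsupport φ).indicator (fun _ => (M : ℝ≥0∞)) x ∂Measure.haar := by
        refine lintegral_mono fun x => ?_
        by_cases hx : x ∈ tsupport φ
        · simpa [hx] using hM x
        · simp [image_eq_zero_of_notMem_tsupport hx]
    _ = M * Measure.haar (tsupport φ) := by
        rw [lintegral_indicator (isClosed_tsupport φ).measurableSet, setLIntegral_const]
    _ < ⊤ := ENNReal.mul_lt_top ENNReal.coe_lt_top hc.measure_lt_top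

lemma withDensity_nnreal_smul (c : ℝ≥0) {f : H → ℝ≥0∞} (hf : Measurable f) (μ : Measure H) :
    μ.withDensity ((c : ℝ≥0∞) • f) = c • μ.withDensity f := by
  rw [withDensity_smul _ hf]; rfl

lemma nnreal_smul_measure_mono {μ ν : Measure H} (h : μ ≤ ν) (C : ℝ≥0) : C • μ ≤ C • ν := by
  intro s
  simp only [Measure.smul_apply]
  exact mul_le_mul_right (h s) (C : ℝ≥0∞)

/-- The density is a normalized Urysohn function for `S ⊆ U`. The constant `C` is its mass before
normalization, since the function equals one on `S`. -/
lemma exists_isBump {S U : Set H} (hS : IsCompact S) (hS0 : S.Nonempty) (hU : IsOpen U)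
    (hSU : S ⊆ U) : ∃ m : Measure H, IsBump m ∧ m Uᶜ = 0 ∧
      ∃ C : ℝ≥0, Measure.haar.restrict S ≤ C • m := by
  obtain ⟨f, hf1, hf2, hf3, hf4⟩ := exists_continuousMap_one_of_isCompact_subset_isOpen hS hU hSU
  set φ : H → ℝ≥0 := fun x => Real.toNNReal (f x) with hφ
  have hφc : Continuous φ := continuous_real_toNNReal.comp f.continuous
  have hφs : HasCompactSupport φ := HasCompactSupport.comp_left (g := Real.toNNReal) hf2 (by simp)
  have hφS : ∀ x ∈ S, φ x = 1 := fun x hx => by simp [hφ, hf1 hx]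
  have hφU : ∀ x ∉ U, φ x = 0 := fun x hx => by
    simp [hφ, image_eq_zero_of_notMem_tsupport fun h => hx (hf3 h)]
  set I : ℝ≥0∞ := ∫⁻ x, φ x ∂(Measure.haar : Measure H) with hI
  have hI0 : I ≠ 0 := by
    obtain ⟨s, hs⟩ := hS0
    have hV : IsOpen (φ ⁻¹' Set.Ioi 0) := isOpen_Ioi.preimage hφc
    intro h0
    rw [hI, lintegral_eq_zero_iff (by fun_prop)] at h0
    have h1 : (Measure.haar : Measure H) (φ ⁻¹' Set.Ioi 0) = 0 := by
      refine measure_mono_null ?_ h0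
      intro x hx h
      have : (0 : ℝ≥0) < φ x := hx
      simp only [Pi.zero_apply, ENNReal.coe_eq_zero] at h
      exact this.ne' h
    exact hV.measure_ne_zero _ ⟨s, by simp [hφS s hs]⟩ h1
  have hItop : I ≠ ⊤ := by
    exact (lintegral_lt_top_of_hasCompactSupport hφc hφs).ne
  set c : ℝ≥0 := I.toNNReal with hc
  have hcI : (c : ℝ≥0∞) = I := ENNReal.coe_toNNReal hItop
  have hc0 : c ≠ 0 := by
    intro h; rw [h] at hcI; exact hI0 hcI.symm
  set ψ : H → ℝ≥0 := fun x => c⁻¹ * φ x with hψ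
  have hψc : Continuous ψ := by fun_prop
  have hψs : HasCompactSupport ψ := hφs.mul_left
  have hdens : Measure.haar.withDensity (fun x => (φ x : ℝ≥0∞)) =
      c • Measure.haar.withDensity (fun x => (ψ x : ℝ≥0∞)) := by
    rw [← withDensity_nnreal_smul _ (by fun_prop)]
    congr 1
    ext x
    simp only [hψ, ENNReal.coe_mul, Pi.smul_apply, smul_eq_mul, ← mul_assoc]
    rw [← ENNReal.coe_mul, mul_inv_cancel₀ hc0]; simp
  refine ⟨Measure.haar.withDensity fun x => (ψ x : ℝ≥0∞), ⟨ψ, hψc, hψs, rfl, ⟨?_⟩⟩, ?_, c, ?_⟩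
  · rw [withDensity_apply _ MeasurableSet.univ, Measure.restrict_univ]
    simp only [hψ, ENNReal.coe_mul]
    rw [lintegral_const_mul _ (by fun_prop), ← hI, ← hcI, ← ENNReal.coe_mul, inv_mul_cancel₀ hc0,
      ENNReal.coe_one]
  · rw [withDensity_apply _ hU.measurableSet.compl]
    refine (setLIntegral_congr_fun hU.measurableSet.compl (g := fun _ => 0) fun x hx => ?_).trans
      (by simp)
    simp [hψ, hφU x hx]
  · rw [← hdens, ← withDensity_indicator_one hS.measurableSet]
    refine withDensity_mono (ae_of_all _ fun x => ?_)
    by_cases hx : x ∈ S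
    · simp [hx, hφS x hx]
    · simp [hx]

lemma mem_support_of_restrict_le {m : Measure H} {C : ℝ≥0} {S : Set H}
    (h : Measure.haar.restrict S ≤ C • m) {x : H} (hx : S ∈ 𝓝 x) : x ∈ m.support := by
  rw [Measure.mem_support_iff_forall]
  intro U hU
  rw [pos_iff_ne_zero]
  intro h0
  have h1 := h (interior (U ∩ S))
  rw [Measure.restrict_apply isOpen_interior.measurableSet,
    Set.inter_eq_left.2 (interior_subset.trans Set.inter_subset_right)] at h1
  have h2 : m (interior (U ∩ S)) = 0 :=
    measure_mono_null (interior_subset.trans Set.inter_subset_left) h0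
  rw [Measure.smul_apply, h2, smul_zero, nonpos_iff_eq_zero] at h1
  exact isOpen_interior.measure_ne_zero _
    ⟨x, mem_interior_iff_mem_nhds.2 (Filter.inter_mem hU hx)⟩ h1

/-- There are bumps with arbitrarily small support around the identity. -/
lemma exists_isBump_near_one {U : Set H} (hU : U ∈ 𝓝 1) :
    ∃ m : Measure H, IsBump m ∧ m Uᶜ = 0 ∧ (1 : H) ∈ m.support := by
  obtain ⟨S, hS1, hSU, hS⟩ := local_compact_nhds (interior_mem_nhds.2 hU)
  obtain ⟨m, hm, hmU, C, hC⟩ := exists_isBump hS ⟨1, mem_of_mem_nhds hS1⟩ isOpen_interior hSU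
  exact ⟨m, hm, measure_mono_null (Set.compl_subset_compl.2 interior_subset) hmU,
    mem_support_of_restrict_le hC hS1⟩

lemma map_mul_left_withDensity (φ : H → ℝ≥0) (hφ : Continuous φ) (k : H) :
    (Measure.haar.withDensity fun x => (φ x : ℝ≥0∞)).map (fun h => k * h) =
      Measure.haar.withDensity fun x => (φ (k⁻¹ * x) : ℝ≥0∞) := by
  have hk : Measurable fun h : H => k * h := (continuous_const_mul k).measurable
  have hφ' : Measurable fun x => (φ (k⁻¹ * x) : ℝ≥0∞) := by
    have : Continuous fun x => φ (k⁻¹ * x) := by fun_prop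
    exact this.measurable.coe_nnreal_ennreal
  ext A hA
  rw [Measure.map_apply hk hA, withDensity_apply _ (hk hA), withDensity_apply _ hA,
    ← lintegral_indicator (hk hA), ← lintegral_indicator hA,
    ← lintegral_mul_left_eq_self (μ := Measure.haar) (A.indicator _) k]
  congr 1
  ext h
  by_cases hh : k * h ∈ A
  · rw [Set.indicator_of_mem hh, Set.indicator_of_mem (by exact hh)]; simp
  · rw [Set.indicator_of_notMem hh, Set.indicator_of_notMem (by exact hh)]

/-- A compact set of translates of a bump is dominated by multiples of the Haar measure. -/
lemma IsBump.map_le {q : Measure H} (hq : IsBump q) {K : Set H} (hK : IsCompact K) :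
    ∃ S : Set H, IsCompact S ∧ K ⊆ S ∧ ∃ C : ℝ≥0, ∀ k ∈ K,
      q.map (fun h => k * h) ≤ C • Measure.haar.restrict S := by
  obtain ⟨φ, hφ, hc, rfl, -⟩ := hq
  obtain ⟨M, hM⟩ := exists_bound_of_hasCompactSupport_nnreal hφ hc
  refine ⟨K * tsupport φ ∪ K, (hK.mul hc).union hK, Set.subset_union_right, M, fun k hk => ?_⟩
  rw [map_mul_left_withDensity φ hφ, ← withDensity_indicator_one
    ((hK.mul hc).union hK).measurableSet, ← withDensity_nnreal_smul _
    (measurable_one.indicator ((hK.mul hc).union hK).measurableSet)]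
  refine withDensity_mono (ae_of_all _ fun x => ?_)
  by_cases hx : x ∈ K * tsupport φ
  · simp [hx, hM]
  · have : φ (k⁻¹ * x) = 0 :=
      image_eq_zero_of_notMem_tsupport fun h => hx ⟨k, hk, k⁻¹ * x, h, by simp⟩
    simp [this]

/-- A compact set of translates of a bump is dominated by a bump. -/
lemma IsBump.exists_dominating {q : Measure H} (hq : IsBump q) {K : Set H} (hK : IsCompact K) :
    ∃ m : Measure H, IsBump m ∧ ∃ C : ℝ≥0, ∀ k ∈ K, q.map (fun h => k * h) ≤ C • m := by
  obtain ⟨S, hS, -, C, hC⟩ := hq.map_le hK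
  obtain ⟨m, hm, -, C', hC'⟩ := exists_isBump (hS.union isCompact_singleton)
    ⟨1, Or.inr rfl⟩ isOpen_univ (Set.subset_univ _)
  refine ⟨m, hm, C * C', fun k hk => (hC k hk).trans ?_⟩
  rw [mul_smul]
  exact nnreal_smul_measure_mono ((Measure.restrict_mono Set.subset_union_left
    le_rfl).trans hC') C

/-- Domination doubles as a tool for supports: a measure that dominates the translate by `k` of a
measure charging every neighbourhood of the identity charges every neighbourhood of `k`. -/
lemma mem_support_of_map_le {q m : Measure H} {C : ℝ≥0} {k : H}
    (h : q.map (fun h => k * h) ≤ C • m) (hq : (1 : H) ∈ q.support) : k ∈ m.support := by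
  rw [Measure.mem_support_iff_forall] at hq ⊢
  intro U hU
  obtain ⟨V, hVU, hV, hkV⟩ := mem_nhds_iff.1 hU
  have hk : Continuous fun h : H => k * h := continuous_const_mul k
  rw [pos_iff_ne_zero]
  intro h0
  have h1 := h V
  rw [Measure.map_apply hk.measurable hV.measurableSet, Measure.smul_apply,
    measure_mono_null hVU h0, smul_zero, nonpos_iff_eq_zero] at h1
  exact (hq _ ((hV.preimage hk).mem_nhds (by simpa using hkV))).ne' h1

/-- On a sigma-compact group there are probability measures which integrate a given continuous
function and dominate all compact sets of translates of bumps. -/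
lemma exists_dominating_measure [SigmaCompactSpace H] {c : H → ℝ≥0} (hc : Continuous c) :
    ∃ m : Measure H, IsProbabilityMeasure m ∧ (∀ x, x ∈ m.support) ∧ ∫⁻ x, c x ∂m < ⊤ ∧
      ∀ q : Measure H, IsBump q → ∀ K, IsCompact K →
        ∃ C : ℝ≥0, ∀ k ∈ K, q.map (fun h => k * h) ≤ C • m := by
  have hK : ∀ n, ∃ p : Measure H, IsBump p ∧
      ∃ D : ℝ≥0, Measure.haar.restrict (CompactExhaustion.choice H n ∪ {1}) ≤ D • p := fun n => by
    obtain ⟨p, hp, -, h⟩ := exists_isBump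
      (((CompactExhaustion.choice H).isCompact n).union isCompact_singleton)
      ⟨1, Or.inr rfl⟩ isOpen_univ (Set.subset_univ _)
    exact ⟨p, hp, h⟩
  choose p hp D hD using hK
  have hpp : ∀ n, IsProbabilityMeasure (p n) := fun n => (hp n).isProbabilityMeasure
  have hcp : ∀ n, ∫⁻ x, c x ∂(p n) < ⊤ := fun n => by
    obtain ⟨K, hK, hK0⟩ := (hp n).exists_isCompact
    obtain ⟨M, hM⟩ := (hK.image hc).bddAbove
    calc ∫⁻ x, c x ∂(p n) ≤ ∫⁻ x, M ∂(p n) := by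
          refine lintegral_mono_ae ?_
          filter_upwards [mem_ae_iff.2 hK0] with x hx
          exact_mod_cast hM ⟨x, hx, rfl⟩
      _ < ⊤ := by simp
  set b : ℕ → ℝ≥0 := fun n => (∫⁻ x, c x ∂(p n)).toNNReal with hb
  have hbc : ∀ n, (b n : ℝ≥0∞) = ∫⁻ x, c x ∂(p n) := fun n => ENNReal.coe_toNNReal (hcp n).ne
  -- These weights make both the total mass and the integral of `c` converge geometrically, while
  -- staying positive so that every `p n` is dominated.
  set a : ℕ → ℝ≥0 := fun n => (1 / 2) ^ n / (1 + b n) with ha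
  have ha0 : ∀ n, 0 < a n := fun n => by simp only [ha]; positivity
  have hgeo : ∑' n : ℕ, (((1 / 2 : ℝ≥0) ^ n : ℝ≥0) : ℝ≥0∞) < ⊤ := by
    rw [lt_top_iff_ne_top, ENNReal.tsum_coe_ne_top_iff_summable]
    exact NNReal.summable_geometric (by norm_num [NNReal.half_lt_self])
  have hale : ∀ n, a n ≤ (1 / 2) ^ n := fun n => div_le_self (by positivity) (by simp)
  have hable : ∀ n, a n * b n ≤ (1 / 2) ^ n := fun n => by
    rw [ha]; dsimp only
    rw [div_mul_eq_mul_div, div_le_iff₀ (by positivity)]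
    gcongr
    simp
  have hAtop : ∑' n, (a n : ℝ≥0∞) < ⊤ :=
    (ENNReal.tsum_le_tsum fun n => by exact_mod_cast hale n).trans_lt hgeo
  set A : ℝ≥0 := (∑' n, (a n : ℝ≥0∞)).toNNReal with hA
  have hAc : (A : ℝ≥0∞) = ∑' n, (a n : ℝ≥0∞) := ENNReal.coe_toNNReal hAtop.ne
  have hA0 : A ≠ 0 := by
    intro h
    rw [h] at hAc
    have := (ENNReal.tsum_eq_zero.1 hAc.symm) 0
    exact (ha0 0).ne' (by exact_mod_cast this)
  set m₀ : Measure H := Measure.sum fun n => a n • p n with hm₀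
  have hle : ∀ n, p n ≤ (A * (a n)⁻¹) • (A⁻¹ • m₀) := fun n => by
    have h1 : a n • p n ≤ m₀ := Measure.le_sum _ n
    have h2 := nnreal_smul_measure_mono h1 (a n)⁻¹
    rw [smul_smul, inv_mul_cancel₀ (ha0 n).ne', one_smul] at h2
    rw [smul_smul, mul_right_comm, mul_inv_cancel₀ hA0, one_mul]
    exact h2
  have hdom : ∀ q : Measure H, IsBump q → ∀ K, IsCompact K →
      ∃ C : ℝ≥0, ∀ k ∈ K, q.map (fun h => k * h) ≤ C • (A⁻¹ • m₀) := fun q hq K hK => by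
    obtain ⟨S, hS, -, C, hC⟩ := hq.map_le hK
    obtain ⟨n, hn⟩ := (CompactExhaustion.choice H).exists_superset_of_isCompact hS
    refine ⟨C * (D n * (A * (a n)⁻¹)), fun k hk => (hC k hk).trans ?_⟩
    rw [mul_smul, mul_smul]
    refine nnreal_smul_measure_mono (((Measure.restrict_mono (hn.trans Set.subset_union_left)
      le_rfl).trans (hD n)).trans (nnreal_smul_measure_mono (hle n) _)) _
  refine ⟨A⁻¹ • m₀, ⟨?_⟩, fun x => ?_, ?_, hdom⟩
  · rw [Measure.smul_apply, hm₀, Measure.sum_apply _ MeasurableSet.univ]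
    simp only [Measure.smul_apply, measure_univ]
    have : ∑' n, (a n • (1 : ℝ≥0∞)) = A := by rw [hAc]; simp [ENNReal.smul_def]
    rw [this, ENNReal.smul_def, smul_eq_mul, ← ENNReal.coe_mul, inv_mul_cancel₀ hA0,
      ENNReal.coe_one]
  · obtain ⟨q, hq, -, hq1⟩ := exists_isBump_near_one (H := H) Filter.univ_mem
    obtain ⟨C, hC⟩ := hdom q hq {x} isCompact_singleton
    exact mem_support_of_map_le (hC x rfl) hq1
  · rw [lintegral_smul_measure, hm₀, lintegral_sum_measure, ENNReal.smul_def, smul_eq_mul]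
    refine ENNReal.mul_lt_top ENNReal.coe_lt_top (lt_of_le_of_lt
      (ENNReal.tsum_le_tsum fun n => ?_) hgeo)
    rw [lintegral_smul_measure, ENNReal.smul_def, smul_eq_mul, ← hbc]
    exact_mod_cast hable n

end Bumps

/-! ### Projections onto the continuous vectors. -/

section ContinuousVectors

variable {H : Type*} [Group H] {E : Type*} [NormedAddCommGroup E] [NormedSpace ℝ E]
  {ρ : H →* (E →L[ℝ] E)} {𝓕 : Filter H}

variable (ρ 𝓕) in
/-- The vectors whose orbit map is continuous at the identity, along a filter. -/
def continuousVectors : Submodule ℝ E where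
  carrier := {w | Filter.Tendsto (fun γ => ρ γ w) 𝓕 (𝓝 w)}
  add_mem' {v w} hv hw := by
    simpa only [Set.mem_ofPred_eq, map_add] using Filter.Tendsto.add hv hw
  zero_mem' := by simpa using tendsto_const_nhds
  smul_mem' c v hv := by
    simpa only [Set.mem_ofPred_eq, map_smul] using Filter.Tendsto.const_smul hv c

lemma mem_continuousVectors {w : E} :
    w ∈ continuousVectors ρ 𝓕 ↔ Filter.Tendsto (fun γ => ρ γ w) 𝓕 (𝓝 w) := Iff.rfl

lemma isClosed_continuousVectors (hρ : ∀ γ v, ‖ρ γ v‖ = ‖v‖) :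
    IsClosed (continuousVectors ρ 𝓕 : Set E) := by
  refine isClosed_of_closure_subset fun w hw => ?_
  change Filter.Tendsto _ _ _
  rw [Metric.tendsto_nhds]
  intro ε hε
  obtain ⟨v, hv, hvw⟩ := Metric.mem_closure_iff.1 hw (ε / 3) (by positivity)
  filter_upwards [Metric.tendsto_nhds.1 (mem_continuousVectors.1 hv) (ε / 3) (by positivity)]
    with γ hγ
  have h1 : dist (ρ γ w) (ρ γ v) = dist w v := by
    rw [dist_eq_norm, ← map_sub, hρ, dist_eq_norm]
  have h2 := dist_triangle4 (ρ γ w) (ρ γ v) v w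
  rw [h1, dist_comm v w] at h2
  linarith

variable (ρ 𝓕) in
/-- Contractions fixing the continuous vectors and preserving the closed invariant subspaces. -/
def Adapted (T : E →L[ℝ] E) : Prop :=
  (∀ v, ‖T v‖ ≤ ‖v‖) ∧ (∀ w ∈ continuousVectors ρ 𝓕, T w = w) ∧
    ∀ V : Submodule ℝ E, IsClosed (V : Set E) → (∀ γ, ∀ w ∈ V, ρ γ w ∈ V) → ∀ w ∈ V, T w ∈ V

lemma Adapted.one : Adapted ρ 𝓕 (1 : E →L[ℝ] E) :=
  ⟨fun _ => le_rfl, fun _ _ => rfl, fun _ _ _ _ hw => hw⟩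

lemma Adapted.mul {S T : E →L[ℝ] E} (hS : Adapted ρ 𝓕 S) (hT : Adapted ρ 𝓕 T) :
    Adapted ρ 𝓕 (S * T) :=
  ⟨fun v => (hS.1 _).trans (hT.1 v), fun w hw => by
    rw [mul_apply_eq_comp, hT.2.1 w hw, hS.2.1 w hw], fun V hV hi w hw =>
    hS.2.2 V hV hi _ (hT.2.2 V hV hi w hw)⟩

variable [UniformConvexSpace E] [CompleteSpace E]

lemma exists_clm_wlim {I : Type*} (U : Ultrafilter I) {T : I → E →L[ℝ] E}
    (hT : ∀ i v, ‖T i v‖ ≤ ‖v‖) : ∃ S : E →L[ℝ] E, ∀ v, S v = wlim U fun i => T i v := by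
  let L : E →ₗ[ℝ] E :=
    { toFun := fun v => wlim U fun i => T i v
      map_add' := fun v w => by
        simp only [map_add]
        exact wlim_add U (fun i => hT i v) (fun i => hT i w)
      map_smul' := fun c v => by
        simp only [map_smul, RingHom.id_apply]
        exact wlim_clm U (fun i => hT i v) (c • ContinuousLinearMap.id ℝ E) }
  refine ⟨L.mkContinuous 1 fun v => ?_, fun v => rfl⟩
  rw [one_mul]
  exact norm_wlim_le U (fun i => hT i v) (Filter.Eventually.of_forall fun i => hT i v)

lemma Adapted.exists_wlim {I : Type*} (U : Ultrafilter I) {T : I → E →L[ℝ] E}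
    (hT : ∀ i v, ‖T i v‖ ≤ ‖v‖)
    (h1 : ∀ w ∈ continuousVectors ρ 𝓕, Filter.Tendsto (fun i => T i w) U (𝓝 w))
    (h2 : ∀ V : Submodule ℝ E, IsClosed (V : Set E) → (∀ γ, ∀ w ∈ V, ρ γ w ∈ V) →
      ∀ i, ∀ w ∈ V, T i w ∈ V) :
    ∃ S : E →L[ℝ] E, Adapted ρ 𝓕 S ∧ ∀ v, S v = wlim U fun i => T i v := by
  obtain ⟨S, hS⟩ := exists_clm_wlim U hT
  refine ⟨S, ⟨fun v => ?_, fun w hw => ?_, fun V hV hi w hw => ?_⟩, hS⟩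
  · rw [hS]
    exact norm_wlim_le U (fun i => hT i v) (Filter.Eventually.of_forall fun i => hT i v)
  · rw [hS]
    exact wlim_eq fun l => (l.continuous.tendsto w).comp (h1 w hw)
  · rw [hS]
    exact wlim_mem U (fun i => hT i w) V.convex hV (Filter.Eventually.of_forall fun i =>
      h2 V hV hi i w hw)

/-- A weak limit of a minimizing sequence is again adapted, and the norm is lower semicontinuous
under weak limits. -/
lemma Adapted.exists_norm_minimal (w : E) :
    ∃ T, Adapted ρ 𝓕 T ∧ ∀ S, Adapted ρ 𝓕 S → ‖T w‖ ≤ ‖S w‖ := by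
  set A : Set ℝ := (fun T : E →L[ℝ] E => ‖T w‖) '' {T | Adapted ρ 𝓕 T} with hA
  have hA0 : A.Nonempty := ⟨_, 1, Adapted.one, rfl⟩
  have hAb : BddBelow A := ⟨0, by rintro _ ⟨T, -, rfl⟩; exact norm_nonneg _⟩
  have hT : ∀ n : ℕ, ∃ T, Adapted ρ 𝓕 T ∧ ‖T w‖ < sInf A + 1 / ((n : ℝ) + 1) := fun n => by
    obtain ⟨_, ⟨T, hT, rfl⟩, h⟩ := exists_lt_of_csInf_lt hA0
      (lt_add_of_pos_right (sInf A) (show (0 : ℝ) < 1 / ((n : ℝ) + 1) by positivity))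
    exact ⟨T, hT, h⟩
  choose T hTa hTn using hT
  set U : Ultrafilter ℕ := Ultrafilter.of Filter.atTop
  obtain ⟨S, hSa, hS⟩ := Adapted.exists_wlim (ρ := ρ) (𝓕 := 𝓕) U (T := T)
    (fun i => (hTa i).1) (fun v hv => by
      simp only [fun i => (hTa i).2.1 v hv]; exact tendsto_const_nhds)
    fun V hV hi i => (hTa i).2.2 V hV hi
  refine ⟨S, hSa, fun S' hS' => (?_ : ‖S w‖ ≤ sInf A).trans (csInf_le hAb ⟨S', hS', rfl⟩)⟩
  refine le_of_forall_pos_le_add fun ε hε => ?_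
  rw [hS]
  refine norm_wlim_le U (fun i => (hTa i).1 w) ?_
  have h1 : ∀ᶠ n : ℕ in Filter.atTop, 1 / ((n : ℝ) + 1) < ε :=
    tendsto_one_div_add_atTop_nhds_zero_nat.eventually (gt_mem_nhds hε)
  have h2 : ∀ᶠ n : ℕ in (U : Filter ℕ), 1 / ((n : ℝ) + 1) < ε :=
    (Ultrafilter.of_le Filter.atTop) h1
  filter_upwards [h2] with n hn
  exact ((hTn n).trans (by linarith)).le

/-- The vector `T w` of minimal norm is continuous. Otherwise elements `γ` going to the identity
along `𝓕` would move it by `ε`, and a weak limit of the midpoint operators `(1 + ρ γ) / 2`, which is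
adapted, would shorten it by uniform convexity. -/
lemma Adapted.exists_mem (hρ : ∀ γ v, ‖ρ γ v‖ = ‖v‖) (w : E) :
    ∃ T, Adapted ρ 𝓕 T ∧ T w ∈ continuousVectors ρ 𝓕 := by
  obtain ⟨T, hT, hmin⟩ := Adapted.exists_norm_minimal (ρ := ρ) (𝓕 := 𝓕) w
  refine ⟨T, hT, ?_⟩
  by_contra hn
  rw [mem_continuousVectors, Metric.tendsto_nhds] at hn
  push Not at hn
  obtain ⟨ε, hε, hfr⟩ := hn
  have hne : (𝓕 ⊓ Filter.principal {γ | ε ≤ dist (ρ γ (T w)) (T w)}).NeBot :=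
    Filter.frequently_mem_iff_neBot.1 hfr
  set U : Ultrafilter H := Ultrafilter.of (𝓕 ⊓ Filter.principal {γ | ε ≤ dist (ρ γ (T w)) (T w)})
  have hU := Ultrafilter.of_le (𝓕 ⊓ Filter.principal {γ | ε ≤ dist (ρ γ (T w)) (T w)})
  obtain ⟨δ, hδ, huc⟩ := exists_forall_closed_ball_dist_add_le_two_mul_sub E hε ‖T w‖
  have hle : ∀ γ v, ‖((1 / 2 : ℝ) • (1 + ρ γ)) v‖ ≤ ‖v‖ := fun γ v => by
    have h := norm_add_le v (ρ γ v)
    rw [hρ] at h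
    rw [smul_apply, norm_smul, add_apply,
      one_apply_eq_self, Real.norm_of_nonneg (by norm_num)]
    linarith
  obtain ⟨S, hSa, hS⟩ := Adapted.exists_wlim (ρ := ρ) (𝓕 := 𝓕) U
    (T := fun γ => (1 / 2 : ℝ) • (1 + ρ γ)) hle (fun v hv => by
      have h1 : Filter.Tendsto (fun γ => (1 / 2 : ℝ) • (v + ρ γ v)) U (𝓝 ((1 / 2 : ℝ) • (v + v))) :=
        (((mem_continuousVectors.1 hv).mono_left (hU.trans inf_le_left)).const_add v).const_smul _
      rw [← two_smul ℝ v, smul_smul] at h1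
      norm_num at h1
      simpa using h1)
    fun V hV hi γ v hv => V.smul_mem _ (V.add_mem hv (hi γ v hv))
  have h1 := hmin _ (hSa.mul hT)
  have h2 : ‖S (T w)‖ ≤ ‖T w‖ - δ / 2 := by
    rw [hS]
    refine norm_wlim_le U (fun γ => hle γ (T w)) ?_
    filter_upwards [hU (Filter.mem_inf_of_right (Filter.mem_principal_self _))] with γ hγ
    have h3 := huc (x := T w) le_rfl (y := ρ γ (T w)) (hρ _ _).le
      (by rw [← dist_eq_norm, dist_comm]; exact hγ)
    rw [smul_apply, norm_smul, add_apply,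
      one_apply_eq_self, Real.norm_of_nonneg (by norm_num)]
    linarith
  rw [mul_apply_eq_comp] at h1
  linarith

/-- The continuous vectors of an isometric representation on a uniformly convex space are the
image of a projection which preserves all closed invariant subspaces. -/
lemma exists_projection_continuousVectors (hρ : ∀ γ v, ‖ρ γ v‖ = ‖v‖) :
    ∃ T, Adapted ρ 𝓕 T ∧ ∀ w, T w ∈ continuousVectors ρ 𝓕 := by
  classical
  -- Finitely many vectors are treated by composition: the next operator fixes the continuous
  -- vectors already reached. The projection is then a weak limit over the directed set of finite
  -- subsets, the continuous vectors being closed and convex.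
  have hfin : ∀ s : Finset E, ∃ T, Adapted ρ 𝓕 T ∧ ∀ w ∈ s, T w ∈ continuousVectors ρ 𝓕 :=
    fun s => by
    induction s using Finset.induction_on with
    | empty => exact ⟨1, Adapted.one, by simp⟩
    | insert a s _ ih =>
      obtain ⟨T, hT, hs⟩ := ih
      obtain ⟨S, hS, ha⟩ := Adapted.exists_mem (ρ := ρ) (𝓕 := 𝓕) hρ (T a)
      refine ⟨S * T, hS.mul hT, fun w hw => ?_⟩
      rcases Finset.mem_insert.1 hw with rfl | hw
      · exact ha
      · rw [mul_apply_eq_comp, hS.2.1 _ (hs w hw)]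
        exact hs w hw
  choose T hT hTs using hfin
  obtain ⟨S, hSa, hS⟩ := Adapted.exists_wlim (ρ := ρ) (𝓕 := 𝓕)
    (Ultrafilter.of (Filter.atTop : Filter (Finset E))) (T := T)
    (fun i => (hT i).1) (fun v hv => by
      simp only [fun i => (hT i).2.1 v hv]; exact tendsto_const_nhds)
    fun V hV hi i => (hT i).2.2 V hV hi
  refine ⟨S, hSa, fun w => ?_⟩
  rw [hS]
  refine wlim_mem _ (fun i => (hT i).1 w) (continuousVectors ρ 𝓕).convex
    (isClosed_continuousVectors hρ) ?_
  filter_upwards [Ultrafilter.of_le (Filter.atTop : Filter (Finset E))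
    (Filter.eventually_ge_atTop {w})] with s hs
  exact hTs s w (by simpa using hs)

end ContinuousVectors

/-! ### Sums of ranges of compatible projections. -/

section SumProjection

variable {E : Type*} [NormedAddCommGroup E] [NormedSpace ℝ E] {ι : Type*} [Fintype ι]

/-- A finite sum of ranges of projections which preserve each other's ranges is complemented and
closed. -/
lemma exists_projection_iSup {V : ι → Submodule ℝ E} {Q : ι → E →L[ℝ] E}
    (h1 : ∀ i w, Q i w ∈ V i) (h2 : ∀ i, ∀ w ∈ V i, Q i w = w)
    (h3 : ∀ i j, ∀ w ∈ V j, Q i w ∈ V j) :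
    ∃ R : E →L[ℝ] E, (∀ w, R w ∈ ⨆ i, V i) ∧ ∀ w ∈ ⨆ i, V i, R w = w := by
  classical
  -- `P` is the product of the operators `1 - Q i`. Each factor preserves every `V j` and the factor
  -- `1 - Q j` kills it, so `P` vanishes on the sum and `1 - P` is the projection sought. The sum
  -- need not be direct.
  have key : ∀ l : List ι, ∃ P : E →L[ℝ] E, (∀ w, w - P w ∈ ⨆ i, V i) ∧
      (∀ j, ∀ w ∈ V j, P w ∈ V j) ∧ ∀ j ∈ l, ∀ w ∈ V j, P w = 0 := fun l => by
    induction l with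
    | nil => exact ⟨1, by simp, fun j w hw => hw, by simp⟩
    | cons i l ih =>
      obtain ⟨P, hP1, hP2, hP3⟩ := ih
      refine ⟨(1 - Q i) * P, fun w => ?_, fun j w hw => ?_, fun j hj w hw => ?_⟩
      · have : w - ((1 - Q i) * P) w = (w - P w) + Q i (P w) := by
          simp; abel
        rw [this]
        exact Submodule.add_mem _ (hP1 w) (Submodule.mem_iSup_of_mem i (h1 i _))
      · have : ((1 - Q i) * P) w = P w - Q i (P w) := by simp
        rw [this]
        exact Submodule.sub_mem _ (hP2 j w hw) (h3 i j _ (hP2 j w hw))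
      · have : ((1 - Q i) * P) w = P w - Q i (P w) := by simp
        rw [this]
        rcases List.mem_cons.1 hj with rfl | hj
        · rw [h2 _ _ (hP2 _ w hw), sub_self]
        · rw [hP3 j hj w hw, map_zero, sub_zero]
  obtain ⟨P, hP1, -, hP3⟩ := key Finset.univ.toList
  have hP0 : ∀ w ∈ ⨆ i, V i, P w = 0 := fun w hw => by
    refine Submodule.iSup_induction V (motive := fun w => P w = 0) hw
      (fun i w hw => hP3 i (by simp) w hw) (map_zero P) fun a b ha hb => ?_
    rw [map_add, ha, hb, add_zero]
  refine ⟨1 - P, fun w => hP1 w, fun w hw => ?_⟩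
  simp [hP0 w hw]

end SumProjection

/-! ### Extension of an isometric representation from a dense image. -/

section FactorExtension

variable {Λ : Type*} [Group Λ] {H : Type*} [Group H] [TopologicalSpace H] [IsTopologicalGroup H]
  {E : Type*} [NormedAddCommGroup E] [NormedSpace ℝ E] [CompleteSpace E]
  {ρ : Λ →* (E →L[ℝ] E)} {pr : Λ →* H}

lemma dist_map_apply (hρ : ∀ γ v, ‖ρ γ v‖ = ‖v‖) (γ : Λ) (v w : E) :
    dist (ρ γ v) (ρ γ w) = dist v w := by
  rw [dist_eq_norm, ← map_sub, hρ, dist_eq_norm]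

lemma dist_map_apply_map_apply (hρ : ∀ γ v, ‖ρ γ v‖ = ‖v‖) (γ δ : Λ) (v : E) :
    dist (ρ γ v) (ρ δ v) = dist (ρ (δ⁻¹ * γ) v) v := by
  have : ρ γ v = ρ δ (ρ (δ⁻¹ * γ) v) := by
    rw [← mul_apply_eq_comp, ← map_mul, mul_inv_cancel_left]
  rw [this, dist_map_apply hρ]

/-- Since `ρ` is isometric, the distance between `ρ γ w` and `ρ δ w` depends only on `δ⁻¹ γ`.
Continuity at the identity therefore makes the orbit map Cauchy near every point of `H`, and `E` is
complete. -/
lemma exists_continuous_extension (hρ : ∀ γ v, ‖ρ γ v‖ = ‖v‖) (hpr : DenseRange pr) {w : E}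
    (hw : w ∈ continuousVectors ρ (Filter.comap pr (𝓝 1))) :
    ∃ φ : H → E, Continuous φ ∧ ∀ γ, φ (pr γ) = ρ γ w := by
  let _ : TopologicalSpace Λ := TopologicalSpace.induced pr inferInstance
  have hd : IsDenseInducing pr := ⟨⟨rfl⟩, hpr⟩
  have hw' : ∀ ε : ℝ, 0 < ε → ∃ W ∈ 𝓝 (1 : H), ∀ γ, pr γ ∈ W → dist (ρ γ w) w < ε :=
    fun ε hε => by
    obtain ⟨W, hW, h⟩ := Filter.mem_comap.1
      (Metric.tendsto_nhds.1 (mem_continuousVectors.1 hw) ε hε)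
    exact ⟨W, hW, fun γ hγ => h hγ⟩
  have hN : ∀ ε : ℝ, 0 < ε → ∀ x : H, ∃ N ∈ 𝓝 x, ∀ γ δ, pr γ ∈ N → pr δ ∈ N →
      dist (ρ γ w) (ρ δ w) < ε := fun ε hε x => by
    obtain ⟨W, hW, h⟩ := hw' ε hε
    have hc : Filter.Tendsto (fun p : H × H => p.2⁻¹ * p.1) (𝓝 (x, x)) (𝓝 1) := by
      have : Continuous fun p : H × H => p.2⁻¹ * p.1 := by fun_prop
      simpa using this.tendsto (x, x)
    have h1 := hc hW
    rw [Filter.mem_map, nhds_prod_eq, Filter.mem_prod_same_iff] at h1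
    obtain ⟨N, hN, h2⟩ := h1
    refine ⟨N, hN, fun γ δ hγ hδ => ?_⟩
    rw [dist_map_apply_map_apply hρ]
    refine h _ ?_
    simpa using h2 (Set.mk_mem_prod hγ hδ)
  have hcont : Continuous fun γ => ρ γ w := by
    refine continuous_iff_continuousAt.2 fun γ => Metric.tendsto_nhds.2 fun ε hε => ?_
    obtain ⟨N, hN', h⟩ := hN ε hε (pr γ)
    rw [hd.nhds_eq_comap]
    filter_upwards [Filter.preimage_mem_comap hN'] with δ hδ
    exact h δ γ hδ (mem_of_mem_nhds hN')
  refine ⟨hd.extend fun γ => ρ γ w, hd.continuous_extend fun x => ?_, fun γ => hd.extend_eq hcont γ⟩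
  have : (Filter.comap pr (𝓝 x)).NeBot := hd.comap_nhds_neBot x
  refine cauchy_map_iff_exists_tendsto.1 (Metric.cauchy_iff.2 ⟨inferInstance, fun ε hε => ?_⟩)
  obtain ⟨N, hN', h⟩ := hN ε hε x
  refine ⟨_, Filter.image_mem_map (Filter.preimage_mem_comap hN'), ?_⟩
  rintro _ ⟨γ, hγ, rfl⟩ _ ⟨δ, hδ, rfl⟩
  exact h γ δ hγ hδ

/-- The representation on the vectors which are continuous with respect to a homomorphism of dense
image extends continuously. -/
lemma exists_extension_continuousVectors (hρ : ∀ γ v, ‖ρ γ v‖ = ‖v‖) (hpr : DenseRange pr) :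
    ∃ R : H →* (continuousVectors ρ (Filter.comap pr (𝓝 1)) →L[ℝ]
        continuousVectors ρ (Filter.comap pr (𝓝 1))),
      (∀ x w, ‖R x w‖ = ‖w‖) ∧ (∀ w, Continuous fun x => R x w) ∧
        ∀ γ w, (R (pr γ) w : E) = ρ γ w := by
  set V := continuousVectors ρ (Filter.comap pr (𝓝 1)) with hV
  have hVc : IsClosed (V : Set E) := isClosed_continuousVectors hρ
  choose φ hφc hφ using fun w : V => exists_continuous_extension hρ hpr w.2
  -- Conjugation by `pr γ` is continuous at the identity, so `ρ γ` preserves the continuous vectors.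
  have hVi : ∀ γ, ∀ w ∈ V, ρ γ w ∈ V := fun γ w hw => by
    rw [hV, mem_continuousVectors] at hw ⊢
    have h1 : Filter.Tendsto (fun δ => γ⁻¹ * δ * γ) (Filter.comap pr (𝓝 1))
        (Filter.comap pr (𝓝 1)) := by
      rw [Filter.tendsto_comap_iff]
      have h2 : Continuous fun x : H => (pr γ)⁻¹ * x * pr γ := by fun_prop
      have h3 : Filter.Tendsto (fun x : H => (pr γ)⁻¹ * x * pr γ) (𝓝 1) (𝓝 1) := by
        simpa using h2.tendsto 1
      have h4 := h3.comp (Filter.tendsto_comap (f := pr) (x := 𝓝 1))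
      refine h4.congr fun δ => ?_
      simp
    have h2 := ((ρ γ).continuous.tendsto w).comp (hw.comp h1)
    refine h2.congr fun δ => ?_
    simp only [Function.comp_apply]
    rw [← mul_apply_eq_comp, ← map_mul, ← mul_apply_eq_comp, ← map_mul]
    congr 2
    group
  have hmem : ∀ x w, φ w x ∈ V := fun x w => by
    have hc : IsClosed {x | φ w x ∈ V} := hVc.preimage (hφc w)
    have : ∀ x, x ∈ {x | φ w x ∈ V} := fun x => hpr.induction_on x hc fun γ => by
      change φ w (pr γ) ∈ V
      rw [hφ]; exact hVi γ w w.2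
    exact this x
  have hnorm : ∀ x w, ‖φ w x‖ = ‖w‖ := fun x w =>
    hpr.induction_on x (isClosed_eq (hφc w).norm continuous_const) fun γ => by
      rw [hφ, hρ, Submodule.norm_coe]
  have hadd : ∀ x v w, φ (v + w) x = φ v x + φ w x := fun x v w =>
    hpr.induction_on x (isClosed_eq (hφc _) ((hφc _).add (hφc _))) fun γ => by
      simp [hφ]
  have hsmul : ∀ x (c : ℝ) w, φ (c • w) x = c • φ w x := fun x c w =>
    hpr.induction_on x (isClosed_eq (hφc _) ((hφc _).const_smul c)) fun γ => by
      simp [hφ]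
  have hone : ∀ w, φ w 1 = w := fun w => by
    rw [← map_one pr, hφ, map_one, one_apply_eq_self]
  have hmul1 : ∀ γ y w, φ w (pr γ * y) = ρ γ (φ w y) := fun γ y w =>
    hpr.induction_on y (isClosed_eq ((hφc w).comp (continuous_const_mul _))
      ((ρ γ).continuous.comp (hφc w))) fun δ => by
      rw [← map_mul, hφ, hφ, map_mul, mul_apply_eq_comp]
  have hmul : ∀ x y w, φ w (x * y) = φ ⟨φ w y, hmem y w⟩ x := fun x y w =>
    hpr.induction_on x (isClosed_eq ((hφc w).comp (continuous_mul_const y)) (hφc _)) fun γ => by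
      rw [hmul1, hφ]
  let R : H → V →L[ℝ] V := fun x => LinearMap.mkContinuous
    { toFun := fun w => ⟨φ w x, hmem x w⟩
      map_add' := fun v w => Subtype.ext (hadd x v w)
      map_smul' := fun c w => Subtype.ext (hsmul x c w) } 1
    fun w => by rw [one_mul]; exact (hnorm x w).le
  have hR : ∀ x w, (R x w : E) = φ w x := fun x w => rfl
  refine ⟨⟨⟨R, ?_⟩, fun x y => ?_⟩, fun x w => hnorm x w,
    fun w => (hφc w).subtype_mk _, fun γ w => hφ w γ⟩
  · ext w; rw [hR, hone]; rfl
  · ext w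
    change (R (x * y) w : E) = R x (R y w)
    rw [hR, hR, hmul]
    rfl

end FactorExtension

/-! ### Uniformly convex subspaces and linear parts. -/

section Subspaces

/-- Subspaces of uniformly convex spaces are uniformly convex. -/
lemma uniformConvexSpace_submodule {E : Type*} [NormedAddCommGroup E] [NormedSpace ℝ E]
    [UniformConvexSpace E] (V : Submodule ℝ E) : UniformConvexSpace V where
  uniform_convex ε hε := by
    obtain ⟨δ, hδ, h⟩ := UniformConvexSpace.uniform_convex (E := E) hε
    exact ⟨δ, hδ, fun x hx y hy hxy => h hx hy hxy⟩

lemma isSuperreflexive_submodule {E : Type*} [NormedAddCommGroup E] [NormedSpace ℝ E]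
    [UniformConvexSpace E] [CompleteSpace E] (V : Submodule ℝ E) (hV : IsClosed (V : Set E)) :
    IsSuperreflexive V :=
  ⟨V, inferInstance, inferInstance, hV.completeSpace_coe, uniformConvexSpace_submodule V,
    ⟨ContinuousLinearEquiv.refl ℝ V⟩⟩

lemma exists_linear_part {Λ E : Type*} [Group Λ] [NormedAddCommGroup E] [NormedSpace ℝ E]
    (α : Λ →* (E ≃ᵃ[ℝ] E)) (h : ∀ γ v, ‖(α γ).linear v‖ = ‖v‖) :
    ∃ ρ : Λ →* (E →L[ℝ] E), ∀ γ v, ρ γ v = (α γ).linear v := by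
  refine ⟨⟨⟨fun γ => ((α γ).linear : E →ₗ[ℝ] E).mkContinuous 1 fun v => ?_, ?_⟩, ?_⟩,
    fun γ v => rfl⟩
  · rw [one_mul]; exact (h γ v).le
  · ext v
    change (α 1).linear v = v
    rw [map_one]; rfl
  · intro γ δ; ext v
    change (α (γ * δ)).linear v = (α γ).linear ((α δ).linear v)
    rw [map_mul]; rfl

end Subspaces

/-! ### From an equivariant function with split increments to actions of the factors. -/

section FactorActions

variable {ι : Type*} [Fintype ι] [DecidableEq ι] {G : ι → Type*} [∀ i, Group (G i)]
  [∀ i, TopologicalSpace (G i)] [∀ i, IsTopologicalGroup (G i)]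
  {Γ : Subgroup (∀ i, G i)} {E : Type*} [NormedAddCommGroup E] [NormedSpace ℝ E]
  [UniformConvexSpace E] [CompleteSpace E]

/-- A continuous equivariant function whose increments along each factor are invariant under the
other factors yields a splitting of the action. -/
theorem splitting_of_equivariant (hirr : IsIrreducibleSubgroup Γ) (α : Γ →* (E ≃ᵃ[ℝ] E))
    (hα : ∀ γ v, ‖(α γ).linear v‖ = ‖v‖) {f : (∀ i, G i) → E} (hf : Continuous f)
    (hfe : ∀ (g : ∀ i, G i) (γ : Γ), f (g * (γ : ∀ i, G i)⁻¹) = α γ (f g))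
    (hfi : ∀ i (h : G i) (k g : ∀ i, G i), k i = 1 →
      f (Pi.mulSingle i h * (k * g)) - f (k * g) = f (Pi.mulSingle i h * g) - f g) :
    ∃ S : AffineSubspace ℝ E, (S : Set E).Nonempty ∧ IsClosed (S : Set E) ∧
      S.direction.ClosedComplemented ∧ (∀ γ : Γ, ∀ x ∈ S, α γ x ∈ S) ∧
      IsSumOfFactorActions Γ α S := by
  obtain ⟨ρ, hρα⟩ := exists_linear_part α hα
  have hρ : ∀ γ v, ‖ρ γ v‖ = ‖v‖ := fun γ v => by rw [hρα, hα]
  let pr : ∀ i, Γ →* G i := fun i => (Pi.evalMonoidHom G i).comp Γ.subtype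
  have hpr : ∀ i, DenseRange (pr i) := fun i => by
    have := hirr i
    rw [Set.image_eq_range] at this
    exact this
  let V : ι → Submodule ℝ E := fun i => continuousVectors ρ (Filter.comap (pr i) (𝓝 1))
  have hVc : ∀ i, IsClosed (V i : Set E) := fun i => isClosed_continuousVectors hρ
  choose R hRn hRc hRρ using fun i => exists_extension_continuousVectors hρ (hpr i)
  have hVinv : ∀ i γ, ∀ w ∈ V i, ρ γ w ∈ V i := fun i γ w hw => by
    rw [← hRρ i γ ⟨w, hw⟩]; exact (R i (pr i γ) ⟨w, hw⟩).2
  choose Q hQ hQV using fun i => exists_projection_continuousVectors (ρ := ρ)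
    (𝓕 := Filter.comap (pr i) (𝓝 1)) hρ
  obtain ⟨P, hP1, hP2⟩ := exists_projection_iSup (V := V) (Q := Q) hQV (fun i => (hQ i).2.1)
    fun i j => (hQ i).2.2 (V j) (hVc j) (hVinv j)
  set v : E := f 1 with hv
  set c : ∀ i, G i → E := fun i x => f (Pi.mulSingle i x) - v with hc
  have hcc : ∀ i, Continuous (c i) := fun i =>
    (hf.comp (continuous_mulSingle i)).sub continuous_const
  have hstep : ∀ i x (k : ∀ i, G i), k i = 1 → f (Pi.mulSingle i x * k) = f k + c i x :=
    fun i x k hk => by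
    have h1 := hfi i x k 1 hk
    rw [mul_one, mul_one] at h1
    rw [← sub_eq_iff_eq_add', h1]
  -- Apply `α γ` to `f (Pi.mulSingle i x)` and to `f 1` and subtract. Splitting off the coordinate
  -- `i` of `γ⁻¹` leaves an element `k` trivial in that coordinate, whose contribution `f k`
  -- cancels. The right side involves `γ` only through its projection to `G i`.
  have hcoc : ∀ i (x : G i) (γ : Γ), ρ γ (c i x) = c i (x * (pr i γ)⁻¹) - c i (pr i γ)⁻¹ :=
    fun i x γ => by
    have h1 : ρ γ (c i x) = f (Pi.mulSingle i x * (γ : ∀ i, G i)⁻¹) - f ((γ : ∀ i, G i)⁻¹) := by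
      have h2 := hfe 1 γ
      rw [one_mul] at h2
      rw [hfe, h2, hρα, AffineEquiv.sub_eq_linear]
    set k : ∀ i, G i := Function.update (γ : ∀ i, G i)⁻¹ i 1 with hk
    have hk1 : k i = 1 := by simp [hk]
    have hγk : (γ : ∀ i, G i)⁻¹ = Pi.mulSingle i (pr i γ)⁻¹ * k := by
      ext j
      rcases eq_or_ne j i with rfl | hj
      · simp [hk, pr]
      · simp [hk, hj]
    rw [h1, hγk, ← mul_assoc, ← Pi.mulSingle_mul, hstep _ _ _ hk1, hstep _ _ _ hk1]
    abel
  -- As `pr i γ` tends to the identity, the right side of `hcoc` tends to `c i x` because `c i` is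
  -- continuous; this is the continuity of the orbit map of `c i x`.
  have hcV : ∀ i x, c i x ∈ V i := fun i x => by
    have hcont : Continuous fun y => c i (x * y⁻¹) - c i y⁻¹ :=
      ((hcc i).comp (by fun_prop)).sub ((hcc i).comp (by fun_prop))
    have hlim : Filter.Tendsto (fun y => c i (x * y⁻¹) - c i y⁻¹) (𝓝 1) (𝓝 (c i x)) := by
      have := hcont.tendsto 1
      simpa [hc, hv] using this
    refine (hlim.comp Filter.tendsto_comap).congr fun γ => ?_
    rw [hcoc]; rfl
  have hRcoc : ∀ i (x y : G i), (R i y ⟨c i x, hcV i x⟩ : E) = c i (x * y⁻¹) - c i y⁻¹ :=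
    fun i x y => (hpr i).induction_on y (isClosed_eq (continuous_subtype_val.comp (hRc i _))
      (((hcc i).comp (by fun_prop)).sub ((hcc i).comp (by fun_prop)))) fun γ => by
      rw [hRρ, hcoc]
  -- The inverse accounts for the right equivariance of `f` with respect to `γ⁻¹` and turns `c i`
  -- into a genuine cocycle for `R i`.
  let C : ∀ i, G i → V i := fun i x => ⟨c i x⁻¹, hcV i x⁻¹⟩
  have hC1 : ∀ i, C i 1 = 0 := fun i => by
    apply Subtype.ext; simp [C, hc, hv]
  have hCmul : ∀ i x y, C i (x * y) = R i x (C i y) + C i x := fun i x y => by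
    apply Subtype.ext
    rw [Submodule.coe_add, hRcoc]
    simp [C]
  let b : ∀ i, G i → V i →ᵃ[ℝ] V i := fun i x =>
    (R i x : V i →ₗ[ℝ] V i).toAffineMap + AffineMap.const ℝ (V i) (C i x)
  have hb : ∀ i x w, b i x w = R i x w + C i x := fun i x w => rfl
  have hb1 : ∀ i, b i 1 = AffineMap.id ℝ (V i) := fun i => by
    ext w; simp [hb, hC1]
  have hbmul : ∀ i x y, b i (x * y) = (b i x).comp (b i y) := fun i x y => by
    ext w
    simp only [hb, AffineMap.comp_apply, map_add, hCmul, map_mul, mul_apply_eq_comp]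
    rw [add_assoc]
  let bh : ∀ i, G i →* (V i →ᵃ[ℝ] V i) := fun i =>
    { toFun := b i
      map_one' := hb1 i
      map_mul' := hbmul i }
  let β : ∀ i, G i →* (V i ≃ᵃ[ℝ] V i) := fun i =>
    (AffineEquiv.equivUnitsAffineMap (k := ℝ) (P₁ := V i)).symm.toMonoidHom.comp
      (bh i).toHomUnits
  have hβ : ∀ i x w, β i x w = R i x w + C i x := fun i x w => rfl
  -- `α γ v` is `f γ⁻¹`, and `f` is reached from `f 1` by changing one coordinate at a time, each
  -- change contributing its `c i`.
  have hαf : ∀ γ : Γ, α γ v = v + ∑ i, c i (pr i γ)⁻¹ := fun γ => by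
    have h1 : α γ v = f ((γ : ∀ i, G i)⁻¹) := by rw [← hfe, one_mul]
    have h2 : ∀ (s : Finset ι) (k : ∀ i, G i), (∀ i ∉ s, k i = 1) →
        f k = v + ∑ i ∈ s, c i (k i) := fun s => by
      induction s using Finset.induction_on with
      | empty =>
        intro k hk
        have : k = 1 := funext fun i => hk i (by simp)
        simp [this, hv]
      | insert a s ha ih =>
        intro k hk
        set k' : ∀ i, G i := Function.update k a 1 with hk'
        have hkk : k = Pi.mulSingle a (k a) * k' := by
          ext j
          rcases eq_or_ne j a with rfl | hj
          · simp [hk']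
          · simp [hk', hj]
        have h3 := ih k' fun i hi => by
          rcases eq_or_ne i a with rfl | hia
          · simp [hk']
          · simpa [hk', hia] using hk i (by simp [hia, hi])
        rw [Finset.sum_insert ha]
        conv_lhs => rw [hkk, hstep a _ k' (by simp [hk']), h3]
        rw [Finset.sum_congr rfl fun i hi => show c i (k' i) = c i (k i) by
          have : i ≠ a := fun h => ha (h ▸ hi)
          simp [hk', this]]
        abel
    rw [h1, h2 Finset.univ _ (by simp)]
    rfl
  have hαadd : ∀ γ w, α γ (v + w) = α γ v + ρ γ w := fun γ w => by
    have := AffineEquiv.sub_eq_linear (α γ) (v + w) v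
    rw [add_sub_cancel_left, sub_eq_iff_eq_add'] at this
    rw [this, hρα]
  set S : AffineSubspace ℝ E := AffineSubspace.mk' v (⨆ i, V i) with hS
  have hSmem : ∀ x, x ∈ S ↔ x - v ∈ ⨆ i, V i := fun x => by
    rw [hS, AffineSubspace.mem_mk', vsub_eq_sub]
  have hinv : ∀ γ, ∀ w ∈ ⨆ i, V i, ρ γ w ∈ ⨆ i, V i := fun γ w hw => by
    refine Submodule.iSup_induction V (motive := fun w => ρ γ w ∈ ⨆ i, V i) hw
      (fun i w hw => Submodule.mem_iSup_of_mem i (hVinv i γ w hw)) (by simp) fun a b ha hb => ?_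
    rw [map_add]; exact Submodule.add_mem _ ha hb
  have hclosed : IsClosed ((⨆ i, V i : Submodule ℝ E) : Set E) := by
    have : ((⨆ i, V i : Submodule ℝ E) : Set E) = {w | P w = w} := by
      ext w
      exact ⟨fun hw => hP2 w hw, fun hw => by
        have : P w = w := hw
        rw [← this]; exact hP1 w⟩
    rw [this]
    exact isClosed_eq P.continuous continuous_id
  refine ⟨S, ⟨v, (hSmem v).2 (by simp)⟩, ?_, ?_, fun γ x hx => ?_, v, (hSmem v).2 (by simp), V, hVc,
    fun i => isSuperreflexive_submodule (V i) (hVc i), ?_, β, fun i U hU => ?_, fun i => ?_,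
    fun γ x => ?_⟩
  · have : (S : Set E) = (fun x => x - v) ⁻¹' ((⨆ i, V i : Submodule ℝ E) : Set E) := by
      ext x; exact hSmem x
    rw [this]
    exact hclosed.preimage (by fun_prop)
  · rw [hS, AffineSubspace.direction_mk']
    exact ⟨P.codRestrict _ hP1, fun w => Subtype.ext (hP2 w w.2)⟩
  · rw [hSmem] at hx ⊢
    have h1 := hαadd γ (x - v)
    rw [add_sub_cancel] at h1
    rw [h1, hαf, add_assoc, add_sub_cancel_left]
    refine Submodule.add_mem _ (Submodule.sum_mem _ fun i _ =>
      Submodule.mem_iSup_of_mem i (hcV i _)) (hinv γ _ hx)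
  · rw [hS, AffineSubspace.direction_mk']
  · obtain ⟨ε, hε, hεU⟩ := Metric.mem_nhds_iff.1 hU
    refine ⟨Metric.ball 0 ε, Metric.ball_mem_nhds _ hε, fun x y hxy g => hεU ?_⟩
    rw [hβ, hβ, add_sub_add_right_eq_sub, ← map_sub, mem_ball_zero_iff, hRn]
    exact mem_ball_zero_iff.1 hxy
  · have h1 : Continuous fun q : G i × V i => R i q.1 q.2 := by
      rw [continuous_iff_continuousAt]
      rintro ⟨x₀, w₀⟩
      rw [ContinuousAt, tendsto_iff_norm_sub_tendsto_zero]
      have h2 : Filter.Tendsto (fun q : G i × V i => ‖q.2 - w₀‖ + ‖R i q.1 w₀ - R i x₀ w₀‖)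
          (𝓝 (x₀, w₀)) (𝓝 0) := by
        have : Continuous fun q : G i × V i => ‖q.2 - w₀‖ + ‖R i q.1 w₀ - R i x₀ w₀‖ :=
          (continuous_snd.sub continuous_const).norm.add
            (((hRc i w₀).comp continuous_fst).sub continuous_const).norm
        simpa using this.tendsto (x₀, w₀)
      refine squeeze_zero (fun q => norm_nonneg _) (fun q => ?_) h2
      rw [← hRn i q.1 (q.2 - w₀), map_sub]
      exact norm_sub_le_norm_sub_add_norm_sub _ _ _
    have h2 : Continuous fun q : G i × V i => C i q.1 :=
      ((hcc i).comp (by fun_prop : Continuous fun q : G i × V i => q.1⁻¹)).subtype_mk _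
    exact h1.add h2
  · rw [hαadd, hαf, map_sum, add_assoc, ← Finset.sum_add_distrib]
    congr 1
    refine Finset.sum_congr rfl fun i _ => ?_
    rw [hβ, Submodule.coe_add, add_comm]
    congr 1
    exact (hRρ i γ (x i)).symm

end FactorActions

/-! ### Nearly constant equivariant functions produce almost invariant vectors. -/

section AlmostInvariance

variable {ι : Type*} [Fintype ι] [DecidableEq ι] {G : ι → Type*} [∀ i, Group (G i)]
  [∀ i, TopologicalSpace (G i)] [∀ i, IsTopologicalGroup (G i)] [∀ i, T2Space (G i)]
  [∀ i, LocallyCompactSpace (G i)] [∀ i, SigmaCompactSpace (G i)]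
  [∀ i, MeasurableSpace (G i)] [∀ i, BorelSpace (G i)]
  {E : Type*} [NormedAddCommGroup E] [NormedSpace ℝ E] [UniformConvexSpace E] [CompleteSpace E]
  {Γ : Subgroup (∀ i, G i)} {m q : ∀ i, Measure (G i)}
  [∀ i, IsProbabilityMeasure (m i)] [∀ i, IsProbabilityMeasure (q i)]

/-- The defects of `f` seen by `m` at `g` dominate, up to the factor `C ^ l.length`, those seen by
`q` at `k⁻¹ g`. A single functional `T` thus nearly norms the `q`-averages at all these points at
once. -/
lemma avg_near_one {C : NNReal} {f : (∀ i, G i) → E} (hfm : Admissible m f)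
    (hfq : Admissible q f) {l : List ι} (hl : l.Nodup) (hlu : ∀ i, i ∈ l) {k : ∀ i, G i}
    (hk : ∀ i, (q i).map (fun h => k i * h) ≤ C • m i) {g : ∀ i, G i} {T : E →L[ℝ] ℝ} {δ : ℝ}
    (h1 : avg m l (fun x => |‖f x‖ - 1|) g ≤ δ) (h2 : avg m l (fun x => |1 - T (f x)|) g ≤ δ) :
    ‖avg q l f (k⁻¹ * g)‖ ≤ 1 + C ^ l.length * δ ∧
      1 - C ^ l.length * δ ≤ T (avg q l f (k⁻¹ * g)) := by
  have hd : ∀ F : (∀ i, G i) → ℝ, Admissible m F → Admissible q F → (∀ g, 0 ≤ F g) →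
      avg m l F g ≤ δ → avg q l F (k⁻¹ * g) ≤ C ^ l.length * δ := fun F hm hq hF h =>
    (avg_le_of_map_le hm hq hF hl (fun i _ => hk i) (fun i hi => absurd (hlu i) hi) g).trans
      (mul_le_mul_of_nonneg_left h (by positivity))
  have hA : ∀ {n : ∀ i, Measure (G i)}, Admissible n f →
      Admissible n (fun x => |‖f x‖ - 1|) ∧ Admissible n fun x => |1 - T (f x)| := fun hn => by
    have h3 := (hn.norm.sub (Admissible.const (m := _) (1 : ℝ))).norm
    have h4 := ((Admissible.const (m := _) (1 : ℝ)).sub (hn.clm T)).norm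
    exact ⟨h3, h4⟩
  have h3 := hd _ (hA hfm).1 (hA hfq).1 (fun _ => abs_nonneg _) h1
  have h4 := hd _ (hA hfm).2 (hA hfq).2 (fun _ => abs_nonneg _) h2
  have h5 := norm_avg_le hfq l (k⁻¹ * g)
  have h6 : avg q l (fun g => ‖f g‖) (k⁻¹ * g) ≤
      avg q l (fun x => |‖f x‖ - 1| + 1) (k⁻¹ * g) :=
    avg_mono hfq.norm ((hA hfq).1.add (Admissible.const 1))
      (fun x => by linarith [le_abs_self (‖f x‖ - 1)]) l _
  rw [avg_add (hA hfq).1 (Admissible.const 1), avg_const] at h6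
  have h7 : avg q l (fun x => 1 - T (f x)) (k⁻¹ * g) ≤ avg q l (fun x => |1 - T (f x)|) (k⁻¹ * g) :=
    avg_mono ((Admissible.const 1).sub (hfq.clm T)) (hA hfq).2 (fun x => le_abs_self _) l _
  rw [avg_sub (Admissible.const 1) (hfq.clm T), avg_const, avg_clm hfq] at h7
  exact ⟨by linarith, by linarith⟩

/-- An equivariant function whose values are averaged near a unit vector yields almost invariant
vectors. -/
lemma exists_no_almost_constant {ρ : Γ →* (E →L[ℝ] E)} {F : Finset Γ} {ε : ℝ} (hε : 0 < ε)
    (hF : ∀ v, ∃ γ ∈ F, ε * ‖v‖ ≤ ‖ρ γ v - v‖) {L : Set (∀ i, G i)} {C : NNReal}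
    (hC : ∀ g ∈ L, ∀ γ ∈ F, ∀ i,
      (q i).map (fun h => (g * (γ : ∀ i, G i) * g⁻¹) i * h) ≤ C • m i)
    (hC1 : ∀ i, q i ≤ C • m i) {l : List ι} (hl : l.Nodup) (hlu : ∀ i, i ∈ l) :
    ∃ δ : ℝ, 0 < δ ∧ ∀ f : (∀ i, G i) → E, Admissible m f → Admissible q f →
      (∀ (g : ∀ i, G i) (γ : Γ), f (g * (γ : ∀ i, G i)⁻¹) = ρ γ (f g)) → ∀ g ∈ L,
      ∀ T : E →L[ℝ] ℝ, ‖T‖ ≤ 1 → avg m l (fun x => |‖f x‖ - 1|) g ≤ δ →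
        avg m l (fun x => |1 - T (f x)|) g ≤ δ → False := by
  obtain ⟨η, hη, huc⟩ := exists_norm_sub_lt_of_almost_norming (E := E) (half_pos hε)
  set D : ℝ := C ^ l.length with hD
  have hD0 : 0 ≤ D := by positivity
  -- After the loss `D` from domination, the defect must remain below `η` for uniform convexity, and
  -- below `1 / 2` so that `v` is not too short.
  refine ⟨min η (1 / 2) / (D + 1), by positivity, fun f hfm hfq hfe g hg T hT h1 h2 => ?_⟩
  have hDδ : D * (min η (1 / 2) / (D + 1)) ≤ min η (1 / 2) := by
    rw [mul_div_assoc', div_le_iff₀ (by positivity)]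
    have : 0 ≤ min η (1 / 2) := by positivity
    nlinarith
  have hDη := hDδ.trans (min_le_left _ _)
  have hDh := hDδ.trans (min_le_right _ _)
  set v := avg q l f g with hv
  have hv1 := avg_near_one hfm hfq hl hlu (k := 1) (C := C) (fun i => by simpa using hC1 i) h1 h2
  rw [inv_one, one_mul, ← hv, ← hD] at hv1
  obtain ⟨γ, hγ, hγv⟩ := hF v
  have hw1 := avg_near_one hfm hfq hl hlu (k := g * (γ : ∀ i, G i) * g⁻¹) (C := C)
    (hC g hg γ hγ) h1 h2
  -- The shifted base point is `g γ⁻¹`, so equivariance identifies the second average with `ρ γ v`.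
  have hw : avg q l f ((g * (γ : ∀ i, G i) * g⁻¹)⁻¹ * g) = ρ γ v := by
    have : (g * (γ : ∀ i, G i) * g⁻¹)⁻¹ * g = g * (γ : ∀ i, G i)⁻¹ := by group
    rw [this, ← avg_comp_mul_right, hv, ← avg_clm hfq]
    simp only [hfe]
  rw [hw, ← hD] at hw1
  -- Both vectors are nearly normed by `T`, so they are less than `ε / 2` apart. As `‖v‖ ≥ 1 / 2`,
  -- this contradicts the choice of `γ`.
  have h3 := huc (ρ γ v) v T hT (hw1.1.trans (by linarith)) (hv1.1.trans (by linarith))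
    (by linarith [hw1.2]) (by linarith [hv1.2])
  have h4 : T v ≤ ‖v‖ := (le_abs_self _).trans (by simpa using T.le_of_opNorm_le hT v)
  have h5 : 1 / 2 ≤ ‖v‖ := by linarith [hv1.2]
  nlinarith

end AlmostInvariance

/-! ### Periodization, and equivariant functions for cocompact lattices. -/

section Periodization

variable {H : Type*} [Group H] [TopologicalSpace H] [IsTopologicalGroup H] [T2Space H]
  [LocallyCompactSpace H] (Γ : Subgroup H) {V : Type*} [NormedAddCommGroup V] [NormedSpace ℝ V]

/-- A twisted periodization of a function with respect to a subgroup. -/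
noncomputable def periodize (ψ : H → ℝ) (b : Γ → V) (g : H) : V := ∑ᶠ γ : Γ, ψ (g * γ) • b γ

lemma finite_mem_of_isCompact [DiscreteTopology Γ] {K : Set H} (hK : IsCompact K) :
    {γ : Γ | (γ : H) ∈ K}.Finite := by
  have hc : IsClosedEmbedding ((↑) : Γ → H) :=
    (Subgroup.isClosed_of_discrete (H := Γ)).isClosedEmbedding_subtypeVal
  exact (hc.isCompact_preimage hK).finite_of_discrete

variable {Γ} {ψ : H → ℝ}

lemma locallyFinite_support_translates [DiscreteTopology Γ] (hs : HasCompactSupport ψ) :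
    LocallyFinite fun γ : Γ => Function.support fun g => ψ (g * γ) := by
  intro g
  obtain ⟨K, hK, hKg⟩ := exists_compact_mem_nhds g
  refine ⟨K, hKg, (finite_mem_of_isCompact Γ (hK.inv.mul hs)).subset ?_⟩
  rintro γ ⟨x, hx, hxK⟩
  exact ⟨x⁻¹, Set.inv_mem_inv.2 hxK, x * γ, subset_tsupport ψ hx, by simp⟩

lemma finite_support_translates [DiscreteTopology Γ] (hs : HasCompactSupport ψ) (g : H) :
    (Function.support fun γ : Γ => ψ (g * γ)).Finite :=
  (locallyFinite_support_translates hs).point_finite g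

lemma finite_support_smul [DiscreteTopology Γ] (hs : HasCompactSupport ψ) (b : Γ → V) (g : H) :
    (Function.support fun γ : Γ => ψ (g * γ) • b γ).Finite :=
  (finite_support_translates hs g).subset fun γ hγ h => hγ (by simp_all)

lemma continuous_periodize [DiscreteTopology Γ] (hψ : Continuous ψ) (hs : HasCompactSupport ψ)
    (b : Γ → V) : Continuous (periodize Γ ψ b) := by
  refine continuous_finsum (fun γ => (hψ.comp (continuous_mul_const _)).smul continuous_const)
    ((locallyFinite_support_translates hs).subset fun γ g hg h => hg ?_)
  simp_all

lemma periodize_mul_right (ψ : H → ℝ) (b : Γ → V) (g : H) (δ : Γ) :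
    periodize Γ ψ b (g * (δ : H)⁻¹) = periodize Γ ψ (fun γ => b (δ * γ)) g := by
  rw [periodize, periodize, ← finsum_comp_equiv (Equiv.mulLeft δ)]
  refine finsum_congr fun γ => ?_
  simp [mul_assoc]

lemma periodize_const_mul_right (ψ : H → ℝ) (v : V) (g : H) (δ : Γ) :
    periodize Γ ψ (fun _ => v) (g * (δ : H)) = periodize Γ ψ (fun _ => v) g := by
  have := periodize_mul_right ψ (fun _ => v) (g * δ) δ
  rw [mul_inv_cancel_right] at this
  exact this.symm

lemma periodize_one_pos [DiscreteTopology Γ] (hs : HasCompactSupport ψ) (h0 : ∀ g, 0 ≤ ψ g)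
    {g : H} {γ : Γ} (hγ : 0 < ψ (g * γ)) : 0 < periodize Γ ψ (fun _ => (1 : ℝ)) g :=
  finsum_pos (fun δ => by simpa using h0 _) ⟨γ, by simpa using hγ⟩
    (finite_support_smul hs _ g)

/-- A partition of unity by translates of a compactly supported function. -/
lemma exists_partition [DiscreteTopology Γ] {L : Set H} (hL : IsCompact L)
    (hLΓ : ∀ g, ∃ γ : Γ, g * (γ : H) ∈ L) :
    ∃ ψ : H → ℝ, Continuous ψ ∧ HasCompactSupport ψ ∧ (∀ g, 0 ≤ ψ g) ∧
      ∀ g, periodize Γ ψ (fun _ => (1 : ℝ)) g = 1 := by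
  obtain ⟨f, hf1, hf2, hf3, hf4⟩ :=
    exists_continuousMap_one_of_isCompact_subset_isOpen hL isOpen_univ (Set.subset_univ L)
  have hf0 : ∀ g, 0 ≤ f g := fun g => (hf4 g).1
  have hpos : ∀ g, 0 < periodize Γ f (fun _ => (1 : ℝ)) g := fun g => by
    obtain ⟨γ, hγ⟩ := hLΓ g
    refine periodize_one_pos hf2 hf0 (γ := γ) ?_
    rw [hf1 hγ]; exact one_pos
  have hc : Continuous fun g => f g / periodize Γ f (fun _ => (1 : ℝ)) g :=
    f.continuous.div (continuous_periodize f.continuous hf2 _) fun g => (hpos g).ne'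
  refine ⟨_, hc, ?_, fun g => div_nonneg (hf0 g) (hpos g).le, fun g => ?_⟩
  · simp only [div_eq_mul_inv]
    exact HasCompactSupport.mul_right (f := f) hf2
  · have : ∀ γ : Γ, (f (g * γ) / periodize Γ f (fun _ => (1 : ℝ)) (g * γ)) • (1 : ℝ) =
        (periodize Γ f (fun _ => (1 : ℝ)) g)⁻¹ • (f (g * γ) • (1 : ℝ)) := fun γ => by
      rw [periodize_const_mul_right]
      simp [div_eq_inv_mul]
    rw [periodize, finsum_congr this, ← smul_finsum]
    exact inv_mul_cancel₀ (hpos g).ne'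

/-- A cocompact subgroup has a compact set of representatives. -/
lemma exists_isCompact_mul_mem [SigmaCompactSpace H] [CompactSpace (H ⧸ Γ)] :
    ∃ L : Set H, IsCompact L ∧ ∀ g, ∃ γ : Γ, g * (γ : H) ∈ L := by
  set K := CompactExhaustion.choice H
  have hopen : ∀ n, IsOpen ((QuotientGroup.mk : H → H ⧸ Γ) '' interior (K n)) := fun n =>
    QuotientGroup.isOpenMap_coe _ isOpen_interior
  obtain ⟨n, hn⟩ := isCompact_univ.elim_directed_cover _ hopen (fun x _ => by
    obtain ⟨g, rfl⟩ := QuotientGroup.mk_surjective x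
    have hg : g ∈ ⋃ n, K n := by rw [K.iUnion_eq]; trivial
    obtain ⟨n, hn⟩ := Set.mem_iUnion.1 hg
    exact Set.mem_iUnion.2 ⟨n + 1, g, K.subset_interior_succ n hn, rfl⟩)
    (directed_of_isDirected_le fun a b hab => Set.image_mono (interior_mono (K.subset hab)))
  refine ⟨K n, K.isCompact n, fun g => ?_⟩
  obtain ⟨x, hx, hxg⟩ := hn (Set.mem_univ (g : H ⧸ Γ))
  refine ⟨⟨g⁻¹ * x, QuotientGroup.eq.1 hxg.symm⟩, ?_⟩
  simpa using interior_subset hx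

/-- A cocompact lattice acting affinely admits a continuous equivariant function. -/
lemma exists_equivariant_of_cocompact [SigmaCompactSpace H] [DiscreteTopology Γ]
    [CompactSpace (H ⧸ Γ)] (α : Γ →* (V ≃ᵃ[ℝ] V)) (ρ : Γ →* (V →L[ℝ] V))
    (hρ : ∀ γ v, ρ γ v = (α γ).linear v) :
    ∃ f : H → V, Continuous f ∧ ∀ g (γ : Γ), f (g * (γ : H)⁻¹) = α γ (f g) := by
  obtain ⟨L, hL, hLΓ⟩ := exists_isCompact_mul_mem (Γ := Γ)
  obtain ⟨ψ, hψ, hs, -, h1⟩ := exists_partition hL hLΓ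
  -- The value at `g` is the barycentre of the orbit points `α γ 0` with weights `ψ (g γ)`. The
  -- weights have total mass one, which is why the affine map `α δ` passes through the sum.
  refine ⟨periodize Γ ψ fun γ => α γ 0, continuous_periodize hψ hs _, fun g δ => ?_⟩
  have hα : ∀ x, α δ x = ρ δ x + α δ 0 := fun x => by
    have := AffineEquiv.sub_eq_linear (α δ) x 0
    rw [sub_zero, sub_eq_iff_eq_add] at this
    rw [this, hρ]
  rw [periodize_mul_right, hα, periodize, periodize,
    show ρ δ (∑ᶠ γ : Γ, ψ (g * γ) • α γ 0) = ∑ᶠ γ : Γ, ρ δ (ψ (g * γ) • α γ 0) from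
      AddMonoidHom.map_finsum (ρ δ : V →+ V) (finite_support_smul hs (fun γ : Γ => α γ 0) g)]
  have h2 : ∀ γ : Γ, ψ (g * γ) • α (δ * γ) 0 =
      ρ δ (ψ (g * γ) • α γ 0) + (ψ (g * γ) • (1 : ℝ)) • α δ 0 := fun γ => by
    rw [map_mul, AffineEquiv.mul_def, AffineEquiv.trans_apply, hα (α γ 0), smul_add, map_smul,
      smul_eq_mul, mul_one]
  rw [finsum_congr h2, finsum_add_distrib, ← finsum_smul]
  · congr 1
    have := h1 g
    rw [periodize] at this
    rw [this, one_smul]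
  · refine (finite_support_smul hs (fun γ : Γ => α γ 0) g).subset fun γ hγ h => hγ ?_
    change ρ δ (ψ (g * γ) • α γ 0) = 0
    rw [show ψ (g * γ) • α γ 0 = 0 from h, map_zero]
  · refine (finite_support_translates hs g).subset fun γ hγ h => hγ ?_
    change (ψ (g * γ) • (1 : ℝ)) • α δ 0 = 0
    rw [show ψ (g * γ) = 0 from h, zero_smul, zero_smul]

end Periodization

/-! ### Common fixed points of commuting affine averages. -/

section CommutingAverages

variable {ι : Type*} [Fintype ι] [DecidableEq ι] {G : ι → Type*} [∀ i, Group (G i)]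
  [∀ i, TopologicalSpace (G i)] [∀ i, IsTopologicalGroup (G i)] [∀ i, T2Space (G i)]
  [∀ i, LocallyCompactSpace (G i)] [∀ i, SigmaCompactSpace (G i)]
  [∀ i, MeasurableSpace (G i)] [∀ i, BorelSpace (G i)]
  {W : Type*} [NormedAddCommGroup W] [NormedSpace ℝ W] [CompleteSpace W]
  (m : ∀ i, Measure (G i)) [∀ i, IsProbabilityMeasure (m i)]
  (τ : (∀ i, G i) →* (W →L[ℝ] W))

/-- The average of an isometric representation over one factor. -/
noncomputable def repAverage (hc : ∀ u, Continuous fun h => τ h u) (h1 : ∀ h u, ‖τ h u‖ ≤ ‖u‖)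
    (i : ι) : W →L[ℝ] W :=
  LinearMap.mkContinuous
    { toFun := fun u => ∫ h, τ (Pi.mulSingle i h) u ∂(m i)
      map_add' := fun u v => by
        have hi : ∀ u, Integrable (fun h => τ (Pi.mulSingle i h) u) (m i) := fun u =>
          Controlled.integrable (Or.inl ⟨‖u‖, fun h => h1 _ u⟩)
            ((hc u).comp (continuous_mulSingle i))
        simp only [map_add]
        exact integral_add (hi u) (hi v)
      map_smul' := fun c u => by
        simp only [map_smul, RingHom.id_apply]
        exact integral_smul c _ } 1
    fun u => by
      rw [one_mul]
      exact norm_integral_le_of_bound fun h => h1 _ u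

variable {m τ} (hc : ∀ u, Continuous fun h => τ h u) (h1 : ∀ h u, ‖τ h u‖ ≤ ‖u‖)

lemma repAverage_apply (i : ι) (u : W) :
    repAverage m τ hc h1 i u = ∫ h, τ (Pi.mulSingle i h) u ∂(m i) := rfl

/-- The average over a list of factors. -/
noncomputable def repAverageList : List ι → W →L[ℝ] W
  | [] => 1
  | i :: l => repAverage m τ hc h1 i * repAverageList l

/-- Fixed points of commuting averages of an affine isometric action. -/
lemma exists_fixed_of_contraction {d : (∀ i, G i) → W}
    (hcoc : ∀ h k, d (h * k) = τ h (d k) + d h)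
    (hint : ∀ i, Integrable (fun h => d (Pi.mulSingle i h)) (m i))
    {l : List ι} {c : ℝ} (hc0 : 0 ≤ c) (hc1 : c < 1)
    (hcon : ∀ u, ‖repAverageList (m := m) hc h1 l u‖ ≤ c * ‖u‖) :
    ∃ u : W, ∀ j, ∀ k : ∀ i, G i, k j = 1 →
      repAverage m τ hc h1 j (τ k u + d k - u) = τ k u + d k - u := by
  set A := repAverage m τ hc h1 with hA
  set a : ι → W := fun i => ∫ h, d (Pi.mulSingle i h) ∂(m i) with ha
  set T : ι → W → W := fun i u => A i u + a i with hT
  have hi : ∀ i u, Integrable (fun h => τ (Pi.mulSingle i h) u) (m i) := fun i u =>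
    Controlled.integrable (Or.inl ⟨‖u‖, fun h => h1 _ u⟩) ((hc u).comp (continuous_mulSingle i))
  have hid : ∀ i u, Integrable
      (fun h => τ (Pi.mulSingle i h) u + d (Pi.mulSingle i h)) (m i) :=
    fun i u => (hi i u).add (hint i)
  have hTi : ∀ i u, T i u = ∫ h, (τ (Pi.mulSingle i h) u + d (Pi.mulSingle i h)) ∂(m i) :=
    fun i u => (integral_add (hi i u) (hint i)).symm
  -- An element trivial in the coordinate `i` commutes with the factor `i`; by the cocycle identity
  -- its affine action commutes with the average over that factor.
  have hcomm : ∀ i (k : ∀ i, G i) u, k i = 1 → T i (τ k u + d k) = τ k (T i u) + d k :=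
    fun i k u hk => by
    rw [hTi, hTi, ← ContinuousLinearMap.integral_comp_comm _ (hid i u)]
    have h2 : d k = ∫ _, d k ∂(m i) := by simp
    conv_rhs => rw [h2]
    have h3 : Integrable (fun h => τ k (τ (Pi.mulSingle i h) u + d (Pi.mulSingle i h))) (m i) :=
      (τ k).integrable_comp (hid i u)
    rw [← integral_add h3 (integrable_const _)]
    refine integral_congr_ae (ae_of_all _ fun h => ?_)
    simp only [map_add]
    rw [add_assoc, ← hcoc, add_assoc, ← hcoc, ← mul_apply_eq_comp, ← mul_apply_eq_comp, ← map_mul,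
      ← map_mul, mulSingle_mul_comm hk]
  have hTT : ∀ i j u, T i (T j u) = T j (T i u) := fun i j u => by
    rcases eq_or_ne i j with rfl | hij
    · rfl
    have h2 : Integrable (fun h => τ (Pi.mulSingle j h) u + d (Pi.mulSingle j h)) (m j) :=
      (hi j u).add (hint j)
    have h3 : T i (T j u) =
        ∫ h, T i (τ (Pi.mulSingle j h) u + d (Pi.mulSingle j h)) ∂(m j) := by
      rw [hTi j u]
      simp only [hT]
      rw [integral_add ((A i).integrable_comp h2) (integrable_const _),
        ← ContinuousLinearMap.integral_comp_comm _ h2]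
      simp
    rw [h3, hTi j]
    exact integral_congr_ae (ae_of_all _ fun h => hcomm i _ u (by simp [hij]))
  have hTl : ∀ l' : List ι, ∃ S : W → W, (∀ u v, S u - S v = repAverageList hc h1 l' (u - v)) ∧
      ∀ j u, T j (S u) = S (T j u) := fun l' => by
    induction l' with
    | nil => exact ⟨id, fun u v => rfl, fun j u => rfl⟩
    | cons i l' ih =>
      obtain ⟨S, hS1, hS2⟩ := ih
      refine ⟨fun u => T i (S u), fun u v => ?_, fun j u => ?_⟩
      · simp only [hT, add_sub_add_right_eq_sub, ← map_sub, hS1]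
        rfl
      · dsimp only
        rw [hTT, hS2]
  obtain ⟨S, hS1, hS2⟩ := hTl l
  have hS : ContractingWith ⟨c, hc0⟩ S :=
    ⟨hc1, LipschitzWith.of_dist_le_mul fun u v => by
      rw [dist_eq_norm, dist_eq_norm, hS1]; exact hcon _⟩
  set u := ContractingWith.fixedPoint S hS with hu
  have hSu : S u = u := hS.fixedPoint_isFixedPt
  -- `T j` commutes with the contraction `S`, so it maps the unique fixed point of `S` to a fixed
  -- point of `S`.
  have hTu : ∀ j, T j u = u := fun j => hS.fixedPoint_unique (by
    change S (T j u) = T j u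
    rw [← hS2, hSu])
  refine ⟨u, fun j k hk => ?_⟩
  have h2 := hcomm j k u hk
  rw [hTu] at h2
  have h3 : A j (τ k u + d k - u) = T j (τ k u + d k) - T j u := by
    simp only [hT, map_sub]; abel
  rw [h3, h2, hTu]

end CommutingAverages

/-! ### Bounded equivariant functions with the sup norm. -/

section EquivariantFunctions

open scoped BoundedContinuousFunction

variable {H : Type*} [Group H] [TopologicalSpace H] [IsTopologicalGroup H] {Γ : Subgroup H}
  {E : Type*} [NormedAddCommGroup E] [NormedSpace ℝ E]

/-- Bounded continuous equivariant functions. -/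
def equivariantFunctions (ρ : Γ →* (E →L[ℝ] E)) : Submodule ℝ (H →ᵇ E) where
  carrier := {u | ∀ g (γ : Γ), u (g * (γ : H)⁻¹) = ρ γ (u g)}
  add_mem' {u v} hu hv g γ := by simp [hu g γ, hv g γ]
  zero_mem' g γ := by simp
  smul_mem' c u hu g γ := by simp [hu g γ]

variable {ρ : Γ →* (E →L[ℝ] E)}

lemma isClosed_equivariantFunctions :
    IsClosed (equivariantFunctions ρ : Set (H →ᵇ E)) := by
  have : (equivariantFunctions ρ : Set (H →ᵇ E)) =
      ⋂ g : H, ⋂ γ : Γ, {u | u (g * (γ : H)⁻¹) = ρ γ (u g)} := by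
    ext u; simp [equivariantFunctions]
  rw [this]
  refine isClosed_iInter fun g => isClosed_iInter fun γ => isClosed_eq ?_ ?_
  · exact continuous_eval_const _
  · exact (ρ γ).continuous.comp (continuous_eval_const _)

instance [CompleteSpace E] : CompleteSpace (equivariantFunctions ρ) :=
  isClosed_equivariantFunctions.completeSpace_coe

lemma norm_equivariant_le (hρ : ∀ γ v, ‖ρ γ v‖ = ‖v‖) {L : Set H}
    (hLΓ : ∀ g, ∃ γ : Γ, g * (γ : H) ∈ L) {y : H → E}
    (hy : ∀ g (γ : Γ), y (g * (γ : H)⁻¹) = ρ γ (y g)) {C : ℝ} (hC : ∀ g ∈ L, ‖y g‖ ≤ C) (g : H) :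
    ‖y g‖ ≤ C := by
  obtain ⟨γ, hγ⟩ := hLΓ g
  have := hy (g * γ) γ
  rw [mul_inv_cancel_right] at this
  rw [this, hρ]
  exact hC _ hγ

/-- Equivariant continuous functions for a cocompact subgroup are bounded. -/
lemma exists_equivariantFunctions_coe (hρ : ∀ γ v, ‖ρ γ v‖ = ‖v‖) {L : Set H} (hL : IsCompact L)
    (hLΓ : ∀ g, ∃ γ : Γ, g * (γ : H) ∈ L) {y : H → E} (hyc : Continuous y)
    (hy : ∀ g (γ : Γ), y (g * (γ : H)⁻¹) = ρ γ (y g)) :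
    ∃ u : equivariantFunctions ρ, ∀ g, (u : H →ᵇ E) g = y g := by
  obtain ⟨C, hC⟩ := hL.exists_bound_of_continuousOn hyc.continuousOn
  exact ⟨⟨BoundedContinuousFunction.ofNormedAddCommGroup y hyc C
    (norm_equivariant_le hρ hLΓ hy hC), hy⟩, fun g => rfl⟩

/-- The norm of an equivariant function is controlled by its values on the compact set `L` of
representatives, where joint continuity is uniform. -/
lemma continuous_equivariantFunctions (hρ : ∀ γ v, ‖ρ γ v‖ = ‖v‖) {L : Set H} (hL : IsCompact L)
    (hLΓ : ∀ g, ∃ γ : Γ, g * (γ : H) ∈ L) {Z : Type*} [TopologicalSpace Z] {Y : Z → H → E}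
    (hY : Continuous Y.uncurry) {u : Z → equivariantFunctions ρ}
    (hu : ∀ z g, (u z : H →ᵇ E) g = Y z g) : Continuous u := by
  rw [continuous_iff_continuousAt]
  intro z₀
  rw [ContinuousAt, Metric.tendsto_nhds]
  intro ε hε
  obtain ⟨v, hv, hvK⟩ := hL.mem_uniformity_of_prod (f := Y) (s := Set.univ) (q := z₀)
    hY.continuousOn (Set.mem_univ _) (Metric.dist_mem_uniformity (half_pos hε))
  rw [nhdsWithin_univ] at hv
  filter_upwards [hv] with z hz
  refine lt_of_le_of_lt ?_ (half_lt_self hε)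
  rw [dist_eq_norm, Submodule.coe_norm, BoundedContinuousFunction.norm_le (by positivity)]
  refine norm_equivariant_le hρ hLΓ (u z - u z₀).2 fun g hg => ?_
  have h1 : dist (Y z g) (Y z₀ g) < ε / 2 := hvK z hz g hg
  rw [dist_eq_norm, ← hu, ← hu] at h1
  exact h1.le

variable (ρ) in
/-- Left translation on equivariant functions. -/
noncomputable def leftTranslation : H →* (equivariantFunctions ρ →L[ℝ] equivariantFunctions ρ) where
  toFun h := LinearMap.mkContinuous
    { toFun := fun u => ⟨(u : H →ᵇ E).compContinuous ⟨fun g => h⁻¹ * g, by fun_prop⟩, fun g γ => by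
        have := u.2 (h⁻¹ * g) γ
        simpa [mul_assoc] using this⟩
      map_add' := fun u v => rfl
      map_smul' := fun c u => rfl } 1 fun u => by
        rw [one_mul, Submodule.coe_norm, BoundedContinuousFunction.norm_le (norm_nonneg _)]
        exact fun g => (u : H →ᵇ E).norm_coe_le_norm _
  map_one' := by
    ext u g
    change (u : H →ᵇ E) (1⁻¹ * g) = (u : H →ᵇ E) g
    simp
  map_mul' h k := by
    ext u g
    change (u : H →ᵇ E) ((h * k)⁻¹ * g) = (u : H →ᵇ E) (k⁻¹ * (h⁻¹ * g))
    rw [mul_inv_rev, mul_assoc]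

lemma leftTranslation_apply (h : H) (u : equivariantFunctions ρ) (g : H) :
    (leftTranslation ρ h u : H →ᵇ E) g = (u : H →ᵇ E) (h⁻¹ * g) := rfl

lemma norm_leftTranslation_le (h : H) (u : equivariantFunctions ρ) :
    ‖leftTranslation ρ h u‖ ≤ ‖u‖ := by
  rw [Submodule.coe_norm, BoundedContinuousFunction.norm_le (norm_nonneg _)]
  exact fun g => (u : H →ᵇ E).norm_coe_le_norm _

lemma continuous_leftTranslation (hρ : ∀ γ v, ‖ρ γ v‖ = ‖v‖) {L : Set H} (hL : IsCompact L)
    (hLΓ : ∀ g, ∃ γ : Γ, g * (γ : H) ∈ L) (u : equivariantFunctions ρ) :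
    Continuous fun h => leftTranslation ρ h u :=
  continuous_equivariantFunctions hρ hL hLΓ (Y := fun h g => (u : H →ᵇ E) (h⁻¹ * g))
    ((u : H →ᵇ E).continuous.comp (by fun_prop : Continuous fun p : H × H => p.1⁻¹ * p.2))
    fun h g => rfl

end EquivariantFunctions

/-! ### The case of a uniform lattice. -/

section Uniform

open scoped BoundedContinuousFunction

variable {ι : Type*} [Fintype ι] [DecidableEq ι] {G : ι → Type*} [∀ i, Group (G i)]
  [∀ i, TopologicalSpace (G i)] [∀ i, IsTopologicalGroup (G i)] [∀ i, T2Space (G i)]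
  [∀ i, LocallyCompactSpace (G i)] [∀ i, SigmaCompactSpace (G i)]
  [∀ i, MeasurableSpace (G i)] [∀ i, BorelSpace (G i)]
  {E : Type*} [NormedAddCommGroup E] [NormedSpace ℝ E] [UniformConvexSpace E] [CompleteSpace E]
  {Γ : Subgroup (∀ i, G i)} {ρ : Γ →* (E →L[ℝ] E)} {m : ∀ i, Measure (G i)}
  [∀ i, IsProbabilityMeasure (m i)]

lemma nnreal_smul_measure_mono_left {X : Type*} [MeasurableSpace X] (μ : Measure X)
    {C D : NNReal} (h : C ≤ D) : C • μ ≤ D • μ := by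
  intro s
  simp only [Measure.smul_apply]
  exact mul_le_mul_left (ENNReal.coe_le_coe.2 h) (μ s)

lemma admissible_equivariantFunctions (u : equivariantFunctions ρ) :
    Admissible m fun g => (u : (∀ i, G i) →ᵇ E) g :=
  ⟨(u : (∀ i, G i) →ᵇ E).continuous, Or.inl ⟨_, (u : (∀ i, G i) →ᵇ E).norm_coe_le_norm⟩⟩

variable (hc : ∀ u, Continuous fun h => leftTranslation ρ h u)

lemma repAverage_coe (i : ι) (u : equivariantFunctions ρ) (g : ∀ i, G i) :
    (repAverage m (leftTranslation ρ) hc norm_leftTranslation_le i u : (∀ i, G i) →ᵇ E) g =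
      ∫ h, (u : (∀ i, G i) →ᵇ E) ((Pi.mulSingle i h)⁻¹ * g) ∂(m i) := by
  rw [repAverage_apply]
  let ev : equivariantFunctions ρ →L[ℝ] E :=
    (BoundedContinuousFunction.evalCLM ℝ g).comp (equivariantFunctions ρ).subtypeL
  have hi : Integrable (fun h => leftTranslation ρ (Pi.mulSingle i h) u) (m i) :=
    Controlled.integrable (Or.inl ⟨‖u‖, fun h => norm_leftTranslation_le _ u⟩)
      ((hc u).comp (continuous_mulSingle i))
  exact (ev.integral_comp_comm hi).symm

lemma repAverageList_coe (l : List ι) (u : equivariantFunctions ρ) (g : ∀ i, G i) :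
    (repAverageList (m := m) hc norm_leftTranslation_le l u : (∀ i, G i) →ᵇ E) g =
      avg m l (fun g => (u : (∀ i, G i) →ᵇ E) g) g := by
  induction l generalizing g with
  | nil => rfl
  | cons i l ih =>
    refine (repAverage_coe hc i _ g).trans ?_
    exact integral_congr_ae (ae_of_all _ fun h => ih _)

/-- Averaging is a contraction on bounded equivariant functions. -/
lemma exists_norm_repAverageList_le (hρ : ∀ γ v, ‖ρ γ v‖ = ‖v‖) {L : Set (∀ i, G i)}
    (hLΓ : ∀ g, ∃ γ : Γ, g * (γ : ∀ i, G i) ∈ L) {q : ∀ i, Measure (G i)}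
    [∀ i, IsProbabilityMeasure (q i)] {F : Finset Γ} {ε : ℝ} (hε : 0 < ε)
    (hF : ∀ v, ∃ γ ∈ F, ε * ‖v‖ ≤ ‖ρ γ v - v‖) {C : NNReal}
    (hC : ∀ g ∈ L, ∀ γ ∈ F, ∀ i,
      (q i).map (fun h => (g * (γ : ∀ i, G i) * g⁻¹) i * h) ≤ C • m i)
    (hC1 : ∀ i, q i ≤ C • m i) {l : List ι} (hl : l.Nodup) (hlu : ∀ i, i ∈ l) :
    ∃ c : ℝ, 0 ≤ c ∧ c < 1 ∧ ∀ u : equivariantFunctions ρ,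
      ‖repAverageList (m := m) hc norm_leftTranslation_le l u‖ ≤ c * ‖u‖ := by
  obtain ⟨δ, hδ, hB⟩ := exists_no_almost_constant hε hF hC hC1 hl hlu
  have hmin := min_le_left δ (1 / 2)
  have hmin2 := min_le_right δ (1 / 2)
  have hmin0 : 0 < min δ (1 / 2) := by positivity
  have key : ∀ u : equivariantFunctions ρ, ‖u‖ ≤ 1 →
      ‖repAverageList (m := m) hc norm_leftTranslation_le l u‖ ≤ 1 - min δ (1 / 2) := fun u hu => by
    have hu1 : ∀ g, ‖(u : (∀ i, G i) →ᵇ E) g‖ ≤ 1 := fun g =>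
      ((u : (∀ i, G i) →ᵇ E).norm_coe_le_norm g).trans hu
    rw [Submodule.coe_norm, BoundedContinuousFunction.norm_le (by linarith)]
    refine norm_equivariant_le hρ hLΓ
      (repAverageList (m := m) hc norm_leftTranslation_le l u).2 fun g hg => ?_
    rw [repAverageList_coe]
    by_contra hn
    push Not at hn
    have hA : ∀ {n : ∀ i, Measure (G i)} [∀ i, IsProbabilityMeasure (n i)],
        Admissible n fun g => (u : (∀ i, G i) →ᵇ E) g :=
      admissible_equivariantFunctions u
    obtain ⟨T, hT, hTv⟩ := exists_dual_vector'' ℝ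
      (avg m l (fun g => (u : (∀ i, G i) →ᵇ E) g) g)
    have hTu : ∀ x, T ((u : (∀ i, G i) →ᵇ E) x) ≤ ‖(u : (∀ i, G i) →ᵇ E) x‖ := fun x =>
      (le_abs_self _).trans (by simpa using T.le_of_opNorm_le hT _)
    -- With `T` norming the average, `T u ≤ ‖u‖ ≤ 1` pointwise while `1 - T u` has small average.
    -- This single function dominates both defects of `exists_no_almost_constant`.
    have h0 : avg m l (fun x => 1 - T ((u : (∀ i, G i) →ᵇ E) x)) g ≤ δ := by
      rw [avg_sub (Admissible.const 1) (hA.clm T), avg_const, avg_clm hA, hTv]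
      simp only [RCLike.ofReal_real_eq_id, id]
      linarith
    have hA1 : Admissible m fun x => 1 - T ((u : (∀ i, G i) →ᵇ E) x) :=
      (Admissible.const 1).sub (hA.clm T)
    refine hB _ hA hA u.2 g hg T hT ((avg_mono (hA.norm.sub (Admissible.const 1)).norm hA1
      (fun x => ?_) l g).trans h0) ((avg_mono hA1.norm hA1 (fun x => ?_) l g).trans h0)
    · rw [Real.norm_eq_abs, abs_of_nonpos (by linarith [hu1 x])]
      linarith [hTu x]
    · rw [Real.norm_eq_abs, abs_of_nonneg (by linarith [hu1 x, hTu x])]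
  refine ⟨1 - min δ (1 / 2), by linarith, by linarith, fun u => ?_⟩
  rcases eq_or_ne u 0 with rfl | hu
  · simp
  have hu0 : 0 < ‖u‖ := norm_pos_iff.2 hu
  have h1 := key (‖u‖⁻¹ • u) (by rw [norm_smul, norm_inv, norm_norm, inv_mul_cancel₀ hu0.ne'])
  rw [map_smul, norm_smul, norm_inv, norm_norm, inv_mul_le_iff₀ hu0] at h1
  linarith

/-- Equivariant functions fixed by the averages over all but one factor are invariant under these
factors. -/
lemma equivariant_eq_of_average_eq (hirr : IsIrreducibleSubgroup Γ) (hρ : ∀ γ v, ‖ρ γ v‖ = ‖v‖)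
    {L : Set (∀ i, G i)} (hL : IsCompact L) (hLΓ : ∀ g, ∃ γ : Γ, g * (γ : ∀ i, G i) ∈ L)
    (hm : ∀ i x, x ∈ (m i).support) {y : equivariantFunctions ρ} {i : ι}
    (hy : ∀ j, j ≠ i → repAverage m (leftTranslation ρ) hc norm_leftTranslation_le j y = y)
    {k : ∀ i, G i} (hk : k i = 1) (g : ∀ i, G i) :
    (y : (∀ i, G i) →ᵇ E) (k * g) = (y : (∀ i, G i) →ᵇ E) g := by
  set w : (∀ i, G i) → E := fun g => (y : (∀ i, G i) →ᵇ E) g with hw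
  have hwc : Continuous w := (y : (∀ i, G i) →ᵇ E).continuous
  have hA : Admissible m w := admissible_equivariantFunctions y
  have hwΓ : ∀ g (γ : Γ), w (g * (γ : ∀ i, G i)⁻¹) = ρ γ (w g) := y.2
  have hwΓ' : ∀ g (γ : Γ), w (g * (γ : ∀ i, G i)) = ρ γ⁻¹ (w g) := fun g γ => by
    rw [← hwΓ]; simp
  obtain ⟨γ₀, hγ₀⟩ := hLΓ 1
  -- Compactness of `L` and invariance of the norm under `Γ` yield a global maximum of `‖w‖`; strict
  -- convexity is exploited there.
  obtain ⟨g₀, hg₀, hmax⟩ := hL.exists_isMaxOn ⟨_, hγ₀⟩ hwc.norm.continuousOn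
  have hle : ∀ g, ‖w g‖ ≤ ‖w g₀‖ := norm_equivariant_le hρ hLΓ hwΓ fun g hg => hmax hg
  set l : List ι := (Finset.univ.erase i).toList with hl
  have hmem : ∀ j, j ∈ l ↔ j ≠ i := fun j => by simp [hl]
  have havg : ∀ l' : List ι, (∀ j ∈ l', j ≠ i) → ∀ g, avg m l' w g = w g := fun l' => by
    induction l' with
    | nil => intro _ g; rfl
    | cons j l' ih =>
      intro hj g
      have h1 := ih fun j' hj' => hj j' (List.mem_cons_of_mem _ hj')
      simp only [avg, h1]
      have h2 := repAverage_coe (m := m) hc j y g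
      rw [hy j (hj j List.mem_cons_self)] at h2
      exact h2.symm
  -- With `T` norming `w g₀`, the nonnegative function `‖w g₀‖ - T w` has zero average over the
  -- factors other than `i`, so it vanishes on all their translates of `g₀`, the supports being
  -- full. Strict convexity turns `T w = ‖w‖ = ‖w g₀‖` into `w = w g₀`.
  have hconst : ∀ k : ∀ i, G i, k i = 1 → w (k * g₀) = w g₀ := fun k hk => by
    obtain ⟨T, hT, hTv⟩ := exists_dual_vector'' ℝ (w g₀)
    simp only [RCLike.ofReal_real_eq_id, id] at hTv
    have hTw : ∀ x, T (w x) ≤ ‖w x‖ := fun x =>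
      (le_abs_self _).trans (by simpa using T.le_of_opNorm_le hT _)
    have h0 : avg m l (fun x => ‖w g₀‖ - T (w x)) g₀ = 0 := by
      rw [avg_sub (Admissible.const _) (hA.clm T), avg_const, avg_clm hA,
        havg l (fun j hj => (hmem j).1 hj), hTv, sub_self]
    have h1 := eq_zero_of_avg_eq_zero ((Admissible.const _).sub (hA.clm T))
      (fun x => by linarith [hTw x, hle x]) (Finset.nodup_toList _) h0 (k := k⁻¹)
      (fun j _ => hm j _) (fun j hj => by
        rw [hmem, not_not] at hj
        subst hj
        simp [hk])
    rw [inv_inv, sub_eq_zero] at h1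
    have h2 := hTw (k * g₀)
    have h3 : ‖w (k * g₀)‖ = ‖w g₀‖ := le_antisymm (hle _) (by linarith)
    refine eq_of_norm_eq_of_norm_add_eq h3 (le_antisymm (norm_add_le _ _) ?_)
    have h4 : T (w (k * g₀) + w g₀) ≤ ‖w (k * g₀) + w g₀‖ :=
      (le_abs_self _).trans
        (by rw [← Real.norm_eq_abs]; simpa only [one_mul] using T.le_of_opNorm_le hT _)
    rw [map_add, ← h1, hTv] at h4
    linarith
  -- Right translation by `γ` carries the constancy at `g₀` to all points whose coordinate `i` is
  -- that of `g₀ γ`. These coordinates are dense in `G i`, and continuity does the rest.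
  have hD : ∀ (γ : Γ) (x : ∀ i, G i), x i = (g₀ * (γ : ∀ i, G i)) i → w (k * x) = w x := fun γ x hx => by
    have hx' : (x * (γ : ∀ i, G i)⁻¹ * g₀⁻¹) i = 1 := by simp [hx]
    have hkx' : (k * (x * (γ : ∀ i, G i)⁻¹ * g₀⁻¹)) i = 1 := by simp [hx, hk]
    have e1 : x = (x * (γ : ∀ i, G i)⁻¹ * g₀⁻¹) * g₀ * (γ : ∀ i, G i) := by group
    have e2 : k * x = (k * (x * (γ : ∀ i, G i)⁻¹ * g₀⁻¹)) * g₀ * (γ : ∀ i, G i) := by group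
    rw [e2, hwΓ', hconst _ hkx', ← hconst _ hx', ← hwΓ', ← e1]
  have hcl : IsClosed {t : G i | w (k * Function.update g i (g₀ i * t)) =
      w (Function.update g i (g₀ i * t))} := by
    have hu : Continuous fun t : G i => Function.update g i (g₀ i * t) :=
      continuous_const.update i (continuous_const_mul _)
    exact isClosed_eq (hwc.comp (continuous_const.mul hu)) (hwc.comp hu)
  have hsub : (fun g : ∀ i, G i => g i) '' (Γ : Set (∀ i, G i)) ⊆
      {t : G i | w (k * Function.update g i (g₀ i * t)) = w (Function.update g i (g₀ i * t))} := by
    rintro _ ⟨γ, hγ, rfl⟩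
    exact hD ⟨γ, hγ⟩ _ (by simp)
  have hall : (g₀ i)⁻¹ * g i ∈ {t : G i | w (k * Function.update g i (g₀ i * t)) =
      w (Function.update g i (g₀ i * t))} :=
    closure_minimal hsub hcl ((hirr i) _)
  rw [Set.mem_ofPred_eq, mul_inv_cancel_left, Function.update_eq_self] at hall
  exact hall

/-- For a uniform irreducible lattice, there is a continuous equivariant function whose increments
along each factor are invariant under the other factors. -/
theorem exists_splitting_function_of_uniform (hirr : IsIrreducibleSubgroup Γ)
    (hΓ : IsUniformLattice Γ) (α : Γ →* (E ≃ᵃ[ℝ] E))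
    (hα : ∀ γ v, ‖(α γ).linear v‖ = ‖v‖) {F : Finset Γ} {ε : ℝ} (hε : 0 < ε)
    (hF : ∀ v, ∃ γ ∈ F, ε * ‖v‖ ≤ ‖(α γ).linear v - v‖) :
    ∃ f : (∀ i, G i) → E, Continuous f ∧
      (∀ (g : ∀ i, G i) (γ : Γ), f (g * (γ : ∀ i, G i)⁻¹) = α γ (f g)) ∧
      ∀ i (h : G i) (k g : ∀ i, G i), k i = 1 →
        f (Pi.mulSingle i h * (k * g)) - f (k * g) = f (Pi.mulSingle i h * g) - f g := by
  obtain ⟨_, _⟩ := hΓ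
  obtain ⟨ρ, hρα⟩ := exists_linear_part α hα
  have hρ : ∀ γ v, ‖ρ γ v‖ = ‖v‖ := fun γ v => by rw [hρα, hα]
  obtain ⟨L, hL, hLΓ⟩ := exists_isCompact_mul_mem (Γ := Γ)
  obtain ⟨f₀, hf₀c, hf₀⟩ := exists_equivariant_of_cocompact α ρ hρα
  -- The cocycle describing left translations of the affine space of equivariant functions with
  -- origin `f₀`.
  have hd : ∀ h : ∀ i, G i, ∃ u : equivariantFunctions ρ,
      ∀ g, (u : (∀ i, G i) →ᵇ E) g = f₀ (h⁻¹ * g) - f₀ g := fun h =>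
    exists_equivariantFunctions_coe hρ hL hLΓ (by fun_prop) fun g γ => by
      rw [← mul_assoc, hf₀, hf₀, AffineEquiv.sub_eq_linear, hρα]
  choose d hd using hd
  have hdc : Continuous d := continuous_equivariantFunctions hρ hL hLΓ
    (Y := fun h g => f₀ (h⁻¹ * g) - f₀ g) (by
      change Continuous fun p : (∀ i, G i) × (∀ i, G i) => f₀ (p.1⁻¹ * p.2) - f₀ p.2
      fun_prop) hd
  have hcoc : ∀ h k, d (h * k) = leftTranslation ρ h (d k) + d h := fun h k => by
    ext g
    simp only [Submodule.coe_add, BoundedContinuousFunction.add_apply, leftTranslation_apply, hd]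
    rw [mul_inv_rev, mul_assoc]
    abel
  have hmex : ∀ i, ∃ m : Measure (G i), IsProbabilityMeasure m ∧ (∀ x, x ∈ m.support) ∧
      ∫⁻ x, ‖d (Pi.mulSingle i x)‖₊ ∂m < ⊤ ∧
      ∀ q : Measure (G i), IsBump q → ∀ K, IsCompact K →
        ∃ C : NNReal, ∀ k ∈ K, q.map (fun h => k * h) ≤ C • m := fun i =>
    exists_dominating_measure (hdc.comp (continuous_mulSingle i)).nnnorm
  choose m hmp hms hmi hmd using hmex
  have hqex : ∀ i, ∃ q : Measure (G i), IsBump q ∧ q Set.univᶜ = 0 ∧ (1 : G i) ∈ q.support :=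
    fun i => exists_isBump_near_one Filter.univ_mem
  choose q hq _ _ using hqex
  have hqp : ∀ i, IsProbabilityMeasure (q i) := fun i => (hq i).isProbabilityMeasure
  -- These are the translations that `m i` must dominate: the coordinates of the conjugates `g γ
  -- g⁻¹` for `g ∈ L` and `γ ∈ F`, together with the identity.
  have hK : ∀ i, IsCompact (insert (1 : G i) (⋃ γ ∈ F,
      (fun g : ∀ i, G i => (g * (γ : ∀ i, G i) * g⁻¹) i) '' L)) := fun i =>
    (F.finite_toSet.isCompact_biUnion fun γ _ => hL.image (by fun_prop)).insert 1
  choose C hC using fun i => hmd i (q i) (hq i) _ (hK i)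
  have hCle : ∀ i, C i ≤ Finset.univ.sup C := fun i => Finset.le_sup (Finset.mem_univ i)
  have hc : ∀ u, Continuous fun h => leftTranslation ρ h u :=
    continuous_leftTranslation hρ hL hLΓ
  obtain ⟨c, hc0, hc1, hcon⟩ := exists_norm_repAverageList_le (m := m) (q := q) hc hρ hLΓ hε
    (fun v => by simpa only [hρα] using hF v) (C := Finset.univ.sup C)
    (fun g hg γ hγ i => (hC i _ (Set.mem_insert_of_mem _ (Set.mem_biUnion hγ ⟨g, hg, rfl⟩))).trans
      (nnreal_smul_measure_mono_left _ (hCle i)))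
    (fun i => by
      have := (hC i _ (Set.mem_insert _ _)).trans (nnreal_smul_measure_mono_left _ (hCle i))
      simpa using this)
    (Finset.nodup_toList Finset.univ) (by simp)
  obtain ⟨u, hu⟩ := exists_fixed_of_contraction (m := m) hc norm_leftTranslation_le hcoc
    (fun i => ⟨(hdc.comp (continuous_mulSingle i)).stronglyMeasurable_of_sigmaCompact.aestronglyMeasurable,
      hmi i⟩) hc0 hc1 hcon
  refine ⟨fun g => f₀ g + (u : (∀ i, G i) →ᵇ E) g,
    hf₀c.add (u : (∀ i, G i) →ᵇ E).continuous, fun g γ => ?_, fun i h k g hk => ?_⟩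
  · have h1 := u.2 g γ
    have h2 := AffineEquiv.sub_eq_linear (α γ) (f₀ g + (u : (∀ i, G i) →ᵇ E) g) (f₀ g)
    rw [add_sub_cancel_left, sub_eq_iff_eq_add', ← hρα] at h2
    rw [h2, ← hf₀, ← h1]
  -- The increment of `f` along `h` is the displacement of the fixed point `u` by `h⁻¹` in the
  -- affine action; `h⁻¹` is trivial in the coordinates `j ≠ i`, so the averages over these factors
  -- fix it.
  · have h1 := equivariant_eq_of_average_eq hc hirr hρ hL hLΓ hms
      (fun j hj => hu j (Pi.mulSingle i h⁻¹) (by simp [hj])) hk g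
    simp only [Submodule.coe_add, AddSubgroupClass.coe_sub, BoundedContinuousFunction.add_apply,
      BoundedContinuousFunction.sub_apply, leftTranslation_apply, hd, Pi.mulSingle_inv,
      inv_inv] at h1
    rw [← sub_eq_zero] at h1 ⊢
    rw [← h1]
    dsimp only
    abel

end Uniform

/-! ### Measurability of continuous functions on products. -/

section ProductMeasurability

lemma exists_cutoff_sequence (X : Type*) [TopologicalSpace X] [T2Space X] [LocallyCompactSpace X]
    [SigmaCompactSpace X] : ∃ e : ℕ → X → ℝ, (∀ n, Continuous (e n)) ∧
      (∀ n, HasCompactSupport (e n)) ∧ ∀ x, ∀ᶠ n in Filter.atTop, e n x = 1 := by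
  set K := CompactExhaustion.choice X
  have h : ∀ n, ∃ f : C(X, ℝ), Set.EqOn f 1 (K n) ∧ IsCompact (tsupport f) := fun n => by
    obtain ⟨f, h1, h2, -, -⟩ := exists_continuousMap_one_of_isCompact_subset_isOpen (K.isCompact n)
      isOpen_univ (Set.subset_univ _)
    exact ⟨f, h1, h2⟩
  choose f h1 h2 using h
  refine ⟨fun n => f n, fun n => (f n).continuous, h2, fun x => ?_⟩
  obtain ⟨n, hn⟩ := Set.mem_iUnion.1 (K.iUnion_eq ▸ Set.mem_univ x : x ∈ ⋃ n, K n)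
  filter_upwards [Filter.eventually_ge_atTop n] with k hk
  exact h1 k (K.subset hk hn)

/-- Continuous functions on products of sigma-compact spaces are measurable for the product
sigma-algebra. -/
lemma Continuous.measurable_of_sigmaCompact_prod {X Y : Type*} [TopologicalSpace X] [T2Space X]
    [LocallyCompactSpace X] [SigmaCompactSpace X] [MeasurableSpace X] [BorelSpace X]
    [TopologicalSpace Y] [T2Space Y] [LocallyCompactSpace Y] [SigmaCompactSpace Y]
    [MeasurableSpace Y] [BorelSpace Y] {f : X × Y → ℝ} (hf : Continuous f) : Measurable f := by
  obtain ⟨e, he, hes, he1⟩ := exists_cutoff_sequence (X × Y)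
  -- Without second countability the Borel sigma-algebra of the product may exceed the product
  -- sigma-algebra. Compactly supported continuous functions are measurable for the latter, and
  -- cut-offs reduce to them.
  refine measurable_of_tendsto_metrizable (f := fun n p => e n p * f p) (fun n =>
    HasCompactSupport.measurable_of_prod ((he n).mul hf) (hes n).mul_right)
    (tendsto_pi_nhds.2 fun p => ?_)
  refine tendsto_const_nhds.congr' ?_
  filter_upwards [he1 p] with n hn
  rw [hn, one_mul]

end ProductMeasurability

/-! ### Integrals over the quotient of right invariant functions. -/

section InvariantIntegral

variable {H : Type*} [Group H] [TopologicalSpace H] {Γ : Subgroup H}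

variable (Γ) in
/-- Continuous functions which are invariant under right translations by the subgroup. -/
def RightInvariant (F : H → ℝ) : Prop := Continuous F ∧ ∀ g (γ : Γ), F (g * γ) = F g

variable (Γ) in
/-- The integral over the quotient of a right invariant function. -/
noncomputable def quotientLIntegral (μ : @Measure (H ⧸ Γ) (borel (H ⧸ Γ))) (F : H → ℝ) : ℝ≥0∞ :=
  @lintegral (H ⧸ Γ) (borel (H ⧸ Γ)) μ fun x => ENNReal.ofReal (F x.out)

lemma RightInvariant.out {F : H → ℝ} (hF : RightInvariant Γ F) (g : H) :
    F (g : H ⧸ Γ).out = F g := by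
  obtain ⟨γ, hγ⟩ := QuotientGroup.mk_out_eq_mul Γ g
  rw [hγ, hF.2]

lemma RightInvariant.continuous_out {F : H → ℝ} (hF : RightInvariant Γ F) :
    Continuous fun x : H ⧸ Γ => F x.out := by
  rw [(QuotientGroup.isQuotientMap_mk Γ).continuous_iff]
  exact hF.1.congr fun g => (hF.out g).symm

lemma RightInvariant.const (a : ℝ) : RightInvariant Γ fun _ => a :=
  ⟨continuous_const, fun _ _ => rfl⟩

lemma RightInvariant.comp {F : H → ℝ} (hF : RightInvariant Γ F) {φ : ℝ → ℝ} (hφ : Continuous φ) :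
    RightInvariant Γ fun g => φ (F g) :=
  ⟨hφ.comp hF.1, fun g γ => by dsimp only; rw [hF.2]⟩

lemma RightInvariant.add {F F' : H → ℝ} (hF : RightInvariant Γ F) (hF' : RightInvariant Γ F') :
    RightInvariant Γ fun g => F g + F' g :=
  ⟨hF.1.add hF'.1, fun g γ => by dsimp only; rw [hF.2, hF'.2]⟩

lemma RightInvariant.sub {F F' : H → ℝ} (hF : RightInvariant Γ F) (hF' : RightInvariant Γ F') :
    RightInvariant Γ fun g => F g - F' g :=
  ⟨hF.1.sub hF'.1, fun g γ => by dsimp only; rw [hF.2, hF'.2]⟩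

lemma RightInvariant.mul {F F' : H → ℝ} (hF : RightInvariant Γ F) (hF' : RightInvariant Γ F') :
    RightInvariant Γ fun g => F g * F' g :=
  ⟨hF.1.mul hF'.1, fun g γ => by dsimp only; rw [hF.2, hF'.2]⟩

lemma RightInvariant.comp_mul_left [IsTopologicalGroup H] {F : H → ℝ} (hF : RightInvariant Γ F)
    (h : H) : RightInvariant Γ fun g => F (h * g) :=
  ⟨hF.1.comp (continuous_const_mul h), fun g γ => by dsimp only; rw [← mul_assoc, hF.2]⟩

variable {μ : @Measure (H ⧸ Γ) (borel (H ⧸ Γ))}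

lemma RightInvariant.measurable_out {F : H → ℝ} (hF : RightInvariant Γ F) :
    @Measurable (H ⧸ Γ) ℝ≥0∞ (borel (H ⧸ Γ)) _ fun x : H ⧸ Γ => ENNReal.ofReal (F x.out) := by
  let _ : MeasurableSpace (H ⧸ Γ) := borel (H ⧸ Γ)
  have _ : BorelSpace (H ⧸ Γ) := ⟨rfl⟩
  exact (ENNReal.continuous_ofReal.comp hF.continuous_out).measurable

lemma quotientLIntegral_mono {F F' : H → ℝ} (h : ∀ g, F g ≤ F' g) :
    quotientLIntegral Γ μ F ≤ quotientLIntegral Γ μ F' :=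
  @lintegral_mono _ (borel (H ⧸ Γ)) _ _ _ fun _ => ENNReal.ofReal_le_ofReal (h _)

lemma quotientLIntegral_add {F F' : H → ℝ} (hF : RightInvariant Γ F) (h0 : ∀ g, 0 ≤ F g)
    (h0' : ∀ g, 0 ≤ F' g) : quotientLIntegral Γ μ (fun g => F g + F' g) =
      quotientLIntegral Γ μ F + quotientLIntegral Γ μ F' := by
  let _ : MeasurableSpace (H ⧸ Γ) := borel (H ⧸ Γ)
  unfold quotientLIntegral
  rw [← lintegral_add_left hF.measurable_out]
  exact lintegral_congr fun x => ENNReal.ofReal_add (h0 _) (h0' _)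

lemma quotientLIntegral_const_mul {F : H → ℝ} (hF : RightInvariant Γ F) {a : ℝ} (ha : 0 ≤ a) :
    quotientLIntegral Γ μ (fun g => a * F g) = ENNReal.ofReal a * quotientLIntegral Γ μ F := by
  let _ : MeasurableSpace (H ⧸ Γ) := borel (H ⧸ Γ)
  unfold quotientLIntegral
  rw [← lintegral_const_mul _ hF.measurable_out]
  exact lintegral_congr fun x => ENNReal.ofReal_mul ha

variable [IsTopologicalGroup H]

lemma quotientLIntegral_const (hμ : IsInvariantProbability Γ μ) (a : ℝ) :
    quotientLIntegral Γ μ (fun _ => a) = ENNReal.ofReal a := by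
  let _ : MeasurableSpace (H ⧸ Γ) := borel (H ⧸ Γ)
  have h1 : IsProbabilityMeasure μ := hμ.1
  unfold quotientLIntegral
  rw [lintegral_const, measure_univ, mul_one]

lemma RightInvariant.out_smul {F : H → ℝ} (hF : RightInvariant Γ F) (h : H) (x : H ⧸ Γ) :
    F (h • x).out = F (h * x.out) := by
  have : h • x = ((h * x.out : H) : H ⧸ Γ) := by
    conv_lhs => rw [← QuotientGroup.out_eq' x]
    rfl
  rw [this, hF.out]

lemma quotientLIntegral_comp_mul_left (hμ : IsInvariantProbability Γ μ) {F : H → ℝ}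
    (hF : RightInvariant Γ F) (h : H) :
    quotientLIntegral Γ μ (fun g => F (h * g)) = quotientLIntegral Γ μ F := by
  let _ : MeasurableSpace (H ⧸ Γ) := borel (H ⧸ Γ)
  have _ : BorelSpace (H ⧸ Γ) := ⟨rfl⟩
  have h2 : SMulInvariantMeasure H (H ⧸ Γ) μ := hμ.2.2
  unfold quotientLIntegral
  have hm : Measurable fun x : H ⧸ Γ => h • x := (continuous_const_smul h).measurable
  have hmp : MeasurePreserving (fun x : H ⧸ Γ => h • x) μ μ := measurePreserving_smul h μ
  rw [← hmp.lintegral_comp hF.measurable_out]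
  exact lintegral_congr fun x => by rw [hF.out_smul]

/-- Nonempty open sets of the quotient have positive measure. -/
lemma measure_pos_of_isOpen [SigmaCompactSpace H] (hμ : IsInvariantProbability Γ μ)
    {U : Set (H ⧸ Γ)} (hU : IsOpen U) (hne : U.Nonempty) : 0 < μ U := by
  let _ : MeasurableSpace (H ⧸ Γ) := borel (H ⧸ Γ)
  have _ : BorelSpace (H ⧸ Γ) := ⟨rfl⟩
  have h1 : IsProbabilityMeasure μ := hμ.1
  have h2 : SMulInvariantMeasure H (H ⧸ Γ) μ := hμ.2.2
  by_contra hn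
  have h0 : μ U = 0 := by simpa using hn
  obtain ⟨x, hx⟩ := hne
  have hcov : ∀ n, ∃ t : Finset H, ((↑) : H → H ⧸ Γ) '' compactCovering H n ⊆
      ⋃ g ∈ t, (fun y => g • y) ⁻¹' U := fun n => by
    refine ((isCompact_compactCovering H n).image QuotientGroup.continuous_mk).elim_finite_subcover
      (fun g : H => (fun y => g • y) ⁻¹' U) (fun g => hU.preimage (continuous_const_smul g))
      fun y _ => ?_
    obtain ⟨g, hg⟩ := MulAction.exists_smul_eq H y x
    exact Set.mem_iUnion.2 ⟨g, by simpa [hg] using hx⟩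
  have hz : ∀ n, μ (((↑) : H → H ⧸ Γ) '' compactCovering H n) = 0 := fun n => by
    obtain ⟨t, ht⟩ := hcov n
    refine measure_mono_null ht ((measure_biUnion_null_iff t.countable_toSet).2 fun g _ => ?_)
    rw [measure_preimage_smul, h0]
  have : (Set.univ : Set (H ⧸ Γ)) = ⋃ n, ((↑) : H → H ⧸ Γ) '' compactCovering H n := by
    rw [← Set.image_iUnion, iUnion_compactCovering, Set.image_univ]
    exact (QuotientGroup.mk_surjective.range_eq).symm
  have h3 : μ Set.univ = 0 := by
    rw [this]; exact measure_iUnion_null hz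
  rw [measure_univ] at h3
  exact one_ne_zero h3

lemma ofReal_mul_le_quotientLIntegral {F : H → ℝ} (hF : RightInvariant Γ F) {V : Set H} {a : ℝ}
    (h : ∀ g ∈ V, a ≤ F g) :
    ENNReal.ofReal a * μ (((↑) : H → H ⧸ Γ) '' V) ≤ quotientLIntegral Γ μ F := by
  let _ : MeasurableSpace (H ⧸ Γ) := borel (H ⧸ Γ)
  refine le_trans ?_ (mul_meas_ge_le_lintegral hF.measurable_out (ENNReal.ofReal a))
  gcongr
  rintro _ ⟨g, hg, rfl⟩
  change ENNReal.ofReal a ≤ ENNReal.ofReal (F (g : H ⧸ Γ).out)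
  rw [hF.out]
  exact ENNReal.ofReal_le_ofReal (h g hg)

lemma eq_zero_of_quotientLIntegral_eq_zero [SigmaCompactSpace H]
    (hμ : IsInvariantProbability Γ μ) {F : H → ℝ}
    (hF : RightInvariant Γ F) (h : quotientLIntegral Γ μ F = 0) (g : H) : F g ≤ 0 := by
  by_contra hn
  push Not at hn
  have hV : IsOpen {x | F g / 2 < F x} := isOpen_lt continuous_const hF.1
  have h1 := ofReal_mul_le_quotientLIntegral (μ := μ) hF (V := {x | F g / 2 < F x}) (a := F g / 2)
    fun x hx => le_of_lt hx
  rw [h, nonpos_iff_eq_zero, mul_eq_zero, ENNReal.ofReal_eq_zero] at h1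
  rcases h1 with h1 | h1
  · linarith
  · exact (measure_pos_of_isOpen hμ (QuotientGroup.isOpenMap_coe _ hV)
      ⟨_, g, half_lt_self hn, rfl⟩).ne' h1

/-- There is a compact set whose image has at least half the measure. -/
lemma exists_isCompact_half [SigmaCompactSpace H] (hμ : IsInvariantProbability Γ μ) :
    ∃ L : Set H, IsCompact L ∧ 1 / 2 ≤ μ (((↑) : H → H ⧸ Γ) '' L) := by
  let _ : MeasurableSpace (H ⧸ Γ) := borel (H ⧸ Γ)
  have h1 : IsProbabilityMeasure μ := hμ.1
  have hmono : Monotone fun n => ((↑) : H → H ⧸ Γ) '' compactCovering H n :=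
    fun a b hab => Set.image_mono (compactCovering_subset H hab)
  have h := tendsto_measure_iUnion_atTop (μ := μ) hmono
  rw [← Set.image_iUnion, iUnion_compactCovering, Set.image_univ,
    QuotientGroup.mk_surjective.range_eq, measure_univ] at h
  obtain ⟨n, hn⟩ := (h.eventually (lt_mem_nhds (show (1 / 2 : ℝ≥0∞) < 1 by simp))).exists
  exact ⟨_, isCompact_compactCovering H n, hn.le⟩

lemma quotientLIntegral_le_liminf {F : ℕ → H → ℝ} {F' : H → ℝ} (hF : ∀ n, RightInvariant Γ (F n))
    (h : ∀ g, Filter.Tendsto (fun n => F n g) Filter.atTop (𝓝 (F' g))) :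
    quotientLIntegral Γ μ F' ≤
      Filter.liminf (fun n => quotientLIntegral Γ μ (F n)) Filter.atTop := by
  let _ : MeasurableSpace (H ⧸ Γ) := borel (H ⧸ Γ)
  unfold quotientLIntegral
  refine le_trans (lintegral_mono fun x => ?_) (lintegral_liminf_le fun n => (hF n).measurable_out)
  exact ((ENNReal.continuous_ofReal.tendsto _).comp (h x.out)).liminf_eq.ge

/-- Tonelli for averages of right invariant functions. -/
lemma quotientLIntegral_integral_swap [T2Space H] [LocallyCompactSpace H] [SigmaCompactSpace H]
    [DiscreteTopology Γ] (hμ : IsInvariantProbability Γ μ) {A : Type*} [TopologicalSpace A]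
    [T2Space A] [LocallyCompactSpace A] [SigmaCompactSpace A] [MeasurableSpace A] [BorelSpace A]
    {m : Measure A} [IsFiniteMeasure m] {F : A → H → ℝ} (hFc : Continuous F.uncurry)
    (hF : ∀ a, RightInvariant Γ (F a)) (h0 : ∀ a g, 0 ≤ F a g)
    (hi : ∀ g, Integrable (fun a => F a g) m) :
    quotientLIntegral Γ μ (fun g => ∫ a, F a g ∂m) = ∫⁻ a, quotientLIntegral Γ μ (F a) ∂m := by
  let _ : MeasurableSpace (H ⧸ Γ) := borel (H ⧸ Γ)
  have _ : BorelSpace (H ⧸ Γ) := ⟨rfl⟩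
  have h1 : IsProbabilityMeasure μ := hμ.1
  have _ : IsClosed (Γ : Set H) := Subgroup.isClosed_of_discrete
  have _ : T2Space (H ⧸ Γ) := inferInstance
  have _ : SigmaCompactSpace (H ⧸ Γ) := by
    rw [← isSigmaCompact_univ_iff, ← (QuotientGroup.mk_surjective (s := Γ)).range_eq]
    exact isSigmaCompact_range QuotientGroup.continuous_mk
  have hc : Continuous fun p : (H ⧸ Γ) × A => F p.2 p.1.out := by
    rw [((QuotientGroup.isOpenQuotientMap_mk (N := Γ)).prodMap
      (IsOpenQuotientMap.id (X := A))).isQuotientMap.continuous_iff]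
    exact (hFc.comp continuous_swap).congr fun p => ((hF p.2).out p.1).symm
  have hm : Measurable fun p : (H ⧸ Γ) × A => ENNReal.ofReal (F p.2 p.1.out) :=
    hc.measurable_of_sigmaCompact_prod.ennreal_ofReal
  calc quotientLIntegral Γ μ (fun g => ∫ a, F a g ∂m)
      = ∫⁻ x : H ⧸ Γ, ∫⁻ a, ENNReal.ofReal (F a x.out) ∂m ∂μ :=
        lintegral_congr fun x => ofReal_integral_eq_lintegral_ofReal (hi _)
          (ae_of_all _ fun a => h0 _ _)
    _ = ∫⁻ a, quotientLIntegral Γ μ (F a) ∂m :=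
        lintegral_lintegral_swap hm.aemeasurable

lemma quotientLIntegral_integral [T2Space H] [LocallyCompactSpace H] [SigmaCompactSpace H]
    [DiscreteTopology Γ] (hμ : IsInvariantProbability Γ μ) {A : Type*} [TopologicalSpace A]
    [T2Space A] [LocallyCompactSpace A] [SigmaCompactSpace A] [MeasurableSpace A] [BorelSpace A]
    {m : Measure A} [IsProbabilityMeasure m] {j : A → H} (hj : Continuous j) {F : H → ℝ}
    (hF : RightInvariant Γ F) (h0 : ∀ g, 0 ≤ F g)
    (hi : ∀ g, Integrable (fun a => F (j a * g)) m) :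
    quotientLIntegral Γ μ (fun g => ∫ a, F (j a * g) ∂m) = quotientLIntegral Γ μ F := by
  rw [quotientLIntegral_integral_swap hμ (F := fun a g => F (j a * g))
    (hF.1.comp ((hj.comp continuous_fst).mul continuous_snd)) (fun a => hF.comp_mul_left _)
    (fun _ _ => h0 _) hi]
  simp only [quotientLIntegral_comp_mul_left hμ hF]
  simp

lemma eLpNorm_out_sq (F : H → ℝ) :
    @eLpNorm _ _ _ (borel (H ⧸ Γ)) (fun x => F x.out) 2 μ ^ 2 =
      quotientLIntegral Γ μ fun g => F g ^ 2 := by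
  let _ : MeasurableSpace (H ⧸ Γ) := borel (H ⧸ Γ)
  have h := eLpNorm_nnreal_pow_eq_lintegral (f := fun x : H ⧸ Γ => F x.out) (μ := μ) (p := 2)
    two_ne_zero
  have h2 : ((2 : NNReal) : ℝ) = ((2 : ℕ) : ℝ) := by simp
  rw [h2, ENNReal.rpow_natCast] at h
  refine h.trans (lintegral_congr fun x => ?_)
  rw [ENNReal.rpow_natCast, ← ofReal_norm, ← ENNReal.ofReal_pow (norm_nonneg _),
    Real.norm_eq_abs, sq_abs]

/-- Weak cocompactness in terms of right invariant functions. -/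
lemma IsWeaklyCocompact.exists_gap (hw : IsWeaklyCocompact Γ) :
    ∃ μ : @Measure (H ⧸ Γ) (borel (H ⧸ Γ)), IsInvariantProbability Γ μ ∧
      ∃ K : Set H, IsCompact K ∧ ∃ ε : ℝ, 0 < ε ∧ ∀ F : H → ℝ, RightInvariant Γ F →
        quotientLIntegral Γ μ (fun g => F g ^ 2) < ⊤ → ∃ a : ℝ,
          quotientLIntegral Γ μ (fun g => (F g - a) ^ 2) = 0 ∨ ∃ k ∈ K, ∃ k' ∈ K,
            ENNReal.ofReal (ε ^ 2) * quotientLIntegral Γ μ (fun g => (F g - a) ^ 2) ≤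
              quotientLIntegral Γ μ fun g => (F (k⁻¹ * g) - F (k'⁻¹ * g)) ^ 2 := by
  let _ : MeasurableSpace (H ⧸ Γ) := borel (H ⧸ Γ)
  have _ : BorelSpace (H ⧸ Γ) := ⟨rfl⟩
  obtain ⟨μ, hμ, K, hK, ε, hε, h⟩ := hw
  have h1 : IsProbabilityMeasure μ := hμ.1
  refine ⟨μ, hμ, K, hK, ε, hε, fun F hF hfin => ?_⟩
  set f : H ⧸ Γ → ℝ := fun x => F x.out with hf
  have hfm : MemLp f 2 μ := by
    refine ⟨hF.continuous_out.measurable.aestronglyMeasurable, ?_⟩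
    rw [← eLpNorm_out_sq] at hfin
    exact (ENNReal.pow_lt_top_iff.1 hfin).resolve_right (by simp)
  -- The constant is the mean, so that `F - a` has integral zero; the gap is applied to its
  -- normalization.
  set a : ℝ := ∫ x, f x ∂μ with ha
  refine ⟨a, ?_⟩
  have hfa : MemLp (fun x => f x - a) 2 μ := hfm.sub (memLp_const a)
  set c : ℝ≥0∞ := eLpNorm (fun x => f x - a) 2 μ with hc
  have hc2 : c ^ 2 = quotientLIntegral Γ μ (fun g => (F g - a) ^ 2) :=
    eLpNorm_out_sq fun g => F g - a
  rcases eq_or_ne c 0 with h0 | h0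
  · left
    rw [← hc2, h0]; simp
  right
  have hct : c ≠ ⊤ := hfa.2.ne
  have hcr : 0 < c.toReal := ENNReal.toReal_pos h0 hct
  have hsm : ∀ u : H ⧸ Γ → ℝ, eLpNorm (fun x => c.toReal⁻¹ * u x) 2 μ = c⁻¹ * eLpNorm u 2 μ :=
    fun u => by
    have := eLpNorm_const_smul (c.toReal⁻¹) u 2 μ
    refine (this : _).trans ?_
    congr 1
    rw [← ofReal_norm, norm_inv, Real.norm_of_nonneg hcr.le,
      ENNReal.ofReal_inv_of_pos hcr, ENNReal.ofReal_toReal hct]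
  obtain ⟨k, hk, k', hk', hkk⟩ := h (fun x => c.toReal⁻¹ * (f x - a)) (hfa.const_mul _) (by
    rw [integral_const_mul, integral_sub (hfm.integrable (by norm_num)) (integrable_const a)]
    simp [ha]) (by
    rw [hsm, ← hc, ENNReal.inv_mul_cancel h0 hct])
  refine ⟨k, hk, k', hk', ?_⟩
  have h3 : (fun x => c.toReal⁻¹ * (f (k⁻¹ • x) - a) - c.toReal⁻¹ * (f (k'⁻¹ • x) - a)) =
      fun x => c.toReal⁻¹ * ((fun g => F (k⁻¹ * g) - F (k'⁻¹ * g)) x.out) := by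
    funext x
    simp only [hf, hF.out_smul]
    ring
  rw [h3, hsm, ← ENNReal.div_eq_inv_mul, ENNReal.le_div_iff_mul_le (Or.inl h0) (Or.inl hct)] at hkk
  rw [← hc2, ← eLpNorm_out_sq, ENNReal.ofReal_pow hε.le, ← mul_pow]
  exact pow_le_pow_left' hkk 2

end InvariantIntegral

/-! ### Elementary inequalities for powers between one and two. -/

section PowerInequalities

variable {p : ℝ}

/-- A quantitative form of the convexity of the `p`-th power, for `1 < p ≤ 2`. -/
lemma rpow_tangent_add_sq_le (hp : 1 < p) (hp2 : p ≤ 2) {t b : ℝ} (ht : 0 ≤ t) (hb : 0 ≤ b) :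
    b ^ p + p * b ^ (p - 1) * (t - b) + (p - 1) * (t ^ (p / 2) - b ^ (p / 2)) ^ 2 ≤ t ^ p := by
  have hp0 : 0 < p := by linarith
  have hsq : ∀ s : ℝ, 0 ≤ s → s ^ p = (s ^ (p / 2)) ^ 2 := fun s hs => by
    rw [← Real.rpow_natCast, ← Real.rpow_mul hs]; congr 1; push_cast; ring
  have hbp : b ^ (p - 1) * b = b ^ p := by
    rcases hb.eq_or_lt with rfl | hb'
    · rw [mul_zero, Real.zero_rpow hp0.ne']
    · rw [← Real.rpow_add_one hb'.ne']; congr 1; ring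
  -- Expanding the square and cancelling the terms in `b ^ p` leaves a bound on `p * t * b ^ (p -
  -- 1)`, which is the weighted inequality of means with these weights.
  have h := Real.geom_mean_le_arith_mean2_weighted (w₁ := (2 - p) / p) (w₂ := 2 * (p - 1) / p)
    (p₁ := t ^ p) (p₂ := t ^ (p / 2) * b ^ (p / 2)) (div_nonneg (by linarith) hp0.le)
    (div_nonneg (by linarith) hp0.le) (by positivity) (by positivity) (by field_simp; ring)
  have h1 : (t ^ p) ^ ((2 - p) / p) * (t ^ (p / 2) * b ^ (p / 2)) ^ (2 * (p - 1) / p) =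
      t * b ^ (p - 1) := by
    rw [Real.mul_rpow (by positivity) (by positivity), ← Real.rpow_mul ht, ← Real.rpow_mul ht,
      ← Real.rpow_mul hb, ← mul_assoc, ← Real.rpow_add_of_nonneg ht]
    · have e1 : p * ((2 - p) / p) + p / 2 * (2 * (p - 1) / p) = 1 := by field_simp; ring
      have e2 : p / 2 * (2 * (p - 1) / p) = p - 1 := by field_simp
      rw [e1, e2, Real.rpow_one]
    · rw [mul_div_cancel₀ _ hp0.ne']; linarith
    · have e2 : p / 2 * (2 * (p - 1) / p) = p - 1 := by field_simp
      rw [e2]; linarith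
  rw [h1] at h
  have h2 := mul_le_mul_of_nonneg_left h hp0.le
  have h3 : p * ((2 - p) / p * t ^ p + 2 * (p - 1) / p * (t ^ (p / 2) * b ^ (p / 2))) =
      (2 - p) * t ^ p + 2 * (p - 1) * (t ^ (p / 2) * b ^ (p / 2)) := by field_simp
  rw [h3] at h2
  have e3 : p * b ^ (p - 1) * (t - b) = p * (t * b ^ (p - 1)) - p * b ^ p := by
    rw [← hbp]; ring
  rw [e3]
  rw [hsq t ht, hsq b hb] at *
  nlinarith

/-- With `w = t ^ (p / 2)`, the number `w ^ 2 = t ^ p` lies farther from one than `t`, on the same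
side, and `w ^ 2 - 1 = 2 (w - 1) + (w - 1) ^ 2`. -/
lemma abs_rpow_sub_one_le (hp : 1 < p) {t : ℝ} (ht : 0 ≤ t) :
    |t - 1| ≤ 2 * |t ^ (p / 2) - 1| + (t ^ (p / 2) - 1) ^ 2 := by
  have hp0 : 0 < p := by linarith
  set w := t ^ (p / 2) with hw
  have hw0 : 0 ≤ w := by positivity
  have hwp : w ^ 2 = t ^ p := by
    rw [hw, ← Real.rpow_natCast, ← Real.rpow_mul ht]; congr 1; push_cast; ring
  rcases le_total 1 t with h1 | h1
  · have h2 : 1 ≤ w := Real.one_le_rpow h1 (by positivity)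
    have h3 : t ≤ w ^ 2 := by
      rw [hwp]
      calc t = t ^ (1 : ℝ) := (Real.rpow_one t).symm
        _ ≤ t ^ p := Real.rpow_le_rpow_of_exponent_le h1 hp.le
    rw [abs_of_nonneg (by linarith), abs_of_nonneg (by linarith)]
    nlinarith
  · have h2 : w ≤ 1 := Real.rpow_le_one ht h1 (by positivity)
    have h3 : w ^ 2 ≤ t := by
      rw [hwp]
      rcases ht.eq_or_lt with rfl | ht'
      · rw [Real.zero_rpow hp0.ne']
      · calc t ^ p ≤ t ^ (1 : ℝ) := Real.rpow_le_rpow_of_exponent_ge ht' h1 hp.le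
          _ = t := Real.rpow_one t
    rw [abs_of_nonpos (by linarith), abs_of_nonpos (by linarith)]
    nlinarith

/-- `b ^ p - a ^ p` is at least `b ^ (p - 1) * (b - a)`, and `b ^ (p - 1) ≥ 1 / 2` because the
exponent is at most one. -/
lemma half_mul_sub_le_rpow_sub (hp : 1 < p) (hp2 : p ≤ 2) {a b : ℝ} (ha : 0 ≤ a) (hab : a ≤ b)
    (hb : 1 / 2 ≤ b) : 1 / 2 * (b - a) ≤ b ^ p - a ^ p := by
  have hmul : ∀ s : ℝ, 0 ≤ s → s ^ p = s ^ (p - 1) * s := fun s hs => by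
    rcases hs.eq_or_lt with rfl | hs'
    · rw [mul_zero, Real.zero_rpow (by linarith)]
    · rw [← Real.rpow_add_one hs'.ne']; congr 1; ring
  have h1 : a ^ (p - 1) ≤ b ^ (p - 1) := Real.rpow_le_rpow ha hab (by linarith)
  have h2 : 1 / 2 ≤ b ^ (p - 1) := by
    calc (1 / 2 : ℝ) = (1 / 2) ^ (1 : ℝ) := (Real.rpow_one _).symm
      _ ≤ (1 / 2) ^ (p - 1) :=
        Real.rpow_le_rpow_of_exponent_ge (by norm_num) (by norm_num) (by linarith)
      _ ≤ b ^ (p - 1) := Real.rpow_le_rpow (by norm_num) hb (by linarith)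
  rw [hmul a ha, hmul b (ha.trans hab)]
  nlinarith

end PowerInequalities

/-! ### Jensen's inequality for averages, with its defect. -/

section AverageInequalities

variable {ι : Type*} [Fintype ι] [DecidableEq ι] {G : ι → Type*} [∀ i, Group (G i)]
  [∀ i, TopologicalSpace (G i)] [∀ i, IsTopologicalGroup (G i)] [∀ i, T2Space (G i)]
  [∀ i, LocallyCompactSpace (G i)] [∀ i, SigmaCompactSpace (G i)]
  [∀ i, MeasurableSpace (G i)] [∀ i, BorelSpace (G i)]
  {m q : ∀ i, Measure (G i)} [∀ i, IsProbabilityMeasure (m i)] [∀ i, IsProbabilityMeasure (q i)]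
  {p : ℝ}

variable (m) in
/-- The measures are carried by compact sets. -/
def CompactlyCarried : Prop := ∀ i, ∃ K, IsCompact K ∧ m i Kᶜ = 0

lemma CompactlyCarried.admissible (hm : CompactlyCarried m) {V : Type*} [NormedAddCommGroup V]
    {f : (∀ i, G i) → V} (hf : Continuous f) : Admissible m f := ⟨hf, Or.inr hm⟩

lemma sq_avg_le (hm : CompactlyCarried m) {t : (∀ i, G i) → ℝ} (ht : Continuous t) (l : List ι)
    (g : ∀ i, G i) : avg m l t g ^ 2 ≤ avg m l (fun x => t x ^ 2) g := by
  set b := avg m l t g with hb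
  have h := avg_mono (hm.admissible (f := fun x => (2 * b) • t x - b ^ 2) (by fun_prop))
    (hm.admissible (f := fun x => t x ^ 2) (by fun_prop)) (fun x => by
      have := sq_nonneg (t x - b)
      simp only [smul_eq_mul]; nlinarith) l g
  rw [avg_sub (hm.admissible (by fun_prop)) (Admissible.const _), avg_const,
    avg_smul (hm.admissible ht), ← hb, smul_eq_mul] at h
  nlinarith

/-- Averaging the tangent inequality at the mean kills its linear term and leaves the variation of
`t ^ (p / 2)` as the defect in Jensen's inequality. -/
lemma rpow_avg_add_le (hm : CompactlyCarried m) (hp : 1 < p) (hp2 : p ≤ 2) {t : (∀ i, G i) → ℝ}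
    (ht : Continuous t) (ht0 : ∀ g, 0 ≤ t g) (l : List ι) (g : ∀ i, G i) :
    avg m l t g ^ p +
      (p - 1) * avg m l (fun x => (t x ^ (p / 2) - avg m l t g ^ (p / 2)) ^ 2) g ≤
      avg m l (fun x => t x ^ p) g := by
  set b := avg m l t g with hb
  have hb0 : 0 ≤ b := avg_nonneg ht0 l g
  have hc : ∀ r : ℝ, 0 ≤ r → Continuous fun x => t x ^ r := fun r hr =>
    (Real.continuous_rpow_const hr).comp ht
  have hc2 : Continuous fun x => (t x ^ (p / 2) - b ^ (p / 2)) ^ 2 :=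
    ((hc _ (by linarith)).sub continuous_const).pow 2
  have key : ∀ (c c' : ℝ) (s : (∀ i, G i) → ℝ), Continuous s →
      Continuous fun x => c • t x + c' • s x := fun c c' s hs => by fun_prop
  have h := avg_mono (hm.admissible (f := fun x => (b ^ p - p * b ^ (p - 1) * b) +
      ((p * b ^ (p - 1)) • t x + (p - 1) • (t x ^ (p / 2) - b ^ (p / 2)) ^ 2))
      (continuous_const.add (key _ _ _ hc2)))
    (hm.admissible (hc p (by linarith))) (fun x => by
      have := rpow_tangent_add_sq_le hp hp2 (ht0 x) hb0
      simp only [smul_eq_mul]; linarith) l g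
  rw [avg_add (Admissible.const _) (hm.admissible (key _ _ _ hc2)),
    avg_const, avg_add ((hm.admissible ht).smul _) ((hm.admissible hc2).smul _),
    avg_smul (hm.admissible ht), avg_smul (hm.admissible hc2), ← hb, smul_eq_mul,
    smul_eq_mul] at h
  linarith

lemma rpow_avg_le (hm : CompactlyCarried m) (hp : 1 < p) (hp2 : p ≤ 2) {t : (∀ i, G i) → ℝ}
    (ht : Continuous t) (ht0 : ∀ g, 0 ≤ t g) (l : List ι) (g : ∀ i, G i) :
    avg m l t g ^ p ≤ avg m l (fun x => t x ^ p) g := by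
  have h := rpow_avg_add_le hm hp hp2 ht ht0 l g
  have h1 : 0 ≤ avg m l (fun x => (t x ^ (p / 2) - avg m l t g ^ (p / 2)) ^ 2) g :=
    avg_nonneg (fun _ => sq_nonneg _) l g
  nlinarith

lemma rpow_norm_avg_le (hm : CompactlyCarried m) (hp : 1 < p) (hp2 : p ≤ 2) {E : Type*}
    [NormedAddCommGroup E] [NormedSpace ℝ E] {u : (∀ i, G i) → E} (hu : Continuous u) (l : List ι)
    (g : ∀ i, G i) : ‖avg m l u g‖ ^ p ≤ avg m l (fun x => ‖u x‖ ^ p) g :=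
  (Real.rpow_le_rpow (norm_nonneg _) (norm_avg_le (hm.admissible hu) l g) (by linarith)).trans
    (rpow_avg_le hm hp hp2 hu.norm (fun _ => norm_nonneg _) l g)

variable {Γ : Subgroup (∀ i, G i)} {μ : @Measure ((∀ i, G i) ⧸ Γ) (borel ((∀ i, G i) ⧸ Γ))}

lemma RightInvariant.avg (hm : CompactlyCarried m) {F : (∀ i, G i) → ℝ} (hF : RightInvariant Γ F)
    (l : List ι) : RightInvariant Γ (avg m l F) :=
  ⟨((hm.admissible hF.1).avg l).1, fun g γ => by
    rw [← avg_comp_mul_right]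
    simp only [hF.2]⟩

lemma quotientLIntegral_avg [DiscreteTopology Γ] (hμ : IsInvariantProbability Γ μ)
    (hm : CompactlyCarried m) {F : (∀ i, G i) → ℝ} (hF : RightInvariant Γ F) (h0 : ∀ g, 0 ≤ F g)
    (l : List ι) : quotientLIntegral Γ μ (avg m l F) = quotientLIntegral Γ μ F := by
  induction l with
  | nil => rfl
  | cons i l ih =>
    rw [← ih]
    exact quotientLIntegral_integral hμ (j := fun a => (Pi.mulSingle i a)⁻¹)
      ((continuous_mulSingle i).inv) (hF.avg hm l) (avg_nonneg h0 l)
      fun g => ((hm.admissible hF.1).avg l).integrable i g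

lemma quotientLIntegral_le_of_le_add {F F₁ F₂ : (∀ i, G i) → ℝ} (h₁ : RightInvariant Γ F₁)
    (h₂ : RightInvariant Γ F₂) (h₁0 : ∀ g, 0 ≤ F₁ g) (h₂0 : ∀ g, 0 ≤ F₂ g) {c₁ c₂ x₁ x₂ : ℝ}
    (hc₁ : 0 ≤ c₁) (hc₂ : 0 ≤ c₂) (hx₁ : 0 ≤ x₁) (hx₂ : 0 ≤ x₂)
    (h : ∀ g, F g ≤ c₁ * F₁ g + c₂ * F₂ g)
    (hJ₁ : quotientLIntegral Γ μ F₁ ≤ ENNReal.ofReal x₁)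
    (hJ₂ : quotientLIntegral Γ μ F₂ ≤ ENNReal.ofReal x₂) :
    quotientLIntegral Γ μ F ≤ ENNReal.ofReal (c₁ * x₁ + c₂ * x₂) := by
  refine (quotientLIntegral_mono h).trans ?_
  rw [quotientLIntegral_add ((RightInvariant.const c₁).mul h₁)
    (fun g => mul_nonneg hc₁ (h₁0 g)) (fun g => mul_nonneg hc₂ (h₂0 g)),
    quotientLIntegral_const_mul h₁ hc₁, quotientLIntegral_const_mul h₂ hc₂,
    ENNReal.ofReal_add (mul_nonneg hc₁ hx₁) (mul_nonneg hc₂ hx₂), ENNReal.ofReal_mul hc₁,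
    ENNReal.ofReal_mul hc₂]
  gcongr

end AverageInequalities

/-! ### The spectral gap makes the norm of an extremal function nearly constant. -/

section Contraction

variable {ι : Type*} [Fintype ι] [DecidableEq ι] {G : ι → Type*} [∀ i, Group (G i)]
  [∀ i, TopologicalSpace (G i)] [∀ i, IsTopologicalGroup (G i)] [∀ i, T2Space (G i)]
  [∀ i, LocallyCompactSpace (G i)] [∀ i, SigmaCompactSpace (G i)]
  [∀ i, MeasurableSpace (G i)] [∀ i, BorelSpace (G i)]
  {m q : ∀ i, Measure (G i)} [∀ i, IsProbabilityMeasure (m i)] [∀ i, IsProbabilityMeasure (q i)]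
  {p : ℝ} {Γ : Subgroup (∀ i, G i)} {μ : @Measure ((∀ i, G i) ⧸ Γ) (borel ((∀ i, G i) ⧸ Γ))}

lemma avg_sq_sub (hm : CompactlyCarried m) {w : (∀ i, G i) → ℝ} (hw : Continuous w) (b : ℝ)
    (l : List ι) (g : ∀ i, G i) : avg m l (fun x => (w x - b) ^ 2) g =
      avg m l (fun x => w x ^ 2) g - 2 * b * avg m l w g + b ^ 2 := by
  have h1 : (fun x => (w x - b) ^ 2) = fun x => (w x ^ 2 - (2 * b) • w x) + b ^ 2 := by
    funext x; simp only [smul_eq_mul]; ring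
  have hw2 : Continuous fun x => w x ^ 2 := hw.pow 2
  rw [h1, avg_add (f := fun x => w x ^ 2 - (2 * b) • w x)
    ((hm.admissible hw2).sub ((hm.admissible hw).smul _)) (Admissible.const _), avg_const,
    avg_sub (hm.admissible hw2) ((hm.admissible hw).smul _), avg_smul (hm.admissible hw),
    smul_eq_mul]

lemma RightInvariant.avg_sq_sub (hm : CompactlyCarried m) {w B : (∀ i, G i) → ℝ}
    (hw : RightInvariant Γ w) (hB : RightInvariant Γ B) (l : List ι) :
    RightInvariant Γ fun g => _root_.avg m l (fun x => (w x - B g) ^ 2) g := by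
  simp only [_root_.avg_sq_sub hm hw.1]
  exact (((hw.comp (continuous_pow 2)).avg hm l).sub
    (((RightInvariant.const 2).mul hB).mul (hw.avg hm l))).add (hB.comp (continuous_pow 2))

lemma sq_avg_sub_le {C : NNReal} (hm : CompactlyCarried m) (hq : CompactlyCarried q)
    {w : (∀ i, G i) → ℝ} (hw : Continuous w) {l : List ι} (hl : l.Nodup) (hlu : ∀ i, i ∈ l)
    {k : ∀ i, G i} (hk : ∀ i, (q i).map (fun h => k i * h) ≤ C • m i) (b : ℝ) (g : ∀ i, G i) :
    (avg q l w (k⁻¹ * g) - b) ^ 2 ≤ (C : ℝ) ^ l.length * avg m l (fun x => (w x - b) ^ 2) g := by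
  have hc : Continuous fun x => w x - b := hw.sub continuous_const
  have h1 := sq_avg_le hq hc l (k⁻¹ * g)
  rw [avg_sub (hq.admissible hw) (Admissible.const _), avg_const] at h1
  exact h1.trans (avg_le_of_map_le (hm.admissible (hc.pow 2)) (hq.admissible (hc.pow 2))
    (fun x => sq_nonneg _) hl (fun i _ => hk i) (fun i hi => absurd (hlu i) hi) g)

/-- To be used with `P` the mean of `(w - b) ^ 2` and `x` the mean of `w - b`: the left side is then
the mean of `(w - b + y + z) ^ 2`. -/
lemma sum_sq_le {x y z D P : ℝ} (hx : x ^ 2 ≤ P) (hy : y ^ 2 ≤ D * P) :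
    P + 2 * x * (y + z) + (y + z) ^ 2 ≤ 3 * (1 + D) * P + 3 * z ^ 2 := by
  have h : (x + y + z) ^ 2 ≤ 3 * x ^ 2 + 3 * y ^ 2 + 3 * z ^ 2 := by
    nlinarith [sq_nonneg (x - y), sq_nonneg (y - z), sq_nonneg (x - z)]
  nlinarith

/-- A function of square norm one which is close to a constant is close to the constant one. -/
lemma exists_sub_one_sq_le (hμ : IsInvariantProbability Γ μ) {δ : ℝ} (hδ : 0 < δ) :
    ∃ κ : ℝ, 0 < κ ∧ ∀ w : (∀ i, G i) → ℝ, RightInvariant Γ w → (∀ g, 0 ≤ w g) →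
      quotientLIntegral Γ μ (fun g => w g ^ 2) = 1 → ∀ a : ℝ,
      quotientLIntegral Γ μ (fun g => (w g - a) ^ 2) ≤ ENNReal.ofReal κ →
      quotientLIntegral Γ μ (fun g => (w g - 1) ^ 2) ≤ ENNReal.ofReal δ := by
  set t : ℝ := min 1 (Real.sqrt δ / 4) with ht
  have ht0 : 0 < t := by positivity
  have ht1 : t ≤ 1 := min_le_left _ _
  have htδ : 4 * t ^ 2 ≤ δ / 4 := by
    have h1 : t ≤ Real.sqrt δ / 4 := min_le_right _ _
    have h2 := Real.sq_sqrt hδ.le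
    nlinarith
  set κ : ℝ := min (δ / 4) (t / (1 + 1 / t)) with hκ
  have hκ0 : 0 < κ := by positivity
  have hRη1 : κ ≤ δ / 4 := min_le_left _ _
  have hRη2 : (1 + 1 / t) * κ ≤ t := by
    have h1 : κ ≤ _ := min_le_right _ _
    rwa [le_div_iff₀ (by positivity), mul_comm] at h1
  refine ⟨κ, hκ0, fun w hwI hw0 hJw a hJwa => ?_⟩
  have hsqI : ∀ {f : (∀ i, G i) → ℝ}, RightInvariant Γ f → RightInvariant Γ fun g => f g ^ 2 :=
    fun hf => hf.comp (continuous_pow 2)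
  set A : ℝ := |a| with hA
  have hA0 : 0 ≤ A := abs_nonneg a
  have hwAI : RightInvariant Γ fun g => (w g - A) ^ 2 := hsqI (hwI.sub (RightInvariant.const A))
  have hJwA : quotientLIntegral Γ μ (fun g => (w g - A) ^ 2) ≤ ENNReal.ofReal κ := by
    refine le_trans (quotientLIntegral_mono fun g => ?_) hJwa
    have h1 : |w g - A| ≤ |w g - a| := by
      have := abs_abs_sub_abs_le (w g) a
      rwa [abs_of_nonneg (hw0 g)] at this
    exact sq_le_sq.2 h1
  have hJw' : quotientLIntegral Γ μ (fun g => w g ^ 2) ≤ ENNReal.ofReal 1 := by rw [hJw]; simp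
  have hJA : quotientLIntegral Γ μ (fun _ => A ^ 2) ≤ ENNReal.ofReal (A ^ 2) :=
    (quotientLIntegral_const hμ _).le
  -- This form of the triangle inequality has a factor close to one on `y ^ 2`; used in both
  -- directions it brings `A ^ 2` close to the square norm of `w`, which is one.
  have hinv : ∀ s : ℝ, 0 < s → ∀ x y : ℝ, (x + y) ^ 2 ≤ (1 + 1 / s) * x ^ 2 + (1 + s) * y ^ 2 :=
    fun s hs x y => by
    have h1 : (1 + 1 / s) * x ^ 2 + (1 + s) * y ^ 2 - (x + y) ^ 2 = (x - s * y) ^ 2 / s := by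
      field_simp; ring
    have h2 : 0 ≤ (x - s * y) ^ 2 / s := by positivity
    linarith
  have e1 : 1 ≤ (1 + 1 / t) * κ + (1 + t) * A ^ 2 := by
    have h1 := quotientLIntegral_le_of_le_add (F := fun g => w g ^ 2) hwAI (RightInvariant.const (A ^ 2))
      (fun _ => sq_nonneg _) (fun _ => sq_nonneg _) (c₁ := 1 + 1 / t) (c₂ := 1 + t)
      (by positivity) (by positivity) (by positivity) (by positivity) (fun g => by
        have := hinv t ht0 (w g - A) A
        rwa [sub_add_cancel] at this) hJwA hJA
    rw [hJw] at h1
    exact ENNReal.one_le_ofReal.1 h1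
  have e2 : A ^ 2 ≤ (1 + 1 / t) * κ + (1 + t) * 1 := by
    have h1 := quotientLIntegral_le_of_le_add (F := fun _ => A ^ 2) hwAI (hsqI hwI)
      (fun _ => sq_nonneg _) (fun _ => sq_nonneg _) (c₁ := 1 + 1 / t) (c₂ := 1 + t)
      (by positivity) (by positivity) (by positivity) zero_le_one (fun g => by
        have := hinv t ht0 (A - w g) (w g)
        rw [sub_add_cancel] at this
        nlinarith [this]) hJwA hJw'
    rw [quotientLIntegral_const hμ] at h1
    exact (ENNReal.ofReal_le_ofReal_iff (by positivity)).1 h1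
  have e3 : (A - 1) ^ 2 ≤ δ / 4 := by
    have h1 : A ^ 2 ≤ 1 + 2 * t := by linarith
    have h2 : 1 - 2 * t ≤ A ^ 2 := by nlinarith [sq_nonneg A]
    have h3 : A - 1 ≤ 2 * t := by nlinarith
    have h4 : 1 - A ≤ 2 * t := by
      by_contra hn
      push Not at hn
      nlinarith
    nlinarith
  have h1 := quotientLIntegral_le_of_le_add (F := fun g => (w g - 1) ^ 2) hwAI
    (RightInvariant.const ((A - 1) ^ 2))
    (fun _ => sq_nonneg _) (fun _ => sq_nonneg _) (c₁ := 2) (c₂ := 2)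
    (by positivity) (by positivity) (by positivity) (by positivity) (fun g => by
      nlinarith [sq_nonneg (w g - A - (A - 1))]) hJwA (quotientLIntegral_const hμ _).le
  exact h1.trans (ENNReal.ofReal_le_ofReal (by linarith))

/-- A right invariant function whose averages nearly have the same norm is nearly constant, by
the spectral gap. -/
lemma exists_almost_constant [DiscreteTopology Γ] (hμ : IsInvariantProbability Γ μ)
    {K : Set (∀ i, G i)} {ε : ℝ} (hε : 0 < ε)
    (hgap : ∀ F : (∀ i, G i) → ℝ, RightInvariant Γ F →
      quotientLIntegral Γ μ (fun g => F g ^ 2) < ⊤ → ∃ a : ℝ,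
        quotientLIntegral Γ μ (fun g => (F g - a) ^ 2) = 0 ∨ ∃ k ∈ K, ∃ k' ∈ K,
          ENNReal.ofReal (ε ^ 2) * quotientLIntegral Γ μ (fun g => (F g - a) ^ 2) ≤
            quotientLIntegral Γ μ fun g => (F (k⁻¹ * g) - F (k'⁻¹ * g)) ^ 2)
    (hm : CompactlyCarried m) (hq : CompactlyCarried q) {C : NNReal}
    (hCK : ∀ k ∈ K, ∀ i, (q i).map (fun h => k i * h) ≤ C • m i) (hC1 : ∀ i, q i ≤ C • m i)
    {l : List ι} (hl : l.Nodup) (hlu : ∀ i, i ∈ l) (hp : 1 < p) (hp2 : p ≤ 2) {δ : ℝ}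
    (hδ : 0 < δ) : ∃ η : ℝ, 0 < η ∧ ∀ F : (∀ i, G i) → ℝ, RightInvariant Γ F → (∀ g, 0 ≤ F g) →
      quotientLIntegral Γ μ (fun g => F g ^ p) = 1 →
      1 ≤ quotientLIntegral Γ μ (fun g => avg m l F g ^ p) + ENNReal.ofReal η →
      quotientLIntegral Γ μ (fun g => (F g ^ (p / 2) - 1) ^ 2) ≤ ENNReal.ofReal δ := by
  have hp0 : 0 < p := by linarith
  set D : ℝ := C ^ l.length with hD
  have hD0 : 0 ≤ D := by positivity
  set R : ℝ := 3 * (1 + D + 4 * D / ε ^ 2) / (p - 1) with hR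
  have hR0 : 0 ≤ R := div_nonneg (by positivity) (by linarith)
  obtain ⟨κ, hκ, hκw⟩ := exists_sub_one_sq_le (Γ := Γ) hμ hδ
  set η : ℝ := κ / (R + 1) with hη
  have hη0 : 0 < η := by positivity
  have hRη : R * η ≤ κ := by
    rw [hη, mul_div_assoc', div_le_iff₀ (by positivity)]
    nlinarith
  refine ⟨η, hη0, fun F hF hF0 hF1 hFη => ?_⟩
  have hrp : ∀ r : ℝ, 0 ≤ r → Continuous fun x : ℝ => x ^ r := fun r hr =>
    Real.continuous_rpow_const hr
  set b : (∀ i, G i) → ℝ := avg m l F with hb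
  have hbI : RightInvariant Γ b := hF.avg hm l
  have hb0 : ∀ g, 0 ≤ b g := avg_nonneg hF0 l
  set w : (∀ i, G i) → ℝ := fun g => F g ^ (p / 2) with hw
  have hwI : RightInvariant Γ w := hF.comp (hrp _ (by linarith))
  set B : (∀ i, G i) → ℝ := fun g => b g ^ (p / 2) with hB
  have hBI : RightInvariant Γ B := hbI.comp (hrp _ (by linarith))
  have hsq : ∀ s : ℝ, 0 ≤ s → (s ^ (p / 2)) ^ 2 = s ^ p := fun s hs => by
    rw [← Real.rpow_natCast, ← Real.rpow_mul hs]; congr 1; push_cast; ring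
  set P : (∀ i, G i) → ℝ := fun g => avg m l (fun x => (w x - B g) ^ 2) g with hP
  have hPI : RightInvariant Γ P := hwI.avg_sq_sub hm hBI l
  have hP0 : ∀ g, 0 ≤ P g := fun g => avg_nonneg (fun _ => sq_nonneg _) l g
  set x : ℝ := η / (p - 1) with hx
  have hx0 : 0 ≤ x := div_nonneg hη0.le (by linarith)
  have hFp : RightInvariant Γ fun g => F g ^ p := hF.comp (hrp _ hp0.le)
  have hbp : RightInvariant Γ fun g => b g ^ p := hbI.comp (hrp _ hp0.le)
  have hJb1 : quotientLIntegral Γ μ (fun g => b g ^ p) ≤ 1 := by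
    rw [← hF1, ← quotientLIntegral_avg hμ hm hFp (fun g => Real.rpow_nonneg (hF0 g) _) l]
    exact quotientLIntegral_mono fun g => rpow_avg_le hm hp hp2 hF.1 hF0 l g
  -- Averaging preserves integrals over the quotient, so the Jensen defect integrates to at most
  -- `η`; it bounds the mean square deviation `P` of `w` from the function `B`.
  have hJP : quotientLIntegral Γ μ P ≤ ENNReal.ofReal x := by
    have h1 : quotientLIntegral Γ μ (fun g => b g ^ p + (p - 1) * P g) ≤ 1 := by
      rw [← hF1, ← quotientLIntegral_avg hμ hm hFp (fun g => Real.rpow_nonneg (hF0 g) _) l]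
      exact quotientLIntegral_mono fun g => rpow_avg_add_le hm hp hp2 hF.1 hF0 l g
    rw [quotientLIntegral_add hbp (fun g => Real.rpow_nonneg (hb0 g) _)
      (fun g => mul_nonneg (by linarith) (hP0 g)), quotientLIntegral_const_mul hPI
      (by linarith)] at h1
    have h2 := (ENNReal.add_le_add_iff_left (ne_top_of_le_ne_top ENNReal.one_ne_top hJb1)).1
      (h1.trans hFη)
    rw [hx, ENNReal.ofReal_div_of_pos (by linarith), ENNReal.le_div_iff_mul_le
      (Or.inl (by simp; linarith)) (Or.inl ENNReal.ofReal_ne_top), mul_comm]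
    exact h2
  -- By domination, `W (k⁻¹ g)` is close to the same number `B g` for every `k ∈ K`. So `W` is
  -- almost invariant under `K`, and the gap makes it nearly constant; `w` is compared with `W`
  -- through `B`.
  set W : (∀ i, G i) → ℝ := avg q l w with hW
  have hWI : RightInvariant Γ W := hwI.avg hq l
  have hWB : ∀ k : ∀ i, G i, (∀ i, (q i).map (fun h => k i * h) ≤ C • m i) → ∀ g,
      (W (k⁻¹ * g) - B g) ^ 2 ≤ D * P g := fun k hk g =>
    sq_avg_sub_le hm hq hwI.1 hl hlu hk (B g) g
  have hWB1 : ∀ g, (W g - B g) ^ 2 ≤ D * P g := fun g => by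
    simpa using hWB 1 (fun i => by simpa using hC1 i) g
  have hsqI : ∀ {f : (∀ i, G i) → ℝ}, RightInvariant Γ f → RightInvariant Γ fun g => f g ^ 2 :=
    fun hf => hf.comp (continuous_pow 2)
  have hJB : quotientLIntegral Γ μ (fun g => B g ^ 2) ≤ ENNReal.ofReal 1 := by
    simp only [hB, hsq _ (hb0 _), ENNReal.ofReal_one]; exact hJb1
  have hWfin : quotientLIntegral Γ μ (fun g => W g ^ 2) < ⊤ :=
    (quotientLIntegral_le_of_le_add hPI (hsqI hBI) hP0 (fun _ => sq_nonneg _)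
      (c₁ := 2 * D) (c₂ := 2) (by positivity) (by norm_num) hx0 zero_le_one (fun g => by
        have h1 := hWB1 g
        nlinarith [sq_nonneg (W g - 2 * B g)]) hJP hJB).trans_lt ENNReal.ofReal_lt_top
  obtain ⟨a, ha⟩ := hgap W hWI hWfin
  have hWaI : RightInvariant Γ fun g => (W g - a) ^ 2 := hsqI (hWI.sub (RightInvariant.const a))
  have hJW : quotientLIntegral Γ μ (fun g => (W g - a) ^ 2) ≤
      ENNReal.ofReal (4 * D / ε ^ 2 * x) := by
    rcases ha with ha | ⟨k, hk, k', hk', ha⟩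
    · rw [ha]; exact zero_le
    · have h1 : quotientLIntegral Γ μ (fun g => (W (k⁻¹ * g) - W (k'⁻¹ * g)) ^ 2) ≤
          ENNReal.ofReal (2 * D * x + 2 * D * x) :=
        quotientLIntegral_le_of_le_add hPI hPI hP0 hP0 (by positivity) (by positivity) hx0 hx0
          (fun g => by
            have h1 := hWB k (hCK k hk) g
            have h2 := hWB k' (hCK k' hk') g
            nlinarith [sq_nonneg (W (k⁻¹ * g) - B g + (W (k'⁻¹ * g) - B g))]) hJP hJP
      have h2 := ha.trans h1
      have h3 : 4 * D / ε ^ 2 * x = (2 * D * x + 2 * D * x) / ε ^ 2 := by ring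
      rw [h3, ENNReal.ofReal_div_of_pos (by positivity), ENNReal.le_div_iff_mul_le
        (Or.inl (by simpa using hε.ne')) (Or.inl ENNReal.ofReal_ne_top), mul_comm]
      exact h2
  have hwaI : RightInvariant Γ fun g => (w g - a) ^ 2 := hsqI (hwI.sub (RightInvariant.const a))
  have hJwa : quotientLIntegral Γ μ (fun g => (w g - a) ^ 2) ≤ ENNReal.ofReal (R * η) := by
    rw [← quotientLIntegral_avg hμ hm hwaI (fun _ => sq_nonneg _) l]
    have h3 : R * η = 3 * (1 + D) * x + 3 * (4 * D / ε ^ 2 * x) := by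
      rw [hR, hx]; ring
    rw [h3]
    refine quotientLIntegral_le_of_le_add hPI hWaI hP0 (fun _ => sq_nonneg _) (by positivity)
      (by norm_num) hx0 (by positivity) (fun g => ?_) hJP hJW
    have h4 := hWB1 g
    rw [avg_sq_sub hm hwI.1]
    have h5 := avg_sq_sub hm hwI.1 (B g) l g
    have h6 : P g = avg m l (fun x => w x ^ 2) g - 2 * B g * avg m l w g + B g ^ 2 := h5
    have h7 := sq_avg_le hm hwI.1 l g
    have h8 : (avg m l w g - B g) ^ 2 ≤ P g := by rw [h6]; linarith
    have h9 := sum_sq_le (z := W g - a) h8 (by rwa [sub_sq_comm] at h4 : (B g - W g) ^ 2 ≤ D * P g)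
    refine le_trans (le_of_eq ?_) h9
    rw [h6]; ring
  refine hκw w hwI (fun g => Real.rpow_nonneg (hF0 g) _) ?_ a
    (hJwa.trans (ENNReal.ofReal_le_ofReal hRη))
  simp only [hw, hsq _ (hF0 _)]; exact hF1

end Contraction

/-! ### Averaging contracts the norm of equivariant functions over the quotient. -/

section Contraction

variable {ι : Type*} [Fintype ι] [DecidableEq ι] {G : ι → Type*} [∀ i, Group (G i)]
  [∀ i, TopologicalSpace (G i)] [∀ i, IsTopologicalGroup (G i)] [∀ i, T2Space (G i)]
  [∀ i, LocallyCompactSpace (G i)] [∀ i, SigmaCompactSpace (G i)]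
  [∀ i, MeasurableSpace (G i)] [∀ i, BorelSpace (G i)]
  {E : Type*} [NormedAddCommGroup E] [NormedSpace ℝ E]
  {m q : ∀ i, Measure (G i)} [∀ i, IsProbabilityMeasure (m i)] [∀ i, IsProbabilityMeasure (q i)]
  {p : ℝ} {Γ : Subgroup (∀ i, G i)} {μ : @Measure ((∀ i, G i) ⧸ Γ) (borel ((∀ i, G i) ⧸ Γ))}
  {ρ : Γ →* (E →L[ℝ] E)}

variable (ρ) in
/-- Continuous functions which are equivariant for an isometric linear action. -/
def LinearEquivariant (u : (∀ i, G i) → E) : Prop :=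
  Continuous u ∧ ∀ (g : ∀ i, G i) (γ : Γ), u (g * (γ : ∀ i, G i)⁻¹) = ρ γ (u g)

lemma LinearEquivariant.rpow_norm (hρ : ∀ γ v, ‖ρ γ v‖ = ‖v‖) {u : (∀ i, G i) → E}
    (hu : LinearEquivariant ρ u) {r : ℝ} (hr : 0 ≤ r) : RightInvariant Γ fun g => ‖u g‖ ^ r :=
  ⟨hu.1.norm.rpow_const fun _ => Or.inr hr, fun g γ => by
    have h := hu.2 g γ⁻¹
    simp only [InvMemClass.coe_inv, inv_inv] at h
    dsimp only
    rw [h, hρ]⟩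

lemma LinearEquivariant.norm (hρ : ∀ γ v, ‖ρ γ v‖ = ‖v‖) {u : (∀ i, G i) → E}
    (hu : LinearEquivariant ρ u) : RightInvariant Γ fun g => ‖u g‖ := by
  simpa using hu.rpow_norm hρ zero_le_one

lemma LinearEquivariant.smul {u : (∀ i, G i) → E} (hu : LinearEquivariant ρ u) (t : ℝ) :
    LinearEquivariant ρ fun g => t • u g :=
  ⟨hu.1.const_smul t, fun g γ => by dsimp only; rw [hu.2, map_smul]⟩

lemma LinearEquivariant.sub {u u' : (∀ i, G i) → E} (hu : LinearEquivariant ρ u)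
    (hu' : LinearEquivariant ρ u') : LinearEquivariant ρ fun g => u g - u' g :=
  ⟨hu.1.sub hu'.1, fun g γ => by dsimp only; rw [hu.2, hu'.2, map_sub]⟩

lemma LinearEquivariant.comp_mul_left {u : (∀ i, G i) → E} (hu : LinearEquivariant ρ u)
    (k : ∀ i, G i) : LinearEquivariant ρ fun g => u (k * g) :=
  ⟨hu.1.comp (continuous_const_mul k), fun g γ => by dsimp only; rw [← mul_assoc, hu.2]⟩

lemma LinearEquivariant.avg [CompleteSpace E] (hm : CompactlyCarried m) {u : (∀ i, G i) → E}
    (hu : LinearEquivariant ρ u) (l : List ι) : LinearEquivariant ρ (avg m l u) :=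
  ⟨((hm.admissible hu.1).avg l).1, fun g γ => by
    rw [← avg_comp_mul_right, ← avg_clm (hm.admissible hu.1)]
    simp only [hu.2]⟩

lemma quotientLIntegral_rpow_avg_le [DiscreteTopology Γ] (hμ : IsInvariantProbability Γ μ)
    (hm : CompactlyCarried m) (hp : 1 < p) (hp2 : p ≤ 2) (hρ : ∀ γ v, ‖ρ γ v‖ = ‖v‖)
    {u : (∀ i, G i) → E} (hu : LinearEquivariant ρ u) (l : List ι) :
    quotientLIntegral Γ μ (fun g => avg m l (fun x => ‖u x‖) g ^ p) ≤
      quotientLIntegral Γ μ fun g => ‖u g‖ ^ p := by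
  rw [← quotientLIntegral_avg hμ hm (hu.rpow_norm hρ (by linarith : 0 ≤ p))
    (fun g => Real.rpow_nonneg (norm_nonneg _) _) l]
  exact quotientLIntegral_mono fun g => rpow_avg_le hm hp hp2 hu.1.norm (fun _ => norm_nonneg _) l g

lemma quotientLIntegral_rpow_norm_avg_le [DiscreteTopology Γ] (hμ : IsInvariantProbability Γ μ)
    (hm : CompactlyCarried m) (hp : 1 < p) (hp2 : p ≤ 2) (hρ : ∀ γ v, ‖ρ γ v‖ = ‖v‖)
    {u : (∀ i, G i) → E} (hu : LinearEquivariant ρ u) (l : List ι) :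
    quotientLIntegral Γ μ (fun g => ‖avg m l u g‖ ^ p) ≤
      quotientLIntegral Γ μ fun g => ‖u g‖ ^ p :=
  (quotientLIntegral_mono fun g => Real.rpow_le_rpow (norm_nonneg _)
    (norm_avg_le (hm.admissible hu.1) l g) (by linarith)).trans
    (quotientLIntegral_rpow_avg_le hμ hm hp hp2 hρ hu l)

/-- An equivariant function with small defects at a point is nearly constant near the point. -/
lemma almost_constant_at [CompleteSpace E] (hm : CompactlyCarried m) (hp : 1 < p) (hp2 : p ≤ 2)
    {u : (∀ i, G i) → E} (hu : Continuous u) (l : List ι) {s : ℝ} (hs : 0 < s) (hs8 : s ≤ 1 / 8)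
    (g : ∀ i, G i) (h1 : avg m l (fun x => (‖u x‖ ^ (p / 2) - 1) ^ 2) g < s ^ 2)
    (h2 : avg m l (fun x => ‖u x‖) g ^ p - ‖avg m l u g‖ ^ p < s ^ 2) :
    ∃ T : E →L[ℝ] ℝ, ‖T‖ ≤ 1 ∧ avg m l (fun x => |‖u x‖ - 1|) g ≤ 3 * s ∧
      avg m l (fun x => |1 - T (u x)|) g ≤ 4 * s := by
  set w : (∀ i, G i) → ℝ := fun x => ‖u x‖ ^ (p / 2) with hw
  have hwc : Continuous w := hu.norm.rpow_const fun _ => Or.inr (by linarith)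
  have hw1 : Continuous fun x => |w x - 1| := (hwc.sub continuous_const).abs
  have hd : avg m l (fun x => |w x - 1|) g ≤ s := by
    have h := sq_avg_le hm hw1 l g
    simp only [sq_abs] at h
    exact le_of_lt (lt_of_pow_lt_pow_left₀ 2 hs.le (h.trans_lt h1))
  have ha : avg m l (fun x => |‖u x‖ - 1|) g ≤ 3 * s := by
    have h := avg_mono (f := fun x => |‖u x‖ - 1|) (f' := fun x => 2 • |w x - 1| + (w x - 1) ^ 2)
      (hm.admissible (by fun_prop)) (hm.admissible (by fun_prop)) (fun x => by
        have := abs_rpow_sub_one_le hp (norm_nonneg (u x))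
        simpa using this) l g
    have h3 : avg m l (fun x => 2 • |w x - 1| + (w x - 1) ^ 2) g =
        2 * avg m l (fun x => |w x - 1|) g + avg m l (fun x => (w x - 1) ^ 2) g := by
      rw [avg_add (hm.admissible (by fun_prop)) (hm.admissible (by fun_prop))]
      congr 1
      simpa using avg_smul (hm.admissible hw1) 2 l g
    nlinarith
  have hau : Continuous fun x => |‖u x‖ - 1| := (hu.norm.sub continuous_const).abs
  have hb : 1 - 3 * s ≤ avg m l (fun x => ‖u x‖) g := by
    have h := avg_mono (f := fun x => 1 - |‖u x‖ - 1|) (f' := fun x => ‖u x‖)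
      (hm.admissible (by fun_prop)) (hm.admissible (by fun_prop)) (fun x => by
        linarith [neg_abs_le (‖u x‖ - 1)]) l g
    rw [avg_sub (Admissible.const _) (hm.admissible hau), avg_const] at h
    linarith
  have hMb := norm_avg_le (hm.admissible hu) l g
  -- The deficit of `p`-th powers bounds the loss of norm under averaging by `2 * s ^ 2`; the mean
  -- of `‖u‖` exceeds `1 / 2` because `s ≤ 1 / 8`.
  have hbM := half_mul_sub_le_rpow_sub hp hp2 (norm_nonneg _) hMb (by linarith)
  obtain ⟨T, hT, hTv⟩ := exists_dual_vector'' ℝ (avg m l u g)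
  refine ⟨T, hT, ha, ?_⟩
  have hTu : Continuous fun x => T (u x) := T.continuous.comp hu
  have h := avg_mono (f := fun x => |1 - T (u x)|) (f' := fun x => |‖u x‖ - 1| + (‖u x‖ - T (u x)))
    (hm.admissible (by fun_prop)) (hm.admissible (by fun_prop)) (fun x => by
      have h3 : T (u x) ≤ ‖u x‖ := (le_abs_self _).trans (by simpa using T.le_of_opNorm_le hT (u x))
      have h4 : |1 - T (u x)| ≤ |1 - ‖u x‖| + |‖u x‖ - T (u x)| := abs_sub_le _ _ _
      rwa [abs_sub_comm 1 ‖u x‖, abs_of_nonneg (sub_nonneg.2 h3)] at h4) l g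
  rw [avg_add (hm.admissible hau) (hm.admissible (by fun_prop)),
    avg_sub (hm.admissible hu.norm) (hm.admissible hTu), avg_clm (hm.admissible hu), hTv] at h
  simp only [RCLike.ofReal_real_eq_id, id] at h
  nlinarith

/-- The averaging operator is a strict contraction of the space of equivariant functions. -/
theorem exists_contraction [UniformConvexSpace E] [CompleteSpace E] [DiscreteTopology Γ]
    (hμ : IsInvariantProbability Γ μ)
    {K : Set (∀ i, G i)} {ε : ℝ} (hε : 0 < ε)
    (hgap : ∀ F : (∀ i, G i) → ℝ, RightInvariant Γ F →
      quotientLIntegral Γ μ (fun g => F g ^ 2) < ⊤ → ∃ a : ℝ,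
        quotientLIntegral Γ μ (fun g => (F g - a) ^ 2) = 0 ∨ ∃ k ∈ K, ∃ k' ∈ K,
          ENNReal.ofReal (ε ^ 2) * quotientLIntegral Γ μ (fun g => (F g - a) ^ 2) ≤
            quotientLIntegral Γ μ fun g => (F (k⁻¹ * g) - F (k'⁻¹ * g)) ^ 2)
    (hm : CompactlyCarried m) (hq : CompactlyCarried q) {C : NNReal}
    (hCK : ∀ k ∈ K, ∀ i, (q i).map (fun h => k i * h) ≤ C • m i) (hC1 : ∀ i, q i ≤ C • m i)
    {l : List ι} (hl : l.Nodup) (hlu : ∀ i, i ∈ l) (hp : 1 < p) (hp2 : p ≤ 2)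
    {F : Finset Γ} {ε' : ℝ} (hε' : 0 < ε') (hF : ∀ v, ∃ γ ∈ F, ε' * ‖v‖ ≤ ‖ρ γ v - v‖)
    (hρ : ∀ γ v, ‖ρ γ v‖ = ‖v‖)
    {L : Set (∀ i, G i)} (hL : 1 / 2 ≤ μ (((↑) : (∀ i, G i) → (∀ i, G i) ⧸ Γ) '' L))
    (hCL : ∀ g ∈ L, ∀ γ ∈ F, ∀ i,
      (q i).map (fun h => (g * (γ : ∀ i, G i) * g⁻¹) i * h) ≤ C • m i) :
    ∃ c : ℝ, 0 ≤ c ∧ c < 1 ∧ ∀ u : (∀ i, G i) → E, LinearEquivariant ρ u →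
      quotientLIntegral Γ μ (fun g => ‖u g‖ ^ p) < ⊤ →
      quotientLIntegral Γ μ (fun g => ‖avg m l u g‖ ^ p) ≤
        ENNReal.ofReal c * quotientLIntegral Γ μ (fun g => ‖u g‖ ^ p) := by
  have hp0 : 0 < p := by linarith
  obtain ⟨δ, hδ, hno⟩ := exists_no_almost_constant (E := E) (ρ := ρ) hε' hF hCL hC1 hl hlu
  set s : ℝ := min (δ / 4) (1 / 8) with hs
  have hs0 : 0 < s := by positivity
  have hsδ : s ≤ δ / 4 := min_le_left _ _
  have hs8 : s ≤ 1 / 8 := min_le_right _ _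
  obtain ⟨η₁, hη₁, hη⟩ := exists_almost_constant hμ hε hgap hm hq hCK hC1 hl hlu hp hp2
    (δ := s ^ 2 / 8) (by positivity)
  set η : ℝ := min η₁ (s ^ 2 / 8) with hη'
  have hη0 : 0 < η := by positivity
  have hηs : η ≤ s ^ 2 / 8 := min_le_right _ _
  have hη1 : η ≤ 1 := by nlinarith
  have hnorm : ∀ u : (∀ i, G i) → E, LinearEquivariant ρ u →
      quotientLIntegral Γ μ (fun g => ‖u g‖ ^ p) = 1 →
      quotientLIntegral Γ μ (fun g => ‖avg m l u g‖ ^ p) ≤ ENNReal.ofReal (1 - η) := by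
    intro u hu h1
    by_contra hcon
    push Not at hcon
    have hM1 : quotientLIntegral Γ μ (fun g => ‖avg m l u g‖ ^ p) ≤ 1 :=
      (quotientLIntegral_rpow_norm_avg_le hμ hm hp hp2 hρ hu l).trans_eq h1
    have hMη : 1 ≤ quotientLIntegral Γ μ (fun g => ‖avg m l u g‖ ^ p) + ENNReal.ofReal η := by
      have h2 := add_le_add_left hcon.le (ENNReal.ofReal η)
      rw [← ENNReal.ofReal_add (by linarith) hη0.le] at h2
      simpa using h2
    have huI := hu.norm hρ
    have huA := hu.avg hm l
    set b : (∀ i, G i) → ℝ := avg m l (fun x => ‖u x‖) with hb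
    have hbI : RightInvariant Γ b := huI.avg hm l
    have hMb : ∀ g, ‖avg m l u g‖ ≤ b g := norm_avg_le (hm.admissible hu.1) l
    have hMbp : ∀ g, ‖avg m l u g‖ ^ p ≤ b g ^ p := fun g =>
      Real.rpow_le_rpow (norm_nonneg _) (hMb g) hp0.le
    -- The spectral gap enters here: the mass of `‖u‖` cannot concentrate away from the compact set
    -- `L`.
    have hJw := hη (fun g => ‖u g‖) huI (fun _ => norm_nonneg _) h1
      (hMη.trans (add_le_add (quotientLIntegral_mono hMbp)
        (ENNReal.ofReal_le_ofReal (min_le_left _ _))))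
    have hwI : RightInvariant Γ fun g => (‖u g‖ ^ (p / 2) - 1) ^ 2 :=
      ((hu.rpow_norm hρ (by linarith : 0 ≤ p / 2)).sub (RightInvariant.const 1)).comp
        (continuous_pow 2)
    have hMp := huA.rpow_norm hρ hp0.le
    have hbp : RightInvariant Γ fun g => b g ^ p :=
      hbI.comp (Real.continuous_rpow_const hp0.le)
    have hR : quotientLIntegral Γ μ (fun g => b g ^ p - ‖avg m l u g‖ ^ p) ≤ ENNReal.ofReal η := by
      have h2 := quotientLIntegral_add (μ := μ) hMp (fun g => Real.rpow_nonneg (norm_nonneg _) _)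
        (fun g => sub_nonneg.2 (hMbp g))
      simp only [add_sub_cancel] at h2
      have h3 := quotientLIntegral_rpow_avg_le hμ hm hp hp2 hρ hu l
      rw [h1, h2] at h3
      exact (ENNReal.add_le_add_iff_left (ne_top_of_le_ne_top ENNReal.one_ne_top hM1)).1
        (h3.trans hMη)
    have hQ : quotientLIntegral Γ μ (avg m l fun g => (‖u g‖ ^ (p / 2) - 1) ^ 2) ≤
        ENNReal.ofReal (s ^ 2 / 8) := by
      rwa [quotientLIntegral_avg hμ hm hwI (fun _ => sq_nonneg _) l]
    have hΨ := quotientLIntegral_le_of_le_add (hwI.avg hm l) (hbp.sub hMp)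
      (avg_nonneg (fun _ => sq_nonneg _) l) (fun g => sub_nonneg.2 (hMbp g)) zero_le_one zero_le_one
      (by positivity) hη0.le (fun g => le_rfl) hQ hR
    -- The total defect is at most `s ^ 2 / 8 + η ≤ s ^ 2 / 4`, whereas a defect of at least `s ^ 2`
    -- throughout `L`, whose image has half of the mass, would contribute `s ^ 2 / 2`.
    obtain ⟨g, hg, hΨg⟩ : ∃ g ∈ L, avg m l (fun g => (‖u g‖ ^ (p / 2) - 1) ^ 2) g +
        (b g ^ p - ‖avg m l u g‖ ^ p) < s ^ 2 := by
      by_contra hall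
      push Not at hall
      have h2 := ofReal_mul_le_quotientLIntegral (μ := μ) (a := s ^ 2) (V := L)
        (((RightInvariant.const 1).mul (hwI.avg hm l)).add
          ((RightInvariant.const 1).mul (hbp.sub hMp))) (fun g hg => by
          simpa using hall g hg)
      have h3 : ENNReal.ofReal (s ^ 2 / 2) ≤ ENNReal.ofReal (1 * (s ^ 2 / 8) + 1 * η) := by
        refine le_trans ?_ (h2.trans hΨ)
        rw [ENNReal.ofReal_div_of_pos (by norm_num), div_eq_mul_inv, ENNReal.ofReal_ofNat]
        gcongr
        simpa using hL
      rw [ENNReal.ofReal_le_ofReal_iff (by positivity)] at h3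
      nlinarith [sq_pos_of_pos hs0]
    have h0 : 0 ≤ avg m l (fun g => (‖u g‖ ^ (p / 2) - 1) ^ 2) g :=
      avg_nonneg (fun _ => sq_nonneg _) l g
    obtain ⟨T, hT, h4, h5⟩ := almost_constant_at hm hp hp2 hu.1 l hs0 hs8 g
      (by linarith [sub_nonneg.2 (hMbp g)]) (by linarith)
    exact hno u (hm.admissible hu.1) (hq.admissible hu.1) hu.2 g hg T hT (by linarith)
      (by linarith)
  refine ⟨1 - η, by linarith, by linarith, fun u hu hfin => ?_⟩
  set N := quotientLIntegral Γ μ (fun g => ‖u g‖ ^ p) with hN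
  rcases eq_or_ne N 0 with h0 | h0
  · have h1 := quotientLIntegral_rpow_norm_avg_le hμ hm hp hp2 hρ hu l
    rw [← hN, h0] at h1
    rw [h0, mul_zero]; exact h1
  have hn : 0 < N.toReal := ENNReal.toReal_pos h0 hfin.ne
  set t : ℝ := N.toReal ^ (-p⁻¹) with ht
  have ht0 : 0 < t := Real.rpow_pos_of_pos hn _
  have htp : t ^ p = N.toReal⁻¹ := by
    rw [ht, ← Real.rpow_mul hn.le, neg_mul, inv_mul_cancel₀ hp0.ne', Real.rpow_neg_one]
  have hsc : ∀ v : (∀ i, G i) → E, LinearEquivariant ρ v →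
      quotientLIntegral Γ μ (fun g => ‖t • v g‖ ^ p) =
        N⁻¹ * quotientLIntegral Γ μ fun g => ‖v g‖ ^ p := fun v hv => by
    have h1 : ∀ g, ‖t • v g‖ ^ p = N.toReal⁻¹ * ‖v g‖ ^ p := fun g => by
      rw [norm_smul, Real.norm_of_nonneg ht0.le, Real.mul_rpow ht0.le (norm_nonneg _), htp]
    simp only [h1]
    rw [quotientLIntegral_const_mul (hv.rpow_norm hρ hp0.le) (inv_nonneg.2 hn.le),
      ENNReal.ofReal_inv_of_pos hn, ENNReal.ofReal_toReal hfin.ne]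
  have h1 := hnorm (fun g => t • u g) (hu.smul t) (by
    rw [hsc u hu]; exact ENNReal.inv_mul_cancel h0 hfin.ne)
  have h2 : avg m l (fun g => t • u g) = fun g => t • avg m l u g :=
    funext fun g => avg_smul (hm.admissible hu.1) t l g
  rw [h2, hsc _ (hu.avg hm l), mul_comm, ← div_eq_mul_inv,
    ENNReal.div_le_iff h0 hfin.ne] at h1
  exact h1

end Contraction

/-! ### The norm over the quotient, and the affine fixed point equation. -/

section EnergyNorm

variable {ι : Type*} [Fintype ι] [DecidableEq ι] {G : ι → Type*} [∀ i, Group (G i)]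
  [∀ i, TopologicalSpace (G i)] [∀ i, IsTopologicalGroup (G i)] [∀ i, T2Space (G i)]
  [∀ i, LocallyCompactSpace (G i)] [∀ i, SigmaCompactSpace (G i)]
  [∀ i, MeasurableSpace (G i)] [∀ i, BorelSpace (G i)]
  {E : Type*} [NormedAddCommGroup E] [NormedSpace ℝ E]
  {m : ∀ i, Measure (G i)} [∀ i, IsProbabilityMeasure (m i)]
  {p : ℝ} {Γ : Subgroup (∀ i, G i)} {μ : @Measure ((∀ i, G i) ⧸ Γ) (borel ((∀ i, G i) ⧸ Γ))}
  {ρ : Γ →* (E →L[ℝ] E)}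

variable (Γ) in
/-- The `L ^ p` norm over the quotient of a function of right invariant norm. -/
noncomputable def quotientLpNorm (μ : @Measure ((∀ i, G i) ⧸ Γ) (borel ((∀ i, G i) ⧸ Γ))) (p : ℝ)
    (u : (∀ i, G i) → E) : ℝ≥0∞ := quotientLIntegral Γ μ (fun g => ‖u g‖ ^ p) ^ (1 / p)

lemma LinearEquivariant.add {u u' : (∀ i, G i) → E} (hu : LinearEquivariant ρ u)
    (hu' : LinearEquivariant ρ u') : LinearEquivariant ρ fun g => u g + u' g :=
  ⟨hu.1.add hu'.1, fun g γ => by dsimp only; rw [hu.2, hu'.2, map_add]⟩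

lemma LinearEquivariant.zero : LinearEquivariant ρ (fun _ : ∀ i, G i => (0 : E)) :=
  ⟨continuous_const, fun _ γ => (map_zero (ρ γ)).symm⟩

lemma LinearEquivariant.neg {u : (∀ i, G i) → E} (hu : LinearEquivariant ρ u) :
    LinearEquivariant ρ fun g => -u g :=
  ⟨hu.1.neg, fun g γ => by dsimp only; rw [hu.2, map_neg]⟩

lemma quotientLpNorm_neg (u : (∀ i, G i) → E) :
    quotientLpNorm Γ μ p (fun g => -u g) = quotientLpNorm Γ μ p u := by
  simp only [quotientLpNorm, norm_neg]

lemma quotientLpNorm_zero (hp : 1 < p) (hμ : IsInvariantProbability Γ μ) :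
    quotientLpNorm Γ μ p (fun _ : ∀ i, G i => (0 : E)) = 0 := by
  have hp0 : 0 < p := by linarith
  simp [quotientLpNorm, Real.zero_rpow hp0.ne', quotientLIntegral_const hμ, hp0]

lemma quotientLpNorm_add_le (hp : 1 < p) (hρ : ∀ γ v, ‖ρ γ v‖ = ‖v‖) {u u' : (∀ i, G i) → E}
    (hu : LinearEquivariant ρ u) (hu' : LinearEquivariant ρ u') :
    quotientLpNorm Γ μ p (fun g => u g + u' g) ≤
      quotientLpNorm Γ μ p u + quotientLpNorm Γ μ p u' := by
  let _ : MeasurableSpace ((∀ i, G i) ⧸ Γ) := borel ((∀ i, G i) ⧸ Γ)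
  have hp0 : 0 < p := by linarith
  have h := ENNReal.lintegral_Lp_add_le (μ := μ) (p := p) (hu.norm hρ).measurable_out.aemeasurable
    (hu'.norm hρ).measurable_out.aemeasurable hp.le
  have e : ∀ v : (∀ i, G i) → E, quotientLpNorm Γ μ p v =
      (∫⁻ x : (∀ i, G i) ⧸ Γ, ENNReal.ofReal ‖v x.out‖ ^ p ∂μ) ^ (1 / p) := fun v => by
    unfold quotientLpNorm quotientLIntegral
    simp only [ENNReal.ofReal_rpow_of_nonneg (norm_nonneg _) hp0.le]
  rw [e, e, e]
  refine le_trans (ENNReal.rpow_le_rpow (lintegral_mono fun x => ENNReal.rpow_le_rpow ?_ hp0.le)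
    (by positivity)) h
  rw [Pi.add_apply, ← ENNReal.ofReal_add (norm_nonneg _) (norm_nonneg _)]
  exact ENNReal.ofReal_le_ofReal (norm_add_le _ _)

lemma quotientLpNorm_sub_le (hp : 1 < p) (hρ : ∀ γ v, ‖ρ γ v‖ = ‖v‖) {u u' : (∀ i, G i) → E}
    (hu : LinearEquivariant ρ u) (hu' : LinearEquivariant ρ u') :
    quotientLpNorm Γ μ p (fun g => u g - u' g) ≤
      quotientLpNorm Γ μ p u + quotientLpNorm Γ μ p u' := by
  rw [← quotientLpNorm_neg u']
  simpa only [sub_eq_add_neg] using quotientLpNorm_add_le hp hρ hu hu'.neg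

lemma quotientLpNorm_avg_le [DiscreteTopology Γ] (hμ : IsInvariantProbability Γ μ)
    (hm : CompactlyCarried m) (hp : 1 < p) (hp2 : p ≤ 2) (hρ : ∀ γ v, ‖ρ γ v‖ = ‖v‖)
    {u : (∀ i, G i) → E} (hu : LinearEquivariant ρ u) (l : List ι) :
    quotientLpNorm Γ μ p (avg m l u) ≤ quotientLpNorm Γ μ p u :=
  ENNReal.rpow_le_rpow (quotientLIntegral_rpow_norm_avg_le hμ hm hp hp2 hρ hu l)
    (div_nonneg zero_le_one (by linarith))

lemma quotientLpNorm_comp_mul_left (hμ : IsInvariantProbability Γ μ) (hp : 1 < p)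
    (hρ : ∀ γ v, ‖ρ γ v‖ = ‖v‖) {u : (∀ i, G i) → E} (hu : LinearEquivariant ρ u) (k : ∀ i, G i) :
    quotientLpNorm Γ μ p (fun g => u (k * g)) = quotientLpNorm Γ μ p u := by
  unfold quotientLpNorm
  rw [quotientLIntegral_comp_mul_left hμ (hu.rpow_norm hρ (by linarith : 0 ≤ p)) k]

lemma eq_zero_of_quotientLpNorm_eq_zero (hμ : IsInvariantProbability Γ μ) (hp : 1 < p)
    (hρ : ∀ γ v, ‖ρ γ v‖ = ‖v‖) {u : (∀ i, G i) → E} (hu : LinearEquivariant ρ u)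
    (h : quotientLpNorm Γ μ p u = 0) (g : ∀ i, G i) : u g = 0 := by
  have hp0 : 0 < p := by linarith
  have h1 := (ENNReal.rpow_eq_zero_iff_of_pos (by positivity)).1 h
  have h2 := eq_zero_of_quotientLIntegral_eq_zero hμ (hu.rpow_norm hρ hp0.le) h1 g
  by_contra hne
  exact absurd (Real.rpow_pos_of_pos (norm_pos_iff.2 hne) p) (not_lt.2 h2)

lemma quotientLpNorm_le_of_tendsto (hp : 1 < p) (hρ : ∀ γ v, ‖ρ γ v‖ = ‖v‖)
    {u : ℕ → (∀ i, G i) → E} (hu : ∀ n, LinearEquivariant ρ (u n)) {v : (∀ i, G i) → E}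
    (hv : ∀ g, Filter.Tendsto (fun n => u n g) Filter.atTop (𝓝 (v g))) {B : ℝ≥0∞}
    (hB : ∀ n, quotientLpNorm Γ μ p (u n) ≤ B) : quotientLpNorm Γ μ p v ≤ B := by
  have hp0 : 0 < p := by linarith
  have h1 := quotientLIntegral_le_liminf (μ := μ) (fun n => (hu n).rpow_norm hρ hp0.le)
    (F' := fun g => ‖v g‖ ^ p) fun g =>
      ((hv g).norm.rpow_const (Or.inr hp0.le))
  unfold quotientLpNorm at hB ⊢
  rw [one_div, ENNReal.rpow_inv_le_iff hp0]
  refine h1.trans ?_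
  have h2 : ∀ n, quotientLIntegral Γ μ (fun g => ‖u n g‖ ^ p) ≤ B ^ p := fun n => by
    have := hB n
    rwa [one_div, ENNReal.rpow_inv_le_iff hp0] at this
  exact Filter.liminf_le_of_le (by isBoundedDefault) fun b hb => by
    obtain ⟨n, hn⟩ := hb.exists
    exact hn.trans (h2 n)

/-- Averages of equivariant functions by bumps are locally bounded by the norm. -/
lemma exists_norm_avg_le_quotientLpNorm [DiscreteTopology Γ] (hμ : IsInvariantProbability Γ μ)
    (hm : ∀ i, IsBump (m i)) (hp : 1 < p) (hp2 : p ≤ 2) (hρ : ∀ γ v, ‖ρ γ v‖ = ‖v‖)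
    {l : List ι} (hl : l.Nodup) (hlu : ∀ i, i ∈ l) (g₀ : ∀ i, G i) :
    ∃ V ∈ 𝓝 g₀, ∃ A : ℝ≥0∞, A ≠ ⊤ ∧ ∀ u : (∀ i, G i) → E, LinearEquivariant ρ u → ∀ g ∈ V,
      ENNReal.ofReal ‖avg m l u g‖ ≤ A * quotientLpNorm Γ μ p u := by
  have hp0 : 0 < p := by linarith
  have hmc : CompactlyCarried m := fun i => (hm i).exists_isCompact
  obtain ⟨K, hK, hK1⟩ := exists_compact_mem_nhds (1 : ∀ i, G i)
  obtain ⟨V, hV, hVo, hgV⟩ : ∃ V : Set (∀ i, G i), (∀ g ∈ V, ∀ g' ∈ V, g' * g⁻¹ ∈ K) ∧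
      IsOpen V ∧ g₀ ∈ V := by
    have hc : Continuous fun x : (∀ i, G i) × (∀ i, G i) => x.2 * x.1⁻¹ := by fun_prop
    have h1 : (fun x : (∀ i, G i) × (∀ i, G i) => x.2 * x.1⁻¹) ⁻¹' K ∈ 𝓝 (g₀, g₀) :=
      hc.continuousAt.preimage_mem_nhds (by simpa using hK1)
    rw [nhds_prod_eq, Filter.mem_prod_same_iff] at h1
    obtain ⟨t, ht, hts⟩ := h1
    obtain ⟨V, hVt, hVo, hgV⟩ := mem_nhds_iff.1 ht
    exact ⟨V, fun g hg g' hg' => hts (Set.mk_mem_prod (hVt hg) (hVt hg')), hVo, hgV⟩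
  choose m' hm' C hC using fun i => (hm i).exists_dominating (hK.image (continuous_apply i))
  have hm'p : ∀ i, IsProbabilityMeasure (m' i) := fun i => (hm' i).isProbabilityMeasure
  have hm'c : CompactlyCarried m' := fun i => (hm' i).exists_isCompact
  set D : NNReal := Finset.univ.sup C with hD
  have hCD : ∀ k ∈ K, ∀ i, (m i).map (fun h => k i * h) ≤ D • m' i := fun k hk i =>
    (hC i _ ⟨k, hk, rfl⟩).trans
      (nnreal_smul_measure_mono_left _ (Finset.le_sup (Finset.mem_univ i)))
  set a := μ (((↑) : (∀ i, G i) → (∀ i, G i) ⧸ Γ) '' V) with ha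
  have ha0 : 0 < a := measure_pos_of_isOpen hμ (QuotientGroup.isOpenMap_coe _ hVo) ⟨_, g₀, hgV, rfl⟩
  have hat : a ≠ ⊤ := by
    let _ : MeasurableSpace ((∀ i, G i) ⧸ Γ) := borel ((∀ i, G i) ⧸ Γ)
    have h1 : IsProbabilityMeasure μ := hμ.1
    exact measure_ne_top _ _
  have hp1 : 0 < 1 / p := by positivity
  refine ⟨V, hVo.mem_nhds hgV, (ENNReal.ofReal ((D : ℝ) ^ l.length) / a) ^ (1 / p),
    ENNReal.rpow_ne_top_of_nonneg hp1.le (ENNReal.div_ne_top ENNReal.ofReal_ne_top ha0.ne'),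
    fun u hu g hg => ?_⟩
  have hF := hu.rpow_norm hρ hp0.le
  -- The `m`-average at `g` is dominated by the `m'`-average at each `g' ∈ V`; integrating over the
  -- image of `V`, which has positive measure, brings in the norm.
  have h1 : ∀ g' ∈ V, ‖avg m l u g‖ ^ p ≤ (D : ℝ) ^ l.length *
      avg m' l (fun x => ‖u x‖ ^ p) g' := fun g' hg' => by
    have h2 := avg_le_of_map_le (hm'c.admissible hF.1) (hmc.admissible hF.1)
      (fun x => Real.rpow_nonneg (norm_nonneg _) _) hl (k := g' * g⁻¹)
      (fun i _ => hCD _ (hV g hg g' hg') i) (fun i hi => absurd (hlu i) hi) g'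
    rw [mul_inv_rev, inv_inv, inv_mul_cancel_right] at h2
    exact (rpow_norm_avg_le hmc hp hp2 hu.1 l g).trans h2
  have hD0 : 0 ≤ (D : ℝ) ^ l.length := by positivity
  have h2 := ofReal_mul_le_quotientLIntegral (μ := μ)
    ((RightInvariant.const ((D : ℝ) ^ l.length)).mul (hF.avg hm'c l)) h1
  rw [quotientLIntegral_const_mul (hF.avg hm'c l) hD0, quotientLIntegral_avg hμ hm'c hF
    (fun g => Real.rpow_nonneg (norm_nonneg _) _), ← ENNReal.le_div_iff_mul_le (Or.inl ha0.ne')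
    (Or.inl hat), ENNReal.mul_div_right_comm] at h2
  unfold quotientLpNorm
  rw [← ENNReal.mul_rpow_of_nonneg _ _ hp1.le, one_div, ENNReal.le_rpow_inv_iff hp0,
    ENNReal.ofReal_rpow_of_nonneg (norm_nonneg _) hp0.le]
  exact h2

/-- A contracting average has fixed points after an affine perturbation. -/
theorem exists_eq_add_avg [CompleteSpace E] [DiscreteTopology Γ] (hμ : IsInvariantProbability Γ μ)
    (hm : ∀ i, IsBump (m i)) (hp : 1 < p) (hp2 : p ≤ 2) (hρ : ∀ γ v, ‖ρ γ v‖ = ‖v‖)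
    {l : List ι} (hl : l.Nodup) (hlu : ∀ i, i ∈ l) {c : ℝ≥0∞} (hc : c < 1)
    (hcon : ∀ u : (∀ i, G i) → E, LinearEquivariant ρ u → quotientLpNorm Γ μ p u < ⊤ →
      quotientLpNorm Γ μ p (avg m l u) ≤ c * quotientLpNorm Γ μ p u)
    {u₀ : (∀ i, G i) → E} (hu₀ : LinearEquivariant ρ u₀) (hu₀t : quotientLpNorm Γ μ p u₀ < ⊤) :
    ∃ U : (∀ i, G i) → E, LinearEquivariant ρ U ∧ quotientLpNorm Γ μ p U < ⊤ ∧
      ∀ g, U g = u₀ g + avg m l U g := by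
  have hmc : CompactlyCarried m := fun i => (hm i).exists_isCompact
  set N₀ := quotientLpNorm Γ μ p u₀ with hN₀
  -- Continuous functions are not complete for this norm, so the contraction principle is replaced
  -- by a Neumann series of iterated averages, which converges locally uniformly to a continuous
  -- function.
  set v : ℕ → (∀ i, G i) → E := fun k => (avg m l)^[k] u₀ with hv
  have hvs : ∀ k, v (k + 1) = avg m l (v k) := fun k => Function.iterate_succ_apply' _ _ _
  have hvL : ∀ k, LinearEquivariant ρ (v k) := fun k => by
    induction k with
    | zero => exact hu₀
    | succ k ih => rw [hvs]; exact ih.avg hmc l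
  have hvN : ∀ k, quotientLpNorm Γ μ p (v k) ≤ c ^ k * N₀ := fun k => by
    induction k with
    | zero => simp [hv, hN₀]
    | succ k ih =>
      rw [hvs, pow_succ', mul_assoc]
      refine (hcon _ (hvL k) (ih.trans_lt ?_)).trans (by gcongr)
      exact ENNReal.mul_lt_top (ENNReal.pow_lt_top (hc.trans ENNReal.one_lt_top)) hu₀t
  have hloc : ∀ g₀ : ∀ i, G i, ∃ V ∈ 𝓝 g₀, ∃ A : ℝ, ∀ k, ∀ g ∈ V,
      ‖v (k + 1) g‖ ≤ A * c.toReal ^ k := fun g₀ => by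
    obtain ⟨V, hV, A, hA, h⟩ := exists_norm_avg_le_quotientLpNorm (ρ := ρ) hμ hm hp hp2 hρ hl hlu g₀
    refine ⟨V, hV, (A * N₀).toReal, fun k g hg => ?_⟩
    have h1 := (h (v k) (hvL k) g hg).trans (mul_le_mul_right (hvN k) A)
    rw [← hvs] at h1
    have h2 : A * (c ^ k * N₀) ≠ ⊤ := ENNReal.mul_ne_top hA (ENNReal.mul_lt_top
      (ENNReal.pow_lt_top (hc.trans ENNReal.one_lt_top)) hu₀t).ne
    have h3 := (ENNReal.ofReal_le_iff_le_toReal h2).1 h1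
    rw [mul_left_comm, ENNReal.toReal_mul, ENNReal.toReal_pow, mul_comm] at h3
    exact h3
  have hr1 : c.toReal < 1 := by
    rw [← ENNReal.toReal_one]
    exact (ENNReal.toReal_lt_toReal hc.ne_top ENNReal.one_ne_top).2 hc
  have hsumm : ∀ A : ℝ, Summable fun k : ℕ => A * c.toReal ^ k := fun A =>
    (summable_geometric_of_lt_one ENNReal.toReal_nonneg hr1).mul_left A
  have hsum : ∀ g, Summable fun k => v (k + 1) g := fun g => by
    obtain ⟨V, hV, A, h⟩ := hloc g
    exact Summable.of_norm_bounded (hsumm A) fun k => h k g (mem_of_mem_nhds hV)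
  -- The term of index zero is left out: the local bound by the norm holds only after at least one
  -- averaging.
  set W : (∀ i, G i) → E := fun g => ∑' k, v (k + 1) g with hW
  have hWc : Continuous W := continuous_iff_continuousAt.2 fun g₀ => by
    obtain ⟨V, hV, A, h⟩ := hloc g₀
    exact (continuousOn_tsum (fun k => (hvL (k + 1)).1.continuousOn) (hsumm A)
      fun k g hg => h k g hg).continuousAt hV
  have hWL : LinearEquivariant ρ W := ⟨hWc, fun g γ => by
    simp only [hW, (hvL _).2]
    exact ((ρ γ).map_tsum (hsum g)).symm⟩
  set S : ℕ → (∀ i, G i) → E := fun n g => ∑ k ∈ Finset.range n, v (k + 1) g with hS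
  have hSs : ∀ n g, S (n + 1) g = S n g + v (n + 1) g := fun n g => Finset.sum_range_succ _ _
  have hSL : ∀ n, LinearEquivariant ρ (S n) := fun n => by
    induction n with
    | zero => simpa [hS] using LinearEquivariant.zero (ρ := ρ)
    | succ n ih => exact funext (hSs n) ▸ ih.add (hvL (n + 1))
  have hST : ∀ g, Filter.Tendsto (fun n => S n g) Filter.atTop (𝓝 (W g)) := fun g =>
    (hsum g).hasSum.tendsto_sum_nat
  have hSM : ∀ n g, S (n + 1) g = avg m l u₀ g + avg m l (S n) g := fun n => by
    induction n with
    | zero =>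
      intro g
      have h0 : S 0 = fun _ => (0 : E) := by funext g; simp [hS]
      have h1 : S 1 g = avg m l u₀ g := by simp [hS, hv]
      rw [h0, avg_const, zero_add, add_zero, h1]
    | succ n ih =>
      intro g
      rw [hSs, ih, hvs, funext (hSs n), avg_add (hmc.admissible (hSL n).1)
        (hmc.admissible (hvL _).1), add_assoc]
  have hST' : ∀ n k, quotientLpNorm Γ μ p (fun g => S (n + k) g - S n g) ≤
      ∑ j ∈ Finset.range k, c ^ n * c ^ j * N₀ := fun n k => by
    induction k with
    | zero => simpa using (quotientLpNorm_zero (E := E) hp hμ).le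
    | succ k ih =>
      rw [Finset.sum_range_succ]
      have h1 : (fun g => S (n + (k + 1)) g - S n g) =
          fun g => (S (n + k) g - S n g) + v (n + k + 1) g := by
        funext g; rw [← add_assoc, hSs]; abel
      rw [h1]
      refine (quotientLpNorm_add_le hp hρ ((hSL _).sub (hSL _)) (hvL _)).trans
        (add_le_add ih ((hvN _).trans ?_))
      rw [← pow_add, pow_succ, mul_assoc]
      gcongr
      exact mul_le_of_le_one_left zero_le hc.le
  have hWS : ∀ n, quotientLpNorm Γ μ p (fun g => W g - S n g) ≤ c ^ n * ((1 - c)⁻¹ * N₀) :=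
    fun n => by
    refine quotientLpNorm_le_of_tendsto hp hρ (fun k => (hSL (n + k)).sub (hSL n))
      (fun g => (((hST g).comp (Filter.tendsto_add_atTop_nat n)).congr fun k => by
        simp [add_comm]).sub_const _) fun k => (hST' n k).trans ?_
    rw [← Finset.sum_mul, ← Finset.mul_sum, mul_assoc, ← ENNReal.tsum_geometric]
    gcongr
    exact ENNReal.sum_le_tsum _
  have hBt : (1 - c)⁻¹ * N₀ < ⊤ :=
    ENNReal.mul_lt_top (ENNReal.inv_lt_top.2 (tsub_pos_of_lt hc)) hu₀t
  have hWt : quotientLpNorm Γ μ p W < ⊤ := by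
    have h1 := hWS 0
    simp only [hS, Finset.range_zero, Finset.sum_empty, sub_zero, pow_zero, one_mul] at h1
    exact h1.trans_lt hBt
  -- The equation holds for partial sums up to an index shift. The tails tend to zero in norm, by
  -- Fatou, and a continuous equivariant function of norm zero vanishes.
  have hWM : ∀ g, W g - (avg m l u₀ g + avg m l W g) = 0 := by
    have hzL : LinearEquivariant ρ fun g => W g - (avg m l u₀ g + avg m l W g) :=
      hWL.sub ((hu₀.avg hmc l).add (hWL.avg hmc l))
    refine eq_zero_of_quotientLpNorm_eq_zero hμ hp hρ hzL ?_
    have hz : ∀ n, quotientLpNorm Γ μ p (fun g => W g - (avg m l u₀ g + avg m l W g)) ≤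
        c ^ n * (2 * ((1 - c)⁻¹ * N₀)) := fun n => by
      have h1 : (fun g => W g - (avg m l u₀ g + avg m l W g)) =
          fun g => (W g - S (n + 1) g) - avg m l (fun g => W g - S n g) g := by
        funext g
        rw [hSM, avg_sub (hmc.admissible hWL.1) (hmc.admissible (hSL n).1)]
        abel
      rw [h1]
      refine (quotientLpNorm_sub_le hp hρ (hWL.sub (hSL _)) ((hWL.sub (hSL _)).avg hmc l)).trans ?_
      rw [two_mul, mul_add]
      refine add_le_add ((hWS _).trans ?_)
        ((quotientLpNorm_avg_le hμ hmc hp hp2 hρ (hWL.sub (hSL _)) l).trans (hWS n))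
      rw [pow_succ, mul_assoc]
      exact mul_le_mul_right (mul_le_of_le_one_left zero_le hc.le) _
    have h2 : Filter.Tendsto (fun n : ℕ => c ^ n * (2 * ((1 - c)⁻¹ * N₀))) Filter.atTop (𝓝 0) := by
      have h3 := ENNReal.Tendsto.mul_const (b := 2 * ((1 - c)⁻¹ * N₀))
        (ENNReal.tendsto_pow_atTop_nhds_zero_of_lt_one hc)
        (Or.inr (ENNReal.mul_lt_top (by simp) hBt).ne)
      rwa [zero_mul] at h3
    exact le_antisymm (ge_of_tendsto' h2 hz) zero_le
  refine ⟨fun g => u₀ g + W g, hu₀.add hWL, (quotientLpNorm_add_le hp hρ hu₀ hWL).trans_lt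
    (ENNReal.add_lt_top.2 ⟨hu₀t, hWt⟩), fun g => ?_⟩
  rw [avg_add (hmc.admissible hu₀.1) (hmc.admissible hWL.1), ← sub_eq_zero.1 (hWM g)]

end EnergyNorm

/-! ### Splitting functions from an initial function of finite displacement. -/

section Splitting

variable {ι : Type*} [Fintype ι] [DecidableEq ι] {G : ι → Type*} [∀ i, Group (G i)]
  [∀ i, TopologicalSpace (G i)] [∀ i, IsTopologicalGroup (G i)] [∀ i, T2Space (G i)]
  [∀ i, LocallyCompactSpace (G i)] [∀ i, SigmaCompactSpace (G i)]
  [∀ i, MeasurableSpace (G i)] [∀ i, BorelSpace (G i)]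
  {E : Type*} [NormedAddCommGroup E] [NormedSpace ℝ E]
  {m : ∀ i, Measure (G i)} [∀ i, IsProbabilityMeasure (m i)]
  {p : ℝ} {Γ : Subgroup (∀ i, G i)} {μ : @Measure ((∀ i, G i) ⧸ Γ) (borel ((∀ i, G i) ⧸ Γ))}
  {ρ : Γ →* (E →L[ℝ] E)}

/-- Fubini for continuous functions and compactly carried measures. -/
lemma integral_integral_swap_of_isCompact {X Y : Type*} [TopologicalSpace X] [T2Space X]
    [LocallyCompactSpace X] [MeasurableSpace X] [BorelSpace X] [TopologicalSpace Y] [T2Space Y]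
    [LocallyCompactSpace Y] [MeasurableSpace Y] [BorelSpace Y] {μ : Measure X} [IsFiniteMeasure μ]
    {ν : Measure Y} [IsFiniteMeasure ν] {K : Set X} (hK : IsCompact K) (hμ : μ Kᶜ = 0)
    {L : Set Y} (hL : IsCompact L) (hν : ν Lᶜ = 0) {f : X → Y → E} (hf : Continuous f.uncurry) :
    ∫ x, ∫ y, f x y ∂ν ∂μ = ∫ y, ∫ x, f x y ∂μ ∂ν := by
  obtain ⟨a, ha1, ha, -, -⟩ := exists_continuousMap_one_of_isCompact_subset_isOpen hK isOpen_univ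
    (Set.subset_univ _)
  obtain ⟨b, hb1, hb, -, -⟩ := exists_continuousMap_one_of_isCompact_subset_isOpen hL isOpen_univ
    (Set.subset_univ _)
  have hx : ∀ᵐ x ∂μ, x ∈ K := mem_ae_iff.2 hμ
  have hy : ∀ᵐ y ∂ν, y ∈ L := mem_ae_iff.2 hν
  set f' : X → Y → E := fun x y => (a x * b y) • f x y with hf'
  have hc : Continuous f'.uncurry := by
    have h1 : Continuous fun z : X × Y => a z.1 * b z.2 := by fun_prop
    exact h1.smul hf
  have hs : HasCompactSupport f'.uncurry := by
    refine HasCompactSupport.intro (IsCompact.prod ha hb) fun z hz => ?_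
    change (a z.1 * b z.2) • f z.1 z.2 = 0
    by_cases h1 : z.1 ∈ tsupport a
    · have h2 : z.2 ∉ tsupport b := fun h2 => hz ⟨h1, h2⟩
      rw [image_eq_zero_of_notMem_tsupport h2, mul_zero, zero_smul]
    · rw [image_eq_zero_of_notMem_tsupport h1, zero_mul, zero_smul]
  have he : ∀ x ∈ K, ∀ y ∈ L, f x y = f' x y := fun x hx y hy => by simp [hf', ha1 hx, hb1 hy]
  calc ∫ x, ∫ y, f x y ∂ν ∂μ = ∫ x, ∫ y, f' x y ∂ν ∂μ := integral_congr_ae (by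
        filter_upwards [hx] with x hx
        exact integral_congr_ae (by filter_upwards [hy] with y hy using he x hx y hy))
    _ = ∫ y, ∫ x, f' x y ∂μ ∂ν := integral_integral_swap_of_hasCompactSupport hc hs
    _ = _ := integral_congr_ae (by
        filter_upwards [hy] with y hy
        exact integral_congr_ae (by filter_upwards [hx] with x hx using (he x hx y hy).symm))

lemma avg_cons_swap (hm : CompactlyCarried m) {u : (∀ i, G i) → E} (hu : Continuous u) (i j : ι)
    (g : ∀ i, G i) : avg m [i] (avg m [j] u) g = avg m [j] (avg m [i] u) g := by
  rcases eq_or_ne i j with rfl | hij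
  · rfl
  obtain ⟨K, hK, hK0⟩ := hm i
  obtain ⟨L, hL, hL0⟩ := hm j
  have hi : Continuous fun h : G i => (Pi.mulSingle i h : ∀ i, G i) := continuous_mulSingle i
  have hj : Continuous fun h : G j => (Pi.mulSingle j h : ∀ i, G i) := continuous_mulSingle j
  have h1 := integral_integral_swap_of_isCompact hK hK0 hL hL0
    (f := fun h k => u ((Pi.mulSingle j k)⁻¹ * ((Pi.mulSingle i h)⁻¹ * g))) (by
      change Continuous fun z : G i × G j => u ((Pi.mulSingle j z.2)⁻¹ *
        ((Pi.mulSingle i z.1)⁻¹ * g))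
      fun_prop)
  refine h1.trans (integral_congr_ae (ae_of_all _ fun k => integral_congr_ae
    (ae_of_all _ fun h => ?_)))
  dsimp only
  rw [← mul_assoc, ← mul_assoc, mulSingle_inv_mul_comm (by simp [hij.symm])]
  rfl

lemma avg_avg_comm (hm : CompactlyCarried m) {u : (∀ i, G i) → E} (hu : Continuous u) (i : ι)
    (l : List ι) : avg m l (avg m [i] u) = avg m [i] (avg m l u) := by
  induction l with
  | nil => rfl
  | cons j l ih =>
    have h1 : avg m (j :: l) (avg m [i] u) = avg m [j] (avg m l (avg m [i] u)) := rfl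
    rw [h1, ih]
    exact funext fun g => avg_cons_swap hm ((hm.admissible hu).avg l).1 j i g

/-- Equality in the convexity inequality for a function fixed by an average. -/
lemma eq_of_avg_eq_self [CompleteSpace E] [UniformConvexSpace E] [DiscreteTopology Γ]
    (hμ : IsInvariantProbability Γ μ)
    (hm : CompactlyCarried m) (hp : 1 < p) (hp2 : p ≤ 2) (hρ : ∀ γ v, ‖ρ γ v‖ = ‖v‖)
    {y : (∀ i, G i) → E} (hy : LinearEquivariant ρ y) (hyt : quotientLpNorm Γ μ p y < ⊤) {j : ι}
    (hyj : avg m [j] y = y) {h : G j} (hh : h ∈ (m j).support) (g : ∀ i, G i) :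
    y ((Pi.mulSingle j h)⁻¹ * g) = y g := by
  have hp0 : 0 < p := by linarith
  have hJ : quotientLIntegral Γ μ (fun g => ‖y g‖ ^ p) < ⊤ :=
    (ENNReal.rpow_lt_top_iff_of_pos (by positivity)).1 hyt
  have hF := hy.rpow_norm hρ hp0.le
  have hF0 : ∀ g, 0 ≤ ‖y g‖ ^ p := fun g => Real.rpow_nonneg (norm_nonneg _) _
  have hle : ∀ g, ‖y g‖ ^ p ≤ avg m [j] (fun x => ‖y x‖ ^ p) g := fun g => by
    have h1 := rpow_norm_avg_le hm hp hp2 hy.1 [j] g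
    rwa [hyj] at h1
  -- `‖y‖ ^ p` lies below its average and both have the same finite integral. The difference has
  -- zero integral and, being continuous, vanishes everywhere.
  have hD : quotientLIntegral Γ μ
      (fun g => avg m [j] (fun x => ‖y x‖ ^ p) g - ‖y g‖ ^ p) = 0 := by
    have h1 := quotientLIntegral_add (μ := μ) hF hF0 (fun g => sub_nonneg.2 (hle g))
    simp only [add_sub_cancel] at h1
    rw [quotientLIntegral_avg hμ hm hF hF0] at h1
    exact (ENNReal.add_right_inj hJ.ne).1 (by rw [add_zero, ← h1])
  have heq : avg m [j] (fun x => ‖y x‖ ^ p) g ≤ ‖y g‖ ^ p :=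
    sub_nonpos.1 (eq_zero_of_quotientLIntegral_eq_zero hμ ((hF.avg hm [j]).sub hF) hD g)
  have hb : ‖y g‖ ≤ avg m [j] (fun x => ‖y x‖) g := by
    have h1 := norm_avg_le (hm.admissible hy.1) [j] g
    rwa [hyj] at h1
  have hR := rpow_avg_add_le hm hp hp2 hy.1.norm (fun _ => norm_nonneg _) [j] g
  have hbp : ‖y g‖ ^ p ≤ avg m [j] (fun x => ‖y x‖) g ^ p :=
    Real.rpow_le_rpow (norm_nonneg _) hb hp0.le
  set Q := avg m [j] (fun x => (‖y x‖ ^ (p / 2) - avg m [j] (fun x => ‖y x‖) g ^ (p / 2)) ^ 2) g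
    with hQ
  have hQ0 : 0 ≤ Q := avg_nonneg (fun _ => sq_nonneg _) _ _
  -- Equality in Jensen kills the defect, so `‖y‖` is constant on the translates by the support;
  -- with a functional norming `y g`, strict convexity then fixes the vector itself.
  have hQ1 : (p - 1) * Q = 0 := le_antisymm (by linarith) (mul_nonneg (by linarith) hQ0)
  have hQ2 : Q = 0 := (mul_eq_zero.1 hQ1).resolve_left (by linarith)
  have hbe : avg m [j] (fun x => ‖y x‖) g = ‖y g‖ := by
    refine le_antisymm ?_ hb
    rw [← Real.rpow_le_rpow_iff (hb.trans' (norm_nonneg _)) (norm_nonneg _) hp0]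
    linarith
  obtain ⟨T, hT, hTv⟩ := exists_dual_vector'' ℝ (y g)
  simp only [RCLike.ofReal_real_eq_id, id] at hTv
  have hTy : ∀ x, T (y x) ≤ ‖y x‖ := fun x =>
    (le_abs_self _).trans (by simpa using T.le_of_opNorm_le hT _)
  have hTc : Continuous fun x => T (y x) := T.continuous.comp hy.1
  have hyn := hy.1.norm
  have h0 : avg m [j] (fun x => ‖y x‖ - T (y x)) g = 0 := by
    rw [avg_sub (hm.admissible hyn) (hm.admissible hTc), avg_clm (hm.admissible hy.1), hyj, hTv,
      hbe, sub_self]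
  have hwc : Continuous fun x => (‖y x‖ ^ (p / 2) - avg m [j] (fun x => ‖y x‖) g ^ (p / 2)) ^ 2 :=
    ((hyn.rpow_const fun _ => Or.inr (by linarith)).sub continuous_const).pow 2
  have key : ∀ F : (∀ i, G i) → ℝ, Continuous F → (∀ g, 0 ≤ F g) → avg m [j] F g = 0 →
      F ((Pi.mulSingle j h)⁻¹ * g) = 0 := fun F hF hF0 h0 =>
    eq_zero_of_avg_eq_zero (hm.admissible hF) hF0 (List.nodup_singleton j) h0
      (fun i hi => by obtain rfl := List.mem_singleton.1 hi; simpa using hh)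
      (fun i hi => by rw [List.mem_singleton] at hi; simp [hi])
  have h1 := key (fun x => ‖y x‖ - T (y x)) (hyn.sub hTc) (fun x => sub_nonneg.2 (hTy x)) h0
  have h2 := key _ hwc (fun _ => sq_nonneg _) hQ2
  set v := y ((Pi.mulSingle j h)⁻¹ * g) with hv
  have h3 : ‖v‖ = ‖y g‖ := by
    rw [hbe] at h2
    have h4 := sub_eq_zero.1 (pow_eq_zero_iff two_ne_zero |>.1 h2)
    exact (Real.rpow_left_inj (norm_nonneg _) (norm_nonneg _) (by linarith)).1 h4
  refine eq_of_norm_eq_of_norm_add_eq h3 (le_antisymm (norm_add_le _ _) ?_)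
  have h4 : T (v + y g) ≤ ‖v + y g‖ :=
    (le_abs_self _).trans
      (by rw [← Real.norm_eq_abs]; simpa only [one_mul] using T.le_of_opNorm_le hT _)
  have h5 : ‖v‖ = T v := sub_eq_zero.1 h1
  rw [map_add, ← h5, hTv] at h4
  exact h4

/-- Functions invariant under generators of a dense subgroup of a factor are invariant. -/
lemma eq_of_invariant_generators (hirr : IsIrreducibleSubgroup Γ) {S : Set Γ}
    (hS : Subgroup.closure S = ⊤) {y : (∀ i, G i) → E} (hy : Continuous y) {j : ι}
    (h : ∀ γ ∈ S, ∀ g, y ((Pi.mulSingle j ((γ : ∀ i, G i) j))⁻¹ * g) = y g) (x : G j)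
    (g : ∀ i, G i) : y (Pi.mulSingle j x * g) = y g := by
  have hΓ : ∀ γ : Γ, ∀ g, y (Pi.mulSingle j ((γ : ∀ i, G i) j) * g) = y g := fun γ => by
    have hγ : γ ∈ Subgroup.closure S := hS ▸ Subgroup.mem_top γ
    induction hγ using Subgroup.closure_induction with
    | mem γ hγ => intro g; rw [← h γ hγ, inv_mul_cancel_left]
    | one => intro g; simp
    | mul a b _ _ ha hb =>
      intro g
      rw [Subgroup.coe_mul, Pi.mul_apply, Pi.mulSingle_mul, mul_assoc, ha, hb]
    | inv a _ ha =>
      intro g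
      rw [← ha, Subgroup.coe_inv, Pi.inv_apply, Pi.mulSingle_inv, mul_inv_cancel_left]
  have hj : Continuous fun h : G j => (Pi.mulSingle j h : ∀ i, G i) := continuous_mulSingle j
  have hcl : IsClosed {x : G j | y (Pi.mulSingle j x * g) = y g} :=
    isClosed_eq (by fun_prop) continuous_const
  have hsub : (fun g : ∀ i, G i => g j) '' (Γ : Set (∀ i, G i)) ⊆
      {x : G j | y (Pi.mulSingle j x * g) = y g} := by
    rintro _ ⟨γ, hγ, rfl⟩
    exact hΓ ⟨γ, hγ⟩ g
  exact closure_minimal hsub hcl (hirr j x)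

lemma eq_of_forall_mulSingle {y : (∀ i, G i) → E} {i : ι}
    (h : ∀ j, j ≠ i → ∀ x g, y (Pi.mulSingle j x * g) = y g) {k : ∀ i, G i} (hk : k i = 1)
    (g : ∀ i, G i) : y (k * g) = y g := by
  have key : ∀ s : Finset ι, ∀ k : ∀ i, G i, k i = 1 → (∀ j ∉ s, k j = 1) → y (k * g) = y g := by
    intro s
    induction s using Finset.induction_on with
    | empty =>
      intro k _ hks
      have : k = 1 := funext fun j => hks j (by simp)
      rw [this, one_mul]
    | insert j s _ ih =>
      intro k hk hks
      have e : k = Pi.mulSingle j (k j) * Function.update k j 1 := by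
        ext j'
        rcases eq_or_ne j' j with rfl | hj
        · simp
        · simp [hj]
      have h1 : y (Function.update k j 1 * g) = y g := by
        refine ih _ ?_ fun j' hj' => ?_
        · rcases eq_or_ne i j with rfl | hj
          · simp
          · simp [hj, hk]
        · rcases eq_or_ne j' j with rfl | hj
          · simp
          · rw [Function.update_of_ne hj]
            exact hks j' (by simp [hj, hj'])
      rcases eq_or_ne j i with rfl | hji
      · rw [hk, Pi.mulSingle_one, one_mul] at e
        rw [e]; exact h1
      · rw [e, mul_assoc, h j hji, h1]
  exact key Finset.univ k hk fun j hj => absurd (Finset.mem_univ j) hj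

variable {α : Γ →* (E ≃ᵃ[ℝ] E)}

variable (α) in
/-- Continuous functions which are equivariant for an affine action. -/
def AffineEquivariant (f : (∀ i, G i) → E) : Prop :=
  Continuous f ∧ ∀ (g : ∀ i, G i) (γ : Γ), f (g * (γ : ∀ i, G i)⁻¹) = α γ (f g)

lemma AffineEquivariant.sub (hρα : ∀ γ v, ρ γ v = (α γ).linear v) {f f' : (∀ i, G i) → E}
    (hf : AffineEquivariant α f) (hf' : AffineEquivariant α f') :
    LinearEquivariant ρ fun g => f g - f' g :=
  ⟨hf.1.sub hf'.1, fun g γ => by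
    dsimp only
    rw [hf.2, hf'.2, AffineEquiv.sub_eq_linear, hρα]⟩

lemma AffineEquivariant.add (hρα : ∀ γ v, ρ γ v = (α γ).linear v) {f u : (∀ i, G i) → E}
    (hf : AffineEquivariant α f) (hu : LinearEquivariant ρ u) :
    AffineEquivariant α fun g => f g + u g :=
  ⟨hf.1.add hu.1, fun g γ => by
    have h2 := AffineEquiv.sub_eq_linear (α γ) (f g + u g) (f g)
    rw [add_sub_cancel_left, sub_eq_iff_eq_add', ← hρα] at h2
    dsimp only
    rw [h2, hf.2, hu.2]⟩

lemma AffineEquivariant.comp_mul_left {f : (∀ i, G i) → E} (hf : AffineEquivariant α f)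
    (k : ∀ i, G i) : AffineEquivariant α fun g => f (k * g) :=
  ⟨hf.1.comp (continuous_const_mul k), fun g γ => by dsimp only; rw [← mul_assoc, hf.2]⟩

lemma AffineEquivariant.avg [CompleteSpace E] (hρα : ∀ γ v, ρ γ v = (α γ).linear v)
    (hm : CompactlyCarried m) {f : (∀ i, G i) → E}
    (hf : AffineEquivariant α f) (l : List ι) : AffineEquivariant α (avg m l f) :=
  ⟨((hm.admissible hf.1).avg l).1, fun g γ => by
    have ha : ∀ v, α γ v = ρ γ v + α γ 0 := fun v => by
      have := AffineEquiv.sub_eq_linear (α γ) v 0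
      rwa [sub_zero, ← hρα, sub_eq_iff_eq_add] at this
    rw [← avg_comp_mul_right, ha, ← avg_clm (hm.admissible hf.1)]
    have e : (fun x => f (x * (γ : ∀ i, G i)⁻¹)) = fun x => ρ γ (f x) + α γ 0 :=
      funext fun x => (hf.2 x γ).trans (ha _)
    rw [e, avg_add ((hm.admissible hf.1).clm (ρ γ)) (Admissible.const _), avg_const]⟩

/-- Given an equivariant function of finite displacement and contracting averages, there is an
equivariant function whose increments along each factor are invariant under the others. -/
theorem exists_splitting_function_of_displacement [CompleteSpace E] [UniformConvexSpace E]
    [DiscreteTopology Γ] (hirr : IsIrreducibleSubgroup Γ) (hμ : IsInvariantProbability Γ μ)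
    (hm : ∀ i, IsBump (m i)) (hp : 1 < p) (hp2 : p ≤ 2) (hρ : ∀ γ v, ‖ρ γ v‖ = ‖v‖)
    (hρα : ∀ γ v, ρ γ v = (α γ).linear v)
    {l : List ι} (hl : l.Nodup) (hlu : ∀ i, i ∈ l) {c : ℝ≥0∞} (hc : c < 1)
    (hcon : ∀ u : (∀ i, G i) → E, LinearEquivariant ρ u → quotientLpNorm Γ μ p u < ⊤ →
      quotientLpNorm Γ μ p (avg m l u) ≤ c * quotientLpNorm Γ μ p u)
    {S : Set Γ} (hS : Subgroup.closure S = ⊤)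
    (hSm : ∀ γ ∈ S, ∀ j, (γ : ∀ i, G i) j ∈ (m j).support)
    {f₀ : (∀ i, G i) → E} (hf₀ : AffineEquivariant α f₀)
    (hdisp : ∀ k, quotientLpNorm Γ μ p (fun g => f₀ (k * g) - f₀ g) < ⊤)
    (havg : ∀ i, quotientLpNorm Γ μ p (fun g => avg m [i] f₀ g - f₀ g) < ⊤) :
    ∃ f : (∀ i, G i) → E, Continuous f ∧
      (∀ (g : ∀ i, G i) (γ : Γ), f (g * (γ : ∀ i, G i)⁻¹) = α γ (f g)) ∧
      ∀ i (h : G i) (k g : ∀ i, G i), k i = 1 →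
        f (Pi.mulSingle i h * (k * g)) - f (k * g) = f (Pi.mulSingle i h * g) - f g := by
  have hmc : CompactlyCarried m := fun i => (hm i).exists_isCompact
  -- Finite displacement passes from single averages to iterated ones, because averaging does not
  -- increase the norm.
  have hM : ∀ l' : List ι, quotientLpNorm Γ μ p (fun g => avg m l' f₀ g - f₀ g) < ⊤ := fun l' => by
    induction l' with
    | nil =>
      have : (fun g => avg m [] f₀ g - f₀ g) = fun _ => (0 : E) := funext fun g => sub_self _
      rw [this, quotientLpNorm_zero hp hμ]
      exact ENNReal.zero_lt_top
    | cons i l' ih =>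
      have hL := (hf₀.avg hρα hmc l').sub hρα hf₀
      have e : (fun g => avg m (i :: l') f₀ g - f₀ g) = fun g =>
          avg m [i] (fun x => avg m l' f₀ x - f₀ x) g + (avg m [i] f₀ g - f₀ g) := by
        funext g
        rw [avg_sub ((hmc.admissible hf₀.1).avg l') (hmc.admissible hf₀.1), sub_add_sub_cancel]
        rfl
      rw [e]
      exact (quotientLpNorm_add_le hp hρ (hL.avg hmc [i])
        ((hf₀.avg hρα hmc [i]).sub hρα hf₀)).trans_lt (ENNReal.add_lt_top.2
        ⟨(quotientLpNorm_avg_le hμ hmc hp hp2 hρ hL [i]).trans_lt ih, havg i⟩)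
  obtain ⟨U, hU, hUt, hUe⟩ := exists_eq_add_avg hμ hm hp hp2 hρ hl hlu hc hcon
    ((hf₀.avg hρα hmc l).sub hρα hf₀) (hM l)
  set f : (∀ i, G i) → E := fun g => f₀ g + U g with hf
  have hfA : AffineEquivariant α f := hf₀.add hρα hU
  have hfM : avg m l f = f := by
    funext g
    rw [hf, avg_add (hmc.admissible hf₀.1) (hmc.admissible hU.1)]
    dsimp only
    rw [hUe g]
    abel
  -- The difference is a linear equivariant function of finite norm fixed by the full average, as
  -- the averages commute; the strict contraction forces it to vanish.
  have hfi : ∀ i, avg m [i] f = f := fun i => by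
    have hz : LinearEquivariant ρ fun g => avg m [i] f g - f g := (hfA.avg hρα hmc [i]).sub hρα hfA
    have hzt : quotientLpNorm Γ μ p (fun g => avg m [i] f g - f g) < ⊤ := by
      have e : (fun g => avg m [i] f g - f g) = fun g =>
          (avg m [i] U g - U g) + (avg m [i] f₀ g - f₀ g) := by
        funext g
        rw [hf, avg_add (hmc.admissible hf₀.1) (hmc.admissible hU.1)]
        dsimp only
        abel
      rw [e]
      exact (quotientLpNorm_add_le hp hρ ((hU.avg hmc [i]).sub hU)
        ((hf₀.avg hρα hmc [i]).sub hρα hf₀)).trans_lt (ENNReal.add_lt_top.2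
        ⟨(quotientLpNorm_sub_le hp hρ (hU.avg hmc [i]) hU).trans_lt (ENNReal.add_lt_top.2
          ⟨(quotientLpNorm_avg_le hμ hmc hp hp2 hρ hU [i]).trans_lt hUt, hUt⟩), havg i⟩)
    have hzM : avg m l (fun g => avg m [i] f g - f g) = fun g => avg m [i] f g - f g := by
      funext g
      rw [avg_sub ((hmc.admissible hfA.1).avg [i]) (hmc.admissible hfA.1),
        avg_avg_comm hmc hfA.1, hfM]
    have h1 := hcon _ hz hzt
    rw [hzM] at h1
    have h0 : quotientLpNorm Γ μ p (fun g => avg m [i] f g - f g) = 0 := by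
      by_contra hne
      exact absurd h1 (not_le.2 (by
        conv_rhs => rw [← one_mul (quotientLpNorm Γ μ p fun g => avg m [i] f g - f g)]
        exact ENNReal.mul_lt_mul_left hne hzt.ne hc))
    exact funext fun g => sub_eq_zero.1 (eq_zero_of_quotientLpNorm_eq_zero hμ hp hρ hz h0 g)
  refine ⟨f, hfA.1, hfA.2, fun i h k g hk => ?_⟩
  set y : (∀ i, G i) → E := fun g => f (Pi.mulSingle i h * g) - f g with hy
  have hyL : LinearEquivariant ρ y := (hfA.comp_mul_left _).sub hρα hfA
  have hyt : quotientLpNorm Γ μ p y < ⊤ := by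
    have e : y = fun g => (U (Pi.mulSingle i h * g) - U g) +
        (f₀ (Pi.mulSingle i h * g) - f₀ g) := by
      funext g
      simp only [hy, hf]
      abel
    rw [e]
    refine (quotientLpNorm_add_le hp hρ ((hU.comp_mul_left _).sub hU)
      ((hf₀.comp_mul_left _).sub hρα hf₀)).trans_lt (ENNReal.add_lt_top.2
      ⟨(quotientLpNorm_sub_le hp hρ (hU.comp_mul_left _) hU).trans_lt ?_, hdisp _⟩)
    rw [quotientLpNorm_comp_mul_left hμ hp hρ hU]
    exact ENNReal.add_lt_top.2 ⟨hUt, hUt⟩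
  -- Left translation along the factor `i` commutes with the average over the factor `j`, which
  -- fixes `f`.
  have hyj : ∀ j, j ≠ i → avg m [j] y = y := fun j hj => by
    funext g
    have hc' := hfA.comp_mul_left (Pi.mulSingle i h)
    rw [hy, avg_sub (hmc.admissible hc'.1) (hmc.admissible hfA.1),
      avg_comp_mul_left f _ [j] (fun j' hj' => by
        rw [List.mem_singleton] at hj'
        simp [hj', hj]), hfi]
  exact eq_of_forall_mulSingle (y := y) (fun j hj x g => eq_of_invariant_generators hirr hS hyL.1
    (fun γ hγ g => eq_of_avg_eq_self hμ hmc hp hp2 hρ hyL hyt (hyj j hj) (hSm γ hγ j) g) x g) hk g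

end Splitting

/-! ### The integral over the quotient against Haar measure. -/

section HaarQuotient

variable {H : Type*} [Group H] [TopologicalSpace H] [IsTopologicalGroup H] [T2Space H]
  [LocallyCompactSpace H] [SigmaCompactSpace H] [MeasurableSpace H] [BorelSpace H]
  {Γ : Subgroup H} [DiscreteTopology Γ] {μ : @Measure (H ⧸ Γ) (borel (H ⧸ Γ))}

lemma rightInvariant_periodize {ψ : H → ℝ} (hψ : Continuous ψ) (hs : HasCompactSupport ψ) :
    RightInvariant Γ (periodize Γ ψ fun _ => (1 : ℝ)) :=
  ⟨continuous_periodize hψ hs _, fun g γ => periodize_const_mul_right ψ 1 g γ⟩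

lemma periodize_nonneg {ψ : H → ℝ} (h0 : ∀ g, 0 ≤ ψ g) (g : H) :
    0 ≤ periodize Γ ψ (fun _ => (1 : ℝ)) g :=
  finsum_nonneg fun γ => by simpa using h0 _

lemma periodize_mul {F ψ : H → ℝ} (hF : ∀ g (γ : Γ), F (g * γ) = F g) (g : H) :
    periodize Γ (fun h => F h * ψ h) (fun _ => (1 : ℝ)) g =
      F g * periodize Γ ψ (fun _ => (1 : ℝ)) g := by
  simp only [periodize, hF, mul_smul]
  rw [← smul_eq_mul, smul_finsum]

/-- The integral over the quotient of periodizations is proportional to the Haar integral. -/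
theorem exists_quotientLIntegral_periodize (hμ : IsInvariantProbability Γ μ) :
    ∃ c : NNReal, ∀ ψ : H → ℝ, Continuous ψ → HasCompactSupport ψ → (∀ g, 0 ≤ ψ g) →
      quotientLIntegral Γ μ (periodize Γ ψ fun _ => (1 : ℝ)) =
        c * ∫⁻ g, ENNReal.ofReal (ψ g) ∂Measure.haar := by
  let _ : MeasurableSpace (H ⧸ Γ) := borel (H ⧸ Γ)
  have _ : BorelSpace (H ⧸ Γ) := ⟨rfl⟩
  have h1 : IsProbabilityMeasure μ := hμ.1
  have h2 : SMulInvariantMeasure H (H ⧸ Γ) μ := hμ.2.2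
  have _ : IsClosed (Γ : Set H) := Subgroup.isClosed_of_discrete
  have _ : T2Space (H ⧸ Γ) := inferInstance
  set T : (H → ℝ) → H ⧸ Γ → ℝ := fun ψ x => periodize Γ ψ (fun _ => (1 : ℝ)) x.out with hT
  have hTc : ∀ ψ : H → ℝ, Continuous ψ → HasCompactSupport ψ → Continuous (T ψ) :=
    fun ψ hψ hs => (rightInvariant_periodize hψ hs).continuous_out
  have hTi : ∀ ψ : H → ℝ, Continuous ψ → HasCompactSupport ψ → Integrable (T ψ) μ :=
    fun ψ hψ hs => by
    refine (hTc ψ hψ hs).integrable_of_hasCompactSupport (HasCompactSupport.intro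
      (hs.isCompact.image (QuotientGroup.continuous_mk (N := Γ))) fun x hx => ?_)
    refine finsum_eq_zero_of_forall_eq_zero fun γ => ?_
    have h3 : x.out * (γ : H) ∉ tsupport ψ := fun h3 => hx ⟨_, h3, by
      rw [QuotientGroup.mk_mul_of_mem _ γ.2]; exact QuotientGroup.out_eq' x⟩
    simp [image_eq_zero_of_notMem_tsupport h3]
  -- Integrating periodizations is a positive functional. Its Riesz measure is left invariant
  -- because `μ` is, so uniqueness of Haar measure gives the constant.
  let Λ : CompactlySupportedContinuousMap H ℝ →ₚ[ℝ] ℝ := PositiveLinearMap.mk₀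
    { toFun := fun ψ => ∫ x, T ψ x ∂μ
      map_add' := fun ψ φ => by
        refine Eq.trans ?_ (integral_add (hTi ψ ψ.continuous ψ.hasCompactSupport)
          (hTi φ φ.continuous φ.hasCompactSupport))
        refine integral_congr_ae (ae_of_all _ fun x => ?_)
        simp only [hT, periodize]
        have h3 := finite_support_smul ψ.hasCompactSupport (fun _ : Γ => (1 : ℝ)) x.out
        have h4 := finite_support_smul φ.hasCompactSupport (fun _ : Γ => (1 : ℝ)) x.out
        refine Eq.trans (finsum_congr fun γ => ?_) (finsum_add_distrib h3 h4)
        simp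
      map_smul' := fun a ψ => by
        rw [RingHom.id_apply, ← integral_smul]
        refine integral_congr_ae (ae_of_all _ fun x => ?_)
        simp only [hT, periodize]
        rw [smul_finsum]
        exact finsum_congr fun γ => by simp }
    (fun ψ hψ => integral_nonneg fun x => periodize_nonneg (fun g => hψ g) _)
  have hΛ : ∀ ψ : CompactlySupportedContinuousMap H ℝ, Λ ψ = ∫ x, T ψ x ∂μ := fun ψ => rfl
  set ν := RealRMK.rieszMeasure Λ with hν
  have hνΛ : ∀ ψ : CompactlySupportedContinuousMap H ℝ, ∫ x, ψ x ∂ν = Λ ψ := RealRMK.integral_rieszMeasure Λ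
  have hinv : ν.IsMulLeftInvariant := ⟨fun g => by
    have hr : (ν.map fun h => g * h).Regular := Measure.Regular.map (Homeomorph.mulLeft g)
    refine Measure.ext_of_integral_eq_on_compactlySupported fun ψ => ?_
    have e1 : ∫ x, ψ x ∂(ν.map fun h => g * h) = ∫ x, ψ (g * x) ∂ν :=
      (Homeomorph.mulLeft g).measurableEmbedding.integral_map _
    let φ : CompactlySupportedContinuousMap H ℝ := ⟨⟨fun h => ψ (g * h), ψ.continuous.comp (continuous_const_mul g)⟩,
      ψ.hasCompactSupport.comp_homeomorph (Homeomorph.mulLeft g)⟩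
    have e2 : ∫ x, ψ (g * x) ∂ν = Λ φ := hνΛ φ
    rw [e1, e2, hνΛ, hΛ, hΛ]
    have hmp : MeasurePreserving (fun x : H ⧸ Γ => g • x) μ μ := measurePreserving_smul g μ
    refine Eq.trans ?_ (hmp.integral_comp (Homeomorph.smul g).measurableEmbedding (T ψ))
    refine integral_congr_ae (ae_of_all _ fun x => ?_)
    refine Eq.trans ?_
      ((rightInvariant_periodize ψ.continuous ψ.hasCompactSupport).out_smul g x).symm
    refine finsum_congr fun γ => ?_
    rw [mul_assoc]
    rfl⟩
  refine ⟨ν.haarScalarFactor Measure.haar, fun ψ hψ hs h0 => ?_⟩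
  have e1 := Measure.integral_isMulLeftInvariant_eq_smul_of_hasCompactSupport ν Measure.haar hψ hs
  have e2 : ∫ x, ψ x ∂ν = ∫ x, T ψ x ∂μ := hνΛ ⟨⟨ψ, hψ⟩, hs⟩
  rw [e2, integral_smul_nnreal_measure, NNReal.smul_def, smul_eq_mul] at e1
  have e3 := ofReal_integral_eq_lintegral_ofReal (hTi ψ hψ hs)
    (ae_of_all _ fun x => periodize_nonneg h0 _)
  have e4 := ofReal_integral_eq_lintegral_ofReal (μ := Measure.haar)
    (hψ.integrable_of_hasCompactSupport hs) (ae_of_all _ h0)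
  unfold quotientLIntegral
  rw [← e4, ← ENNReal.ofReal_coe_nnreal, ← ENNReal.ofReal_mul (NNReal.coe_nonneg _), ← e1]
  exact e3.symm

/-- Compactly supported functions with periodizations converging to one from below. -/
lemma exists_periodize_tendsto_one (Γ : Subgroup H) [DiscreteTopology Γ] :
    ∃ ψ : ℕ → H → ℝ, (∀ n, Continuous (ψ n)) ∧ (∀ n, HasCompactSupport (ψ n)) ∧
      (∀ n g, 0 ≤ ψ n g) ∧ (∀ n g, periodize Γ (ψ n) (fun _ => (1 : ℝ)) g ≤ 1) ∧
      ∀ g, Filter.Tendsto (fun n => periodize Γ (ψ n) (fun _ => (1 : ℝ)) g) Filter.atTop (𝓝 1) := by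
  set K := CompactExhaustion.choice H
  have hex : ∀ n, ∃ f : C(H, ℝ), Set.EqOn f 1 (K n) ∧ IsCompact (tsupport f) ∧
      ∀ x, f x ∈ Set.Icc (0 : ℝ) 1 := fun n => by
    obtain ⟨f, h1, h2, -, h4⟩ := exists_continuousMap_one_of_isCompact_subset_isOpen (K.isCompact n)
      isOpen_univ (Set.subset_univ _)
    exact ⟨f, h1, h2, h4⟩
  choose e he1 hes he using hex
  have he0 : ∀ n g, 0 ≤ e n g := fun n g => (he n g).1
  set P : ℕ → H → ℝ := fun n => periodize Γ (e n) fun _ => (1 : ℝ) with hP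
  have hP0 : ∀ n g, 0 ≤ P n g := fun n => periodize_nonneg (he0 n)
  have hPI : ∀ n, RightInvariant Γ (P n) := fun n =>
    rightInvariant_periodize (e n).continuous (hes n)
  -- `P n` may vanish at points not yet reached by the exhaustion; adding `t n` permits the
  -- division. Since `P n` is eventually at least one at each point, `P n / (P n + t n)` still tends
  -- to one.
  set t : ℕ → ℝ := fun n => 1 / ((n : ℝ) + 1) with ht
  have ht0 : ∀ n, 0 < t n := fun n => by positivity
  have hpos : ∀ n g, 0 < P n g + t n := fun n g => by linarith [hP0 n g, ht0 n]
  set ψ : ℕ → H → ℝ := fun n g => (P n g + t n)⁻¹ * e n g with hψ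
  have hψP : ∀ n g, periodize Γ (ψ n) (fun _ => (1 : ℝ)) g = (P n g + t n)⁻¹ * P n g :=
    fun n g => periodize_mul (F := fun g => (P n g + t n)⁻¹) (fun g γ => by
      rw [(hPI n).2]) g
  refine ⟨ψ, fun n => ?_, fun n => HasCompactSupport.mul_left (f := fun g => (P n g + t n)⁻¹) (hes n),
    fun n g => mul_nonneg (inv_nonneg.2 (hpos n g).le) (he0 n g), fun n g => ?_, fun g => ?_⟩
  · exact (((hPI n).1.add continuous_const).inv₀ fun g => (hpos n g).ne').mul (e n).continuous
  · rw [hψP, inv_mul_le_iff₀ (hpos n g)]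
    linarith [ht0 n]
  · have hlow : ∀ᶠ n in Filter.atTop, 1 ≤ P n g := by
      obtain ⟨n₀, hn₀⟩ := K.exists_mem g
      filter_upwards [Filter.eventually_ge_atTop n₀] with n hn
      have h1 := single_le_finsum (f := fun γ : Γ => e n (g * γ) • (1 : ℝ)) 1
        (finite_support_smul (hes n) _ g) fun γ => by simpa using he0 n _
      have h2 : e n g = 1 := he1 n (K.subset hn hn₀)
      simpa [hP, periodize, h2] using h1
    have h1 : Filter.Tendsto (fun n => 1 - t n) Filter.atTop (𝓝 1) := by
      simpa [ht] using tendsto_one_div_add_atTop_nhds_zero_nat.const_sub (1 : ℝ)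
    refine tendsto_of_tendsto_of_tendsto_of_le_of_le' h1 tendsto_const_nhds ?_ ?_
    · filter_upwards [hlow] with n hn
      rw [hψP, le_inv_mul_iff₀ (hpos n g)]
      nlinarith [ht0 n]
    · exact Filter.Eventually.of_forall fun n => by
        rw [hψP, inv_mul_le_iff₀ (hpos n g)]
        linarith [ht0 n]

/-- Integrals over the quotient are bounded by Haar integrals over a fundamental domain. -/
theorem quotientLIntegral_le_of_lintegral_le {c : NNReal}
    (hc : ∀ ψ : H → ℝ, Continuous ψ → HasCompactSupport ψ → (∀ g, 0 ≤ ψ g) →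
      quotientLIntegral Γ μ (periodize Γ ψ fun _ => (1 : ℝ)) =
        c * ∫⁻ g, ENNReal.ofReal (ψ g) ∂Measure.haar)
    {θ : ℕ → H → ℝ} (hθ : ∀ n, Continuous (θ n)) (hθs : ∀ n, HasCompactSupport (θ n))
    (hθ0 : ∀ n g, 0 ≤ θ n g) (hθ1 : ∀ᵐ g ∂(Measure.haar : Measure H),
      Filter.Tendsto (fun n => periodize Γ (θ n) (fun _ => (1 : ℝ)) g) Filter.atTop (𝓝 1))
    {F : H → ℝ} (hF : RightInvariant Γ F) (hF0 : ∀ g, 0 ≤ F g) {B : ℝ≥0∞}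
    (hB : ∀ n, ∫⁻ g, ENNReal.ofReal (θ n g * F g) ∂Measure.haar ≤ B) :
    quotientLIntegral Γ μ F ≤ c * B := by
  obtain ⟨ψ, hψ, hψs, hψ0, hψ1, hψt⟩ := exists_periodize_tendsto_one Γ
  have hPψ : ∀ k, RightInvariant Γ (periodize Γ (ψ k) fun _ => (1 : ℝ)) := fun k =>
    rightInvariant_periodize (hψ k) (hψs k)
  have hPθ : ∀ n, RightInvariant Γ (periodize Γ (θ n) fun _ => (1 : ℝ)) := fun n =>
    rightInvariant_periodize (hθ n) (hθs n)
  -- Exchanging the roles of `ψ k` and `θ n` does not change the periodization, which is `F` times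
  -- both periodizations; the Haar integral thus moves from the support of `ψ k` to that of `θ n`.
  have hkn : ∀ k n, c * ∫⁻ g, ENNReal.ofReal ((F g * periodize Γ (θ n) (fun _ => (1 : ℝ)) g) * ψ k g)
      ∂Measure.haar ≤ c * B := fun k n => by
    have h1 := hF.mul (hPθ n)
    have h2 := hF.mul (hPψ k)
    rw [← hc (fun g => (F g * periodize Γ (θ n) (fun _ => (1 : ℝ)) g) * ψ k g)
      (h1.1.mul (hψ k)) ((hψs k).mul_left)
      fun g => mul_nonneg (mul_nonneg (hF0 g) (periodize_nonneg (hθ0 n) g)) (hψ0 k g)]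
    have e : (periodize Γ (fun g => (F g * periodize Γ (θ n) (fun _ => (1 : ℝ)) g) * ψ k g)
        fun _ => (1 : ℝ)) =
        periodize Γ (fun g => (F g * periodize Γ (ψ k) (fun _ => (1 : ℝ)) g) * θ n g)
        fun _ => (1 : ℝ) := by
      funext g
      rw [periodize_mul h1.2, periodize_mul h2.2]
      ring
    rw [e, hc (fun g => (F g * periodize Γ (ψ k) (fun _ => (1 : ℝ)) g) * θ n g) (h2.1.mul (hθ n))
      ((hθs n).mul_left)
      fun g => mul_nonneg (mul_nonneg (hF0 g) (periodize_nonneg (hψ0 k) g)) (hθ0 n g)]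
    refine mul_le_mul_right ((lintegral_mono fun g => ENNReal.ofReal_le_ofReal ?_).trans (hB n)) _
    rw [mul_comm]
    refine mul_le_mul_of_nonneg_left ?_ (hθ0 n g)
    exact mul_le_of_le_one_right (hF0 g) (hψ1 k g)
  have hk : ∀ k, quotientLIntegral Γ μ (fun g => F g * periodize Γ (ψ k) (fun _ => (1 : ℝ)) g) ≤
      c * B := fun k => by
    have e : (fun g => F g * periodize Γ (ψ k) (fun _ => (1 : ℝ)) g) =
        periodize Γ (fun g => F g * ψ k g) fun _ => (1 : ℝ) :=
      funext fun g => (periodize_mul hF.2 g).symm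
    rw [e, hc (fun g => F g * ψ k g) (hF.1.mul (hψ k)) ((hψs k).mul_left) fun g => mul_nonneg (hF0 g) (hψ0 k g)]
    have hfat : ∫⁻ g, ENNReal.ofReal (F g * ψ k g) ∂Measure.haar ≤ Filter.liminf (fun n =>
        ∫⁻ g, ENNReal.ofReal ((F g * periodize Γ (θ n) (fun _ => (1 : ℝ)) g) * ψ k g)
          ∂Measure.haar) Filter.atTop := by
      refine le_trans (lintegral_mono_ae ?_) (lintegral_liminf_le fun n => ?_)
      · filter_upwards [hθ1] with g hg
        have h3 := ((hg.const_mul (F g)).mul_const (ψ k g))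
        rw [mul_one] at h3
        exact ((ENNReal.continuous_ofReal.tendsto _).comp h3).liminf_eq.ge
      · exact (((hF.mul (hPθ n)).1.mul (hψ k)).measurable).ennreal_ofReal
    rcases eq_or_ne c 0 with rfl | hc0
    · simp
    · refine mul_le_mul_right (hfat.trans ?_) _
      exact Filter.liminf_le_of_le (by isBoundedDefault) fun b hb => by
        obtain ⟨n, hn⟩ := hb.exists
        exact hn.trans ((ENNReal.mul_le_mul_iff_right (by simpa using hc0)
          ENNReal.coe_ne_top).1 (hkn k n))
  refine (quotientLIntegral_le_liminf (fun k => hF.mul (hPψ k)) fun g => by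
    simpa using (hψt g).const_mul (F g)).trans ?_
  exact Filter.liminf_le_of_le (by isBoundedDefault) fun b hb => by
    obtain ⟨n, hn⟩ := hb.exists
    exact hn.trans (hk n)

end HaarQuotient

/-! ### Word length and displacement. -/

section WordLength

variable {Λ : Type*} [Group Λ] {E : Type*} [NormedAddCommGroup E] [NormedSpace ℝ E]

lemma exists_list_prod_eq {S : Set Λ} (hS : Subgroup.closure S = ⊤) (γ : Λ) :
    ∃ l : List Λ, l.length = wordLength S γ ∧ (∀ x ∈ l, x ∈ S ∨ x⁻¹ ∈ S) ∧ l.prod = γ := by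
  have h1 : γ ∈ Submonoid.closure (S ∪ S⁻¹) := by
    rw [← Subgroup.closure_toSubmonoid, hS]
    trivial
  obtain ⟨l, hl, hlp⟩ := Submonoid.exists_list_of_mem_closure h1
  exact Nat.sInf_mem (s := {n | ∃ l : List Λ, l.length = n ∧ (∀ x ∈ l, x ∈ S ∨ x⁻¹ ∈ S) ∧
    l.prod = γ}) ⟨l.length, l, rfl, fun x hx => by simpa using hl x hx, hlp⟩

/-- The displacement of a point under an isometric action is bounded by the word length. -/
lemma exists_norm_sub_le_wordLength (α : Λ →* (E ≃ᵃ[ℝ] E)) (hα : ∀ γ v, ‖(α γ).linear v‖ = ‖v‖)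
    {S : Finset Λ} (hS : Subgroup.closure (S : Set Λ) = ⊤) (v : E) :
    ∃ C : NNReal, ∀ γ, ‖α γ v - v‖ ≤ C * wordLength (S : Set Λ) γ := by
  have hiso : ∀ γ x y, ‖α γ x - α γ y‖ = ‖x - y‖ := fun γ x y => by
    rw [AffineEquiv.sub_eq_linear, hα]
  have hinv : ∀ γ, ‖α γ⁻¹ v - v‖ = ‖α γ v - v‖ := fun γ => by
    have h1 : α γ (α γ⁻¹ v) = v := by
      rw [← AffineEquiv.trans_apply, ← AffineEquiv.mul_def, ← map_mul, mul_inv_cancel, map_one]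
      rfl
    rw [← hiso γ, h1, norm_sub_rev]
  set C : NNReal := S.sup fun γ => ‖α γ v - v‖₊ with hC
  have hCS : ∀ γ, γ ∈ (S : Set Λ) → ‖α γ v - v‖ ≤ C := fun γ hγ =>
    Finset.le_sup (f := fun γ => ‖α γ v - v‖₊) hγ
  refine ⟨C, fun γ => ?_⟩
  obtain ⟨l, hl, hlS, rfl⟩ := exists_list_prod_eq hS γ
  rw [← hl]
  clear hl
  induction l with
  | nil => simp
  | cons x l ih =>
    have h1 := ih fun y hy => hlS y (List.mem_cons_of_mem _ hy)
    have h2 : ‖α x v - v‖ ≤ C := by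
      rcases hlS x List.mem_cons_self with h | h
      · exact hCS x h
      · rw [← hinv]; exact hCS _ h
    have h3 : α (x :: l).prod v - v = (α x (α l.prod v) - α x v) + (α x v - v) := by
      rw [List.prod_cons, map_mul, AffineEquiv.mul_def, AffineEquiv.trans_apply, sub_add_sub_cancel]
    rw [h3]
    refine (norm_add_le _ _).trans ?_
    rw [hiso, List.length_cons]
    push_cast
    linarith

end WordLength

/-! ### Fundamental domains with null boundary. -/

section FundamentalDomain

variable {H : Type*} [Group H] [TopologicalSpace H] [IsTopologicalGroup H] [T2Space H]
  [LocallyCompactSpace H] [SigmaCompactSpace H] [MeasurableSpace H] [BorelSpace H]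
  {Γ : Subgroup H}

/-- A Borel fundamental domain with null boundary and the associated map to the lattice. -/
structure IsFundamentalSection (Γ : Subgroup H) (D : Set H) (χ : H → Γ) : Prop where
  measurableSet : MeasurableSet D
  frontier : (Measure.haar : Measure H) (frontier D) = 0
  preimage : χ ⁻¹' {1} = D
  equivariant : ∀ (g : H) (γ : Γ), χ (g * (γ : H)⁻¹) = γ * χ g

variable {D : Set H} {χ : H → Γ}

lemma IsFundamentalSection.mul_mem_iff (h : IsFundamentalSection Γ D χ) {g : H} {γ : Γ} :
    g * γ ∈ D ↔ χ g = γ := by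
  have h1 := h.equivariant g γ⁻¹
  rw [Subgroup.coe_inv, inv_inv] at h1
  rw [← h.preimage, Set.mem_preimage, Set.mem_singleton_iff, h1, inv_mul_eq_one, eq_comm]

lemma IsFundamentalSection.mul_mem (h : IsFundamentalSection Γ D χ) (g : H) : g * χ g ∈ D :=
  h.mul_mem_iff.2 rfl

lemma IsFundamentalSection.periodize_eq (h : IsFundamentalSection Γ D χ) {V : Type*}
    [NormedAddCommGroup V] [NormedSpace ℝ V] {θ : H → ℝ} (hθ : ∀ g ∉ D, θ g = 0) (b : Γ → V)
    (g : H) : periodize Γ θ b g = θ (g * χ g) • b (χ g) :=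
  finsum_eq_single _ _ fun γ hγ => by
    rw [hθ _ fun hD => hγ (h.mul_mem_iff.1 hD).symm, zero_smul]

lemma countable_of_discrete (Γ : Subgroup H) [DiscreteTopology Γ] : Countable Γ := by
  have hc : IsClosedEmbedding ((↑) : Γ → H) :=
    (Subgroup.isClosed_of_discrete (H := Γ)).isClosedEmbedding_subtypeVal
  have : SigmaCompactSpace Γ := hc.sigmaCompactSpace
  exact countable_of_Lindelof_of_discrete

lemma IsFundamentalSection.measurable [DiscreteTopology Γ] (h : IsFundamentalSection Γ D χ) :
    Measurable χ := by
  have := countable_of_discrete Γ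
  refine measurable_to_countable' fun γ => ?_
  have : χ ⁻¹' {γ} = (fun g => g * (γ : H)) ⁻¹' D := by
    ext g
    exact h.mul_mem_iff.symm
  rw [this]
  exact (continuous_mul_const (γ : H)).measurable h.measurableSet

/-- Right translation only multiplies Haar measure by the modular function, so null sets are
preserved without unimodularity. -/
lemma quasiMeasurePreserving_mul_right_haar (g : H) :
    Measure.QuasiMeasurePreserving (fun h => h * g) (Measure.haar : Measure H) Measure.haar := by
  refine ⟨(continuous_mul_const g).measurable, ?_⟩
  rw [Measure.map_right_mul_eq_modularCharacterFun_smul]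
  exact Measure.smul_absolutelyContinuous

lemma ae_mul_right {P : H → Prop} (hP : ∀ᵐ h ∂(Measure.haar : Measure H), P h) (g : H) :
    ∀ᵐ h ∂(Measure.haar : Measure H), P (h * g) :=
  (quasiMeasurePreserving_mul_right_haar g).ae hP

/-- A domain without interior would lie in its null boundary, but countably many right translates of
it cover the group. -/
lemma IsFundamentalSection.interior_nonempty [DiscreteTopology Γ]
    (h : IsFundamentalSection Γ D χ) : (interior D).Nonempty := by
  have := countable_of_discrete Γ
  by_contra hne
  rw [Set.not_nonempty_iff_eq_empty] at hne
  have h0 : (Measure.haar : Measure H) D = 0 := by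
    refine measure_mono_null (fun g hg => ?_) h.frontier
    rw [_root_.frontier, hne, Set.sdiff_empty]
    exact subset_closure hg
  have h1 : ∀ᵐ g ∂(Measure.haar : Measure H), ∀ γ : Γ, g * (γ : H) ∉ D :=
    ae_all_iff.2 fun γ => ae_mul_right (measure_eq_zero_iff_ae_notMem.1 h0) γ
  obtain ⟨g, hg⟩ := h1.exists
  exact hg _ (h.mul_mem g)

/-- The indicator of a fundamental domain with null boundary is almost everywhere a limit of
compactly supported functions below it. -/
lemma IsFundamentalSection.exists_approx [DiscreteTopology Γ] (h : IsFundamentalSection Γ D χ) :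
    ∃ θ : ℕ → H → ℝ, (∀ n, Continuous (θ n)) ∧ (∀ n, HasCompactSupport (θ n)) ∧
      (∀ n g, 0 ≤ θ n g) ∧ (∀ n g, θ n g ≤ 1) ∧ (∀ n, ∀ g ∉ D, θ n g = 0) ∧
      ∀ᵐ g ∂(Measure.haar : Measure H), ∀ᶠ n in Filter.atTop, θ n (g * χ g) = 1 := by
  have := countable_of_discrete Γ
  set A : ℕ → Set H := fun n => interior D ∩ compactCovering H n with hA
  -- The geometric errors are summable, so by Borel–Cantelli almost every interior point lies in all
  -- but finitely many `K n`. Almost every point of `D` is interior because the boundary is null.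
  have hex : ∀ n, ∃ K ⊆ A n, IsCompact K ∧
      (Measure.haar : Measure H) (A n \ K) < (2⁻¹ : ℝ≥0∞) ^ n := fun n =>
    MeasurableSet.exists_isCompact_sdiff_lt (isOpen_interior.measurableSet.inter
      (isCompact_compactCovering H n).measurableSet) (ne_top_of_le_ne_top
      (isCompact_compactCovering H n).measure_ne_top (measure_mono Set.inter_subset_right))
      (pow_ne_zero _ (by simp))
  choose K hKA hK hKm using hex
  have hf : ∀ n, ∃ f : C(H, ℝ), Set.EqOn f 1 (K n) ∧ IsCompact (tsupport f) ∧
      tsupport f ⊆ interior D ∧ ∀ x, f x ∈ Set.Icc (0 : ℝ) 1 := fun n =>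
    exists_continuousMap_one_of_isCompact_subset_isOpen (hK n) isOpen_interior
      ((hKA n).trans Set.inter_subset_left)
  choose θ hθ1 hθs hθD hθ using hf
  refine ⟨fun n => θ n, fun n => (θ n).continuous, hθs, fun n g => (hθ n g).1,
    fun n g => (hθ n g).2, fun n g hg => image_eq_zero_of_notMem_tsupport fun hg' =>
      hg (interior_subset (hθD n hg')), ?_⟩
  have h1 : ∀ᵐ g ∂(Measure.haar : Measure H), ∀ᶠ n in Filter.atTop, g ∉ A n \ K n := by
    refine ae_eventually_notMem (ne_top_of_le_ne_top ?_ (ENNReal.tsum_le_tsum fun n => (hKm n).le))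
    rw [ENNReal.tsum_geometric]
    simp
  have h2 : ∀ᵐ g ∂(Measure.haar : Measure H), g ∈ D → ∀ᶠ n in Filter.atTop, θ n g = 1 := by
    filter_upwards [h1, measure_eq_zero_iff_ae_notMem.1 h.frontier] with g hg hgf hgD
    have hgi : g ∈ interior D := by
      by_contra hn
      exact hgf ⟨subset_closure hgD, hn⟩
    obtain ⟨n₀, hn₀⟩ := exists_mem_compactCovering g
    filter_upwards [hg, Filter.eventually_ge_atTop n₀] with n hn hn'
    refine hθ1 n ?_
    by_contra hK
    exact hn ⟨⟨hgi, compactCovering_subset H hn' hn₀⟩, hK⟩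
  have h3 : ∀ᵐ g ∂(Measure.haar : Measure H), ∀ γ : Γ, g * (γ : H) ∈ D →
      ∀ᶠ n in Filter.atTop, θ n (g * γ) = 1 := ae_all_iff.2 fun γ => ae_mul_right h2 γ
  filter_upwards [h3] with g hg using hg _ (h.mul_mem g)

/-- A function which is integrable on the translates of the domain is locally integrable. -/
lemma IsFundamentalSection.lintegral_lt_top_of_isCompact [DiscreteTopology Γ]
    (h : IsFundamentalSection Γ D χ)
    {Q : H → ℝ≥0∞} (hQ : ∀ s, ∫⁻ g in D, Q (s⁻¹ * g) ∂Measure.haar < ⊤) {K : Set H}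
    (hK : IsCompact K) : ∫⁻ g in K, Q g ∂Measure.haar < ⊤ := by
  refine hK.induction_on (p := fun S => ∫⁻ g in S, Q g ∂Measure.haar < ⊤) (by simp)
    (fun S T hST hT => (lintegral_mono_set hST).trans_lt hT)
    (fun S T hS hT => (lintegral_union_le _ _ _).trans_lt (ENNReal.add_lt_top.2 ⟨hS, hT⟩))
    fun g _ => ?_
  -- A left translation carrying `g` to an interior point of `D` bounds the integral near `g` by one
  -- over `D`.
  obtain ⟨d, hd⟩ := h.interior_nonempty
  have hc : Continuous fun x => d * g⁻¹ * x := continuous_const_mul _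
  refine ⟨(fun x => d * g⁻¹ * x) ⁻¹' D, mem_nhdsWithin_of_mem_nhds (hc.continuousAt.preimage_mem_nhds
    (by simpa using mem_interior_iff_mem_nhds.1 hd)), ?_⟩
  have h1 := hQ (d * g⁻¹)
  rw [← lintegral_indicator (hc.measurable h.measurableSet)]
  rw [← lintegral_indicator h.measurableSet, ← lintegral_mul_left_eq_self _ (d * g⁻¹)] at h1
  refine lt_of_eq_of_lt (lintegral_congr fun x => ?_) h1
  by_cases hx : d * g⁻¹ * x ∈ D
  · rw [Set.indicator_of_mem (by exact hx), Set.indicator_of_mem hx, inv_mul_cancel_left]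
  · rw [Set.indicator_of_notMem (by exact hx), Set.indicator_of_notMem hx]

end FundamentalDomain

/-! ### Smoothing by left translations. -/

section Smoothing

open scoped Pointwise

variable {H : Type*} [Group H] [TopologicalSpace H] [IsTopologicalGroup H] [T2Space H]
  [LocallyCompactSpace H] [SigmaCompactSpace H] [MeasurableSpace H] [BorelSpace H]
  {E : Type*} [NormedAddCommGroup E] [NormedSpace ℝ E]

/-- The smoothing of a function by left translations. -/
noncomputable def leftSmoothing (ω : Measure H) (b : H → E) (g : H) : E := ∫ x, b (x * g) ∂ω

lemma IsBump.integrable_mul_right {ω : Measure H} (hω : IsBump ω) {b : H → E}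
    (hb : ∀ K, IsCompact K → IntegrableOn b K Measure.haar) (g : H) :
    Integrable (fun x => b (x * g)) ω := by
  obtain ⟨S, hS, -, C, hC⟩ := hω.map_le (isCompact_singleton (x := (1 : H)))
  have h1 : ω ≤ C • Measure.haar.restrict S := by simpa using hC 1 rfl
  refine Integrable.mono_measure ?_ h1
  refine Integrable.smul_measure_nnreal ?_
  have h2 : IntegrableOn b ((fun x => x * g) '' S) (Measure.haar.map fun x => x * g) := by
    rw [Measure.map_right_mul_eq_modularCharacterFun_smul, IntegrableOn, Measure.restrict_smul]
    exact (hb _ (hS.image (continuous_mul_const g))).smul_measure_nnreal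
  have h3 := (Homeomorph.mulRight g).measurableEmbedding.integrableOn_map_iff.1 h2
  rw [Homeomorph.coe_mulRight, Set.preimage_image_eq _ (mul_left_injective g)] at h3
  exact h3

lemma continuous_integral_smul_comp_mul_inv {φ : H → ℝ} (hφ : Continuous φ)
    (hs : HasCompactSupport φ) {b : H → E} (hb : ∀ K, IsCompact K → IntegrableOn b K Measure.haar) :
    Continuous fun g : H => ∫ y, φ (y * g⁻¹) • b y ∂Measure.haar := by
  refine continuous_iff_continuousAt.2 fun g₀ => ?_
  obtain ⟨K, hK, hKg⟩ := exists_compact_mem_nhds g₀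
  have h1 := continuousOn_integral_bilinear_of_locally_integrable_of_compact_support
    (μ := (Measure.haar : Measure H)) (ContinuousLinearMap.lsmul ℝ ℝ : ℝ →L[ℝ] E →L[ℝ] E).flip
    (f := fun g y => φ (y * g⁻¹)) (s := K) (k := tsupport φ * K) (g := b) (hs.isCompact.mul hK)
    (by
      refine Continuous.continuousOn ?_
      change Continuous fun z : H × H => φ (z.2 * z.1⁻¹)
      fun_prop)
    (fun g y hg hy => image_eq_zero_of_notMem_tsupport fun h =>
      hy ⟨y * g⁻¹, h, g, hg, by simp⟩) (hb _ (hs.isCompact.mul hK))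
  exact h1.continuousAt hKg

lemma integral_smul_comp_mul_right (φ : H → ℝ) (F : H → E) (g : H) :
    ∫ x, φ x • F (x * g) ∂Measure.haar =
      (Measure.modularCharacterFun g : ℝ) • ∫ y, φ (y * g⁻¹) • F y ∂Measure.haar := by
  have h1 := (Homeomorph.mulRight g).measurableEmbedding.integral_map (μ := Measure.haar)
    fun y => φ (y * g⁻¹) • F y
  have h2 : (Measure.haar : Measure H).map (Homeomorph.mulRight g) =
    Measure.modularCharacterFun g • Measure.haar :=
      Measure.map_right_mul_eq_modularCharacterFun_smul _ g
  rw [h2, integral_smul_nnreal_measure] at h1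
  simp only [Homeomorph.coe_mulRight, mul_inv_cancel_right] at h1
  rw [← h1]
  rfl

/-- After the substitution `y = x g` the variable `g` sits in the continuous density, so `b` only
has to be locally integrable. The modular factor is the inverse of the same integral with `b = 1`,
hence continuous. -/
lemma IsBump.continuous_leftSmoothing {ω : Measure H} (hω : IsBump ω) {b : H → E}
    (hb : ∀ K, IsCompact K → IntegrableOn b K Measure.haar) : Continuous (leftSmoothing ω b) := by
  have hωp := hω.isProbabilityMeasure
  obtain ⟨φ, hφ, hs, rfl, -⟩ := hω
  have hφ' : Continuous fun x => (φ x : ℝ) := NNReal.continuous_coe.comp hφ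
  have hs' : HasCompactSupport fun x => (φ x : ℝ) := hs.comp_left (g := ((↑) : NNReal → ℝ)) rfl
  have hmap := fun g (F : H → E) => integral_smul_comp_mul_right (fun x => (φ x : ℝ)) F g
  have hone : ∀ g : H, (Measure.modularCharacterFun g : ℝ) *
      ∫ y, (φ (y * g⁻¹) : ℝ) • (1 : ℝ) ∂Measure.haar = 1 := fun g => by
    have h1 := integral_smul_comp_mul_right (fun x => (φ x : ℝ)) (fun _ : H => (1 : ℝ)) g
    rw [smul_eq_mul] at h1
    rw [← h1]
    have h2 := integral_withDensity_eq_integral_smul (μ := (Measure.haar : Measure H))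
      hφ.measurable (fun _ => (1 : ℝ))
    simp only [integral_const, probReal_univ, smul_eq_mul, mul_one] at h2
    exact h2.symm
  have hN : ∀ g : H, ∫ y, (φ (y * g⁻¹) : ℝ) • (1 : ℝ) ∂Measure.haar ≠ 0 := fun g h => by
    have := hone g
    rw [h, mul_zero] at this
    exact zero_ne_one this
  have hf : leftSmoothing (Measure.haar.withDensity fun x => (φ x : ℝ≥0∞)) b = fun g =>
      (∫ y, (φ (y * g⁻¹) : ℝ) • (1 : ℝ) ∂Measure.haar)⁻¹ •
        ∫ y, (φ (y * g⁻¹) : ℝ) • b y ∂Measure.haar := by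
    funext g
    have h1 : leftSmoothing (Measure.haar.withDensity fun x => (φ x : ℝ≥0∞)) b g =
        ∫ x, (φ x : ℝ) • b (x * g) ∂Measure.haar :=
      integral_withDensity_eq_integral_smul hφ.measurable _
    rw [h1, hmap, ← eq_inv_of_mul_eq_one_left (hone g)]
  rw [hf]
  have hb1 : ∀ K : Set H, IsCompact K → IntegrableOn (fun _ => (1 : ℝ)) K Measure.haar :=
    fun K hK => continuousOn_const.integrableOn_compact hK
  exact ((continuous_integral_smul_comp_mul_inv hφ' hs' hb1).inv₀ hN).smul
    (continuous_integral_smul_comp_mul_inv hφ' hs' hb)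

lemma enorm_leftSmoothing_sub_rpow_le [CompleteSpace E] {ω : Measure H} [IsProbabilityMeasure ω]
    {b : H → E} {p : ℝ} (hp : 1 ≤ p) (v : E) {g : H}
    (hi : Integrable (fun x => b (x * g)) ω) :
    ‖leftSmoothing ω b g - v‖ₑ ^ p ≤ ∫⁻ x, ‖b (x * g) - v‖ₑ ^ p ∂ω := by
  have hp0 : 0 < p := by linarith
  have h1 : leftSmoothing ω b g - v = ∫ x, (b (x * g) - v) ∂ω := by
    rw [integral_sub hi (integrable_const v), integral_const, probReal_univ, one_smul]
    rfl
  have h2 := eLpNorm'_le_eLpNorm'_of_exponent_le zero_lt_one hp ω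
    (hi.sub (integrable_const v)).aestronglyMeasurable
  simp only [eLpNorm', ENNReal.rpow_one, div_one] at h2
  rw [h1]
  refine (ENNReal.rpow_le_rpow ((enorm_integral_le_lintegral_enorm _).trans h2) hp0.le).trans ?_
  rw [← ENNReal.rpow_mul, one_div, inv_mul_cancel₀ hp0.ne', ENNReal.rpow_one]
  exact le_rfl

end Smoothing

/-! ### Invariance of the distance between equivariant functions. -/

section RightInvariance

variable {H : Type*} [Group H] [TopologicalSpace H] {Γ : Subgroup H}
  {E : Type*} [NormedAddCommGroup E] [NormedSpace ℝ E] {α : Γ →* (E ≃ᵃ[ℝ] E)}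

lemma rightInvariant_rpow_norm_sub (hα : ∀ γ v, ‖(α γ).linear v‖ = ‖v‖) {p : ℝ} (hp : 0 ≤ p)
    {f f' : H → E} (hf : Continuous f) (hf' : Continuous f')
    (hfe : ∀ (g : H) (γ : Γ), f (g * (γ : H)⁻¹) = α γ (f g))
    (hfe' : ∀ (g : H) (γ : Γ), f' (g * (γ : H)⁻¹) = α γ (f' g)) :
    RightInvariant Γ fun g => ‖f g - f' g‖ ^ p := by
  refine ⟨((hf.sub hf').norm).rpow_const fun _ => Or.inr hp, fun g γ => ?_⟩
  have h1 := hfe g γ⁻¹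
  have h2 := hfe' g γ⁻¹
  rw [Subgroup.coe_inv, inv_inv] at h1 h2
  dsimp only
  rw [h1, h2, AffineEquiv.sub_eq_linear, hα]

end RightInvariance

/-! ### Continuous equivariant functions of locally bounded displacement. -/

section Displacement

variable {H : Type*} [Group H] [TopologicalSpace H] [IsTopologicalGroup H] [T2Space H]
  [LocallyCompactSpace H] [SigmaCompactSpace H] [MeasurableSpace H] [BorelSpace H]
  {E : Type*} [NormedAddCommGroup E] [NormedSpace ℝ E] [CompleteSpace E]

/-- The correlation of two functions under left translations. -/
noncomputable def correlation (θ A : H → ℝ) (t : H) : ℝ≥0∞ :=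
  ∫⁻ h, ENNReal.ofReal (θ h * A (t * h)) ∂Measure.haar

lemma continuous_correlation {θ A : H → ℝ} (hθ : Continuous θ) (hs : HasCompactSupport θ)
    (hA : Continuous A) (hθ0 : ∀ g, 0 ≤ θ g) (hA0 : ∀ g, 0 ≤ A g) :
    Continuous (correlation θ A) := by
  have h1 : Continuous fun t : H => ∫ h, θ h * A (t * h) ∂Measure.haar := by
    rw [← continuousOn_univ]
    refine continuousOn_integral_of_compact_support (f := fun t h => θ h * A (t * h)) hs.isCompact
      (Continuous.continuousOn ?_) fun t h _ hh => by
        rw [image_eq_zero_of_notMem_tsupport hh, zero_mul]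
    change Continuous fun z : H × H => θ z.2 * A (z.1 * z.2)
    fun_prop
  have h2 : correlation θ A = fun t => ENNReal.ofReal (∫ h, θ h * A (t * h) ∂Measure.haar) := by
    funext t
    have hc : Continuous fun h => θ h * A (t * h) := by fun_prop
    exact (ofReal_integral_eq_lintegral_ofReal (hc.integrable_of_hasCompactSupport hs.mul_right)
      (ae_of_all _ fun h => mul_nonneg (hθ0 h) (hA0 _))).symm
  rw [h2]
  exact ENNReal.continuous_ofReal.comp h1

/-- Jensen moves the power inside the smoothing, and Tonelli turns the result into an `ω`-mean of
correlations. The continuous functions `A n` replace `‖b - v‖ ^ p`, so that Tonelli applies without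
further measurability, and Fatou passes to the limit. -/
lemma lintegral_leftSmoothing_le {ω : Measure H} (hω : IsBump ω) {b : H → E}
    (hb : ∀ K, IsCompact K → IntegrableOn b K Measure.haar) {p : ℝ} (hp : 1 ≤ p) {v : E}
    {θ : H → ℝ} (hθ : Continuous θ) (hθ0 : ∀ g, 0 ≤ θ g) {A : ℕ → H → ℝ}
    (hA : ∀ n, Continuous (A n))
    (hAe : ∀ᵐ g ∂(Measure.haar : Measure H), ∀ᶠ n in Filter.atTop, A n g = ‖b g - v‖ ^ p)
    {k : H} {N : ℝ≥0∞} (hN : ∀ᵐ x ∂ω, ∀ n, correlation θ (A n) (x * k) ≤ N) :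
    ∫⁻ g, ENNReal.ofReal (θ g * ‖leftSmoothing ω b (k * g) - v‖ ^ p) ∂Measure.haar ≤ N := by
  have hωp := hω.isProbabilityMeasure
  have hp0 : 0 ≤ p := by linarith
  have hac : ω ≪ Measure.haar := by
    obtain ⟨φ, -, -, rfl, -⟩ := hω
    exact withDensity_absolutelyContinuous _ _
  have hm : ∀ n, Measurable fun z : H × H => ENNReal.ofReal (θ z.1 * A n (z.2 * k * z.1)) :=
    fun n => by
    have hc : Continuous fun z : H × H => θ z.1 * A n (z.2 * k * z.1) := by
      have := hA n
      fun_prop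
    exact hc.measurable_of_sigmaCompact_prod.ennreal_ofReal
  have h1 : ∀ g, ENNReal.ofReal (θ g * ‖leftSmoothing ω b (k * g) - v‖ ^ p) ≤
      Filter.liminf (fun n => ∫⁻ x, ENNReal.ofReal (θ g * A n (x * k * g)) ∂ω) Filter.atTop :=
    fun g => by
    refine le_trans ?_ (lintegral_liminf_le fun n =>
      (hm n).comp (measurable_const.prodMk measurable_id))
    have h2 := enorm_leftSmoothing_sub_rpow_le hp v (hω.integrable_mul_right hb (k * g))
    have h3 : ENNReal.ofReal (θ g * ‖leftSmoothing ω b (k * g) - v‖ ^ p) =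
        ENNReal.ofReal (θ g) * ‖leftSmoothing ω b (k * g) - v‖ₑ ^ p := by
      rw [ENNReal.ofReal_mul (hθ0 g), ← ENNReal.ofReal_rpow_of_nonneg (norm_nonneg _) hp0,
        ofReal_norm]
    rw [h3]
    refine (mul_le_mul_right h2 _).trans ?_
    rw [← lintegral_const_mul' _ _ ENNReal.ofReal_ne_top]
    refine lintegral_mono_ae ?_
    filter_upwards [hac.ae_le (ae_mul_right hAe (k * g))] with x hx
    have h4 : Filter.Tendsto (fun n => ENNReal.ofReal (θ g * A n (x * k * g))) Filter.atTop
        (𝓝 (ENNReal.ofReal (θ g) * ‖b (x * (k * g)) - v‖ₑ ^ p)) := by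
      refine tendsto_const_nhds.congr' ?_
      filter_upwards [hx] with n hn
      rw [mul_assoc, hn, ENNReal.ofReal_mul (hθ0 g),
        ← ENNReal.ofReal_rpow_of_nonneg (norm_nonneg _) hp0, ofReal_norm]
    exact h4.liminf_eq.ge
  refine (lintegral_mono h1).trans ?_
  refine (lintegral_liminf_le fun n => (hm n).lintegral_prod_right').trans ?_
  refine Filter.liminf_le_of_le (by isBoundedDefault) fun B hB => ?_
  obtain ⟨n, hn⟩ := hB.exists
  refine hn.trans ?_
  rw [lintegral_lintegral_swap (hm n).aemeasurable]
  refine (lintegral_mono_ae (g := fun _ => N) ?_).trans (by simp)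
  filter_upwards [hN] with x hx using hx n

lemma norm_add_rpow_le {p : ℝ} (hp : 1 ≤ p) (x y : E) :
    ‖x + y‖ ^ p ≤ 2 ^ (p - 1) * (‖x‖ ^ p + ‖y‖ ^ p) :=
  (Real.rpow_le_rpow (norm_nonneg _) (norm_add_le x y) (by linarith)).trans
    (by exact_mod_cast NNReal.rpow_add_le_mul_rpow_add_rpow ‖x‖₊ ‖y‖₊ hp)

variable {Γ : Subgroup H} [DiscreteTopology Γ] {μ : @Measure (H ⧸ Γ) (borel (H ⧸ Γ))}
  {α : Γ →* (E ≃ᵃ[ℝ] E)}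

lemma quotientLIntegral_rpow_norm_add_le {p : ℝ} (hp : 1 ≤ p) {x y : H → E}
    (hx : RightInvariant Γ fun g => ‖x g‖ ^ p) (hy : RightInvariant Γ fun g => ‖y g‖ ^ p) :
    quotientLIntegral Γ μ (fun g => ‖x g + y g‖ ^ p) ≤ ENNReal.ofReal (2 ^ (p - 1)) *
      (quotientLIntegral Γ μ (fun g => ‖x g‖ ^ p) + quotientLIntegral Γ μ fun g => ‖y g‖ ^ p) := by
  rw [← quotientLIntegral_add hx (fun g => by positivity) (by intro g; positivity),
    ← quotientLIntegral_const_mul (hx.add hy) (by positivity)]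
  exact quotientLIntegral_mono fun g => norm_add_rpow_le hp _ _

lemma leftSmoothing_equivariant {ω : Measure H} [IsProbabilityMeasure ω] {b : H → E}
    (hi : ∀ g, Integrable (fun x => b (x * g)) ω) (hα : ∀ γ v, ‖(α γ).linear v‖ = ‖v‖)
    (hb : ∀ (g : H) (γ : Γ), b (g * (γ : H)⁻¹) = α γ (b g)) (g : H) (γ : Γ) :
    leftSmoothing ω b (g * (γ : H)⁻¹) = α γ (leftSmoothing ω b g) := by
  set L : E →L[ℝ] E := LinearMap.mkContinuous ((α γ).linear : E →ₗ[ℝ] E) 1 fun w => by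
    rw [one_mul]; exact (hα γ w).le with hL
  have ha : ∀ w, α γ w = L w + α γ 0 := fun w => by
    have := AffineEquiv.sub_eq_linear (α γ) w 0
    rw [sub_zero, sub_eq_iff_eq_add] at this
    exact this
  rw [ha]
  unfold leftSmoothing
  rw [← L.integral_comp_comm (hi g)]
  have h1 : α γ 0 = ∫ _, α γ 0 ∂ω := by simp
  rw [h1, ← integral_add (L.integrable_comp (hi g)) (integrable_const _)]
  refine integral_congr_ae (ae_of_all _ fun x => ?_)
  dsimp only
  rw [← mul_assoc, hb, ha]

variable {D : Set H} {χ : H → Γ}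

lemma IsFundamentalSection.integrableOn_orbit (h : IsFundamentalSection Γ D χ) {v : E} {p : ℝ}
    (hp : 1 ≤ p)
    (hQ : ∀ s, ∫⁻ g in D, ‖α (χ (s⁻¹ * g)) v - v‖ₑ ^ p ∂(Measure.haar : Measure H) < ⊤) {K : Set H}
    (hK : IsCompact K) : IntegrableOn (fun g => α (χ g) v) K Measure.haar := by
  have := countable_of_discrete Γ
  have hs : StronglyMeasurable fun g => α (χ g) v :=
    (StronglyMeasurable.of_discrete (f := fun γ : Γ => α γ v)).comp_measurable h.measurable
  refine ⟨hs.aestronglyMeasurable, ?_⟩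
  have h1 := h.lintegral_lt_top_of_isCompact (Q := fun g => ‖α (χ g) v - v‖ₑ ^ p) hQ hK
  have h2 : ∀ g, ‖α (χ g) v‖ₑ ≤ (‖v‖ₑ + 1) + ‖α (χ g) v - v‖ₑ ^ p := fun g => by
    have h3 : ‖α (χ g) v‖ₑ ≤ ‖v‖ₑ + ‖α (χ g) v - v‖ₑ := by
      simpa using enorm_add_le v (α (χ g) v - v)
    refine h3.trans ?_
    rw [add_assoc]
    refine add_le_add le_rfl ?_
    rcases le_total ‖α (χ g) v - v‖ₑ 1 with h4 | h4
    · exact h4.trans le_self_add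
    · refine le_trans ?_ le_add_self
      simpa using ENNReal.rpow_le_rpow_of_exponent_le h4 hp
  refine (lintegral_mono fun g => h2 g).trans_lt ?_
  rw [lintegral_add_left measurable_const, setLIntegral_const]
  exact ENNReal.add_lt_top.2 ⟨ENNReal.mul_lt_top (by simp [enorm_lt_top]) hK.measure_lt_top, h1⟩

/-- An isometric affine action of a lattice whose displacement is integrable over a fundamental
domain admits a continuous equivariant function of locally bounded displacement. -/
theorem IsFundamentalSection.exists_equivariant_of_displacement (h : IsFundamentalSection Γ D χ)
    (hμ : IsInvariantProbability Γ μ) (hα : ∀ γ v, ‖(α γ).linear v‖ = ‖v‖) (v : E) {p : ℝ}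
    (hp : 1 ≤ p)
    (hQ : ∀ s, ∫⁻ g in D, ‖α (χ (s⁻¹ * g)) v - v‖ₑ ^ p ∂(Measure.haar : Measure H) < ⊤) :
    ∃ f : H → E, Continuous f ∧ (∀ (g : H) (γ : Γ), f (g * (γ : H)⁻¹) = α γ (f g)) ∧
      ∀ k₀, ∃ W ∈ 𝓝 k₀, ∃ B : ℝ≥0∞, B < ⊤ ∧ ∀ k ∈ W,
        quotientLIntegral Γ μ (fun g => ‖f (k * g) - f g‖ ^ p) ≤ B := by
  have hp0 : 0 ≤ p := by linarith
  obtain ⟨θ, hθc, hθs, hθ0, hθ1, hθD, hθe⟩ := h.exists_approx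
  obtain ⟨c, hc⟩ := exists_quotientLIntegral_periodize hμ
  set b : H → E := fun y => α (χ y) v with hbdef
  have hb : ∀ K, IsCompact K → IntegrableOn b K Measure.haar := fun K hK =>
    h.integrableOn_orbit hp hQ hK
  have hbe : ∀ (g : H) (γ : Γ), b (g * (γ : H)⁻¹) = α γ (b g) := fun g γ => by
    rw [hbdef]
    dsimp only
    rw [h.equivariant, map_mul, AffineEquiv.mul_def, AffineEquiv.trans_apply]
  set A : ℕ → H → ℝ := fun m => periodize Γ (θ m) fun γ => ‖α γ v - v‖ ^ p with hAdef
  have hAeq : ∀ m g, A m g = θ m (g * χ g) * ‖b g - v‖ ^ p := fun m g =>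
    h.periodize_eq (hθD m) _ g
  have hA : ∀ m, Continuous (A m) := fun m => continuous_periodize (hθc m) (hθs m) _
  have hA0 : ∀ m g, 0 ≤ A m g := fun m g => by
    rw [hAeq]
    exact mul_nonneg (hθ0 _ _) (by positivity)
  have hAe : ∀ᵐ g ∂(Measure.haar : Measure H),
      ∀ᶠ n in Filter.atTop, A n g = ‖b g - v‖ ^ p := by
    filter_upwards [hθe] with g hg
    filter_upwards [hg] with n hn
    rw [hAeq, hn, one_mul]
  have hPθ : ∀ᵐ g ∂(Measure.haar : Measure H),
      Filter.Tendsto (fun n => periodize Γ (θ n) (fun _ => (1 : ℝ)) g) Filter.atTop (𝓝 1) := by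
    filter_upwards [hθe] with g hg
    refine tendsto_const_nhds.congr' ?_
    filter_upwards [hg] with n hn
    rw [h.periodize_eq (hθD n), hn, one_smul]
  -- Integrability over `D` bounds all correlations at each point `t`, with a bound depending on
  -- `t`. The correlations are continuous, so these sublevel sets are closed, and by Baire the bound
  -- is locally uniform on a dense open set.
  set F : ℕ → Set H := fun N => {t | ∀ n m, correlation (θ n) (A m) t ≤ N} with hF
  have hFc : ∀ N, IsClosed (F N) := fun N => by
    simp only [hF, Set.ofPred_forall]
    exact isClosed_iInter fun n => isClosed_iInter fun m =>
      isClosed_le (continuous_correlation (hθc n) (hθs n) (hA m) (hθ0 n) (hA0 m)) continuous_const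
  have hFu : ⋃ N, F N = Set.univ := by
    refine Set.eq_univ_of_forall fun t => ?_
    have h1 := hQ t⁻¹
    obtain ⟨N, hN⟩ := ENNReal.exists_nat_gt h1.ne
    refine Set.mem_iUnion.2 ⟨N, fun n m => le_trans ?_ hN.le⟩
    rw [← lintegral_indicator h.measurableSet]
    refine lintegral_mono fun g => ?_
    by_cases hg : g ∈ D
    · rw [Set.indicator_of_mem hg, inv_inv, ← ofReal_norm,
        ENNReal.ofReal_rpow_of_nonneg (norm_nonneg _) hp0]
      refine ENNReal.ofReal_le_ofReal ?_
      rw [hAeq, ← mul_assoc]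
      exact mul_le_of_le_one_left (by positivity)
        (mul_le_one₀ (hθ1 _ _) (hθ0 _ _) (hθ1 _ _))
    · rw [Set.indicator_of_notMem hg, hθD n g hg, zero_mul, ENNReal.ofReal_zero]
  have hO : Dense (⋃ N, interior (F N)) := dense_iUnion_interior_of_closed hFc hFu
  have hOo : IsOpen (⋃ N, interior (F N)) := isOpen_iUnion fun N => isOpen_interior
  have hcont : ∀ {ω : Measure H}, IsBump ω → Continuous (leftSmoothing ω b) := fun hω =>
    hω.continuous_leftSmoothing hb
  have hequi : ∀ {ω : Measure H}, IsBump ω → ∀ (g : H) (γ : Γ),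
      leftSmoothing ω b (g * (γ : H)⁻¹) = α γ (leftSmoothing ω b g) := fun {ω} hω => by
    have := hω.isProbabilityMeasure
    exact leftSmoothing_equivariant (fun g => hω.integrable_mul_right hb g) hα hbe
  have hen : ∀ {ω : Measure H} {k : H} {N : ℕ} {V : Set H}, IsBump ω → ω Vᶜ = 0 →
      (∀ x ∈ V, x * k ∈ F N) → ∀ n, ∫⁻ g, ENNReal.ofReal
        (θ n g * ‖leftSmoothing ω b (k * g) - v‖ ^ p) ∂Measure.haar ≤ N :=
    fun {ω k N V} hω hV hVF n => by
    refine lintegral_leftSmoothing_le hω hb hp (hθc n) (hθ0 n) hA hAe ?_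
    have hx : ∀ᵐ x ∂ω, x ∈ V := mem_ae_iff.2 hV
    filter_upwards [hx] with x hx m using hVF x hx n m
  have hleft : ∀ {f : H → E} (k : H), (∀ (g : H) (γ : Γ), f (g * (γ : H)⁻¹) = α γ (f g)) →
      ∀ (g : H) (γ : Γ), f (k * (g * (γ : H)⁻¹)) = α γ (f (k * g)) := fun k hf g γ => by
    rw [← mul_assoc, hf]
  have hJ : ∀ {f f' : H → E} {N N' : ℕ}, Continuous f → Continuous f' →
      (∀ (g : H) (γ : Γ), f (g * (γ : H)⁻¹) = α γ (f g)) →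
      (∀ (g : H) (γ : Γ), f' (g * (γ : H)⁻¹) = α γ (f' g)) →
      (∀ n, ∫⁻ g, ENNReal.ofReal (θ n g * ‖f g - v‖ ^ p) ∂Measure.haar ≤ N) →
      (∀ n, ∫⁻ g, ENNReal.ofReal (θ n g * ‖f' g - v‖ ^ p) ∂Measure.haar ≤ N') →
      quotientLIntegral Γ μ (fun g => ‖f g - f' g‖ ^ p) ≤
        c * (ENNReal.ofReal (2 ^ (p - 1)) * (N + N')) := fun {f f' N N'} hf hf' hfe hfe' hN hN' => by
    refine quotientLIntegral_le_of_lintegral_le hc hθc hθs hθ0 hPθ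
      (rightInvariant_rpow_norm_sub hα hp0 hf hf' hfe hfe') (fun g => by positivity) fun n => ?_
    have h1 : ∀ g, ENNReal.ofReal (θ n g * ‖f g - f' g‖ ^ p) ≤ ENNReal.ofReal (2 ^ (p - 1)) *
        (ENNReal.ofReal (θ n g * ‖f g - v‖ ^ p) + ENNReal.ofReal (θ n g * ‖f' g - v‖ ^ p)) :=
      fun g => by
      have h2 : ∀ w : E, 0 ≤ θ n g * ‖w‖ ^ p := fun w => mul_nonneg (hθ0 n g) (by positivity)
      rw [← ENNReal.ofReal_add (h2 _) (h2 _), ← ENNReal.ofReal_mul (by positivity)]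
      refine ENNReal.ofReal_le_ofReal ?_
      have h3 := norm_add_rpow_le hp (f g - v) (v - f' g)
      rw [sub_add_sub_cancel, norm_sub_rev v] at h3
      calc _ ≤ θ n g * (2 ^ (p - 1) * (‖f g - v‖ ^ p + ‖f' g - v‖ ^ p)) :=
            mul_le_mul_of_nonneg_left h3 (hθ0 n g)
        _ = _ := by ring
    refine (lintegral_mono h1).trans ?_
    rw [lintegral_const_mul' _ _ ENNReal.ofReal_ne_top, lintegral_add_left]
    · exact mul_le_mul_right (add_le_add (hN n) (hN' n)) _
    · have : Continuous fun g => θ n g * ‖f g - v‖ ^ p :=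
        (hθc n).mul ((hf.sub continuous_const).norm.rpow_const fun _ => Or.inr hp0)
      exact this.measurable.ennreal_ofReal
  have hfin : ∀ N N' : ℕ, (c : ℝ≥0∞) * (ENNReal.ofReal (2 ^ (p - 1)) * (N + N')) < ⊤ :=
    fun N N' => ENNReal.mul_lt_top ENNReal.coe_lt_top (ENNReal.mul_lt_top ENNReal.ofReal_lt_top
      (ENNReal.add_lt_top.2 ⟨ENNReal.natCast_lt_top _, ENNReal.natCast_lt_top _⟩))
  obtain ⟨x₀, hx₀⟩ := hO.nonempty
  obtain ⟨N₀, hN₀⟩ := Set.mem_iUnion.1 hx₀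
  obtain ⟨ω, hω, hωF, -⟩ := exists_isBump isCompact_singleton ⟨x₀, rfl⟩ isOpen_interior
    (Set.singleton_subset_iff.2 hN₀)
  have hω0 := hen (k := 1) hω hωF fun x hx => by
    rw [mul_one]; exact interior_subset hx
  simp only [one_mul] at hω0
  refine ⟨leftSmoothing ω b, hcont hω, hequi hω, fun k₀ => ?_⟩
  -- The point `x₁` is chosen with both `x₁` and `x₁ k₀` in the dense open set. Smoothing near `x₁`
  -- gives a second function at finite distance from the first, and so are its translates by all `k`
  -- near `k₀`; the triangle inequality then bounds the displacement of the first function.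
  obtain ⟨x₁, hx₁, hx₁k⟩ := hO.inter_open_nonempty _
    (hOo.preimage (continuous_mul_const k₀)) (by
      obtain ⟨x, hx⟩ := hO.nonempty
      exact ⟨x * k₀⁻¹, by simpa using hx⟩)
  obtain ⟨N₁, hN₁⟩ := Set.mem_iUnion.1 hx₁k
  obtain ⟨N₂, hN₂⟩ := Set.mem_iUnion.1 hx₁
  have hpre : (fun z : H × H => z.1 * z.2) ⁻¹' interior (F N₂) ∈ 𝓝 (x₁, k₀) :=
    (isOpen_interior.preimage continuous_mul).mem_nhds hN₂
  obtain ⟨V, W, hV, hxV, hW, hkW, hVW⟩ := mem_nhds_prod_iff'.1 hpre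
  obtain ⟨ω₁, hω₁, hωV, -⟩ := exists_isBump isCompact_singleton ⟨x₁, rfl⟩
    (hV.inter (isOpen_interior (s := F N₁))) (Set.singleton_subset_iff.2 ⟨hxV, hN₁⟩)
  have hω1 := hen (k := 1) hω₁ hωV fun x hx => by
    rw [mul_one]; exact interior_subset hx.2
  simp only [one_mul] at hω1
  refine ⟨W, hW.mem_nhds hkW, _, ENNReal.mul_lt_top (ENNReal.ofReal_lt_top (r := 2 ^ (p - 1)))
    (ENNReal.add_lt_top.2 ⟨hfin N₀ N₁, hfin N₂ N₀⟩), fun k hk => ?_⟩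
  have hωk := hen (k := k) hω₁ hωV fun x hx => interior_subset (hVW (Set.mk_mem_prod hx.1 hk))
  have hck : Continuous fun g => leftSmoothing ω₁ b (k * g) :=
    (hcont hω₁).comp (continuous_const_mul k)
  have hR := rightInvariant_rpow_norm_sub hα hp0 (hcont hω) (hcont hω₁) (hequi hω) (hequi hω₁)
  have e1 := hJ (hcont hω) (hcont hω₁) (hequi hω) (hequi hω₁) hω0 hω1
  have e2 := hJ hck (hcont hω) (hleft k (hequi hω₁)) (hequi hω) hωk hω0
  rw [← quotientLIntegral_comp_mul_left hμ hR k] at e1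
  have e3 := quotientLIntegral_rpow_norm_add_le (μ := μ) hp (hR.comp_mul_left k)
    (rightInvariant_rpow_norm_sub hα hp0 hck (hcont hω) (hleft k (hequi hω₁)) (hequi hω))
  simp only [sub_add_sub_cancel] at e3
  exact e3.trans (mul_le_mul_right (add_le_add e1 e2) _)

end Displacement

/-! ### Equivariant functions for integrable lattices. -/

section IntegrableLattice

variable {H : Type*} [Group H] [TopologicalSpace H] [IsTopologicalGroup H] [T2Space H]
  [LocallyCompactSpace H] [SigmaCompactSpace H] {Γ : Subgroup H} [DiscreteTopology Γ]
  {E : Type*} [NormedAddCommGroup E] [NormedSpace ℝ E] [CompleteSpace E]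

/-- The displacement of the origin is at most a constant times the word length. The exponent may be
lowered from `p` to `r` because word lengths are zero or at least one. -/
lemma IsPIntegrable.exists_equivariant {p : ℝ} (hΓ : IsPIntegrable Γ p) {r : ℝ} (hr : 1 ≤ r)
    (hrp : r ≤ p) {μ : @Measure (H ⧸ Γ) (borel (H ⧸ Γ))} (hμ : IsInvariantProbability Γ μ)
    (α : Γ →* (E ≃ᵃ[ℝ] E)) (hα : ∀ γ v, ‖(α γ).linear v‖ = ‖v‖) :
    IsUniformLattice Γ ∨ ∃ S : Finset Γ, Subgroup.closure (S : Set Γ) = ⊤ ∧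
      ∃ f : H → E, Continuous f ∧ (∀ (g : H) (γ : Γ), f (g * (γ : H)⁻¹) = α γ (f g)) ∧
        ∀ k₀, ∃ W ∈ 𝓝 k₀, ∃ B : ℝ≥0∞, B < ⊤ ∧ ∀ k ∈ W,
          quotientLIntegral Γ μ (fun g => ‖f (k * g) - f g‖ ^ r) ≤ B := by
  let _ : MeasurableSpace H := borel H
  have _ : BorelSpace H := ⟨rfl⟩
  have hr0 : 0 ≤ r := by linarith
  refine hΓ.imp id ?_
  rintro ⟨S, hS, D, χ, hD, hDf, hχD, hχ, hint⟩
  have h : IsFundamentalSection Γ D χ := ⟨hD, hDf, hχD, hχ⟩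
  refine ⟨S, hS, h.exists_equivariant_of_displacement hμ hα 0 hr fun s => ?_⟩
  obtain ⟨C, hC⟩ := exists_norm_sub_le_wordLength α hα hS 0
  have h1 : ∀ γ : Γ, ‖α γ 0 - 0‖ₑ ^ r ≤
      (C : ℝ≥0∞) ^ r * (wordLength (S : Set Γ) γ : ℝ≥0∞) ^ p := fun γ => by
    have h2 : ‖α γ 0 - 0‖ₑ ≤ C * (wordLength (S : Set Γ) γ : ℝ≥0∞) := by
      have h3 : ‖α γ 0 - 0‖₊ ≤ C * (wordLength (S : Set Γ) γ : NNReal) := by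
        exact_mod_cast hC γ
      rw [enorm_eq_nnnorm]
      exact_mod_cast h3
    refine (ENNReal.rpow_le_rpow h2 hr0).trans ?_
    rw [ENNReal.mul_rpow_of_nonneg _ _ hr0]
    refine mul_le_mul_right ?_ _
    rcases Nat.eq_zero_or_pos (wordLength (S : Set Γ) γ) with h0 | h0
    · rw [h0, Nat.cast_zero, ENNReal.zero_rpow_of_pos (by linarith)]
      exact zero_le
    · exact ENNReal.rpow_le_rpow_of_exponent_le (by exact_mod_cast h0) hrp
  refine (lintegral_mono fun g => h1 _).trans_lt ?_
  rw [lintegral_const_mul' _ _ (ENNReal.rpow_ne_top_of_nonneg hr0 ENNReal.coe_ne_top)]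
  exact ENNReal.mul_lt_top (ENNReal.rpow_lt_top_of_nonneg hr0 ENNReal.coe_ne_top) (hint s)

end IntegrableLattice

/-! ### The general lattice case and the conclusion. -/

section LatticeSplitting

variable {ι : Type*} [Fintype ι] [DecidableEq ι] {G : ι → Type*} [∀ i, Group (G i)]
  [∀ i, TopologicalSpace (G i)] [∀ i, IsTopologicalGroup (G i)] [∀ i, T2Space (G i)]
  [∀ i, LocallyCompactSpace (G i)] [∀ i, SigmaCompactSpace (G i)]
  [∀ i, MeasurableSpace (G i)] [∀ i, BorelSpace (G i)]
  {E : Type*} [NormedAddCommGroup E] [NormedSpace ℝ E] [CompleteSpace E]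
  {m : ∀ i, Measure (G i)} [∀ i, IsProbabilityMeasure (m i)]
  {Γ : Subgroup (∀ i, G i)} [DiscreteTopology Γ]
  {μ : @Measure ((∀ i, G i) ⧸ Γ) (borel ((∀ i, G i) ⧸ Γ))} {α : Γ →* (E ≃ᵃ[ℝ] E)}

/-- Averaging a function of locally bounded displacement moves it by a finite amount. -/
lemma quotientLIntegral_avg_sub_lt_top (hμ : IsInvariantProbability Γ μ) (hm : CompactlyCarried m)
    {p : ℝ} (hp : 1 ≤ p) (hα : ∀ γ v, ‖(α γ).linear v‖ = ‖v‖) {f : (∀ i, G i) → E}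
    (hf : AffineEquivariant α f)
    (hd : ∀ k₀, ∃ W ∈ 𝓝 k₀, ∃ B : ℝ≥0∞, B < ⊤ ∧ ∀ k ∈ W,
      quotientLIntegral Γ μ (fun g => ‖f (k * g) - f g‖ ^ p) ≤ B) (i : ι) :
    quotientLIntegral Γ μ (fun g => ‖avg m [i] f g - f g‖ ^ p) < ⊤ := by
  have hp0 : 0 ≤ p := by linarith
  obtain ⟨K, hK, hK0⟩ := hm i
  have hj : Continuous fun h : G i => (Pi.mulSingle i h : ∀ i, G i)⁻¹ :=
    (continuous_mulSingle i).inv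
  -- Local bounds on the displacement become uniform on the compact set carrying the measure.
  obtain ⟨B, hB, hBK⟩ : ∃ B : ℝ≥0∞, B < ⊤ ∧ ∀ k ∈ (fun h : G i => (Pi.mulSingle i h)⁻¹) '' K,
      quotientLIntegral Γ μ (fun g => ‖f (k * g) - f g‖ ^ p) ≤ B := by
    refine (hK.image hj).induction_on (p := fun S => ∃ B : ℝ≥0∞, B < ⊤ ∧ ∀ k ∈ S,
      quotientLIntegral Γ μ (fun g => ‖f (k * g) - f g‖ ^ p) ≤ B)
      ⟨0, ENNReal.zero_lt_top, by simp⟩ ?_ ?_ fun k _ => ?_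
    · rintro S T hST ⟨B, hB, h⟩
      exact ⟨B, hB, fun k hk => h k (hST hk)⟩
    · rintro S T ⟨B, hB, h⟩ ⟨B', hB', h'⟩
      exact ⟨max B B', max_lt hB hB', fun k hk => hk.elim
        (fun hk => (h k hk).trans (le_max_left _ _)) fun hk => (h' k hk).trans (le_max_right _ _)⟩
    · obtain ⟨W, hW, h⟩ := hd k
      exact ⟨W, mem_nhdsWithin_of_mem_nhds hW, h⟩
  set F : G i → (∀ i, G i) → ℝ := fun h g => ‖f ((Pi.mulSingle i h)⁻¹ * g) - f g‖ ^ p with hF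
  have hfc := hf.1
  have hFc : Continuous F.uncurry := by
    change Continuous fun z : G i × (∀ i, G i) => ‖f ((Pi.mulSingle i z.1)⁻¹ * z.2) - f z.2‖ ^ p
    refine Continuous.rpow_const (Continuous.norm (Continuous.sub ?_ (hfc.comp continuous_snd)))
      fun _ => Or.inr hp0
    exact hfc.comp ((hj.comp continuous_fst).mul continuous_snd)
  have hint : ∀ {φ : G i → ℝ}, Continuous φ →
      Integrable φ (m i) := fun hφ => Controlled.integrable (Or.inr ⟨K, hK, hK0⟩) hφ
  have hle : ∀ g, ‖avg m [i] f g - f g‖ ^ p ≤ ∫ h, F h g ∂(m i) := fun g => by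
    have hc : Continuous fun h => f ((Pi.mulSingle i h)⁻¹ * g) :=
      hfc.comp (hj.mul continuous_const)
    have h1 : avg m [i] f g - f g = ∫ h, (f ((Pi.mulSingle i h)⁻¹ * g) - f g) ∂(m i) := by
      rw [integral_sub (Controlled.integrable (Or.inr ⟨K, hK, hK0⟩) hc) (integrable_const _),
        integral_const, probReal_univ, one_smul]
      rfl
    rw [h1]
    have hcn : Continuous fun h => ‖f ((Pi.mulSingle i h)⁻¹ * g) - f g‖ :=
      (hc.sub continuous_const).norm
    refine (Real.rpow_le_rpow (norm_nonneg _) (norm_integral_le_integral_norm _) hp0).trans ?_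
    exact (convexOn_rpow hp).map_integral_le
      (continuousOn_id.rpow_const fun _ _ => Or.inr hp0) isClosed_Ici
      (ae_of_all _ fun h => norm_nonneg _) (hint hcn)
      (hint (hcn.rpow_const fun _ => Or.inr hp0))
  have hR : ∀ h, RightInvariant Γ (F h) := fun h =>
    rightInvariant_rpow_norm_sub hα hp0 (hfc.comp (continuous_const_mul _)) hfc
      (hf.comp_mul_left _).2 hf.2
  refine (quotientLIntegral_mono hle).trans_lt ?_
  rw [quotientLIntegral_integral_swap hμ hFc hR (fun _ _ => by positivity) fun g =>
    hint (hFc.comp (continuous_id.prodMk continuous_const))]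
  refine lt_of_le_of_lt (lintegral_mono_ae (g := fun _ => B) ?_) (by simpa using hB)
  have hx : ∀ᵐ x ∂(m i), x ∈ K := mem_ae_iff.2 hK0
  filter_upwards [hx] with x hx using hBK _ ⟨x, hx, rfl⟩

/-- The exponent is lowered to `min p 2`, as the quantitative Jensen inequality requires. The
contraction takes place on a half-mass compact set `L`, where conjugates of `F` stay bounded, and
the initial function comes from integrability. -/
theorem exists_splitting_function_of_lattice [UniformConvexSpace E]
    (hirr : IsIrreducibleSubgroup Γ)
    (hw : IsWeaklyCocompact Γ) {p : ℝ} (hp : 1 < p)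
    (hΓp : IsPIntegrable Γ p) (α : Γ →* (E ≃ᵃ[ℝ] E))
    (hα : ∀ γ v, ‖(α γ).linear v‖ = ‖v‖) {F : Finset Γ} {ε : ℝ} (hε : 0 < ε)
    (hF : ∀ v, ∃ γ ∈ F, ε * ‖v‖ ≤ ‖(α γ).linear v - v‖) :
    ∃ f : (∀ i, G i) → E, Continuous f ∧
      (∀ (g : ∀ i, G i) (γ : Γ), f (g * (γ : ∀ i, G i)⁻¹) = α γ (f g)) ∧
      ∀ i (h : G i) (k g : ∀ i, G i), k i = 1 →
        f (Pi.mulSingle i h * (k * g)) - f (k * g) = f (Pi.mulSingle i h * g) - f g := by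
  obtain ⟨ρ, hρα⟩ := exists_linear_part α hα
  have hρ : ∀ γ v, ‖ρ γ v‖ = ‖v‖ := fun γ v => by rw [hρα, hα]
  obtain ⟨μ, hμ, K, hK, δ, hδ, hgap⟩ := hw.exists_gap
  set r := min p 2 with hr
  have hr1 : 1 < r := lt_min hp one_lt_two
  have hr0 : 0 < r := by linarith
  have hr2 : r ≤ 2 := min_le_right _ _
  rcases hΓp.exists_equivariant hr1.le (min_le_left _ _) hμ α hα with
    hu | ⟨S, hS, f₀, hf₀c, hf₀e, hd⟩
  · exact exists_splitting_function_of_uniform hirr hu α hα hε hF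
  obtain ⟨L, hL, hLμ⟩ := exists_isCompact_half hμ
  have hqex : ∀ i, ∃ q : Measure (G i), IsBump q ∧ q Set.univᶜ = 0 ∧ (1 : G i) ∈ q.support :=
    fun i => exists_isBump_near_one Filter.univ_mem
  choose q hq _ hq1 using hqex
  have hqp : ∀ i, IsProbabilityMeasure (q i) := fun i => (hq i).isProbabilityMeasure
  -- One compact set collects what the measures must dominate: the identity and the set `K` of the
  -- spectral gap, the conjugates `g γ g⁻¹` used to compare values, and the generators, so that
  -- their coordinates lie in the supports.
  set A : Set (∀ i, G i) := insert 1 (K ∪ (⋃ γ ∈ F, (fun g : ∀ i, G i =>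
    g * (γ : ∀ i, G i) * g⁻¹) '' L) ∪ ⋃ γ ∈ S, {(γ : ∀ i, G i)}) with hA
  have hAc : IsCompact A := ((hK.union (F.finite_toSet.isCompact_biUnion fun γ _ =>
    hL.image (by fun_prop))).union (S.finite_toSet.isCompact_biUnion fun γ _ =>
      isCompact_singleton)).insert 1
  choose m hm C hC using fun i => (hq i).exists_dominating (hAc.image (continuous_apply i))
  have hmp : ∀ i, IsProbabilityMeasure (m i) := fun i => (hm i).isProbabilityMeasure
  have hmc : CompactlyCarried m := fun i => (hm i).exists_isCompact
  have hdom : ∀ a ∈ A, ∀ i, (q i).map (fun h => a i * h) ≤ Finset.univ.sup C • m i :=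
    fun a ha i => (hC i _ ⟨a, ha, rfl⟩).trans
      (nnreal_smul_measure_mono_left _ (Finset.le_sup (Finset.mem_univ i)))
  obtain ⟨c, hc0, hc1, hcon⟩ := exists_contraction (m := m) hμ hδ hgap hmc
    (fun i => (hq i).exists_isCompact) (C := Finset.univ.sup C)
    (fun k hk => hdom k (Or.inr (Or.inl (Or.inl hk))))
    (fun i => by simpa using hdom 1 (Or.inl rfl) i)
    (Finset.nodup_toList Finset.univ) (by simp) hr1 hr2 hε
    (fun v => by simpa only [hρα] using hF v) hρ hLμ
    (fun g hg γ hγ => hdom _ (Or.inr (Or.inl (Or.inr (Set.mem_biUnion hγ ⟨g, hg, rfl⟩)))))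
  have hlt : ∀ {u : (∀ i, G i) → E}, quotientLIntegral Γ μ (fun g => ‖u g‖ ^ r) < ⊤ →
      quotientLpNorm Γ μ r u < ⊤ := fun h =>
    ENNReal.rpow_lt_top_of_nonneg (by positivity) h.ne
  refine exists_splitting_function_of_displacement (m := m) hirr hμ hm hr1 hr2 hρ hρα
    (Finset.nodup_toList Finset.univ) (by simp) (c := ENNReal.ofReal c ^ (1 / r))
    (ENNReal.rpow_lt_one (ENNReal.ofReal_lt_one.2 hc1) (by positivity))
    (fun u hu hut => ?_) hS (fun γ hγ j => mem_support_of_map_le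
      (hdom γ (Or.inr (Or.inr (Set.mem_biUnion hγ rfl))) j) (hq1 j)) ⟨hf₀c, hf₀e⟩
    (fun k => hlt ?_) fun i => hlt ?_
  · have h1 := hcon u hu ((ENNReal.rpow_lt_top_iff_of_pos (by positivity)).1 hut)
    unfold quotientLpNorm
    rw [← ENNReal.mul_rpow_of_nonneg _ _ (by positivity)]
    exact ENNReal.rpow_le_rpow h1 (by positivity)
  · obtain ⟨W, hW, B, hB, h⟩ := hd k
    exact (h k (mem_of_mem_nhds hW)).trans_lt hB
  · exact quotientLIntegral_avg_sub_lt_top hμ hmc hr1.le hα ⟨hf₀c, hf₀e⟩ hd i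

end LatticeSplitting

theorem theoremD {ι : Type*} [Fintype ι] {G : ι → Type*} [∀ i, Group (G i)]
    [∀ i, TopologicalSpace (G i)] [∀ i, IsTopologicalGroup (G i)] [∀ i, T2Space (G i)]
    [∀ i, LocallyCompactSpace (G i)] [∀ i, SigmaCompactSpace (G i)]
    (Γ : Subgroup (∀ i, G i)) (hirr : IsIrreducibleSubgroup Γ)
    (hΓ : IsUniformLattice Γ ∨
      (IsLatticeSubgroup Γ ∧ IsWeaklyCocompact Γ ∧ ∃ p : ℝ, 1 < p ∧ IsPIntegrable Γ p))
    {B : Type*} [AddCommGroup B] [Module ℝ B] [TopologicalSpace B] [IsTopologicalAddGroup B]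
    [ContinuousSMul ℝ B] (hB : IsSuperreflexive B)
    (α : Γ →* (B ≃ᵃ[ℝ] B)) (hα : IsUniformlyEquicontinuousAction α)
    (hinv : ¬ AlmostHasInvariantVectors ((AffineEquiv.linearHom (k := ℝ) (P₁ := B)).comp α)) :
    ∃ S : AffineSubspace ℝ B, (S : Set B).Nonempty ∧ IsClosed (S : Set B) ∧
      S.direction.ClosedComplemented ∧ (∀ γ : Γ, ∀ x ∈ S, α γ x ∈ S) ∧
      IsSumOfFactorActions Γ α S := by
  classical
  let _ : ∀ i, MeasurableSpace (G i) := fun i => borel (G i)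
  have _ : ∀ i, BorelSpace (G i) := fun i => ⟨rfl⟩
  have hdisc : DiscreteTopology Γ := hΓ.elim (fun h => h.1) fun h => h.1.1
  obtain ⟨p, hp, _, _, hpi, e, he⟩ := exists_invariant_uniformConvex_norm hB α hα
  obtain ⟨F, ε, hε, hF⟩ := exists_finset_of_not_almostHasInvariantVectors α hinv
    (isCompatibleNorm_of_equiv p hp e he) hpi
  refine splitting_of_equiv Γ e α ?_
  have hlin : ∀ γ v, (conjAction e.toLinearEquiv α γ).linear v = e ((α γ).linear (e.symm v)) :=
    fun γ v => by
    rfl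
  have hen : ∀ v, ‖e v‖ = p v := fun v => by rw [he, Renormed.norm_equiv]
  have hα' : ∀ γ v, ‖(conjAction e.toLinearEquiv α γ).linear v‖ = ‖v‖ := fun γ v => by
    obtain ⟨w, rfl⟩ := e.surjective v
    rw [hlin, e.symm_apply_apply, hen, hen, hpi]
  have hF' : ∀ v, ∃ γ ∈ F, ε * ‖v‖ ≤ ‖(conjAction e.toLinearEquiv α γ).linear v - v‖ := fun v => by
    obtain ⟨w, rfl⟩ := e.surjective v
    obtain ⟨γ, hγ, h⟩ := hF w
    refine ⟨γ, hγ, ?_⟩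
    rw [hlin, e.symm_apply_apply, ← map_sub, hen, hen]
    exact h
  obtain ⟨f, hf, hfe, hfi⟩ : ∃ f : (∀ i, G i) → Renormed p hp, Continuous f ∧
      (∀ (g : ∀ i, G i) (γ : Γ), f (g * (γ : ∀ i, G i)⁻¹) =
        conjAction e.toLinearEquiv α γ (f g)) ∧
      ∀ i (h : G i) (k g : ∀ i, G i), k i = 1 →
        f (Pi.mulSingle i h * (k * g)) - f (k * g) = f (Pi.mulSingle i h * g) - f g := by
    rcases hΓ with hΓ | ⟨hΓ, hw, r, hr, hΓr⟩
    · exact exists_splitting_function_of_uniform hirr hΓ _ hα' hε hF'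
    · exact exists_splitting_function_of_lattice hirr hw hr hΓr _ hα' hε hF'
  exact splitting_of_equivariant hirr _ hα' hf hfe hfi
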